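/- Let $\mathcal O$ be an imaginary quadratic order of discriminant $d<0$ and conductor $f$, $L=\mathbb Q(\sqrt d)$ its fraction field, $\bar{\ }$ the nontrivial automorphism of $L$, and $\mathfrak D=\sqrt d\,\mathcal O$. Let $\ell$ be a prime with $\ell\nmid f$ that is not split in $\mathcal O$, and let $\mathfrak l$ be the unique prime of $\mathcal O$ above $\ell$. *Genus characters.* Let $\chi_{-4}(a)=(-1)^{(a-1)/2}$ and $\chi_8(a)=(-1)^{(a^2-1)/8}$ for odd $a$. Let $\Psi$ be the tuple of the characters $\left(\frac{\cdot}{p}\right)$ for the odd primes $p\mid d$, together with: $\chi_{-4}$ if $d\equiv 12 \pmod{16}$ or $d\equiv16\pmod{32}$; $\chi_8$ if $d\equiv 8\pmod{32}$; $\chi_{-4}\chi_8$ if $d\equiv 24\pmod{32}$; both $\chi_{-4}$ and $\chi_8$ if $d\equiv0\pmod{32}$. For a prime $p\mid d$ with $p\nmid f$, let $\Psi_p$ be the component of $\Psi$ belonging to $p$, and $\widehat\Psi_p$ the tuple of the other components. *The algebra.* Let $q\nmid d$ be a prime such that $-\ell q\in\ker\Psi$ if $\ell\nmid d$, and such that $-q\in\ker\widehat\Psi_\ell$,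 $-q\notin\ker\Psi_\ell$ if $\ell\mid d$. Put $c=-\ell q$ and $D=d$ if $\ell\nmid d$, and $c=-q$ and $D=d/\ell$ if $\ell\mid d$. Let $$\mathbb B_{\ell,\infty}=\left\{[\alpha,\beta]:=\begin{pmatrix}\alpha&\beta\\ c\bar\beta&\bar\alpha\end{pmatrix}:\alpha,\beta\in L\right\}\subset \mathrm{Mat}_2(L),$$ and view $L$ as a subfield through $\alpha\mapsto[\alpha,0]$. Fix a prime $\mathfrak q$ of $\mathcal O$ above $q$. *The sets $R(\mathfrak a,\lambda)$.* Let $\mathfrak a\subseteq\mathcal O$ be an invertible integral ideal with $\gcd(\mathrm N(\mathfrak a),f)=1$. Call $\lambda\in\mathcal O$ admissible for $\mathfrak a$ if (1) $\lambda\mathfrak q^{-1}\bar{\mathfrak a}\mathfrak a^{-1}\subseteq\mathcal O$ and (2) $\mathrm N(\lambda)\equiv c\pmod D$. For such $\lambda$ let $\mathfrak E=\mathfrak D^{-1}$ if $\ell\nmid d$, $\mathfrak E=\mathfrak l\mathfrak D^{-1}$ if $\ell\mid d$, and $$R(\mathfrak a,\lambda)=\{[\alpha,\beta]:\alpha\in\mathfrak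 E,\ \beta\in\mathfrak q^{-1}\mathfrak E\,\bar{\mathfrak a}\mathfrak a^{-1},\ \alpha-\lambda\beta\in\mathcal O\}.$$ *The elements $\lambda_{\mathfrak a}$.* For a prime $p$ let $\mathcal O_p$ be the localization of $\mathcal O$ at $p$ and $\mathfrak D_p=\mathcal O\cap\mathfrak D\mathcal O_p$. A prime $p\mid d$ is called regular if $p\nmid f$ and irregular if $p\mid f$. For every $p\mid d$ choose $\lambda^{(p)}\in\mathcal O$ with $\mathrm N(\lambda^{(p)})\equiv c\pmod{p^{v_p(D)}}$; for every regular $p\mid d$ choose also $\widetilde\lambda^{(p)}\in\mathcal O$ with $\mathrm N(\widetilde\lambda^{(p)})\equiv c\pmod{p^{v_p(D)}}$ and $\lambda^{(p)}\not\equiv\widetilde\lambda^{(p)}\pmod{\mathfrak D_p}$, and, if $\ell\mid d$ and $\ell\neq2$, such that $\lambda^{(\ell)}=-\widetilde\lambda^{(\ell)}$. For every prime $\mathfrak p$ of $\mathcal O$ coprime to $\mathfrak D$ choose an integer $M(\mathfrak p)$ divisible by $\mathrm N(\mathfrak p)$ and congruent to $1$ modulo $d$. For $\mathfrak a$ as above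 choose $\mu_{\mathfrak a}\in\mathcal O$ such that, for every regular $p\mid d$, with $\mathfrak p$ the prime above $p$, $\mu_{\mathfrak a}\equiv\lambda^{(p)}\pmod{\mathfrak D_p}$ if $v_{\mathfrak p}(\mathfrak a)$ is even and $\mu_{\mathfrak a}\equiv\widetilde\lambda^{(p)}\pmod{\mathfrak D_p}$ if it is odd, and $\mu_{\mathfrak a}\equiv\lambda^{(p)}\pmod{\mathfrak D_p}$ for every irregular $p$. Put $$\lambda_{\mathfrak a}=\Big(\prod_{\mathfrak p\mid\mathfrak a,\ \mathfrak p+\mathfrak D=\mathcal O}M(\mathfrak p)^{v_{\mathfrak p}(\mathfrak a)}\Big)M(\mathfrak q)\,\mu_{\mathfrak a},\qquad R(\mathfrak a)=R(\mathfrak a,\lambda_{\mathfrak a}).$$ Then: (a) $\mathbb B_{\ell,\infty}$ is a quaternion algebra over $\mathbb Q$ ramified exactly at $\ell$ and $\infty$. For every invertible integral ideal $\mathfrak a$ with $\gcd(\mathrm N(\mathfrak a),f)=1$ and every $\lambda$ admissible for $\mathfrak a$, the set $R(\mathfrak a,\lambda)$ is a maximal order of $\mathbb B_{\ell,\infty}$,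 its discriminant $|\det(\mathrm{trd}(e_ie_j))|$ (for a $\mathbb Z$-basis $e_1,\dots,e_4$) is $\ell^2$, and $R(\mathfrak a,\lambda)\cap L=\mathcal O$. (b) Choices as above exist, and for all such choices and all $\mathfrak a$ the element $\lambda_{\mathfrak a}$ is admissible for $\mathfrak a$. (c) For all such choices, if $\mathfrak a$ is an invertible integral ideal and $\mathfrak b$ an invertible fractional ideal of $\mathcal O$, both prime to $f$, such that $\mathfrak a\mathfrak b$ is integral, then $R(\mathfrak a)\mathfrak b=\mathfrak bR(\mathfrak a\mathfrak b)$. (d) For all such choices, if $R$ is a maximal order of $\mathbb B_{\ell,\infty}$ with $R\cap L=\mathcal O$, then there are an invertible integral ideal $\mathfrak a$ with $\gcd(\mathrm N(\mathfrak a),f)=1$ and a $\theta\in L^\times$ such that $R=\theta^{-1}R(\mathfrak a)\theta$. -/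

import Mathlib

open scoped TensorProduct

namespace QuatOrders

noncomputable section

/-! ### Imaginary quadratic orders, their ideals and lattices -/

section Quadratic

variable {L : Type*} [Field L]

/-- The quadratic order `ℤ[(d + √d) / 2]` of discriminant `d`, where `δ = √d`. -/
def quadOrder (d : ℤ) (δ : L) : Subalgebra ℤ L :=
  Algebra.adjoin ℤ {((d : L) + δ) / 2}

theorem sqrt_mem_quadOrder [CharZero L] (d : ℤ) (δ : L) : δ ∈ quadOrder d δ := by
  have h : ((d : L) + δ) / 2 ∈ quadOrder d δ := Algebra.subset_adjoin rfl
  have h2 : ((d : L) + δ) / 2 + ((d : L) + δ) / 2 - (d : L) ∈ quadOrder d δ :=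
    sub_mem (add_mem h h) (intCast_mem _ d)
  have h3 : ((d : L) + δ) / 2 + ((d : L) + δ) / 2 - (d : L) = δ := by ring
  rwa [h3] at h2

/-- The ideal `𝔇 = √d 𝓞`. -/
def sqrtIdeal [CharZero L] (d : ℤ) (δ : L) : Ideal (quadOrder d δ) :=
  Ideal.span {⟨δ, sqrt_mem_quadOrder d δ⟩}

/-- The conductor of an order `O` of `L`: its index in the ring of integers of `L`. -/
def conductor (O : Subalgebra ℤ L) : ℕ :=
  (Subalgebra.toSubmodule O).toAddSubgroup.relIndex
    (Subalgebra.toSubmodule (integralClosure ℤ L)).toAddSubgroup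

/-- The norm `#(O / I)` of an integral ideal. -/
def idealNorm {O : Subalgebra ℤ L} (I : Ideal O) : ℕ := Nat.card (O ⧸ I)

/-- An integral ideal of `O`, seen as an additive subgroup of `L`. -/
def idealLattice {O : Subalgebra ℤ L} (I : Ideal O) : Submodule ℤ L :=
  (I.restrictScalars ℤ).map O.val.toLinearMap

/-- `I⁻¹ = {x ∈ L : x I ⊆ O}`. -/
def latticeInv (O : Subalgebra ℤ L) (I : Submodule ℤ L) : Submodule ℤ L :=
  Subalgebra.toSubmodule O / I

/-- `I ⊆ L` is an invertible fractional ideal of `O`. -/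
def IsInvertibleFractional (O : Subalgebra ℤ L) (I : Submodule ℤ L) : Prop :=
  Subalgebra.toSubmodule O * I = I ∧ I * latticeInv O I = Subalgebra.toSubmodule O

/-- `I` is an invertible integral ideal of `O` whose norm is prime to the conductor. -/
def IsGoodIdeal {O : Subalgebra ℤ L} (I : Ideal O) : Prop :=
  IsInvertibleFractional O (idealLattice I) ∧ (idealNorm I).Coprime (conductor O)

/-- `I` is an invertible fractional ideal of `O` prime to the conductor: a quotient `J / K` of
invertible integral ideals of norm prime to the conductor. -/
def IsGoodFractional (O : Subalgebra ℤ L) (I : Submodule ℤ L) : Prop :=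
  IsInvertibleFractional O I ∧
    ∃ J K : Ideal O, IsGoodIdeal J ∧ IsGoodIdeal K ∧ I * idealLattice K = idealLattice J

/-- The image of a lattice under conjugation. -/
def latticeConj [StarRing L] (I : Submodule ℤ L) : Submodule ℤ L :=
  I.map (starRingEnd L).toAddMonoidHom.toIntLinearMap

end Quadratic

/-! ### The genus characters -/

/-- The components of `Ψ` (as functions on the integers, used on integers prime to `d`). -/
def genusChars (d : ℤ) : Set (ℤ → ℤ) :=
  {χ | ∃ p : ℕ, p.Prime ∧ p ≠ 2 ∧ (p : ℤ) ∣ d ∧ χ = fun a => jacobiSym a p} ∪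
  {χ | (d % 16 = 12 ∨ d % 32 = 16 ∨ d % 32 = 0) ∧ χ = fun a : ℤ => ZMod.χ₄ (a : ZMod 4)} ∪
  {χ | (d % 32 = 8 ∨ d % 32 = 0) ∧ χ = fun a : ℤ => ZMod.χ₈ (a : ZMod 8)} ∪
  {χ | d % 32 = 24 ∧ χ = fun a : ℤ => ZMod.χ₄ (a : ZMod 4) * ZMod.χ₈ (a : ZMod 8)}

/-- The component `Ψ_p`, for a prime `p` dividing `d` but not the conductor. -/
def localChar (d : ℤ) (p : ℕ) : ℤ → ℤ :=
  if p ≠ 2 then fun a => jacobiSym a p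
  else if d % 16 = 12 then fun a => ZMod.χ₄ (a : ZMod 4)
  else if d % 32 = 8 then fun a => ZMod.χ₈ (a : ZMod 8)
  else fun a => ZMod.χ₄ (a : ZMod 4) * ZMod.χ₈ (a : ZMod 8)

/-- The condition on the auxiliary prime `q`: it does not divide `d`, and `-ℓq ∈ ker Ψ` if
`ℓ ∤ d`, whereas `-q ∈ ker Ψ̂_ℓ` and `-q ∉ ker Ψ_ℓ` if `ℓ ∣ d`. -/
def IsAuxiliaryPrime (d : ℤ) (ℓ q : ℕ) : Prop :=
  q.Prime ∧ ¬ (q : ℤ) ∣ d ∧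
  (¬ (ℓ : ℤ) ∣ d → ∀ χ ∈ genusChars d, χ (-(ℓ * q)) = 1) ∧
  ((ℓ : ℤ) ∣ d →
    (∀ χ ∈ genusChars d \ {localChar d ℓ}, χ (-q) = 1) ∧ localChar d ℓ (-q) ≠ 1)

/-- The integer `j²`: `-ℓq` if `ℓ ∤ d`, and `-q` if `ℓ ∣ d`. -/
def jSq (d : ℤ) (ℓ q : ℕ) : ℤ := if (ℓ : ℤ) ∣ d then -q else -(ℓ * q)

/-- The modulus of the norm condition: `d` if `ℓ ∤ d`, and `d / ℓ` if `ℓ ∣ d`. -/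
def normModulus (d : ℤ) (ℓ : ℕ) : ℤ := if (ℓ : ℤ) ∣ d then d / ℓ else d

/-! ### Quaternion algebras and orders -/

/-- `B` is ramified at the completion `K` of `ℚ`: `K ⊗ B` is a division algebra. -/
def IsRamifiedOver (K B : Type*) [Field K] [Algebra ℚ K] [Ring B] [Algebra ℚ B] : Prop :=
  ∀ x : K ⊗[ℚ] B, x ≠ 0 → IsUnit x

/-- `B` is a quaternion algebra over `ℚ` ramified exactly at `ℓ` and `∞`. -/
structure IsQuaternionRamifiedExactlyAt (ℓ : ℕ) (B : Type*) [Ring B] [Algebra ℚ B] : Prop where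
  central : Algebra.IsCentral ℚ B
  simple : IsSimpleRing B
  finrank : Module.finrank ℚ B = 4
  finite_place : ∀ (p : ℕ) [Fact p.Prime], IsRamifiedOver ℚ_[p] B ↔ p = ℓ
  infinite_place : IsRamifiedOver ℝ B

/-- `R` is an order of the `ℚ`-algebra `A`. -/
structure IsOrder {A : Type*} [Ring A] [Algebra ℚ A] (R : Submodule ℤ A) : Prop where
  one_mem : (1 : A) ∈ R
  mul_mem : ∀ x ∈ R, ∀ y ∈ R, x * y ∈ R
  fg : R.FG
  span_eq_top : Submodule.span ℚ (R : Set A) = ⊤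

/-- `R` is a maximal order of the `ℚ`-algebra `A`. -/
def IsMaximalOrder {A : Type*} [Ring A] [Algebra ℚ A] (R : Submodule ℤ A) : Prop :=
  IsOrder R ∧ ∀ S : Submodule ℤ A, IsOrder S → R ≤ S → S = R

section Quaternion

variable {L : Type*} [Field L] [CharZero L] [StarRing L]

/-- The algebra of matrices `[α : β] = !![α, β; c β̄, ᾱ]` inside `Mat₂(L)`, where `c = j²` and the
bar is `star`. -/
def quatAlg (L : Type*) [Field L] [CharZero L] [StarRing L] (c : ℤ) :
    Subalgebra ℚ (Matrix (Fin 2) (Fin 2) L) where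
  carrier := {m | ∃ α β : L, m = !![α, β; (c : L) * star β, star α]}
  mul_mem' := by
    rintro _ _ ⟨α, β, rfl⟩ ⟨α', β', rfl⟩
    refine ⟨α * α' + β * ((c : L) * star β'), α * β' + β * star α', ?_⟩
    have hc : star (c : L) = c := star_intCast c
    rw [Matrix.mul_fin_two]
    simp only [star_add, star_mul', star_star, hc]
    have h1 : (c : L) * star β * α' + star α * ((c : L) * star β') =
        (c : L) * (star α * star β' + star β * α') := by ring
    have h2 : (c : L) * star β * β' + star α * star α' =
        star α * star α' + star β * ((c : L) * β') := by ring
    rw [h1, h2]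
  add_mem' := by
    rintro _ _ ⟨α, β, rfl⟩ ⟨α', β', rfl⟩
    exact ⟨α + α', β + β', by simp [mul_add]⟩
  algebraMap_mem' := by
    intro r
    refine ⟨algebraMap ℚ L r, 0, ?_⟩
    have hr : star (algebraMap ℚ L r) = algebraMap ℚ L r := by
      simp
    rw [hr]
    ext i j
    fin_cases i <;> fin_cases j <;> simp [Matrix.algebraMap_matrix_apply]

/-- The element `[α : β]`. -/
def quat (c : ℤ) (α β : L) : quatAlg L c :=
  ⟨!![α, β; (c : L) * star β, star α], α, β, rfl⟩

/-- The embedding `ι : L → B`, `α ↦ [α : 0]`. -/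
def emb (c : ℤ) : L →+* quatAlg L c where
  toFun α := quat c α 0
  map_one' := by
    apply Subtype.ext
    ext i j
    fin_cases i <;> fin_cases j <;> simp [quat]
  map_mul' x y := by
    apply Subtype.ext
    ext i j
    fin_cases i <;> fin_cases j <;> simp [quat, mul_comm]
  map_zero' := by
    apply Subtype.ext
    ext i j
    fin_cases i <;> fin_cases j <;> simp [quat]
  map_add' x y := by
    apply Subtype.ext
    ext i j
    fin_cases i <;> fin_cases j <;> simp [quat]

/-- The image in `B` of a lattice of `L`. -/
def embLattice (c : ℤ) (I : Submodule ℤ L) : Submodule ℤ (quatAlg L c) :=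
  I.map (emb c).toAddMonoidHom.toIntLinearMap

/-- The reduced trace: `trd [α : β] = α + ᾱ = Tr_{L/ℚ}(α)`. -/
def redTrace {c : ℤ} (x : quatAlg L c) : ℚ := Algebra.trace ℚ L (x.1 0 0)

/-- `D` is the discriminant `|det (trd (eᵢ eⱼ))|` of `R`, for a `ℤ`-basis `e` of `R`. -/
def HasDiscriminant {c : ℤ} (R : Submodule ℤ (quatAlg L c)) (D : ℚ) : Prop :=
  ∃ e : Module.Basis (Fin 4) ℤ R,
    |(Matrix.of fun i k => redTrace ((e i : quatAlg L c) * (e k : quatAlg L c))).det| = D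

/-- `R ∩ L = O`. -/
def IsOptimal {c : ℤ} (O : Subalgebra ℤ L) (R : Submodule ℤ (quatAlg L c)) : Prop :=
  ∀ α : L, emb c α ∈ R ↔ α ∈ O

/-! ### The sets `R(𝔞, λ)` -/

variable (d : ℤ) (δ : L) (ℓ q : ℕ) (𝔩 𝔮 : Ideal (quadOrder d δ))

/-- The lattice `𝔇⁻¹` if `ℓ ∤ d`, and `𝔩 𝔇⁻¹` if `ℓ ∣ d`. -/
def alphaLattice : Submodule ℤ L :=
  if (ℓ : ℤ) ∣ d then
    idealLattice 𝔩 * latticeInv (quadOrder d δ) (idealLattice (sqrtIdeal d δ))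
  else latticeInv (quadOrder d δ) (idealLattice (sqrtIdeal d δ))

/-- The lattice `𝔮⁻¹ 𝔞̄ 𝔞⁻¹`. -/
def twistLattice (𝔞 : Ideal (quadOrder d δ)) : Submodule ℤ L :=
  latticeInv (quadOrder d δ) (idealLattice 𝔮) * latticeConj (idealLattice 𝔞) *
    latticeInv (quadOrder d δ) (idealLattice 𝔞)

/-- The two conditions on `λ`: `λ 𝔮⁻¹ 𝔞̄ 𝔞⁻¹ ⊆ 𝓞`, and `N(λ) ≡ j²` modulo `d` (if `ℓ ∤ d`) or
modulo `d / ℓ` (if `ℓ ∣ d`). -/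
def IsAdmissible (𝔞 : Ideal (quadOrder d δ)) (lam : quadOrder d δ) : Prop :=
  (∀ x ∈ twistLattice d δ 𝔮 𝔞, (lam : L) * x ∈ quadOrder d δ) ∧
    Algebra.norm ℤ lam ≡ jSq d ℓ q [ZMOD normModulus d ℓ]

/-- The set `R(𝔞, λ)` of all `[α : β]` with `α ∈ 𝔇⁻¹`, `β ∈ 𝔮⁻¹ 𝔇⁻¹ 𝔞̄ 𝔞⁻¹` (if `ℓ ∤ d`), or
`α ∈ 𝔩 𝔇⁻¹`, `β ∈ 𝔮⁻¹ 𝔩 𝔇⁻¹ 𝔞̄ 𝔞⁻¹` (if `ℓ ∣ d`), and `α - λ β ∈ 𝓞`. -/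
def quatOrder (𝔞 : Ideal (quadOrder d δ)) (lam : quadOrder d δ) :
    Submodule ℤ (quatAlg L (jSq d ℓ q)) where
  carrier := {x | ∃ α β : L, x = quat _ α β ∧ α ∈ alphaLattice d δ ℓ 𝔩 ∧
    β ∈ alphaLattice d δ ℓ 𝔩 * twistLattice d δ 𝔮 𝔞 ∧ α - (lam : L) * β ∈ quadOrder d δ}
  add_mem' := by
    rintro _ _ ⟨α, β, rfl, h1, h2, h3⟩ ⟨α', β', rfl, h1', h2', h3'⟩
    refine ⟨α + α', β + β', ?_, add_mem h1 h1', add_mem h2 h2', ?_⟩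
    · apply Subtype.ext
      ext i j
      fin_cases i <;> fin_cases j <;> simp [quat] <;> ring
    · have := add_mem h3 h3'
      convert this using 1
      ring
  zero_mem' := by
    refine ⟨0, 0, ?_, zero_mem _, zero_mem _, by simp⟩
    apply Subtype.ext
    ext i j
    fin_cases i <;> fin_cases j <;> simp [quat]
  smul_mem' := by
    rintro n _ ⟨α, β, rfl, h1, h2, h3⟩
    refine ⟨n • α, n • β, ?_, Submodule.smul_mem _ n h1, Submodule.smul_mem _ n h2, ?_⟩
    · apply Subtype.ext
      change n • !![α, β; (jSq d ℓ q : L) * star β, star α] =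
        !![n • α, n • β; (jSq d ℓ q : L) * star (n • β), star (n • α)]
      simp [-zsmul_eq_mul]
    · have := Subalgebra.smul_mem _ h3 n
      convert this using 1
      simp only [zsmul_eq_mul]
      ring

/-! ### The choice of `λ_𝔞` -/

variable {d δ}

/-- `x ≡ y` modulo `𝔇_p = 𝓞 ∩ 𝔇 𝓞_p`. -/
def CongrModLocal (p : ℕ) (x y : quadOrder d δ) : Prop :=
  ∃ n : ℤ, ¬ (p : ℤ) ∣ n ∧ n • (x - y) ∈ sqrtIdeal d δ

variable (d δ)

/-- The choices that enter the definition of `λ_𝔞`. A prime `p ∣ d` is regular if it does not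
divide the conductor, and irregular otherwise. -/
structure LambdaChoice where
  /-- the elements `λ^(p)` -/
  lam : ℕ → quadOrder d δ
  /-- the elements `λ̃^(p)` -/
  lamTilde : ℕ → quadOrder d δ
  /-- the integers `M(𝔭)` -/
  M : Ideal (quadOrder d δ) → ℤ
  /-- the elements `λ_{𝔟_d}`, where `𝔟_d` is the part of `𝔟` at the regular primes `p ∣ d` -/
  lamRam : Ideal (quadOrder d δ) → quadOrder d δ
  norm_lam : ∀ p : ℕ, p.Prime → (p : ℤ) ∣ d →
    Algebra.norm ℤ (lam p) ≡ jSq d ℓ q [ZMOD (p : ℤ) ^ padicValInt p (normModulus d ℓ)]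
  norm_lamTilde : ∀ p : ℕ, p.Prime → (p : ℤ) ∣ d → ¬ p ∣ conductor (quadOrder d δ) →
    Algebra.norm ℤ (lamTilde p) ≡ jSq d ℓ q [ZMOD (p : ℤ) ^ padicValInt p (normModulus d ℓ)]
  not_congr : ∀ p : ℕ, p.Prime → (p : ℤ) ∣ d → ¬ p ∣ conductor (quadOrder d δ) →
    ¬ CongrModLocal p (lam p) (lamTilde p)
  lam_ell : (ℓ : ℤ) ∣ d → ℓ ≠ 2 → lam ℓ = - lamTilde ℓ
  dvd_M : ∀ 𝔭 : Ideal (quadOrder d δ), 𝔭.IsPrime → IsCoprime 𝔭 (sqrtIdeal d δ) →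
    (idealNorm 𝔭 : ℤ) ∣ M 𝔭
  M_modEq : ∀ 𝔭 : Ideal (quadOrder d δ), 𝔭.IsPrime → IsCoprime 𝔭 (sqrtIdeal d δ) →
    M 𝔭 ≡ 1 [ZMOD d]
  lamRam_regular : ∀ 𝔟 : Ideal (quadOrder d δ), ∀ p : ℕ, p.Prime → (p : ℤ) ∣ d →
    ¬ p ∣ conductor (quadOrder d δ) → ∀ 𝔭 : Ideal (quadOrder d δ), 𝔭.IsPrime →
    (p : quadOrder d δ) ∈ 𝔭 →
    CongrModLocal p (lamRam 𝔟) (if Even (multiplicity 𝔭 𝔟) then lam p else lamTilde p)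
  lamRam_irregular : ∀ 𝔟 : Ideal (quadOrder d δ), ∀ p : ℕ, p.Prime →
    p ∣ conductor (quadOrder d δ) → CongrModLocal p (lamRam 𝔟) (lam p)

variable {d δ ℓ q}

/-- `λ_𝔞 = (∏_{𝔭 ∣ 𝔞'} M(𝔭) ^ v_𝔭(𝔞')) M(𝔮) λ_{𝔞_d}`, where `𝔞'` is the part of `𝔞` prime to
`𝔇`. -/
def LambdaChoice.lambda (C : LambdaChoice d δ ℓ q) (𝔞 : Ideal (quadOrder d δ)) :
    quadOrder d δ :=
  (((∏ᶠ 𝔭 ∈ {𝔭 : Ideal (quadOrder d δ) | 𝔭.IsPrime ∧ IsCoprime 𝔭 (sqrtIdeal d δ) ∧ 𝔭 ∣ 𝔞},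
    C.M 𝔭 ^ multiplicity 𝔭 𝔞) * C.M 𝔮 : ℤ) : quadOrder d δ) * C.lamRam 𝔞

/-- `R(𝔞) = R(𝔞, λ_𝔞)`. -/
def LambdaChoice.order (C : LambdaChoice d δ ℓ q) (𝔞 : Ideal (quadOrder d δ)) :
    Submodule ℤ (quatAlg L (jSq d ℓ q)) :=
  quatOrder d δ ℓ q 𝔩 𝔮 𝔞 (C.lambda 𝔮 𝔞)

end Quaternion

end

end QuatOrders

open QuatOrders

/-!
The proof rests on a coordinate description of the sets `R(𝔞, λ)` and on comparing orders one prime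
number at a time.

*Part (a).* Put `𝔅 = 𝔈 𝔮⁻¹ 𝔞̄ 𝔞⁻¹`. For admissible `λ` the map `[α : β] ↦ (α - λ β, β)` identifies
`R(𝔞, λ)` with `𝓞 × 𝔅`. Since `𝔅 𝔅̄ = (D q)⁻¹ 𝓞` and `D q` divides `N(λ) - c`, the set is closed
under multiplication (`Setting.mul_mem_quatOrder`), and its Gram determinant has absolute value `ℓ²`
(`Setting.hasDiscriminant`). Ramification of `B = 𝔹_{ℓ,∞}` over a field is anisotropy of the norm
form `⟨1, -d, -c, cd⟩` (`isRamifiedOver_iff`). At `∞` it is definite because `c < 0`. At `ℓ` the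
ternary form `x² - d y² - c z²` has no primitive zero modulo a small power of `ℓ`, by the choice of
`q` and because `ℓ` does not split (`Setting.exists_imprimitive`). An algebra that contains an order
of discriminant prime to `p` is split at `p`, by the theorem of Chevalley and Warning and Hensel's
lemma (`IsOrder.not_isRamifiedOver`). This settles the primes `p ≠ ℓ`, and it gives maximality as
well: an order properly containing one of discriminant `ℓ²` would have discriminant `1` and split `B`
at `ℓ`.

*Part (b).* Modulo a power of an odd prime the norm congruence is solved by a rational integer. At `2` it is solved by inspection of residues, using the
genus characters (`Setting.exists_local_choice_two`). The product of the `M(𝔭)` and `M(𝔮)` clears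
the denominators of `𝔮⁻¹ 𝔞̄ 𝔞⁻¹` and is `1` modulo `d`, so that `λ_𝔞` is admissible. Quadratic
reciprocity shows that `q` splits (`IsAuxiliaryPrime.exists_root`), so that `𝔮 𝔮̄ = q 𝓞`.

*Part (c).* By induction on the prime factors it suffices to move one prime ideal `𝔭` across. There
the equality of the two products amounts to
`(λ_𝔞 w - λ_{𝔭𝔞} w̄) z ∈ 𝔭` for `w ∈ 𝔭` and `z ∈ 𝔅` (`Setting.lambda_sub_mul_mem`). The only
delicate case is that of a ramified `𝔭`. Then `λ_𝔞` and `λ_{𝔭𝔞}` are congruent to the two distinct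
solutions of the norm congruence modulo `𝔇_p`, and the difference of these solutions compensates the
denominator of `z` (`Setting.toggle_mem`).

*Part (d).* Let `R` be a maximal order that meets `L` in `𝓞`. Locally at `p ≠ ℓ` it is its own dual
for the trace form. It follows that `R` contains an element `[n / √d : b / √d]` with `n` prime to the
part of `d` prime to `ℓ` (`exists_int_mem_projIdeal`). As the reduced norm of this element is an
integer, `c N(b) ≡ n²` modulo `d`, so that `b` has the same norm as some `u` with `λ u ≡ n` modulo
`√d`, to any prescribed accuracy (`exists_norm_approx`). A multiplicative form of Hilbert's Theorem
90 then provides `θ ∈ L` with `b θ / θ̄` congruent to `u` (`exists_rotation`). Conjugation by `θ`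
reduces to `b = u`, and in this case `R` is contained in `R(𝔞)`, where `𝔞` is read off from the
lattice `{β | [0 : β] ∈ R}` (`Setting.exists_le_order`). The inclusion is checked prime by prime. At
`ℓ` it holds because a ramified local algebra has only one maximal order
(`IsMaximalOrder.mem_locAt_of_isIntAt`). Maximality of `R` makes it an equality.
-/

namespace QuatOrders

set_option linter.unusedSectionVars false

noncomputable section

/-! ### Coordinates on the quadratic field and its orders -/

/-- The standing situation: `L` is an imaginary quadratic field, `δ = √d` for a negative
discriminant `d`, and `star` is the nontrivial automorphism. -/
class ImagQuad (L : Type*) [Field L] [CharZero L] [StarRing L] (d : ℤ) (δ : L) : Prop where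
  finrank : Module.finrank ℚ L = 2
  neg : d < 0
  mod4 : d % 4 = 0 ∨ d % 4 = 1
  sq : δ ^ 2 = (d : L)
  star_eq : star δ = -δ

variable {L : Type*} [Field L] [CharZero L] [StarRing L]

@[simp] theorem star_ratCast' (r : ℚ) : star (r : L) = (r : L) := by
  simp

/-- The generator `(d + √d) / 2` of the quadratic order. -/
def om (d : ℤ) (δ : L) : L := ((d : L) + δ) / 2

/-- The norm `x x̄` of `L / ℚ`. -/
def nm (x : L) : ℚ := Algebra.norm ℚ x

/-- The trace `x + x̄` of `L / ℚ`. -/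
def tr (x : L) : ℚ := Algebra.trace ℚ L x

theorem nm_mul (x y : L) : nm (x * y) = nm x * nm y := by simp [nm]

theorem tr_add (x y : L) : tr (x + y) = tr x + tr y := by simp [tr]

theorem tr_ratCast_mul (r : ℚ) (x : L) : tr ((r : L) * x) = r * tr x := by
  have : (r : L) * x = r • x := by simp [Algebra.smul_def]
  rw [this, tr, tr, map_smul, smul_eq_mul]

section coord

variable (d : ℤ) (δ : L) [h : ImagQuad L d δ]

include h

theorem coord_eq_zero {s t : ℚ} (hst : (s : L) + t * δ = 0) : s = 0 ∧ t = 0 := by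
  have hsq := h.sq
  have hn := h.neg
  have ht : t = 0 := by
    by_contra ht
    have h1 : (s : L) ^ 2 = t ^ 2 * d := by
      rw [← hsq]
      linear_combination ((s : L) - t * δ) * hst
    have h2 : s ^ 2 = t ^ 2 * d := by exact_mod_cast h1
    have h3 : 0 < t ^ 2 := by positivity
    have h4 : (d : ℚ) < 0 := by exact_mod_cast hn
    nlinarith [sq_nonneg s]
  subst ht
  simpa using hst

theorem coord_inj {s t s' t' : ℚ} (hst : (s : L) + t * δ = s' + t' * δ) : s = s' ∧ t = t' := by
  have := coord_eq_zero d δ (s := s - s') (t := t - t') (by push_cast; linear_combination hst)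
  exact ⟨sub_eq_zero.1 this.1, sub_eq_zero.1 this.2⟩

theorem linearIndependent_one_sqrt : LinearIndependent ℚ ![(1 : L), δ] := by
  rw [LinearIndependent.pair_iff]
  intro s t hst
  refine coord_eq_zero d δ (s := s) (t := t) ?_
  simpa [Algebra.smul_def] using hst

/-- The basis `1, √d` of `L` over `ℚ`. -/
def sqrtBasis : Module.Basis (Fin 2) ℚ L :=
  basisOfLinearIndependentOfCardEqFinrank (linearIndependent_one_sqrt d δ) (by simp [h.finrank])

theorem sqrtBasis_zero : sqrtBasis d δ 0 = 1 := by simp [sqrtBasis]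

theorem sqrtBasis_one : sqrtBasis d δ 1 = δ := by simp [sqrtBasis]

theorem exists_coord (x : L) : ∃ s t : ℚ, x = s + t * δ := by
  refine ⟨(sqrtBasis d δ).repr x 0, (sqrtBasis d δ).repr x 1, ?_⟩
  conv_lhs => rw [← (sqrtBasis d δ).sum_repr x]
  simp [Fin.sum_univ_two, sqrtBasis_zero, sqrtBasis_one, Algebra.smul_def]

theorem sqrtBasis_repr (s t : ℚ) :
    (sqrtBasis d δ).repr ((s : L) + t * δ) = Finsupp.single 0 s + Finsupp.single 1 t := by
  have : (s : L) + t * δ = s • sqrtBasis d δ 0 + t • sqrtBasis d δ 1 := by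
    simp [sqrtBasis_zero, sqrtBasis_one, Algebra.smul_def]
  rw [this]
  simp

theorem leftMulMatrix_sqrtBasis (s t : ℚ) :
    Algebra.leftMulMatrix (sqrtBasis d δ) ((s : L) + t * δ) = !![s, t * d; t, s] := by
  have h0 : ((s : L) + t * δ) * sqrtBasis d δ 0 = (s : L) + t * δ := by
    rw [sqrtBasis_zero, mul_one]
  have h1 : ((s : L) + t * δ) * sqrtBasis d δ 1 = ((t * d : ℚ) : L) + s * δ := by
    rw [sqrtBasis_one]
    push_cast
    rw [← h.sq]
    ring
  ext i j
  rw [Algebra.leftMulMatrix_eq_repr_mul]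
  fin_cases i <;> fin_cases j
  · change (sqrtBasis d δ).repr (((s : L) + t * δ) * sqrtBasis d δ 0) 0 = _
    rw [h0, sqrtBasis_repr]; simp
  · change (sqrtBasis d δ).repr (((s : L) + t * δ) * sqrtBasis d δ 1) 0 = _
    rw [h1, sqrtBasis_repr]; simp
  · change (sqrtBasis d δ).repr (((s : L) + t * δ) * sqrtBasis d δ 0) 1 = _
    rw [h0, sqrtBasis_repr]; simp
  · change (sqrtBasis d δ).repr (((s : L) + t * δ) * sqrtBasis d δ 1) 1 = _
    rw [h1, sqrtBasis_repr]; simp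

theorem nm_coord (s t : ℚ) : nm ((s : L) + t * δ) = s ^ 2 - d * t ^ 2 := by
  rw [nm, Algebra.norm_eq_matrix_det (sqrtBasis d δ), leftMulMatrix_sqrtBasis, Matrix.det_fin_two_of]
  ring

theorem tr_coord (s t : ℚ) : tr ((s : L) + t * δ) = 2 * s := by
  rw [tr, Algebra.trace_eq_matrix_trace (sqrtBasis d δ), leftMulMatrix_sqrtBasis,
    Matrix.trace_fin_two_of]
  ring

theorem star_coord (s t : ℚ) : star ((s : L) + t * δ) = s - t * δ := by
  simp [h.star_eq, sub_eq_add_neg]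

theorem nm_cast (x : L) : ((nm x : ℚ) : L) = x * star x := by
  obtain ⟨s, t, rfl⟩ := exists_coord d δ x
  rw [nm_coord d δ, star_coord d δ]
  push_cast
  rw [← h.sq]
  ring

theorem tr_cast (x : L) : ((tr x : ℚ) : L) = x + star x := by
  obtain ⟨s, t, rfl⟩ := exists_coord d δ x
  rw [tr_coord d δ, star_coord d δ]
  push_cast
  ring

theorem nm_star (x : L) : nm (star x) = nm x := by
  have : ((nm (star x) : ℚ) : L) = (nm x : ℚ) := by
    rw [nm_cast d δ, nm_cast d δ, star_star, mul_comm]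
  exact_mod_cast this

theorem tr_star (x : L) : tr (star x) = tr x := by
  have : ((tr (star x) : ℚ) : L) = (tr x : ℚ) := by
    rw [tr_cast d δ, tr_cast d δ, star_star, add_comm]
  exact_mod_cast this

theorem nm_eq_zero {x : L} : nm x = 0 ↔ x = 0 := by
  constructor
  · intro hx
    have h1 := nm_cast d δ x
    rw [hx] at h1
    rcases mul_eq_zero.1 (h1.symm.trans (by simp)) with h2 | h2
    · exact h2
    · exact star_eq_zero.1 h2
  · rintro rfl
    have := nm_coord d δ 0 0
    simpa using this

theorem nm_nonneg (x : L) : 0 ≤ nm x := by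
  obtain ⟨s, t, rfl⟩ := exists_coord d δ x
  rw [nm_coord d δ]
  have : (d : ℚ) < 0 := by exact_mod_cast h.neg
  nlinarith [sq_nonneg s, sq_nonneg t]

theorem nm_pos {x : L} (hx : x ≠ 0) : 0 < nm x :=
  lt_of_le_of_ne (nm_nonneg d δ x) (fun h0 => hx ((nm_eq_zero d δ).1 h0.symm))

theorem nm_ratCast (r : ℚ) : nm (r : L) = r ^ 2 := by
  have := nm_coord d δ r 0
  simpa using this

theorem nm_add (x y : L) : nm (x + y) = nm x + nm y + tr (x * star y) := by
  have : ((nm (x + y) : ℚ) : L) = ((nm x + nm y + tr (x * star y) : ℚ) : L) := by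
    push_cast
    rw [nm_cast d δ, nm_cast d δ, nm_cast d δ, tr_cast d δ]
    simp
    ring
  exact_mod_cast this

theorem sqrt_ne_zero : δ ≠ 0 := by
  intro h0
  have h1 := h.sq
  have h2 := h.neg
  rw [h0] at h1
  have : (d : L) = 0 := by rw [← h1]; simp
  have : d = 0 := by exact_mod_cast this
  omega

theorem nm_sqrt : nm δ = -d := by
  have := nm_coord d δ 0 1
  simpa using this

theorem star_eq_self_iff (x : L) : star x = x ↔ ∃ r : ℚ, x = r := by
  obtain ⟨s, t, rfl⟩ := exists_coord d δ x
  constructor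
  · rw [star_coord d δ]
    intro h1
    have := coord_inj d δ (s := s) (t := -t) (s' := s) (t' := t) (by push_cast; linear_combination h1)
    have ht : t = 0 := by linarith [this.2]
    exact ⟨s, by simp [ht]⟩
  · rintro ⟨r, hr⟩
    rw [hr, star_ratCast']

/-! ### The quadratic order -/

/-- The norm of the generator `om`. -/
def omNorm (d : ℤ) : ℤ := (d ^ 2 - d) / 4

theorem four_mul_omNorm : 4 * omNorm d = d ^ 2 - d := by
  unfold omNorm
  apply Int.mul_ediv_cancel'
  rcases h.mod4 with h1 | h1
  · obtain ⟨k, hk⟩ : (4 : ℤ) ∣ d := Int.dvd_of_emod_eq_zero h1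
    exact ⟨4 * k ^ 2 - k, by rw [hk]; ring⟩
  · obtain ⟨k, hk⟩ : (4 : ℤ) ∣ d - 1 := by omega
    exact ⟨d * k, by linear_combination d * hk⟩

theorem om_sq : om d δ ^ 2 = d * om d δ - omNorm d := by
  have h1 : (4 : L) * omNorm d = d ^ 2 - d := by exact_mod_cast congrArg (Int.cast (R := L)) (four_mul_omNorm d δ)
  have h2 := h.sq
  unfold om
  field_simp
  linear_combination h2 + h1

theorem star_om : star (om d δ) = d - om d δ := by
  unfold om
  have h2 : star (((d : L) + δ) / 2) = (star ((d : L) + δ)) / 2 := by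
    rw [star_div₀]; simp
  rw [h2, star_add, h.star_eq]
  simp
  ring

theorem sqrt_eq_om : δ = 2 * om d δ - d := by
  unfold om; ring

theorem mem_quadOrder_iff {x : L} :
    x ∈ quadOrder d δ ↔ ∃ s t : ℤ, x = s + t * om d δ := by
  constructor
  · intro hx
    refine Algebra.adjoin_induction (p := fun y _ => ∃ s t : ℤ, y = s + t * om d δ)
      ?_ ?_ ?_ ?_ hx
    · rintro y rfl
      exact ⟨0, 1, by simp [om]⟩
    · intro n
      exact ⟨n, 0, by simp⟩
    · rintro y z - - ⟨s, t, rfl⟩ ⟨s', t', rfl⟩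
      exact ⟨s + s', t + t', by push_cast; ring⟩
    · rintro y z - - ⟨s, t, rfl⟩ ⟨s', t', rfl⟩
      refine ⟨s * s' - t * t' * omNorm d, s * t' + t * s' + t * t' * d, ?_⟩
      push_cast
      linear_combination (t : L) * t' * om_sq d δ
  · rintro ⟨s, t, rfl⟩
    have h1 : om d δ ∈ quadOrder d δ := Algebra.subset_adjoin rfl
    exact add_mem (intCast_mem _ s) (mul_mem (intCast_mem _ t) h1)

theorem om_mem : om d δ ∈ quadOrder d δ := Algebra.subset_adjoin rfl

theorem om_coord (s t : ℤ) :
    (s : L) + t * om d δ = ((s + t * d / 2 : ℚ) : L) + ((t / 2 : ℚ) : L) * δ := by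
  unfold om; push_cast; ring

theorem om_coord_inj {s t s' t' : ℤ} (hst : (s : L) + t * om d δ = s' + t' * om d δ) :
    s = s' ∧ t = t' := by
  rw [om_coord, om_coord] at hst
  have := coord_inj d δ hst
  have h1 : (t : ℚ) = t' := by linarith [this.2]
  have h2 : (s : ℚ) = s' := by
    have := this.1
    rw [h1] at this
    linarith
  exact ⟨by exact_mod_cast h2, by exact_mod_cast h1⟩

theorem nm_om_coord (s t : ℤ) :
    nm ((s : L) + t * om d δ) = ((s ^ 2 + d * s * t + omNorm d * t ^ 2 : ℤ) : ℚ) := by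
  have h1 : (4 : ℚ) * omNorm d = d ^ 2 - d := by exact_mod_cast congrArg (Int.cast (R := ℚ)) (four_mul_omNorm d δ)
  rw [om_coord d δ, nm_coord d δ]
  push_cast
  linear_combination -(t : ℚ) ^ 2 / 4 * h1

theorem tr_om_coord (s t : ℤ) : tr ((s : L) + t * om d δ) = ((2 * s + d * t : ℤ) : ℚ) := by
  rw [om_coord d δ, tr_coord d δ]
  push_cast
  ring

theorem star_om_coord (s t : ℤ) :
    star ((s : L) + t * om d δ) = ((s + t * d : ℤ) : L) + ((-t : ℤ) : L) * om d δ := by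
  rw [star_add, star_mul', star_om]
  simp
  ring

theorem star_mem_quadOrder {x : L} (hx : x ∈ quadOrder d δ) : star x ∈ quadOrder d δ := by
  obtain ⟨s, t, rfl⟩ := (mem_quadOrder_iff d δ).1 hx
  exact (mem_quadOrder_iff d δ).2 ⟨_, _, star_om_coord d δ s t⟩

theorem star_mem_quadOrder_iff {x : L} : star x ∈ quadOrder d δ ↔ x ∈ quadOrder d δ :=
  ⟨fun hx => by simpa using star_mem_quadOrder d δ hx, star_mem_quadOrder d δ⟩

theorem exists_nm_eq {x : L} (hx : x ∈ quadOrder d δ) : ∃ n : ℤ, nm x = n := by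
  obtain ⟨s, t, rfl⟩ := (mem_quadOrder_iff d δ).1 hx
  exact ⟨_, nm_om_coord d δ s t⟩

theorem exists_tr_eq {x : L} (hx : x ∈ quadOrder d δ) : ∃ n : ℤ, tr x = n := by
  obtain ⟨s, t, rfl⟩ := (mem_quadOrder_iff d δ).1 hx
  exact ⟨_, tr_om_coord d δ s t⟩

/-- Conjugation is trivial modulo `√d`. -/
theorem exists_sub_star {x : L} (hx : x ∈ quadOrder d δ) : ∃ n : ℤ, x - star x = n * δ := by
  obtain ⟨s, t, rfl⟩ := (mem_quadOrder_iff d δ).1 hx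
  refine ⟨t, ?_⟩
  rw [star_om_coord]
  push_cast
  linear_combination -(t : L) * sqrt_eq_om d δ

theorem ratCast_mem_quadOrder {r : ℚ} : (r : L) ∈ quadOrder d δ ↔ ∃ n : ℤ, r = n := by
  constructor
  · intro hr
    obtain ⟨s, t, hst⟩ := (mem_quadOrder_iff d δ).1 hr
    rw [om_coord] at hst
    have := coord_inj d δ (s := r) (t := 0) (by rw [← hst]; simp)
    have ht : (t : ℚ) = 0 := by linarith [this.2]
    exact ⟨s, by have := this.1; rw [ht] at this; linarith⟩
  · rintro ⟨n, rfl⟩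
    simp

/-- The order is Gorenstein: the dual of `𝓞` for the trace form is `(√d)⁻¹ 𝓞`. -/
theorem sqrt_mul_mem_iff {x : L} :
    δ * x ∈ quadOrder d δ ↔ ∀ y ∈ quadOrder d δ, ∃ n : ℤ, tr (x * y) = n := by
  have hδ := sqrt_ne_zero d δ
  constructor
  · intro hx y hy
    obtain ⟨n, hn⟩ := exists_sub_star d δ (mul_mem hx hy)
    refine ⟨n, ?_⟩
    have : ((tr (x * y) : ℚ) : L) = ((n : ℚ) : L) := by
      rw [tr_cast d δ]
      rw [star_mul', star_mul', h.star_eq] at hn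
      rw [star_mul']
      apply mul_left_cancel₀ hδ
      push_cast
      linear_combination hn
    exact_mod_cast this
  · intro hx
    obtain ⟨s, t, rfl⟩ := exists_coord d δ x
    obtain ⟨A, hA⟩ := hx 1 (one_mem _)
    obtain ⟨B, hB⟩ := hx (om d δ) (om_mem d δ)
    rw [mul_one, tr_coord d δ] at hA
    have h1 : ((s : L) + t * δ) * om d δ = ((s * d / 2 + t * d / 2 : ℚ) : L) + ((s / 2 + t * d / 2 : ℚ) : L) * δ := by
      unfold om
      push_cast
      linear_combination (t : L) / 2 * h.sq
    rw [h1, tr_coord d δ] at hB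
    rw [mem_quadOrder_iff d δ]
    refine ⟨B - A * d, A, ?_⟩
    have hA' : (2 : L) * s = A := by exact_mod_cast congrArg (Rat.cast (K := L)) hA
    have hB' : (2 : L) * (s * d / 2 + t * d / 2) = B := by exact_mod_cast congrArg (Rat.cast (K := L)) hB
    unfold om
    push_cast
    rw [← hA', ← hB']
    linear_combination (t : L) * h.sq

end coord

end

noncomputable section

/-! ### Localization of lattices at an integer -/

section loc

variable {M : Type*} [AddCommGroup M]

/-- The localization of a lattice at the primes dividing `m`, as a subgroup of the ambient group:
all `z` that have a multiple `n z`, with `n` prime to `m`, in the lattice. -/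
def locAt (m : ℤ) (Λ : Submodule ℤ M) : Submodule ℤ M where
  carrier := {z | ∃ n : ℤ, IsCoprime n m ∧ n • z ∈ Λ}
  add_mem' := by
    rintro x y ⟨n, hn, hx⟩ ⟨k, hk, hy⟩
    refine ⟨n * k, hn.mul_left hk, ?_⟩
    rw [smul_add]
    refine add_mem ?_ ?_
    · rw [mul_comm, mul_smul]; exact Λ.smul_mem k hx
    · rw [mul_smul]; exact Λ.smul_mem n hy
  zero_mem' := ⟨1, isCoprime_one_left, by simp⟩
  smul_mem' := by
    rintro c x ⟨n, hn, hx⟩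
    exact ⟨n, hn, by rw [smul_comm]; exact Λ.smul_mem c hx⟩

theorem mem_locAt {m : ℤ} {Λ : Submodule ℤ M} {z : M} :
    z ∈ locAt m Λ ↔ ∃ n : ℤ, IsCoprime n m ∧ n • z ∈ Λ := Iff.rfl

theorem le_locAt (m : ℤ) (Λ : Submodule ℤ M) : Λ ≤ locAt m Λ :=
  fun z hz => ⟨1, isCoprime_one_left, by simpa using hz⟩

theorem mem_locAt_of_smul_mem {m n : ℤ} {Λ : Submodule ℤ M} {z : M} (hn : IsCoprime n m)
    (hz : n • z ∈ locAt m Λ) : z ∈ locAt m Λ := by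
  obtain ⟨k, hk, hz⟩ := hz
  exact ⟨k * n, hk.mul_left hn, by rwa [mul_smul]⟩

theorem isCoprime_prime_iff {p : ℕ} (hp : p.Prime) {n : ℤ} :
    IsCoprime n (p : ℤ) ↔ ¬ (p : ℤ) ∣ n := by
  rw [isCoprime_comm]
  exact (Nat.prime_iff_prime_int.1 hp).coprime_iff_not_dvd

/-- The integers that multiply `z` into a lattice form an ideal; this is the local-global
principle for membership. -/
theorem mem_locAt_of_forall_prime {m : ℤ} {Λ : Submodule ℤ M} {z : M}
    (hz : ∀ p : ℕ, p.Prime → (p : ℤ) ∣ m → z ∈ locAt (p : ℤ) Λ) : z ∈ locAt m Λ := by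
  let I : Ideal ℤ := Λ.comap (LinearMap.toSpanSingleton ℤ M z)
  obtain ⟨g, hg⟩ := (IsPrincipalIdealRing.principal I).principal
  have hI : ∀ n : ℤ, n ∈ I ↔ n • z ∈ Λ := fun n => by simp [I]
  have hgI : g ∈ I := by rw [hg]; exact Submodule.mem_span_singleton_self g
  refine ⟨g, ?_, (hI g).1 hgI⟩
  rw [Int.isCoprime_iff_gcd_eq_one]
  by_contra hne
  obtain ⟨p, hp, hpd⟩ := Nat.exists_prime_and_dvd hne
  have hpg : (p : ℤ) ∣ g := (Int.natCast_dvd_natCast.2 hpd).trans (Int.gcd_dvd_left _ _)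
  have hpm : (p : ℤ) ∣ m := (Int.natCast_dvd_natCast.2 hpd).trans (Int.gcd_dvd_right _ _)
  obtain ⟨n, hn, hnz⟩ := hz p hp hpm
  have : n ∈ Ideal.span {g} := by
    rw [← Ideal.submodule_span_eq, ← hg]; exact (hI n).2 hnz
  rw [Ideal.mem_span_singleton] at this
  exact (isCoprime_prime_iff hp).1 hn (hpg.trans this)

theorem mem_of_forall_prime {Λ : Submodule ℤ M} {z : M}
    (hz : ∀ p : ℕ, p.Prime → z ∈ locAt (p : ℤ) Λ) : z ∈ Λ := by
  obtain ⟨n, hn, hnz⟩ := mem_locAt_of_forall_prime (m := 0) (fun p hp _ => hz p hp)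
  rcases Int.isUnit_iff.1 (isCoprime_zero_right.1 hn) with rfl | rfl
  · simpa using hnz
  · simpa using hnz

theorem mem_of_mem_locAt_of_pow {m : ℤ} {k : ℕ} {Λ : Submodule ℤ M} {z : M}
    (hz : z ∈ locAt m Λ) (hk : m ^ k • z ∈ Λ) : z ∈ Λ := by
  obtain ⟨n, hn, hnz⟩ := hz
  obtain ⟨a, b, hab⟩ := hn.pow_right (n := k)
  have : z = a • n • z + b • m ^ k • z := by
    rw [smul_smul, smul_smul, ← add_smul, hab, one_smul]
  rw [this]
  exact add_mem (Λ.smul_mem _ hnz) (Λ.smul_mem _ hk)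

/-- Elementwise multipliers into a lattice can be chosen uniformly on a finitely generated
module. -/
theorem exists_uniform_smul_mem (S : Submonoid ℤ) {Λ Λ' : Submodule ℤ M} (hfg : Λ.FG)
    (hx : ∀ x ∈ Λ, ∃ n ∈ S, n • x ∈ Λ') : ∃ n ∈ S, ∀ x ∈ Λ, n • x ∈ Λ' := by
  revert hx
  induction Λ, hfg using Submodule.fg_induction with
  | singleton x =>
    intro hx
    obtain ⟨n, hn, hnx⟩ := hx _ (Submodule.mem_span_singleton_self x)
    refine ⟨n, hn, fun y hy => ?_⟩
    obtain ⟨a, rfl⟩ := Submodule.mem_span_singleton.1 hy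
    rw [smul_comm]
    exact Λ'.smul_mem a hnx
  | sup N₁ N₂ _ _ h1 h2 =>
    intro hx
    obtain ⟨n, hn, h1⟩ := h1 fun x h => hx x (Submodule.mem_sup_left h)
    obtain ⟨k, hk, h2⟩ := h2 fun x h => hx x (Submodule.mem_sup_right h)
    refine ⟨n * k, S.mul_mem hn hk, fun x h => ?_⟩
    obtain ⟨y, hy, z, hz, rfl⟩ := Submodule.mem_sup.1 h
    rw [smul_add]
    refine add_mem ?_ ?_
    · rw [mul_comm, mul_smul]; exact Λ'.smul_mem k (h1 y hy)
    · rw [mul_smul]; exact Λ'.smul_mem n (h2 z hz)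

theorem mul_mem_locAt {R : Type*} [Ring R] {m : ℤ} {A B C : Submodule ℤ R} {x y : R}
    (hmul : ∀ a ∈ A, ∀ b ∈ B, a * b ∈ C) (hx : x ∈ locAt m A) (hy : y ∈ locAt m B) :
    x * y ∈ locAt m C := by
  obtain ⟨n, hn, hx⟩ := hx
  obtain ⟨k, hk, hy⟩ := hy
  refine ⟨n * k, hn.mul_left hk, ?_⟩
  have := hmul _ hx _ hy
  rwa [smul_mul_smul_comm] at this

end loc

/-! ### Lattices and their norms -/

variable {L : Type*} [Field L] [CharZero L] [StarRing L]

theorem mem_latticeConj {I : Submodule ℤ L} {x : L} : x ∈ latticeConj I ↔ star x ∈ I := by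
  constructor
  · rintro ⟨y, hy, rfl⟩
    change star (star y) ∈ I
    rwa [star_star]
  · intro hx
    exact ⟨star x, hx, star_star x⟩

theorem latticeConj_latticeConj (I : Submodule ℤ L) : latticeConj (latticeConj I) = I := by
  ext x; rw [mem_latticeConj, mem_latticeConj, star_star]

theorem latticeConj_mul (I J : Submodule ℤ L) :
    latticeConj (I * J) = latticeConj I * latticeConj J := by
  have key : ∀ I J : Submodule ℤ L, latticeConj (I * J) ≤ latticeConj I * latticeConj J := by
    intro I J x hx
    rw [mem_latticeConj] at hx
    rw [← star_star x]
    refine Submodule.mul_induction_on (C := fun z => star z ∈ latticeConj I * latticeConj J) hx ?_ ?_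
    · intro a ha b hb
      rw [star_mul']
      exact Submodule.mul_mem_mul (mem_latticeConj.2 (by rwa [star_star]))
        (mem_latticeConj.2 (by rwa [star_star]))
    · intro a b ha hb
      rw [star_add]
      exact add_mem ha hb
  refine le_antisymm (key I J) ?_
  intro x hx
  rw [mem_latticeConj]
  have h1 := key (latticeConj I) (latticeConj J) (mem_latticeConj.2 (by rwa [star_star]) : star x ∈ _)
  rwa [latticeConj_latticeConj, latticeConj_latticeConj] at h1

theorem mem_latticeInv {O : Subalgebra ℤ L} {I : Submodule ℤ L} {x : L} :
    x ∈ latticeInv O I ↔ ∀ y ∈ I, x * y ∈ O := by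
  rw [latticeInv, Submodule.mem_div_iff_forall_mul_mem]
  rfl

theorem mem_idealLattice {O : Subalgebra ℤ L} {I : Ideal O} {x : L} :
    x ∈ idealLattice I ↔ ∃ hx : x ∈ O, (⟨x, hx⟩ : O) ∈ I := by
  constructor
  · rintro ⟨y, hy, rfl⟩
    exact ⟨y.2, hy⟩
  · rintro ⟨hx, hI⟩
    exact ⟨⟨x, hx⟩, hI, rfl⟩

theorem coe_mem_idealLattice {O : Subalgebra ℤ L} {I : Ideal O} {x : O} :
    (x : L) ∈ idealLattice I ↔ x ∈ I := by
  rw [mem_idealLattice]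
  exact ⟨fun ⟨_, h⟩ => h, fun h => ⟨x.2, h⟩⟩

theorem idealLattice_le {O : Subalgebra ℤ L} (I : Ideal O) :
    idealLattice I ≤ Subalgebra.toSubmodule O := fun _ hx => (mem_idealLattice.1 hx).1

theorem idealLattice_injective {O : Subalgebra ℤ L} :
    Function.Injective (idealLattice : Ideal O → Submodule ℤ L) := by
  intro I J hIJ
  ext x
  rw [← coe_mem_idealLattice, hIJ, coe_mem_idealLattice]

theorem toSubmodule_mul_self (O : Subalgebra ℤ L) :
    Subalgebra.toSubmodule O * Subalgebra.toSubmodule O = Subalgebra.toSubmodule O :=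
  Subalgebra.isIdempotentElem_toSubmodule O

theorem toSubmodule_mul_eq {O : Subalgebra ℤ L} {I : Submodule ℤ L}
    (hI : ∀ x ∈ O, ∀ y ∈ I, x * y ∈ I) : Subalgebra.toSubmodule O * I = I := by
  refine le_antisymm (Submodule.mul_le.2 hI) fun x hx => ?_
  have h1 : (1 : L) ∈ Subalgebra.toSubmodule O := one_mem O
  have := Submodule.mul_mem_mul h1 hx
  rwa [one_mul] at this

theorem mul_mem_of_toSubmodule_mul {O : Subalgebra ℤ L} {I : Submodule ℤ L}
    (hI : Subalgebra.toSubmodule O * I = I) {x y : L} (hx : x ∈ O) (hy : y ∈ I) : x * y ∈ I := by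
  rw [← hI]; exact Submodule.mul_mem_mul hx hy

theorem toSubmodule_mul_idealLattice {O : Subalgebra ℤ L} (I : Ideal O) :
    Subalgebra.toSubmodule O * idealLattice I = idealLattice I := by
  refine toSubmodule_mul_eq ?_
  rintro x hx y ⟨z, hz, rfl⟩
  exact ⟨⟨x, hx⟩ * z, I.mul_mem_left _ hz, rfl⟩

theorem idealLattice_mul {O : Subalgebra ℤ L} (I J : Ideal O) :
    idealLattice (I * J) = idealLattice I * idealLattice J := by
  refine le_antisymm ?_ ?_
  · rintro _ ⟨x, hx, rfl⟩
    change (x : O) ∈ I * J at hx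
    change (x : L) ∈ _
    refine Submodule.mul_induction_on (C := fun z : O => (z : L) ∈ idealLattice I * idealLattice J)
      hx ?_ ?_
    · intro a ha b hb
      exact Submodule.mul_mem_mul (coe_mem_idealLattice.2 ha) (coe_mem_idealLattice.2 hb)
    · intro a b ha hb
      exact add_mem ha hb
  · rw [Submodule.mul_le]
    rintro _ ⟨x, hx, rfl⟩ _ ⟨y, hy, rfl⟩
    exact ⟨x * y, Ideal.mul_mem_mul hx hy, rfl⟩

theorem idealLattice_top {O : Subalgebra ℤ L} :
    idealLattice (⊤ : Ideal O) = Subalgebra.toSubmodule O := by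
  refine le_antisymm (idealLattice_le _) fun x hx => mem_idealLattice.2 ⟨hx, trivial⟩

/-- The ideal of `O` with a given underlying lattice. -/
def idealOfLattice {O : Subalgebra ℤ L} (I : Submodule ℤ L)
    (hI : Subalgebra.toSubmodule O * I = I) : Ideal O where
  carrier := {x | (x : L) ∈ I}
  add_mem' := fun ha hb => I.add_mem ha hb
  zero_mem' := I.zero_mem
  smul_mem' := fun c _ hx => mul_mem_of_toSubmodule_mul hI c.2 hx

theorem idealLattice_idealOfLattice {O : Subalgebra ℤ L} {I : Submodule ℤ L}
    (hI : Subalgebra.toSubmodule O * I = I) (hle : I ≤ Subalgebra.toSubmodule O) :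
    idealLattice (idealOfLattice I hI) = I := by
  ext x
  rw [mem_idealLattice]
  exact ⟨fun ⟨_, hx⟩ => hx, fun hx => ⟨hle hx, hx⟩⟩

section invertible

variable {O : Subalgebra ℤ L} {I J K : Submodule ℤ L}

theorem toSubmodule_mul_latticeInv (I : Submodule ℤ L) :
    Subalgebra.toSubmodule O * latticeInv O I = latticeInv O I := by
  refine toSubmodule_mul_eq fun x hx y hy => ?_
  rw [mem_latticeInv] at hy ⊢
  intro z hz
  rw [mul_assoc]
  exact mul_mem hx (hy z hz)

theorem latticeInv_eq_of_mul_eq (hJ : Subalgebra.toSubmodule O * J = J)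
    (hIJ : I * J = Subalgebra.toSubmodule O) :
    latticeInv O I = J := by
  refine le_antisymm ?_ fun x hx => ?_
  · calc latticeInv O I = Subalgebra.toSubmodule O * latticeInv O I :=
          (toSubmodule_mul_latticeInv I).symm
      _ = latticeInv O I * I * J := by rw [← hIJ]; ring
      _ ≤ Subalgebra.toSubmodule O * J := by
          refine mul_le_mul' ?_ le_rfl
          rw [Submodule.mul_le]
          intro a ha b hb
          exact mem_latticeInv.1 ha b hb
      _ = J := hJ
  · rw [mem_latticeInv]
    intro y hy
    have := Submodule.mul_mem_mul hy hx
    rw [hIJ, mul_comm] at this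
    exact this

theorem isInvertibleFractional_of_mul_eq (hI : Subalgebra.toSubmodule O * I = I)
    (hJ : Subalgebra.toSubmodule O * J = J) (hIJ : I * J = Subalgebra.toSubmodule O) :
    IsInvertibleFractional O I :=
  ⟨hI, by rw [latticeInv_eq_of_mul_eq hJ hIJ, hIJ]⟩

theorem IsInvertibleFractional.inv (hI : IsInvertibleFractional O I) :
    IsInvertibleFractional O (latticeInv O I) :=
  isInvertibleFractional_of_mul_eq (toSubmodule_mul_latticeInv I) hI.1 (by rw [mul_comm, hI.2])

theorem IsInvertibleFractional.mul (hI : IsInvertibleFractional O I)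
    (hJ : IsInvertibleFractional O J) : IsInvertibleFractional O (I * J) := by
  refine isInvertibleFractional_of_mul_eq (J := latticeInv O I * latticeInv O J) ?_ ?_ ?_
  · rw [← mul_assoc, hI.1]
  · rw [← mul_assoc, toSubmodule_mul_latticeInv]
  · calc I * J * (latticeInv O I * latticeInv O J)
        = (I * latticeInv O I) * (J * latticeInv O J) := by ring
      _ = _ := by rw [hI.2, hJ.2, toSubmodule_mul_self]

theorem IsInvertibleFractional.inv_mul (hI : IsInvertibleFractional O I)
    (hJ : IsInvertibleFractional O J) :
    latticeInv O (I * J) = latticeInv O I * latticeInv O J := by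
  refine latticeInv_eq_of_mul_eq (hI.inv.mul hJ.inv).1 ?_
  calc I * J * (latticeInv O I * latticeInv O J)
        = (I * latticeInv O I) * (J * latticeInv O J) := by ring
      _ = _ := by rw [hI.2, hJ.2, toSubmodule_mul_self]

theorem IsInvertibleFractional.mul_cancel (hK : IsInvertibleFractional O K)
    (hI : Subalgebra.toSubmodule O * I = I) (hJ : Subalgebra.toSubmodule O * J = J)
    (h : K * I = K * J) : I = J := by
  have key : ∀ X : Submodule ℤ L, Subalgebra.toSubmodule O * X = X →
      X = latticeInv O K * (K * X) := by
    intro X hX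
    calc X = Subalgebra.toSubmodule O * X := hX.symm
      _ = K * latticeInv O K * X := by rw [hK.2]
      _ = _ := by ring
  rw [key I hI, key J hJ, h]

theorem IsInvertibleFractional.exists_ne_zero (hI : IsInvertibleFractional O I) :
    ∃ x ∈ I, x ≠ 0 := by
  by_contra hne
  push Not at hne
  have h0 : I = ⊥ := by
    rw [eq_bot_iff]
    intro x hx
    simpa using hne x hx
  have h1 := hI.2
  rw [h0, Submodule.bot_mul] at h1
  have : (1 : L) ∈ (⊥ : Submodule ℤ L) := by rw [h1]; exact one_mem O
  exact one_ne_zero ((Submodule.mem_bot ℤ).1 this)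

theorem isInvertibleFractional_span_mul {x : L} (hx : x ≠ 0) :
    IsInvertibleFractional O ((ℤ ∙ x) * Subalgebra.toSubmodule O) := by
  refine isInvertibleFractional_of_mul_eq (J := (ℤ ∙ x⁻¹) * Subalgebra.toSubmodule O) ?_ ?_ ?_
  · rw [mul_left_comm, toSubmodule_mul_self]
  · rw [mul_left_comm, toSubmodule_mul_self]
  · rw [mul_mul_mul_comm, toSubmodule_mul_self, Submodule.span_mul_span, Set.singleton_mul_singleton,
      mul_inv_cancel₀ hx]
    exact toSubmodule_mul_eq_of_one
where
  toSubmodule_mul_eq_of_one {O : Subalgebra ℤ L} :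
      (ℤ ∙ (1 : L)) * Subalgebra.toSubmodule O = Subalgebra.toSubmodule O := by
    rw [← Submodule.one_eq_span, one_mul]

end invertible

/-- The ring of multipliers of an invertible fractional ideal is the order itself. -/
theorem IsInvertibleFractional.mem_of_mul_mem {O : Subalgebra ℤ L} {I : Submodule ℤ L}
    (hI : IsInvertibleFractional O I) {x : L} (hx : ∀ y ∈ I, x * y ∈ I) : x ∈ O := by
  have h1 : (ℤ ∙ x) * I ≤ I := by
    rw [Submodule.mul_le]
    intro a ha b hb
    obtain ⟨n, rfl⟩ := Submodule.mem_span_singleton.1 ha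
    rw [smul_mul_assoc]
    exact I.smul_mem n (hx b hb)
  have h2 : (ℤ ∙ x) * (I * latticeInv O I) ≤ I * latticeInv O I := by
    rw [← mul_assoc]; exact mul_le_mul' h1 le_rfl
  rw [hI.2] at h2
  have := h2 (Submodule.mul_mem_mul (Submodule.mem_span_singleton_self x) (one_mem O))
  rwa [mul_one] at this

/-- A greatest common divisor of three rational numbers. -/
theorem exists_rat_gcd (a b c : ℚ) (ha : a ≠ 0) : ∃ g : ℚ, 0 < g ∧ ∃ A B C x y z : ℤ,
    a = g * A ∧ b = g * B ∧ c = g * C ∧ x * A + y * B + z * C = 1 := by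
  set N : ℤ := a.den * b.den * c.den with hN
  have hNpos : 0 < N := by positivity
  have hNq : (N : ℚ) ≠ 0 := by exact_mod_cast hNpos.ne'
  set a' : ℤ := a.num * b.den * c.den
  set b' : ℤ := b.num * a.den * c.den
  set c' : ℤ := c.num * a.den * b.den
  have ea : a = a' / N := by
    have h1 := Rat.num_div_den a
    conv_lhs => rw [← h1]
    simp only [a', hN]; push_cast; field_simp
  have eb : b = b' / N := by
    have h1 := Rat.num_div_den b
    conv_lhs => rw [← h1]
    simp only [b', hN]; push_cast; field_simp
  have ec : c = c' / N := by
    have h1 := Rat.num_div_den c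
    conv_lhs => rw [← h1]
    simp only [c', hN]; push_cast; field_simp
  set g1 : ℕ := Int.gcd a' b'
  set g0 : ℕ := Int.gcd g1 c'
  have ha' : a' ≠ 0 := by
    rintro h0
    rw [h0] at ea
    simp at ea
    exact ha ea
  have hg0 : 0 < g0 := by
    apply Int.gcd_pos_of_ne_zero_left
    have : 0 < g1 := Int.gcd_pos_of_ne_zero_left _ ha'
    exact_mod_cast this.ne'
  have h01 : (g0 : ℤ) ∣ g1 := Int.gcd_dvd_left _ _
  obtain ⟨A, hA⟩ : (g0 : ℤ) ∣ a' := h01.trans (Int.gcd_dvd_left _ _)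
  obtain ⟨B, hB⟩ : (g0 : ℤ) ∣ b' := h01.trans (Int.gcd_dvd_right _ _)
  obtain ⟨C, hC⟩ : (g0 : ℤ) ∣ c' := Int.gcd_dvd_right _ _
  have bez1 : (g1 : ℤ) = a' * a'.gcdA b' + b' * a'.gcdB b' := Int.gcd_eq_gcd_ab a' b'
  have bez0 : (g0 : ℤ) = g1 * (g1 : ℤ).gcdA c' + c' * (g1 : ℤ).gcdB c' := Int.gcd_eq_gcd_ab g1 c'
  generalize a'.gcdA b' = x at bez1
  generalize a'.gcdB b' = y at bez1
  generalize (g1 : ℤ).gcdA c' = z at bez0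
  generalize (g1 : ℤ).gcdB c' = w at bez0
  have hg0' : (g0 : ℚ) ≠ 0 := by exact_mod_cast hg0.ne'
  refine ⟨g0 / N, by positivity, A, B, C, x * z, y * z, w, ?_, ?_, ?_, ?_⟩
  · rw [ea, hA]; push_cast; ring
  · rw [eb, hB]; push_cast; ring
  · rw [ec, hC]; push_cast; ring
  · have : (g0 : ℤ) ≠ 0 := by exact_mod_cast hg0.ne'
    apply mul_left_cancel₀ this
    rw [mul_one]
    linear_combination -bez0 - z * bez1 - x * z * hA - y * z * hB - w * hC

end

noncomputable section

variable {L : Type*} [Field L] [CharZero L] [StarRing L]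

variable (d : ℤ) (δ : L) [h : ImagQuad L d δ]

include h

theorem linearIndependent_one_om :
    LinearIndependent ℤ ![(1 : quadOrder d δ), ⟨om d δ, om_mem d δ⟩] := by
  rw [LinearIndependent.pair_iff]
  intro s t hst
  have h1 : (s : L) + t * om d δ = (0 : ℤ) + (0 : ℤ) * om d δ := by
    have := congrArg (Subtype.val) hst
    simpa using this
  exact om_coord_inj d δ h1

/-- The `ℤ`-basis `1, (d + √d) / 2` of the quadratic order. -/
def omBasis : Module.Basis (Fin 2) ℤ (quadOrder d δ) :=
  Module.Basis.mk (linearIndependent_one_om d δ) (by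
    rintro ⟨x, hx⟩ -
    obtain ⟨s, t, rfl⟩ := (mem_quadOrder_iff d δ).1 hx
    have : (⟨(s : L) + t * om d δ, hx⟩ : quadOrder d δ) =
        s • (1 : quadOrder d δ) + t • ⟨om d δ, om_mem d δ⟩ := by
      apply Subtype.ext; simp
    rw [this]
    refine add_mem (Submodule.smul_mem _ _ (Submodule.subset_span ⟨0, rfl⟩))
      (Submodule.smul_mem _ _ (Submodule.subset_span ⟨1, rfl⟩)))

theorem omBasis_zero : ((omBasis d δ 0 : quadOrder d δ) : L) = 1 := by simp [omBasis]

theorem omBasis_one : ((omBasis d δ 1 : quadOrder d δ) : L) = om d δ := by simp [omBasis]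

theorem omBasis_repr (s t : ℤ) (x : quadOrder d δ) (hx : (x : L) = s + t * om d δ) :
    (omBasis d δ).repr x = Finsupp.single 0 s + Finsupp.single 1 t := by
  have : x = s • omBasis d δ 0 + t • omBasis d δ 1 := by
    apply Subtype.ext
    simp [omBasis_zero, omBasis_one, hx]
  rw [this, map_add, map_smul, map_smul, Module.Basis.repr_self, Module.Basis.repr_self]
  simp

theorem norm_coe (x : quadOrder d δ) : ((Algebra.norm ℤ x : ℤ) : ℚ) = nm (x : L) := by
  obtain ⟨s, t, hx⟩ := (mem_quadOrder_iff d δ).1 x.2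
  have h0 : ((x * omBasis d δ 0 : quadOrder d δ) : L) = s + t * om d δ := by
    rw [MulMemClass.coe_mul, omBasis_zero, mul_one, hx]
  have h1 : ((x * omBasis d δ 1 : quadOrder d δ) : L) =
      (-(t * omNorm d) : ℤ) + (s + t * d : ℤ) * om d δ := by
    rw [MulMemClass.coe_mul, omBasis_one, hx]
    push_cast
    linear_combination (t : L) * om_sq d δ
  rw [hx, nm_om_coord d δ, Algebra.norm_eq_matrix_det (omBasis d δ), Matrix.det_fin_two]
  simp only [Algebra.leftMulMatrix_eq_repr_mul]
  rw [omBasis_repr d δ _ _ _ h0, omBasis_repr d δ _ _ _ h1]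
  simp
  ring

instance : Module.Free ℤ (quadOrder d δ) := Module.Free.of_basis (omBasis d δ)

instance : Module.Finite ℤ (quadOrder d δ) := Module.Finite.of_basis (omBasis d δ)

theorem quadOrder_fg : (Subalgebra.toSubmodule (quadOrder d δ)).FG := by
  rw [← Module.Finite.iff_fg]
  exact (inferInstance : Module.Finite ℤ (quadOrder d δ))

theorem finrank_quadOrder : Module.finrank ℤ (quadOrder d δ) = 2 := by
  rw [Module.finrank_eq_card_basis (omBasis d δ)]; simp

theorem exists_int_smul_mem (x : L) : ∃ n : ℤ, n ≠ 0 ∧ n • x ∈ quadOrder d δ := by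
  obtain ⟨s, t, rfl⟩ := exists_coord d δ x
  refine ⟨s.den * t.den, by positivity, ?_⟩
  have h1 : ((s.den * t.den : ℤ) • ((s : L) + t * δ)) =
      ((s.num * t.den : ℤ) : L) + ((t.num * s.den : ℤ) : L) * δ := by
    have hs : (s : L) = s.num / s.den := by
      exact_mod_cast congrArg (Rat.cast (K := L)) (Rat.num_div_den s).symm
    have ht : (t : L) = t.num / t.den := by
      exact_mod_cast congrArg (Rat.cast (K := L)) (Rat.num_div_den t).symm
    have hs0 : (s.den : L) ≠ 0 := by exact_mod_cast s.den_nz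
    have ht0 : (t.den : L) ≠ 0 := by exact_mod_cast t.den_nz
    rw [hs, ht, zsmul_eq_mul]
    push_cast
    field_simp
  rw [h1]
  exact add_mem (intCast_mem _ _) (mul_mem (intCast_mem _ _) (sqrt_mem_quadOrder d δ))

/-- A submodule squeezed between two nonzero multiples of the order is a lattice of rank `2`. -/
theorem exists_basis_of_lattice {I : Submodule ℤ L} (h1 : ∃ y ≠ 0, ∀ z ∈ I, y * z ∈ quadOrder d δ)
    (h2 : ∃ y ≠ 0, ∀ z ∈ quadOrder d δ, y * z ∈ I) :
    I.FG ∧ Nonempty (Module.Basis (Fin 2) ℤ I) := by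
  obtain ⟨y, hy, hyI⟩ := h1
  obtain ⟨w, hw, hwI⟩ := h2
  let f : I →ₗ[ℤ] quadOrder d δ :=
    { toFun := fun z => ⟨y * z, hyI z z.2⟩
      map_add' := fun a b => Subtype.ext (by simp [mul_add])
      map_smul' := fun n a => Subtype.ext (by simp; ring) }
  let g : quadOrder d δ →ₗ[ℤ] I :=
    { toFun := fun z => ⟨w * z, hwI z z.2⟩
      map_add' := fun a b => Subtype.ext (by simp [mul_add])
      map_smul' := fun n a => Subtype.ext (by simp; ring) }
  have hf : Function.Injective f := by
    intro a b hab
    have := congrArg Subtype.val hab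
    exact Subtype.ext (mul_left_cancel₀ hy this)
  have hg : Function.Injective g := by
    intro a b hab
    have := congrArg Subtype.val hab
    exact Subtype.ext (mul_left_cancel₀ hw this)
  have hfin : Module.Finite ℤ I := Module.Finite.of_injective f hf
  have hfree : Module.Free ℤ I := Module.Free.of_equiv (LinearEquiv.ofInjective f hf).symm
  refine ⟨Module.Finite.iff_fg.1 hfin, ⟨Module.finBasisOfFinrankEq ℤ I (le_antisymm ?_ ?_)⟩⟩
  · rw [← finrank_quadOrder d δ]; exact LinearMap.finrank_le_finrank_of_injective hf
  · rw [← finrank_quadOrder d δ]; exact LinearMap.finrank_le_finrank_of_injective hg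

theorem IsInvertibleFractional.exists_basis {I : Submodule ℤ L}
    (hI : IsInvertibleFractional (quadOrder d δ) I) :
    I.FG ∧ Nonempty (Module.Basis (Fin 2) ℤ I) := by
  obtain ⟨x, hx, hx0⟩ := hI.exists_ne_zero
  obtain ⟨y, hy, hy0⟩ := hI.inv.exists_ne_zero
  refine exists_basis_of_lattice d δ ⟨y, hy0, fun z hz => mem_latticeInv.1 hy z hz⟩
    ⟨x, hx0, fun z hz => ?_⟩
  rw [mul_comm]
  exact mul_mem_of_toSubmodule_mul hI.1 hz hx

/-- A lattice `I` in a quadratic field satisfies `I Ī = g 𝓞(I)`, where `𝓞(I) = I / I` is its ring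
of multipliers and `g` generates the values of the norm form on `I`; if `𝓞(I)` has discriminant
`d`, then `I` has covolume `g √|d|`. This is the primitivity of the norm form divided by `g`. -/
theorem exists_mul_conj_eq {I : Submodule ℤ L} (b : Module.Basis (Fin 2) ℤ I) :
    ∃ g : ℚ, 0 < g ∧ I * latticeConj I = (ℤ ∙ (g : L)) * (I / I) ∧
      (I / I = Subalgebra.toSubmodule (quadOrder d δ) →
        (((b 0 : I) : L) * star ((b 1 : I) : L) - star ((b 0 : I) : L) * (b 1 : I)) ^ 2 =
          g ^ 2 * d) := by
  set β₁ : L := ((b 0 : I) : L) with hβ₁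
  set β₂ : L := ((b 1 : I) : L) with hβ₂
  have hmem1 : β₁ ∈ I := (b 0).2
  have hmem2 : β₂ ∈ I := (b 1).2
  have hI : ∀ x ∈ I, ∃ m n : ℤ, x = m * β₁ + n * β₂ := by
    intro x hx
    refine ⟨b.repr ⟨x, hx⟩ 0, b.repr ⟨x, hx⟩ 1, ?_⟩
    have := congrArg Subtype.val (b.sum_repr ⟨x, hx⟩)
    simp only [Fin.sum_univ_two] at this
    simpa using this.symm
  have hβ0 : β₁ ≠ 0 := by
    intro h0
    exact b.ne_zero 0 (Subtype.ext h0)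
  obtain ⟨g, hg, A, B, C, x, y, z, hA, hB, hC, hbez⟩ :=
    exists_rat_gcd (nm β₁) (tr (β₁ * star β₂)) (nm β₂) (nm_pos d δ hβ0).ne'
  have hA' : β₁ * star β₁ = g * A := by rw [← nm_cast d δ, hA]; push_cast; ring
  have hC' : β₂ * star β₂ = g * C := by rw [← nm_cast d δ, hC]; push_cast; ring
  have hB' : β₁ * star β₂ + star β₁ * β₂ = g * B := by
    have := tr_cast d δ (β₁ * star β₂)
    rw [hB, star_mul', star_star] at this
    rw [← this]; push_cast; ring
  have hg0 : (g : L) ≠ 0 := by exact_mod_cast hg.ne'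
  set σ : L := β₁ * star β₂ / g with hσ
  have hσg : g * σ = β₁ * star β₂ := by rw [hσ]; field_simp
  have hσg' : g * (B - σ) = star β₁ * β₂ := by linear_combination -hB' - hσg
  have hone : (1 : L) ∈ I / I := by
    rw [Submodule.mem_div_iff_forall_mul_mem]; intro y hy; simpa using hy
  have hint : ∀ n : ℤ, (n : L) ∈ I / I := fun n => by
    have := (I / I).smul_mem n hone
    simpa using this
  have hσ1 : σ * β₁ = B * β₁ - A * β₂ := by
    apply mul_left_cancel₀ hg0
    linear_combination β₁ * hσg + β₁ * hB' - β₂ * hA'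
  have hσ2 : σ * β₂ = C * β₁ := by
    apply mul_left_cancel₀ hg0
    linear_combination β₂ * hσg + β₁ * hC'
  have hσI : σ ∈ I / I := by
    rw [Submodule.mem_div_iff_forall_mul_mem]
    intro w hw
    obtain ⟨m, n, rfl⟩ := hI w hw
    have : σ * (m * β₁ + n * β₂) = (m * B + n * C : ℤ) • β₁ + (-(m * A) : ℤ) • β₂ := by
      rw [zsmul_eq_mul, zsmul_eq_mul]
      push_cast
      linear_combination (m : L) * hσ1 + (n : L) * hσ2
    rw [this]
    exact add_mem (I.smul_mem _ hmem1) (I.smul_mem _ hmem2)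
  -- every product of an element of `I` and a conjugate is `g` times an element of `ℤ + ℤ σ`
  have hprod : ∀ u ∈ I, ∀ v ∈ latticeConj I, ∃ m n : ℤ, u * v = g * (m + n * σ) := by
    intro u hu v hv
    rw [mem_latticeConj] at hv
    obtain ⟨m, n, rfl⟩ := hI u hu
    obtain ⟨m', n', hv⟩ := hI _ hv
    refine ⟨m * m' * A + n * m' * B + n * n' * C, m * n' - n * m', ?_⟩
    have hv' : v = m' * star β₁ + n' * star β₂ := by
      rw [← star_star v, hv]; simp
    rw [hv']
    push_cast
    linear_combination (m * m' : L) * hA' + (n * n' : L) * hC' + (-(m * n' : L)) * hσg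
      - (n * m' : L) * hσg'
  have hle : ∀ w ∈ I * latticeConj I, ∃ m n : ℤ, w = g * (m + n * σ) := by
    intro w hw
    refine Submodule.mul_induction_on hw hprod ?_
    rintro u v ⟨m, n, rfl⟩ ⟨m', n', rfl⟩
    exact ⟨m + m', n + n', by push_cast; ring⟩
  have hmain : I * latticeConj I = (ℤ ∙ (g : L)) * (I / I) := by
    apply le_antisymm
    · intro w hw
      obtain ⟨m, n, rfl⟩ := hle w hw
      rw [Submodule.mem_span_singleton_mul]
      refine ⟨_, add_mem (hint m) ?_, rfl⟩
      have := (I / I).smul_mem n hσI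
      simpa using this
    · intro w hw
      rw [Submodule.mem_span_singleton_mul] at hw
      obtain ⟨u, hu, rfl⟩ := hw
      rw [Submodule.mem_div_iff_forall_mul_mem] at hu
      have hs1 : star β₁ ∈ latticeConj I := mem_latticeConj.2 (by rwa [star_star])
      have hs2 : star β₂ ∈ latticeConj I := mem_latticeConj.2 (by rwa [star_star])
      have e : (g : L) * u = (x • (u * β₁ * star β₁) + y • (u * β₁ * star β₂ + u * β₂ * star β₁))
          + z • (u * β₂ * star β₂) := by
        have hb : (x : L) * A + y * B + z * C = 1 := by exact_mod_cast hbez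
        simp only [zsmul_eq_mul]
        linear_combination -(g : L) * u * hb - x * u * hA' - y * u * hB' - z * u * hC'
      rw [e]
      refine add_mem (add_mem (Submodule.smul_mem _ _ ?_) (Submodule.smul_mem _ _ (add_mem ?_ ?_)))
        (Submodule.smul_mem _ _ ?_)
      · exact Submodule.mul_mem_mul (hu _ hmem1) hs1
      · exact Submodule.mul_mem_mul (hu _ hmem1) hs2
      · exact Submodule.mul_mem_mul (hu _ hmem2) hs1
      · exact Submodule.mul_mem_mul (hu _ hmem2) hs2
  refine ⟨g, hg, hmain, fun hO => ?_⟩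
  have hσO : σ ∈ quadOrder d δ := by
    have := hσI; rw [hO] at this; exact this
  obtain ⟨s, t, hst⟩ := (mem_quadOrder_iff d δ).1 hσO
  obtain ⟨m, n, hmn⟩ := hle (g * om d δ) (by
    rw [hmain, Submodule.mem_span_singleton_mul]
    exact ⟨_, by rw [hO]; exact om_mem d δ, rfl⟩)
  have hmn' : om d δ = m + n * σ := mul_left_cancel₀ hg0 hmn
  have ht : n * t = 1 := by
    have : ((0 : ℤ) : L) + (1 : ℤ) * om d δ = ((m + n * s : ℤ) : L) + ((n * t : ℤ) : L) * om d δ := by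
      push_cast
      rw [hst] at hmn'
      linear_combination hmn'
    exact (om_coord_inj d δ this).2.symm
  have ht2 : (t : L) ^ 2 = 1 := by
    have : t = 1 ∨ t = -1 := Int.isUnit_iff.1 (IsUnit.of_mul_eq_one n (by rw [mul_comm]; exact ht))
    rcases this with rfl | rfl <;> simp
  have hstarσ : star σ = s + t * (d - om d δ) := by
    rw [hst]; simp [star_om d δ]
  have hstarσ' : g * star σ = star β₁ * β₂ := by
    have := congrArg star hσg
    simpa using this
  have e1 : β₁ * star β₂ - star β₁ * β₂ = g * t * δ := by
    rw [← hσg, ← hstarσ', hstarσ, hst]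
    linear_combination -(g * t : L) * sqrt_eq_om d δ
  rw [e1]
  linear_combination (g : L) ^ 2 * δ ^ 2 * ht2 + (g : L) ^ 2 * h.sq

/-- A positive rational generator `g` of a lattice `g 𝓞` is unique, so that norms of lattices are well
defined. -/
theorem span_mul_quadOrder_inj {g g' : ℚ} (hg : 0 < g) (hg' : 0 < g')
    (hgg : (ℤ ∙ (g : L)) * Subalgebra.toSubmodule (quadOrder d δ) =
      (ℤ ∙ (g' : L)) * Subalgebra.toSubmodule (quadOrder d δ)) : g = g' := by
  have key : ∀ a b : ℚ, 0 < a → 0 < b → (a : L) ∈ (ℤ ∙ (b : L)) * Subalgebra.toSubmodule (quadOrder d δ) →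
      ∃ n : ℤ, a = b * n := by
    intro a b ha hb hab
    obtain ⟨z, hz, hz'⟩ := Submodule.mem_span_singleton_mul.1 hab
    have hb0 : (b : L) ≠ 0 := by exact_mod_cast hb.ne'
    have e : ((a / b : ℚ) : L) = z := by push_cast; rw [← hz']; field_simp
    obtain ⟨n, hn⟩ := (ratCast_mem_quadOrder d δ (r := a / b)).1 (by rw [e]; exact hz)
    exact ⟨n, by rw [← hn]; field_simp⟩
  have hmem : ∀ a : ℚ, (a : L) ∈ (ℤ ∙ (a : L)) * Subalgebra.toSubmodule (quadOrder d δ) :=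
    fun a => Submodule.mem_span_singleton_mul.2 ⟨1, one_mem (quadOrder d δ), mul_one _⟩
  obtain ⟨n, hn⟩ := key g g' hg hg' (hgg ▸ hmem g)
  obtain ⟨n', hn'⟩ := key g' g hg' hg (hgg ▸ hmem g')
  have h1 : (n : ℚ) * n' = 1 := by
    apply mul_left_cancel₀ hg.ne'
    linear_combination -hn - (n : ℚ) * hn'
  have h2 : n * n' = 1 := by exact_mod_cast h1
  have hnpos : (0 : ℚ) < n := by
    by_contra hle
    push Not at hle
    nlinarith
  have hnpos' : 0 < n := by exact_mod_cast hnpos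
  have : n = 1 := by
    rcases Int.isUnit_iff.1 (IsUnit.of_mul_eq_one n' h2) with h | h <;> omega
  rw [hn, this]; simp

end

noncomputable section

variable {L : Type*} [Field L] [CharZero L] [StarRing L]

variable (d : ℤ) (δ : L) [h : ImagQuad L d δ]

include h

/-! ### The conductor -/

theorem isIntegral_iff_tr_nm {x : L} :
    IsIntegral ℤ x ↔ (∃ n : ℤ, tr x = n) ∧ ∃ n : ℤ, nm x = n := by
  have hfin : FiniteDimensional ℚ L := Module.finite_of_finrank_pos (by rw [h.finrank]; norm_num)
  constructor
  · intro hx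
    have h1 : IsIntegral ℤ (tr x) := by
      unfold tr; exact Algebra.isIntegral_trace hx
    have h2 : IsIntegral ℤ (nm x) := by
      unfold nm; exact Algebra.isIntegral_norm ℚ hx
    obtain ⟨m, hm⟩ := IsIntegrallyClosed.isIntegral_iff.1 h1
    obtain ⟨n, hn⟩ := IsIntegrallyClosed.isIntegral_iff.1 h2
    exact ⟨⟨m, by rw [← hm]; simp⟩, ⟨n, by rw [← hn]; simp⟩⟩
  · rintro ⟨⟨t, ht⟩, ⟨n, hn⟩⟩
    refine ⟨Polynomial.X ^ 2 - Polynomial.C t * Polynomial.X + Polynomial.C n, by monicity!, ?_⟩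
    have h1 := tr_cast d δ x
    have h2 := nm_cast d δ x
    rw [ht] at h1
    rw [hn] at h2
    have h1' : (t : L) = x + star x := by exact_mod_cast h1
    have h2' : (n : L) = x * star x := by exact_mod_cast h2
    rw [Polynomial.eval₂_add, Polynomial.eval₂_sub, Polynomial.eval₂_mul, Polynomial.eval₂_pow,
      Polynomial.eval₂_X, Polynomial.eval₂_C, Polynomial.eval₂_C, eq_intCast, eq_intCast, h1', h2']
    ring

theorem quadOrder_le_integralClosure : quadOrder d δ ≤ integralClosure ℤ L := fun _ hx =>
  (isIntegral_iff_tr_nm d δ).2 ⟨exists_tr_eq d δ hx, exists_nm_eq d δ hx⟩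

theorem conductor_smul_mem {x : L} (hx : IsIntegral ℤ x) :
    (conductor (quadOrder d δ) : ℤ) • x ∈ quadOrder d δ := by
  have := AddSubgroup.nsmul_relIndex_mem (Subalgebra.toSubmodule (quadOrder d δ)).toAddSubgroup
    (K := (Subalgebra.toSubmodule (integralClosure ℤ L)).toAddSubgroup) (g := x) hx
  rw [natCast_zsmul]
  exact this

theorem two_mul_disc_smul_mem {x : L} (hx : IsIntegral ℤ x) : (2 * d) • x ∈ quadOrder d δ := by
  have hδ : IsIntegral ℤ δ := quadOrder_le_integralClosure d δ (sqrt_mem_quadOrder d δ)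
  obtain ⟨A, hA⟩ := ((isIntegral_iff_tr_nm d δ).1 hx).1
  obtain ⟨B, hB⟩ := ((isIntegral_iff_tr_nm d δ).1 (hx.mul hδ)).1
  obtain ⟨s, t, rfl⟩ := exists_coord d δ x
  have h1 : ((s : L) + t * δ) * δ = ((t * d : ℚ) : L) + s * δ := by
    push_cast
    linear_combination (t : L) * h.sq
  rw [tr_coord d δ] at hA
  rw [h1, tr_coord d δ] at hB
  have hA' : (2 : L) * s = A := by exact_mod_cast congrArg (Rat.cast (K := L)) hA
  have hB' : (2 : L) * (t * d) = B := by exact_mod_cast congrArg (Rat.cast (K := L)) hB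
  have : (2 * d) • ((s : L) + t * δ) = ((d * A : ℤ) : L) + (B : L) * δ := by
    rw [zsmul_eq_mul]; push_cast; linear_combination (d : L) * hA' + δ * hB'
  rw [this]
  exact add_mem (intCast_mem _ _) (mul_mem (intCast_mem _ _) (sqrt_mem_quadOrder d δ))

/-- The order has finite index in the maximal order, because `2 d` kills the quotient. -/
theorem conductor_ne_zero : conductor (quadOrder d δ) ≠ 0 := by
  have hd0 : (2 * d) ≠ 0 := by have := h.neg; omega
  let OL := Subalgebra.toSubmodule (integralClosure ℤ L)
  have hfg : Module.Finite ℤ OL := by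
    let f : OL →ₗ[ℤ] quadOrder d δ :=
      { toFun := fun z => ⟨(2 * d) • (z : L), two_mul_disc_smul_mem d δ z.2⟩
        map_add' := fun a b => Subtype.ext (by simp)
        map_smul' := fun n a => Subtype.ext (by simp; ring) }
    refine Module.Finite.of_injective f ?_
    intro a b hab
    have := congrArg Subtype.val hab
    exact Subtype.ext (smul_right_injective L hd0 this)
  have htors : Module.IsTorsion ℤ (OL ⧸ (Subalgebra.toSubmodule (quadOrder d δ)).comap OL.subtype) := by
    intro x
    induction x using Submodule.Quotient.induction_on with
    | H x =>
      refine ⟨⟨2 * d, mem_nonZeroDivisors_of_ne_zero hd0⟩, ?_⟩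
      change (2 * d) • (Submodule.Quotient.mk x : OL ⧸
        (Subalgebra.toSubmodule (quadOrder d δ)).comap OL.subtype) = 0
      rw [← Submodule.Quotient.mk_smul, Submodule.Quotient.mk_eq_zero]
      exact two_mul_disc_smul_mem d δ x.2
  have hf := Module.finite_of_fg_torsion _ htors
  have : conductor (quadOrder d δ) =
      Nat.card (OL ⧸ (Subalgebra.toSubmodule (quadOrder d δ)).comap OL.subtype) := rfl
  rw [this]
  exact Nat.card_pos.ne'

/-- A prime divides the conductor if and only if the quotient of the maximal order by `𝓞` has
`p`-torsion, by Cauchy's theorem. -/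
theorem prime_dvd_conductor_iff_exists {p : ℕ} (hp : p.Prime) :
    p ∣ conductor (quadOrder d δ) ↔
      ∃ x : L, IsIntegral ℤ x ∧ x ∉ quadOrder d δ ∧ (p : ℤ) • x ∈ quadOrder d δ := by
  let OL := Subalgebra.toSubmodule (integralClosure ℤ L)
  let N := (Subalgebra.toSubmodule (quadOrder d δ)).comap OL.subtype
  have hc : conductor (quadOrder d δ) = Nat.card (OL ⧸ N) := rfl
  have : Fact p.Prime := ⟨hp⟩
  constructor
  · intro hdvd
    rw [hc] at hdvd
    have hfin : Finite (OL ⧸ N) := by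
      apply Nat.finite_of_card_ne_zero
      rw [← hc]; exact conductor_ne_zero d δ
    obtain ⟨x, hx⟩ := exists_prime_addOrderOf_dvd_card' p hdvd
    induction x using Submodule.Quotient.induction_on with
    | H x =>
      refine ⟨x, x.2, ?_, ?_⟩
      · intro hmem
        have h0 : (Submodule.Quotient.mk x : OL ⧸ N) = 0 := (Submodule.Quotient.mk_eq_zero N).2 hmem
        rw [h0, addOrderOf_zero] at hx
        exact hp.one_lt.ne hx
      · have h1 := addOrderOf_nsmul_eq_zero (Submodule.Quotient.mk x : OL ⧸ N)
        rw [hx, ← Submodule.Quotient.mk_smul, Submodule.Quotient.mk_eq_zero] at h1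
        rw [natCast_zsmul]
        exact h1
  · rintro ⟨x, hx, hxO, hpx⟩
    rw [hc]
    have h1 : addOrderOf (Submodule.Quotient.mk ⟨x, hx⟩ : OL ⧸ N) = p := by
      apply addOrderOf_eq_prime
      · rw [← Submodule.Quotient.mk_smul, Submodule.Quotient.mk_eq_zero]
        rw [natCast_zsmul] at hpx
        exact hpx
      · rw [Ne, Submodule.Quotient.mk_eq_zero]
        exact hxO
    rw [← h1]
    exact addOrderOf_dvd_natCard _

/-- A prime divides the conductor exactly when `d / p²` is again a discriminant. -/
theorem prime_dvd_conductor_iff {p : ℕ} (hp : p.Prime) :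
    p ∣ conductor (quadOrder d δ) ↔
      ∃ d' : ℤ, d = (p : ℤ) ^ 2 * d' ∧ (d' % 4 = 0 ∨ d' % 4 = 1) := by
  rw [prime_dvd_conductor_iff_exists d δ hp]
  have hpz : Prime (p : ℤ) := Nat.prime_iff_prime_int.1 hp
  have hp0 : (p : L) ≠ 0 := by exact_mod_cast hp.ne_zero
  have hp0' : (p : ℚ) ≠ 0 := by exact_mod_cast hp.ne_zero
  constructor
  · rintro ⟨x, hx, hxO, hpx⟩
    obtain ⟨u, v, huv⟩ := (mem_quadOrder_iff d δ).1 hpx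
    obtain ⟨⟨t, ht⟩, ⟨n, hn⟩⟩ := (isIntegral_iff_tr_nm d δ).1 hx
    have e : (p : ℤ) • x = ((p : ℚ) : L) * x := by rw [zsmul_eq_mul]; push_cast; ring
    have h1 : 2 * u + d * v = p * t := by
      have := tr_om_coord d δ u v
      rw [← huv, e, tr_ratCast_mul, ht] at this
      exact_mod_cast this.symm
    have h2 : u ^ 2 + d * u * v + omNorm d * v ^ 2 = p ^ 2 * n := by
      have := nm_om_coord d δ u v
      rw [← huv, e, nm_mul, nm_ratCast d δ, hn] at this
      exact_mod_cast this.symm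
    have h3 : v ^ 2 * d = p ^ 2 * (t ^ 2 - 4 * n) := by
      linear_combination (2 * u + d * v + p * t) * h1 - 4 * h2 + v ^ 2 * four_mul_omNorm d δ
    have hv : ¬ (p : ℤ) ∣ v := by
      rintro ⟨v', rfl⟩
      have hu : (p : ℤ) ∣ u := by
        have : (p : ℤ) ∣ u ^ 2 := by
          refine ⟨p * n - d * u * v' - omNorm d * v' ^ 2 * p, ?_⟩
          linear_combination h2
        exact hpz.dvd_of_dvd_pow this
      obtain ⟨u', rfl⟩ := hu
      apply hxO
      rw [mem_quadOrder_iff d δ]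
      refine ⟨u', v', mul_left_cancel₀ hp0 ?_⟩
      rw [e] at huv
      push_cast at huv
      rw [huv]; ring
    have hcop : IsCoprime ((p : ℤ) ^ 2) (v ^ 2) := (hpz.coprime_iff_not_dvd.2 hv).pow
    obtain ⟨d', hd'⟩ : (p : ℤ) ^ 2 ∣ d := hcop.dvd_of_dvd_mul_left ⟨_, h3⟩
    refine ⟨d', hd', ?_⟩
    have h4 : v ^ 2 * d' = t ^ 2 - 4 * n := by
      have hpp : (p : ℤ) ^ 2 ≠ 0 := pow_ne_zero _ hpz.ne_zero
      apply mul_left_cancel₀ hpp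
      rw [← h3, hd']; ring
    rcases hp.eq_two_or_odd' with rfl | hodd
    · have hv2 : v % 2 = 1 := by push_cast at hv; omega
      have hv4 : v ^ 2 % 4 = 1 := by
        rcases Int.even_or_odd' v with ⟨k, rfl | rfl⟩
        · omega
        · ring_nf; omega
      have ht4 : t ^ 2 % 4 = 0 ∨ t ^ 2 % 4 = 1 := by
        rcases Int.even_or_odd' t with ⟨k, rfl | rfl⟩
        · left; ring_nf; omega
        · right; ring_nf; omega
      have h5 : (v ^ 2 * d') % 4 = d' % 4 := by rw [Int.mul_emod, hv4]; simp
      omega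
    · obtain ⟨k, hk⟩ := hodd
      have h5 : d = d' + 4 * ((k ^ 2 + k) * d') := by rw [hd', hk]; push_cast; ring
      have := h.mod4
      omega
  · rintro ⟨d', hd', h4⟩
    refine ⟨((d' : L) + δ / p) / 2, ?_, ?_, ?_⟩
    · have e : ((d' : L) + δ / p) / 2 = ((d' / 2 : ℚ) : L) + ((1 / (2 * p) : ℚ) : L) * δ := by
        push_cast; field_simp
      rw [isIntegral_iff_tr_nm d δ, e, tr_coord d δ, nm_coord d δ]
      refine ⟨⟨d', by ring⟩, ?_⟩
      obtain ⟨k, hk⟩ : ∃ k : ℤ, d' ^ 2 - d' = 4 * k := by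
        rcases h4 with h4 | h4
        · obtain ⟨m, rfl⟩ : ∃ m, d' = 4 * m := ⟨d' / 4, by omega⟩
          exact ⟨4 * m ^ 2 - m, by ring⟩
        · obtain ⟨m, rfl⟩ : ∃ m, d' = 4 * m + 1 := ⟨d' / 4, by omega⟩
          exact ⟨(4 * m + 1) * m, by ring⟩
      refine ⟨k, ?_⟩
      have hk' : (d' : ℚ) ^ 2 - d' = 4 * k := by exact_mod_cast hk
      rw [hd']
      push_cast
      field_simp
      linear_combination hk'
    · intro hmem
      obtain ⟨u, v, huv⟩ := (mem_quadOrder_iff d δ).1 hmem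
      have h2 : ((0 : ℚ) : L) + ((1 / (2 * p) - v / 2 : ℚ) : L) * δ =
          ((u + v * d / 2 - d' / 2 : ℚ) : L) + ((0 : ℚ) : L) * δ := by
        have : ((1 / (2 * p) : ℚ) : L) * δ = δ / p / 2 := by push_cast; field_simp
        unfold om at huv
        push_cast at this ⊢
        linear_combination huv + this
      have h3 := (coord_inj d δ h2).2
      have h4 : (1 : ℚ) = v * p := by
        field_simp at h3
        linarith
      have h5 : (1 : ℤ) = v * p := by exact_mod_cast h4
      exact hpz.not_dvd_one ⟨v, by rw [h5]; ring⟩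
    · rw [mem_quadOrder_iff d δ]
      have hodd : ∃ k : ℤ, p * d' - d = 2 * k := by
        rcases Nat.even_or_odd' p with ⟨m, hm | hm⟩
        · exact ⟨m * d' - 2 * m ^ 2 * d', by rw [hd', hm]; push_cast; ring⟩
        · exact ⟨- (2 * m + 1) * m * d', by rw [hd', hm]; push_cast; ring⟩
      obtain ⟨k, hk⟩ := hodd
      have hk' : (p : L) * d' - d = 2 * k := by exact_mod_cast congrArg (Int.cast (R := L)) hk
      refine ⟨k, 1, ?_⟩
      unfold om
      rw [zsmul_eq_mul]
      push_cast
      field_simp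
      linear_combination hk'

theorem dvd_of_dvd_conductor {p : ℕ} (hp : p.Prime) (hpf : p ∣ conductor (quadOrder d δ)) :
    (p : ℤ) ∣ d := by
  obtain ⟨d', hd', -⟩ := (prime_dvd_conductor_iff d δ hp).1 hpf
  exact ⟨p * d', by rw [hd']; ring⟩

theorem isCoprime_conductor {m : ℤ} (hm : IsCoprime m d) :
    IsCoprime m (conductor (quadOrder d δ)) := by
  rw [Int.isCoprime_iff_gcd_eq_one]
  by_contra hne
  obtain ⟨p, hp, hpd⟩ := Nat.exists_prime_and_dvd hne
  have hpm : (p : ℤ) ∣ m := (Int.natCast_dvd_natCast.2 hpd).trans (Int.gcd_dvd_left _ _)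
  have hpf : (p : ℤ) ∣ (conductor (quadOrder d δ) : ℕ) :=
    (Int.natCast_dvd_natCast.2 hpd).trans (Int.gcd_dvd_right _ _)
  have := dvd_of_dvd_conductor d δ hp (Int.natCast_dvd_natCast.1 hpf)
  have hu := hm.isUnit_of_dvd' hpm this
  exact (Nat.prime_iff_prime_int.1 hp).not_isUnit hu

end

noncomputable section

variable {L : Type*} [Field L] [CharZero L] [StarRing L]

variable (d : ℤ) (δ : L) [h : ImagQuad L d δ]

include h

/-! ### Ideals prime to the conductor -/

/-- Conjugation as an automorphism of the quadratic order. -/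
def starHom : quadOrder d δ →+* quadOrder d δ where
  toFun x := ⟨star (x : L), star_mem_quadOrder d δ x.2⟩
  map_one' := Subtype.ext (by simp)
  map_mul' x y := Subtype.ext (by simp)
  map_zero' := Subtype.ext (by simp)
  map_add' x y := Subtype.ext (by simp)

theorem coe_starHom (x : quadOrder d δ) : (starHom d δ x : L) = star (x : L) := rfl

/-- The conjugate of an ideal. -/
def conjIdeal (I : Ideal (quadOrder d δ)) : Ideal (quadOrder d δ) := I.comap (starHom d δ)

theorem idealLattice_conjIdeal (I : Ideal (quadOrder d δ)) :
    idealLattice (conjIdeal d δ I) = latticeConj (idealLattice I) := by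
  ext x
  rw [mem_latticeConj, mem_idealLattice, mem_idealLattice]
  constructor
  · rintro ⟨hx, hI⟩
    exact ⟨star_mem_quadOrder d δ hx, hI⟩
  · rintro ⟨hx, hI⟩
    exact ⟨(star_mem_quadOrder_iff d δ).1 hx, hI⟩

theorem latticeConj_quadOrder : latticeConj (Subalgebra.toSubmodule (quadOrder d δ)) =
    Subalgebra.toSubmodule (quadOrder d δ) := by
  ext x
  rw [mem_latticeConj]
  exact star_mem_quadOrder_iff d δ

theorem latticeConj_span (x : L) : latticeConj (ℤ ∙ x) = (ℤ ∙ star x) := by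
  unfold latticeConj
  rw [Submodule.map_span, Set.image_singleton]
  rfl

theorem IsInvertibleFractional.conj {I : Submodule ℤ L}
    (hI : IsInvertibleFractional (quadOrder d δ) I) :
    IsInvertibleFractional (quadOrder d δ) (latticeConj I) := by
  refine isInvertibleFractional_of_mul_eq (J := latticeConj (latticeInv (quadOrder d δ) I)) ?_ ?_ ?_
  · rw [← latticeConj_quadOrder d δ, ← latticeConj_mul, hI.1]
  · rw [← latticeConj_quadOrder d δ, ← latticeConj_mul, hI.inv.1]
  · rw [← latticeConj_mul, hI.2, latticeConj_quadOrder]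

theorem IsInvertibleFractional.conj_inv {I : Submodule ℤ L}
    (hI : IsInvertibleFractional (quadOrder d δ) I) :
    latticeInv (quadOrder d δ) (latticeConj I) = latticeConj (latticeInv (quadOrder d δ) I) := by
  refine latticeInv_eq_of_mul_eq (hI.inv.conj d δ).1 ?_
  rw [← latticeConj_mul, hI.2, latticeConj_quadOrder]

theorem intCast_mem_iff {I : Ideal (quadOrder d δ)} {m : ℤ} :
    (m : quadOrder d δ) ∈ I ↔ (m : L) ∈ idealLattice I := by
  rw [← coe_mem_idealLattice]; simp

theorem exists_int_mem {I : Ideal (quadOrder d δ)} (hI : I ≠ ⊥) :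
    ∃ m : ℤ, m ≠ 0 ∧ (m : quadOrder d δ) ∈ I := by
  obtain ⟨x, hx, hx0⟩ := Submodule.exists_mem_ne_zero_of_ne_bot hI
  obtain ⟨n, hn⟩ := exists_nm_eq d δ x.2
  refine ⟨n, ?_, ?_⟩
  · rintro rfl
    apply hx0
    apply Subtype.ext
    exact (nm_eq_zero d δ).1 (by rw [hn]; simp)
  · have h1 : (n : quadOrder d δ) = starHom d δ x * x := by
      apply Subtype.ext
      have := nm_cast d δ (x : L)
      rw [hn] at this
      push_cast at this ⊢
      rw [coe_starHom, this, mul_comm]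
    rw [h1]
    exact I.mul_mem_left _ hx

theorem finite_quotient {I : Ideal (quadOrder d δ)} {m : ℤ} (hm : m ≠ 0)
    (hmI : (m : quadOrder d δ) ∈ I) : Finite (quadOrder d δ ⧸ I) := by
  have htors : Module.IsTorsion ℤ (quadOrder d δ ⧸ I) := by
    intro x
    refine ⟨⟨m, mem_nonZeroDivisors_of_ne_zero hm⟩, ?_⟩
    change m • x = 0
    obtain ⟨x, rfl⟩ := Ideal.Quotient.mk_surjective x
    rw [← map_zsmul, Ideal.Quotient.eq_zero_iff_mem, zsmul_eq_mul]
    exact I.mul_mem_right _ hmI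
  have : Module.Finite ℤ (quadOrder d δ ⧸ I) :=
    Module.Finite.of_surjective (Ideal.Quotient.mk I).toAddMonoidHom.toIntLinearMap
      Ideal.Quotient.mk_surjective
  exact Module.finite_of_fg_torsion _ htors

theorem idealNorm_mem (I : Ideal (quadOrder d δ)) : (idealNorm I : quadOrder d δ) ∈ I := by
  rw [← Ideal.Quotient.eq_zero_iff_mem, map_natCast]
  have := card_nsmul_eq_zero' (G := quadOrder d δ ⧸ I) (x := 1)
  rwa [nsmul_one] at this

theorem dvd_of_dvd_idealNorm {I : Ideal (quadOrder d δ)} {m : ℤ} (hm : m ≠ 0)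
    (hmI : (m : quadOrder d δ) ∈ I) {p : ℕ} (hp : p.Prime) (hdvd : p ∣ idealNorm I) :
    (p : ℤ) ∣ m := by
  have := finite_quotient d δ hm hmI
  have : Fact p.Prime := ⟨hp⟩
  obtain ⟨x, hx⟩ := exists_prime_addOrderOf_dvd_card' p hdvd
  have h1 : m • x = 0 := by
    obtain ⟨x, rfl⟩ := Ideal.Quotient.mk_surjective x
    rw [← map_zsmul, Ideal.Quotient.eq_zero_iff_mem, zsmul_eq_mul]
    exact I.mul_mem_right _ hmI
  rw [← hx]
  exact addOrderOf_dvd_iff_zsmul_eq_zero.2 h1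

/-- A multiplier of `I` is integral, hence multiplied into `𝓞` by the conductor, and it is multiplied
into `𝓞` by `m ∈ I`. As the two are coprime, it lies in `𝓞`. -/
theorem quotient_self_eq_of_coprime {I : Ideal (quadOrder d δ)} {m : ℤ} (hm : m ≠ 0)
    (hmf : IsCoprime m (conductor (quadOrder d δ))) (hmI : (m : quadOrder d δ) ∈ I) :
    idealLattice I / idealLattice I = Subalgebra.toSubmodule (quadOrder d δ) := by
  apply le_antisymm
  · intro x hx
    rw [Submodule.mem_div_iff_forall_mul_mem] at hx
    have hmI' : (m : L) ∈ idealLattice I := (intCast_mem_iff d δ).1 hmI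
    have hint : IsIntegral ℤ x := by
      refine isIntegral_of_smul_mem_submodule (idealLattice I) ?_ ?_ x hx
      · intro hbot
        rw [hbot, Submodule.mem_bot] at hmI'
        exact hm (by exact_mod_cast hmI')
      · exact (quadOrder_fg d δ).of_le (idealLattice_le I)
    have h1 := conductor_smul_mem d δ hint
    have h2 : m • x ∈ quadOrder d δ := by
      rw [zsmul_eq_mul, mul_comm]
      exact idealLattice_le I (hx _ hmI')
    obtain ⟨a, b, hab⟩ := hmf
    have : x = a • m • x + b • (conductor (quadOrder d δ) : ℤ) • x := by
      rw [smul_smul, smul_smul, ← add_smul, hab, one_smul]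
    rw [this]
    exact add_mem (Subalgebra.smul_mem _ h2 a) (Subalgebra.smul_mem _ h1 b)
  · intro x hx
    rw [Submodule.mem_div_iff_forall_mul_mem]
    intro y hy
    exact mul_mem_of_toSubmodule_mul (toSubmodule_mul_idealLattice I) hx hy

/-- An ideal containing an integer prime to the conductor is invertible, with inverse given by its
conjugate. -/
theorem isInvertible_of_coprime {I : Ideal (quadOrder d δ)} {m : ℤ} (hm : m ≠ 0)
    (hmf : IsCoprime m (conductor (quadOrder d δ))) (hmI : (m : quadOrder d δ) ∈ I) :
    IsInvertibleFractional (quadOrder d δ) (idealLattice I) ∧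
      ∃ g : ℚ, 0 < g ∧ idealLattice I * latticeConj (idealLattice I) =
        (ℤ ∙ (g : L)) * Subalgebra.toSubmodule (quadOrder d δ) := by
  have hm0 : (m : L) ≠ 0 := by exact_mod_cast hm
  have hmI' : (m : L) ∈ idealLattice I := (intCast_mem_iff d δ).1 hmI
  obtain ⟨-, ⟨b⟩⟩ := exists_basis_of_lattice d δ (I := idealLattice I)
    ⟨1, one_ne_zero, fun z hz => by rw [one_mul]; exact idealLattice_le I hz⟩
    ⟨m, hm0, fun z hz => by
      rw [mul_comm]; exact mul_mem_of_toSubmodule_mul (toSubmodule_mul_idealLattice I) hz hmI'⟩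
  obtain ⟨g, hg, hgI, -⟩ := exists_mul_conj_eq d δ b
  rw [quotient_self_eq_of_coprime d δ hm hmf hmI] at hgI
  refine ⟨?_, g, hg, hgI⟩
  have hg0 : (g : L) ≠ 0 := by exact_mod_cast hg.ne'
  have hc : Subalgebra.toSubmodule (quadOrder d δ) * latticeConj (idealLattice I) =
      latticeConj (idealLattice I) := by
    rw [← idealLattice_conjIdeal, toSubmodule_mul_idealLattice]
  refine isInvertibleFractional_of_mul_eq (J := (ℤ ∙ (g : L)⁻¹) * latticeConj (idealLattice I))
    (toSubmodule_mul_idealLattice I) ?_ ?_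
  · rw [mul_left_comm, hc]
  · rw [mul_left_comm, hgI, ← mul_assoc, Submodule.span_mul_span, Set.singleton_mul_singleton,
      inv_mul_cancel₀ hg0, ← Submodule.one_eq_span, one_mul]

theorem isGoodIdeal_of_coprime {I : Ideal (quadOrder d δ)} {m : ℤ} (hm : m ≠ 0)
    (hmf : IsCoprime m (conductor (quadOrder d δ))) (hmI : (m : quadOrder d δ) ∈ I) :
    IsGoodIdeal I := by
  refine ⟨(isInvertible_of_coprime d δ hm hmf hmI).1, ?_⟩
  by_contra hne
  obtain ⟨p, hp, hpd⟩ := Nat.exists_prime_and_dvd hne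
  have h1 := dvd_of_dvd_idealNorm d δ hm hmI hp (hpd.trans (Nat.gcd_dvd_left _ _))
  have h2 : (p : ℤ) ∣ (conductor (quadOrder d δ) : ℕ) :=
    Int.natCast_dvd_natCast.2 (hpd.trans (Nat.gcd_dvd_right _ _))
  exact (Nat.prime_iff_prime_int.1 hp).not_isUnit (hmf.isUnit_of_dvd' h1 h2)

theorem IsGoodIdeal.ne_bot {I : Ideal (quadOrder d δ)} (hI : IsGoodIdeal I) : I ≠ ⊥ := by
  rintro rfl
  obtain ⟨x, hx, hx0⟩ := hI.1.exists_ne_zero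
  obtain ⟨y, hy, rfl⟩ := hx
  rw [(Submodule.mem_bot _).1 hy] at hx0
  exact hx0 (map_zero _)

theorem IsGoodIdeal.exists_coprime {I : Ideal (quadOrder d δ)} (hI : IsGoodIdeal I) :
    ∃ m : ℤ, m ≠ 0 ∧ IsCoprime m (conductor (quadOrder d δ)) ∧ (m : quadOrder d δ) ∈ I := by
  refine ⟨idealNorm I, ?_, Nat.isCoprime_iff_coprime.2 hI.2, by simpa using idealNorm_mem d δ I⟩
  obtain ⟨m, hm, hmI⟩ := exists_int_mem d δ (hI.ne_bot d δ)
  have := finite_quotient d δ hm hmI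
  exact_mod_cast Nat.card_pos.ne'

theorem IsGoodIdeal.of_le {I J : Ideal (quadOrder d δ)} (hI : IsGoodIdeal I) (hIJ : I ≤ J) :
    IsGoodIdeal J := by
  obtain ⟨m, hm, hmf, hmI⟩ := hI.exists_coprime d δ
  exact isGoodIdeal_of_coprime d δ hm hmf (hIJ hmI)

theorem IsGoodIdeal.mul {I J : Ideal (quadOrder d δ)} (hI : IsGoodIdeal I) (hJ : IsGoodIdeal J) :
    IsGoodIdeal (I * J) := by
  obtain ⟨m, hm, hmf, hmI⟩ := hI.exists_coprime d δ
  obtain ⟨n, hn, hnf, hnJ⟩ := hJ.exists_coprime d δ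
  refine isGoodIdeal_of_coprime d δ (mul_ne_zero hm hn) (hmf.mul_left hnf) ?_
  push_cast
  exact Ideal.mul_mem_mul hmI hnJ

theorem isGoodIdeal_top : IsGoodIdeal (⊤ : Ideal (quadOrder d δ)) :=
  isGoodIdeal_of_coprime d δ (m := 1) one_ne_zero isCoprime_one_left trivial

/-! ### Prime ideals -/

theorem isMaximal_of_isPrime {P : Ideal (quadOrder d δ)} (hP : P.IsPrime) {m : ℤ} (hm : m ≠ 0)
    (hmP : (m : quadOrder d δ) ∈ P) : P.IsMaximal := by
  have := finite_quotient d δ hm hmP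
  exact Ideal.Quotient.maximal_of_isField P (Finite.isField_of_domain _)

theorem exists_prime_mem {P : Ideal (quadOrder d δ)} (hP : P.IsPrime) {m : ℤ} (hm : m ≠ 0)
    (hmP : (m : quadOrder d δ) ∈ P) : ∃ p : ℕ, p.Prime ∧ (p : ℤ) ∣ m ∧ (p : quadOrder d δ) ∈ P := by
  have key : ∀ n : ℕ, n ≠ 0 → (n : quadOrder d δ) ∈ P →
      ∃ p : ℕ, p.Prime ∧ p ∣ n ∧ (p : quadOrder d δ) ∈ P := by
    intro n
    induction n using Nat.recOnMul with
    | zero => intro h0; exact absurd rfl h0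
    | one => intro _ h1; rw [Nat.cast_one] at h1; exact absurd ((Ideal.eq_top_iff_one P).2 h1) hP.ne_top
    | prime p hp => intro _ h1; exact ⟨p, hp, dvd_rfl, h1⟩
    | mul a b iha ihb =>
      intro h0 h1
      rw [Nat.cast_mul] at h1
      rcases hP.mem_or_mem h1 with h2 | h2
      · obtain ⟨p, hp, hpd, hpP⟩ := iha (left_ne_zero_of_mul h0) h2
        exact ⟨p, hp, hpd.mul_right b, hpP⟩
      · obtain ⟨p, hp, hpd, hpP⟩ := ihb (right_ne_zero_of_mul h0) h2
        exact ⟨p, hp, hpd.mul_left a, hpP⟩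
  obtain ⟨p, hp, hpd, hpP⟩ := key m.natAbs (by simpa using hm) (by
    rcases Int.natAbs_eq m with h1 | h1
    · rw [h1] at hmP; simpa using hmP
    · rw [h1] at hmP; simpa using hmP)
  exact ⟨p, hp, Int.natCast_dvd.2 hpd, hpP⟩

theorem mem_iff_dvd {P : Ideal (quadOrder d δ)} (hP : P.IsPrime) {p : ℕ} (hp : p.Prime)
    (hpP : (p : quadOrder d δ) ∈ P) {m : ℤ} : (m : quadOrder d δ) ∈ P ↔ (p : ℤ) ∣ m := by
  constructor
  · intro hm
    by_contra hnd
    obtain ⟨a, b, hab⟩ := (isCoprime_prime_iff hp).2 hnd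
    apply hP.ne_top
    rw [Ideal.eq_top_iff_one]
    have : (1 : quadOrder d δ) = a * m + b * p := by exact_mod_cast congrArg (Int.cast (R := quadOrder d δ)) hab.symm
    rw [this]
    exact add_mem (P.mul_mem_left _ hm) (P.mul_mem_left _ hpP)
  · rintro ⟨k, rfl⟩
    push_cast
    exact P.mul_mem_right _ hpP

/-- The element `√d` of the order. -/
def sqrtElem : quadOrder d δ := ⟨δ, sqrt_mem_quadOrder d δ⟩

theorem sqrtElem_sq : sqrtElem d δ ^ 2 = (d : quadOrder d δ) := by
  apply Subtype.ext
  have := h.sq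
  simpa [sqrtElem] using this

theorem sqrtElem_mem_iff {P : Ideal (quadOrder d δ)} (hP : P.IsPrime) {p : ℕ} (hp : p.Prime)
    (hpP : (p : quadOrder d δ) ∈ P) : sqrtElem d δ ∈ P ↔ (p : ℤ) ∣ d := by
  rw [← mem_iff_dvd d δ hP hp hpP, ← sqrtElem_sq]
  exact ⟨fun h => P.pow_mem_of_mem h 2 (by norm_num), fun h => hP.mem_of_pow_mem 2 h⟩

theorem isCoprime_sqrtIdeal_iff {P : Ideal (quadOrder d δ)} (hP : P.IsPrime) {p : ℕ} (hp : p.Prime)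
    (hpP : (p : quadOrder d δ) ∈ P) : IsCoprime P (sqrtIdeal d δ) ↔ ¬ (p : ℤ) ∣ d := by
  rw [← sqrtElem_mem_iff d δ hP hp hpP]
  have hmax := isMaximal_of_isPrime d δ hP (m := p) (by exact_mod_cast hp.ne_zero) (by simpa using hpP)
  rw [Ideal.isCoprime_iff_sup_eq]
  constructor
  · intro hsup hmem
    have hle : sqrtIdeal d δ ≤ P := (Ideal.span_singleton_le_iff_mem P).2 hmem
    rw [sup_eq_left.2 hle] at hsup
    exact hP.ne_top hsup
  · intro hmem
    refine hmax.out.2 _ (lt_of_le_of_ne le_sup_left ?_)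
    intro heq
    apply hmem
    rw [heq]
    exact (le_sup_right : sqrtIdeal d δ ≤ _) (Ideal.mem_span_singleton_self _)

theorem starHom_mem_of_sqrtElem_mem {P : Ideal (quadOrder d δ)} (hδ : sqrtElem d δ ∈ P)
    {x : quadOrder d δ} (hx : x ∈ P) : starHom d δ x ∈ P := by
  obtain ⟨n, hn⟩ := exists_sub_star d δ x.2
  have : starHom d δ x = x - n * sqrtElem d δ := by
    apply Subtype.ext
    rw [coe_starHom]
    simp only [sqrtElem, AddSubgroupClass.coe_sub, MulMemClass.coe_mul, SubringClass.coe_intCast]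
    rw [← hn]; ring
  rw [this]
  exact sub_mem hx (P.mul_mem_left _ hδ)

theorem latticeConj_eq_of_sqrtElem_mem {P : Ideal (quadOrder d δ)} (hδ : sqrtElem d δ ∈ P) :
    latticeConj (idealLattice P) = idealLattice P := by
  have key : latticeConj (idealLattice P) ≤ idealLattice P := by
    intro x hx
    rw [mem_latticeConj, mem_idealLattice] at hx
    obtain ⟨hx, hxP⟩ := hx
    have := starHom_mem_of_sqrtElem_mem d δ hδ hxP
    rw [← coe_mem_idealLattice, coe_starHom, star_star] at this
    exact this
  refine le_antisymm key fun x hx => ?_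
  rw [mem_latticeConj]
  exact key (mem_latticeConj.2 (by rwa [star_star]))

theorem eq_of_ramified {P Q : Ideal (quadOrder d δ)} (hP : P.IsPrime) (hQ : Q.IsPrime) {p : ℕ}
    (hp : p.Prime) (hpP : (p : quadOrder d δ) ∈ P) (hpQ : (p : quadOrder d δ) ∈ Q)
    (hpd : (p : ℤ) ∣ d) : P = Q := by
  have key : ∀ P Q : Ideal (quadOrder d δ), P.IsPrime → Q.IsPrime → (p : quadOrder d δ) ∈ P →
      (p : quadOrder d δ) ∈ Q → P ≤ Q := by
    intro P Q hP hQ hpP hpQ x hx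
    obtain ⟨n, hn⟩ := exists_nm_eq d δ x.2
    have h1 : (n : quadOrder d δ) = starHom d δ x * x := by
      apply Subtype.ext
      have := nm_cast d δ (x : L)
      rw [hn] at this
      push_cast at this ⊢
      rw [coe_starHom, this, mul_comm]
    have h2 : (n : quadOrder d δ) ∈ P := by rw [h1]; exact P.mul_mem_left _ hx
    have h3 : (n : quadOrder d δ) ∈ Q :=
      (mem_iff_dvd d δ hQ hp hpQ).2 ((mem_iff_dvd d δ hP hp hpP).1 h2)
    rw [h1] at h3
    rcases hQ.mem_or_mem h3 with h4 | h4
    · have := starHom_mem_of_sqrtElem_mem d δ ((sqrtElem_mem_iff d δ hQ hp hpQ).2 hpd) h4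
      have e : starHom d δ (starHom d δ x) = x := Subtype.ext (by simp [coe_starHom])
      rwa [e] at this
    · exact h4
  exact le_antisymm (key P Q hP hQ hpP hpQ) (key Q P hQ hP hpQ hpP)

theorem exists_isPrime_mem {p : ℕ} (hp : p.Prime) :
    ∃ P : Ideal (quadOrder d δ), P.IsPrime ∧ (p : quadOrder d δ) ∈ P := by
  have hne : Ideal.span {(p : quadOrder d δ)} ≠ ⊤ := by
    intro htop
    rw [Ideal.span_singleton_eq_top] at htop
    obtain ⟨y, hy⟩ := htop.exists_right_inv
    have hp0 : (p : L) ≠ 0 := by exact_mod_cast hp.ne_zero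
    have h1 : (p : L) * y = 1 := by
      have := congrArg Subtype.val hy
      simpa using this
    have h2 : ((1 / p : ℚ) : L) ∈ quadOrder d δ := by
      have : ((1 / p : ℚ) : L) = y := by
        push_cast
        rw [← h1]; field_simp
      rw [this]; exact y.2
    obtain ⟨n, hn⟩ := (ratCast_mem_quadOrder d δ).1 h2
    have hp0' : (p : ℚ) ≠ 0 := by exact_mod_cast hp.ne_zero
    have h3 : (1 : ℤ) = n * p := by
      field_simp at hn
      exact_mod_cast hn.trans (mul_comm _ _)
    exact (Nat.prime_iff_prime_int.1 hp).not_dvd_one ⟨n, by rw [h3]; ring⟩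
  obtain ⟨P, hP, hle⟩ := Ideal.exists_le_maximal _ hne
  exact ⟨P, hP.isPrime, hle (Ideal.mem_span_singleton_self _)⟩

theorem isGoodIdeal_of_prime {P : Ideal (quadOrder d δ)} {p : ℕ} (hp : p.Prime)
    (hpf : ¬ p ∣ conductor (quadOrder d δ)) (hpP : (p : quadOrder d δ) ∈ P) : IsGoodIdeal P :=
  isGoodIdeal_of_coprime d δ (m := p) (by exact_mod_cast hp.ne_zero)
    (Nat.isCoprime_iff_coprime.2 ((Nat.Prime.coprime_iff_not_dvd hp).2 hpf)) (by simpa using hpP)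

theorem add_om_not_mem {p : ℕ} (hp : p.Prime) (s : ℤ) :
    ((s : L) + om d δ) ∉ (ℤ ∙ (p : L)) * Subalgebra.toSubmodule (quadOrder d δ) := by
  intro hmem
  obtain ⟨z, hz, hz'⟩ := Submodule.mem_span_singleton_mul.1 hmem
  obtain ⟨u, v, rfl⟩ := (mem_quadOrder_iff d δ).1 hz
  have h1 : ((p * u : ℤ) : L) + (p * v : ℤ) * om d δ = (s : ℤ) + (1 : ℤ) * om d δ := by
    push_cast
    linear_combination hz'
  have := (om_coord_inj d δ h1).2
  exact (Nat.prime_iff_prime_int.1 hp).not_dvd_one ⟨v, this.symm⟩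

/-- A prime ideal above a non-inert rational prime has norm `p`. -/
theorem prime_mul_conj {P : Ideal (quadOrder d δ)} (hP : P.IsPrime) {p : ℕ} (hp : p.Prime)
    (hpf : ¬ p ∣ conductor (quadOrder d δ)) (hpP : (p : quadOrder d δ) ∈ P)
    (hs : ∃ s : ℤ, (p : ℤ) ∣ s ^ 2 + d * s + omNorm d) :
    idealLattice P * latticeConj (idealLattice P) =
      (ℤ ∙ (p : L)) * Subalgebra.toSubmodule (quadOrder d δ) := by
  have hpz : Prime (p : ℤ) := Nat.prime_iff_prime_int.1 hp
  have hp0 : (p : L) ≠ 0 := by exact_mod_cast hp.ne_zero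
  obtain ⟨hinv, g, hg, hgP⟩ := isInvertible_of_coprime d δ (I := P) (m := p)
    (by exact_mod_cast hp.ne_zero)
    (Nat.isCoprime_iff_coprime.2 ((Nat.Prime.coprime_iff_not_dvd hp).2 hpf)) (by simpa using hpP)
  have hgmem : (g : L) ∈ idealLattice P * latticeConj (idealLattice P) := by
    rw [hgP]
    exact Submodule.mem_span_singleton_mul.2 ⟨1, one_mem (quadOrder d δ), mul_one _⟩
  have hleP : idealLattice P * latticeConj (idealLattice P) ≤ idealLattice P := by
    rw [Submodule.mul_le]
    intro x hx y hy
    rw [mul_comm]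
    refine mul_mem_of_toSubmodule_mul (toSubmodule_mul_idealLattice P) ?_ hx
    exact (star_mem_quadOrder_iff d δ).1 (idealLattice_le P (mem_latticeConj.1 hy))
  obtain ⟨n, rfl⟩ := (ratCast_mem_quadOrder d δ).1 (idealLattice_le P (hleP hgmem))
  have hpmem : (p : L) ∈ idealLattice P := by
    have := (coe_mem_idealLattice (I := P)).2 hpP
    simpa using this
  have hp2 : ((p : L) * p) ∈ idealLattice P * latticeConj (idealLattice P) :=
    Submodule.mul_mem_mul hpmem (mem_latticeConj.2 (by simpa using hpmem))
  rw [hgP] at hp2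
  obtain ⟨z, hz, hz'⟩ := Submodule.mem_span_singleton_mul.1 hp2
  have hn0 : (n : ℚ) ≠ 0 := hg.ne'
  have hnpos : 0 < n := by exact_mod_cast hg
  have hdvd : n ∣ (p : ℤ) ^ 2 := by
    have e : (((p : ℚ) ^ 2 / n : ℚ) : L) = z := by
      have : (n : L) ≠ 0 := by exact_mod_cast hn0
      push_cast at hz' ⊢
      field_simp
      linear_combination -hz'
    obtain ⟨k, hk⟩ := (ratCast_mem_quadOrder d δ).1 (by rw [e]; exact hz)
    refine ⟨k, ?_⟩
    field_simp at hk
    exact_mod_cast hk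
  obtain ⟨i, hi, hni⟩ := (dvd_prime_pow hpz 2).1 hdvd
  have hn : n = p ^ i := Int.eq_of_associated_of_nonneg hni hnpos.le (by positivity)
  interval_cases i
  · -- `i = 0`: the ideal would contain `1`
    exfalso
    rw [hn] at hgmem
    have h1 : ((1 : quadOrder d δ) : L) ∈ idealLattice P := by simpa using hleP hgmem
    exact hP.ne_top ((Ideal.eq_top_iff_one P).2 (coe_mem_idealLattice.1 h1))
  · rw [hgP, hn]; simp
  · -- `i = 2`: the prime would be inert
    exfalso
    have hPp : idealLattice P ≤ (ℤ ∙ (p : L)) * Subalgebra.toSubmodule (quadOrder d δ) := by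
      intro x hx
      have h1 : star x ∈ latticeConj (idealLattice P) := mem_latticeConj.2 (by rwa [star_star])
      have h2 := Submodule.mul_mem_mul hpmem h1
      rw [hgP, hn] at h2
      obtain ⟨y, hy, hy'⟩ := Submodule.mem_span_singleton_mul.1 h2
      refine Submodule.mem_span_singleton_mul.2 ⟨star y, star_mem_quadOrder d δ hy, ?_⟩
      have h3 : (p : L) * y = star x := by
        apply mul_left_cancel₀ hp0
        rw [← hy']; push_cast; ring
      have := congrArg star h3
      simpa using this
    obtain ⟨s, k, hk⟩ := hs
    let z : quadOrder d δ := ⟨(s : L) + om d δ, add_mem (intCast_mem _ s) (om_mem d δ)⟩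
    have hzz : z * starHom d δ z ∈ P := by
      have : z * starHom d δ z = ((p * k : ℤ) : quadOrder d δ) := by
        apply Subtype.ext
        rw [MulMemClass.coe_mul, coe_starHom, ← nm_cast d δ]
        have := nm_om_coord d δ s 1
        simp only [Int.cast_one, one_mul] at this
        change ((nm ((s : L) + om d δ) : ℚ) : L) = _
        rw [this, ← hk]
        push_cast
        ring
      rw [this]
      push_cast
      exact P.mul_mem_right _ hpP
    rcases hP.mem_or_mem hzz with h1 | h1
    · exact add_om_not_mem d δ hp s (hPp (coe_mem_idealLattice.2 h1))
    · have h2 := hPp (coe_mem_idealLattice.2 h1)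
      rw [coe_starHom] at h2
      obtain ⟨y, hy, hy'⟩ := Submodule.mem_span_singleton_mul.1 h2
      apply add_om_not_mem d δ hp s
      refine Submodule.mem_span_singleton_mul.2 ⟨star y, star_mem_quadOrder d δ hy, ?_⟩
      have := congrArg star hy'
      simpa using this

theorem exists_root_of_dvd {p : ℕ} (hp : p.Prime) (hpd : (p : ℤ) ∣ d) :
    ∃ s : ℤ, (p : ℤ) ∣ s ^ 2 + d * s + omNorm d := by
  have h4 := four_mul_omNorm d δ
  rcases hp.eq_two_or_odd' with rfl | hodd
  · refine ⟨omNorm d, ?_⟩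
    obtain ⟨k, hk⟩ := hpd
    obtain ⟨j, hj⟩ := Int.even_mul_succ_self (omNorm d)
    exact ⟨j + k * omNorm d, by push_cast at hk ⊢; linear_combination hj + omNorm d * hk⟩
  · refine ⟨0, ?_⟩
    have h1 : IsCoprime (p : ℤ) 4 := by
      have : IsCoprime (p : ℤ) (2 ^ 2 : ℤ) := by
        apply IsCoprime.pow_right
        exact_mod_cast Nat.isCoprime_iff_coprime.2 (Nat.coprime_two_right.2 hodd)
      simpa using this
    have h2 : (p : ℤ) ∣ 4 * omNorm d := by
      rw [h4]; exact dvd_sub (dvd_pow hpd (by norm_num)) hpd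
    simpa using h1.dvd_of_dvd_mul_left h2

/-- If `ℓ ∤ d` lies below a unique prime, it is inert. -/
theorem not_exists_root_of_inert {P : Ideal (quadOrder d δ)} (hP : P.IsPrime) {p : ℕ} (hp : p.Prime)
    (hpP : (p : quadOrder d δ) ∈ P) (hpd : ¬ (p : ℤ) ∣ d)
    (huniq : ∀ Q : Ideal (quadOrder d δ), Q.IsPrime → (p : quadOrder d δ) ∈ Q → Q = P) (s : ℤ) :
    ¬ (p : ℤ) ∣ s ^ 2 + d * s + omNorm d := by
  rintro ⟨k, hk⟩
  have hconj : conjIdeal d δ P = P := by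
    refine huniq _ (hP.comap _) ?_
    change starHom d δ p ∈ P
    simpa using hpP
  let z : quadOrder d δ := ⟨(s : L) + om d δ, add_mem (intCast_mem _ s) (om_mem d δ)⟩
  have hzz : z * starHom d δ z ∈ P := by
    have : z * starHom d δ z = ((p * k : ℤ) : quadOrder d δ) := by
      apply Subtype.ext
      rw [MulMemClass.coe_mul, coe_starHom, ← nm_cast d δ]
      have := nm_om_coord d δ s 1
      simp only [Int.cast_one, one_mul] at this
      change ((nm ((s : L) + om d δ) : ℚ) : L) = _
      rw [this, ← hk]
      push_cast
      ring
    rw [this]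
    push_cast
    exact P.mul_mem_right _ hpP
  have hboth : z ∈ P ∧ starHom d δ z ∈ P := by
    rcases hP.mem_or_mem hzz with h1 | h1
    · refine ⟨h1, ?_⟩
      rw [← hconj] at h1; exact h1
    · refine ⟨?_, h1⟩
      rw [← hconj]; exact h1
  have h2 : sqrtElem d δ ∈ P := by
    have : sqrtElem d δ = z - starHom d δ z := by
      apply Subtype.ext
      rw [AddSubgroupClass.coe_sub, coe_starHom]
      simp only [z, sqrtElem, star_add, star_om d δ, star_intCast]
      linear_combination sqrt_eq_om d δ
    rw [this]
    exact sub_mem hboth.1 hboth.2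
  exact hpd ((sqrtElem_mem_iff d δ hP hp hpP).1 h2)

end

noncomputable section

variable {L : Type*} [Field L] [CharZero L] [StarRing L]

variable (d : ℤ) (δ : L) [h : ImagQuad L d δ]

include h

/-! ### Factorization of ideals prime to the conductor -/

theorem isNoetherianRing_quadOrder : IsNoetherianRing (quadOrder d δ) :=
  isNoetherian_of_isNoetherianRing_of_finite ℤ (quadOrder d δ) |> fun _ =>
    isNoetherian_of_tower ℤ inferInstance

theorem IsGoodIdeal.dvd_of_le {I P : Ideal (quadOrder d δ)} (hP : IsGoodIdeal P) (hle : I ≤ P) :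
    P ∣ I := by
  have hmul : Subalgebra.toSubmodule (quadOrder d δ) *
      (latticeInv (quadOrder d δ) (idealLattice P) * idealLattice I) =
      latticeInv (quadOrder d δ) (idealLattice P) * idealLattice I := by
    rw [← mul_assoc, toSubmodule_mul_latticeInv]
  refine ⟨idealOfLattice _ hmul, idealLattice_injective ?_⟩
  rw [idealLattice_mul, idealLattice_idealOfLattice]
  · rw [← mul_assoc, hP.1.2, toSubmodule_mul_idealLattice]
  · rw [Submodule.mul_le]
    intro x hx y hy
    refine mem_latticeInv.1 hx y ?_
    obtain ⟨z, hz, rfl⟩ := hy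
    exact ⟨z, hle hz, rfl⟩

theorem IsGoodIdeal.mul_cancel {P I J : Ideal (quadOrder d δ)} (hP : IsGoodIdeal P)
    (hIJ : P * I = P * J) : I = J := by
  apply idealLattice_injective
  refine hP.1.mul_cancel (toSubmodule_mul_idealLattice I) (toSubmodule_mul_idealLattice J) ?_
  rw [← idealLattice_mul, hIJ, idealLattice_mul]

theorem IsGoodIdeal.of_mul_right {I J : Ideal (quadOrder d δ)} (hIJ : IsGoodIdeal (I * J)) :
    IsGoodIdeal J := hIJ.of_le d δ Ideal.mul_le_right

/-- Invertible ideals prime to the conductor are products of primes of the same kind. -/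
theorem IsGoodIdeal.induction {motive : Ideal (quadOrder d δ) → Prop} (top : motive ⊤)
    (mul : ∀ P b : Ideal (quadOrder d δ), P.IsPrime → IsGoodIdeal P → IsGoodIdeal b →
      motive b → motive (P * b)) {a : Ideal (quadOrder d δ)} (ha : IsGoodIdeal a) : motive a := by
  have := isNoetherianRing_quadOrder d δ
  induction a using IsWellFounded.induction (· > · : Ideal (quadOrder d δ) → _ → Prop) with
  | ind a ih =>
    by_cases htop : a = ⊤
    · rw [htop]; exact top
    · obtain ⟨P, hP, hle⟩ := Ideal.exists_le_maximal a htop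
      have hPg := ha.of_le d δ hle
      obtain ⟨b, rfl⟩ := hPg.dvd_of_le d δ hle
      have hb := ha.of_mul_right d δ
      refine mul P b hP.isPrime hPg hb (ih b (lt_of_le_of_ne Ideal.mul_le_right ?_) hb)
      intro heq
      apply hP.ne_top
      refine hb.mul_cancel d δ ?_
      rw [mul_comm, heq, Ideal.mul_top]

theorem IsGoodIdeal.isMaximal {P : Ideal (quadOrder d δ)} (hP : P.IsPrime) (hPg : IsGoodIdeal P) :
    P.IsMaximal := by
  obtain ⟨m, hm, -, hmP⟩ := hPg.exists_coprime d δ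
  exact isMaximal_of_isPrime d δ hP hm hmP

theorem isCoprime_of_ne {P Q : Ideal (quadOrder d δ)} (hP : P.IsMaximal) (hQ : Q.IsMaximal)
    (hne : P ≠ Q) : IsCoprime P Q := by
  rw [Ideal.isCoprime_iff_sup_eq]
  exact hP.coprime_of_ne hQ hne

theorem pow_dvd_mul_self {P b : Ideal (quadOrder d δ)} (hPg : IsGoodIdeal P) (k : ℕ) :
    P ^ (k + 1) ∣ P * b ↔ P ^ k ∣ b := by
  constructor
  · rintro ⟨c, hc⟩
    refine ⟨c, hPg.mul_cancel d δ ?_⟩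
    rw [hc, pow_succ]; ring
  · rintro ⟨c, rfl⟩
    exact ⟨c, by rw [pow_succ]; ring⟩

theorem pow_dvd_mul_of_ne {P Q b : Ideal (quadOrder d δ)} (hP : P.IsMaximal) (hQ : Q.IsMaximal)
    (hne : P ≠ Q) (k : ℕ) : P ^ k ∣ Q * b ↔ P ^ k ∣ b := by
  constructor
  · intro h1
    exact (isCoprime_of_ne d δ hP hQ hne).pow_left.dvd_of_dvd_mul_left h1
  · intro h1
    exact h1.mul_left Q

theorem finiteMultiplicity_good {P b : Ideal (quadOrder d δ)} (hP : P.IsPrime)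
    (hPg : IsGoodIdeal P) (hb : IsGoodIdeal b) : FiniteMultiplicity P b := by
  refine IsGoodIdeal.induction d δ (motive := fun b => FiniteMultiplicity P b) ?_ ?_ hb
  · refine ⟨0, ?_⟩
    rw [zero_add, pow_one]
    intro hdvd
    exact hP.ne_top (top_le_iff.1 (Ideal.le_of_dvd hdvd))
  · rintro Q b hQ hQg hb ⟨n, hn⟩
    by_cases hne : P = Q
    · subst hne
      exact ⟨n + 1, by rwa [pow_dvd_mul_self d δ hPg]⟩
    · exact ⟨n, by rwa [pow_dvd_mul_of_ne d δ (hPg.isMaximal d δ hP) (hQg.isMaximal d δ hQ) hne]⟩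

theorem multiplicity_mul_self {P b : Ideal (quadOrder d δ)} (hP : P.IsPrime)
    (hPg : IsGoodIdeal P) (hb : IsGoodIdeal b) :
    multiplicity P (P * b) = multiplicity P b + 1 := by
  have hf := finiteMultiplicity_good d δ hP hPg hb
  rw [(finiteMultiplicity_good d δ hP hPg (hPg.mul d δ hb)).multiplicity_eq_iff]
  rw [pow_dvd_mul_self d δ hPg, pow_dvd_mul_self d δ hPg]
  exact (hf.multiplicity_eq_iff).1 rfl

theorem multiplicity_mul_of_ne {P Q b : Ideal (quadOrder d δ)} (hP : P.IsPrime)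
    (hPg : IsGoodIdeal P) (hQ : Q.IsPrime) (hQg : IsGoodIdeal Q) (hb : IsGoodIdeal b)
    (hne : P ≠ Q) : multiplicity P (Q * b) = multiplicity P b := by
  have hf := finiteMultiplicity_good d δ hP hPg hb
  rw [(finiteMultiplicity_good d δ hP hPg (hQg.mul d δ hb)).multiplicity_eq_iff]
  rw [pow_dvd_mul_of_ne d δ (hPg.isMaximal d δ hP) (hQg.isMaximal d δ hQ) hne,
    pow_dvd_mul_of_ne d δ (hPg.isMaximal d δ hP) (hQg.isMaximal d δ hQ) hne]
  exact (hf.multiplicity_eq_iff).1 rfl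

theorem multiplicity_top {P : Ideal (quadOrder d δ)} (hP : P.IsPrime) :
    multiplicity P ⊤ = 0 := by
  apply multiplicity_eq_zero.2
  intro hdvd
  exact hP.ne_top (top_le_iff.1 (Ideal.le_of_dvd hdvd))

/-- Primes coprime to `√d` are prime to the conductor. -/
theorem isGoodIdeal_of_isCoprime {P : Ideal (quadOrder d δ)} (hP : P.IsPrime)
    (hc : IsCoprime P (sqrtIdeal d δ)) :
    IsGoodIdeal P ∧ ∃ p : ℕ, p.Prime ∧ (p : quadOrder d δ) ∈ P ∧ ¬ (p : ℤ) ∣ d := by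
  have hne : P ≠ ⊥ := by
    rintro rfl
    rw [Ideal.isCoprime_iff_sup_eq, bot_sup_eq, sqrtIdeal, Ideal.span_singleton_eq_top] at hc
    obtain ⟨y, hy⟩ := hc.exists_right_inv
    have h1 : δ * (y : L) = 1 := by
      have := congrArg Subtype.val hy
      simpa using this
    obtain ⟨n, hn⟩ := exists_nm_eq d δ y.2
    have h2 : nm (δ * (y : L)) = 1 := by
      rw [h1]; have := nm_ratCast d δ 1; simpa using this
    rw [nm_mul, nm_sqrt d δ, hn] at h2
    have h3 : -d * n = 1 := by exact_mod_cast h2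
    have hneg := h.neg
    have h4 : -d = 1 := by
      rcases Int.isUnit_iff.1 (IsUnit.of_mul_eq_one n h3) with h5 | h5 <;> omega
    have := h.mod4
    omega
  obtain ⟨m, hm, hmP⟩ := exists_int_mem d δ hne
  obtain ⟨p, hp, -, hpP⟩ := exists_prime_mem d δ hP hm hmP
  have hpd := (isCoprime_sqrtIdeal_iff d δ hP hp hpP).1 hc
  exact ⟨isGoodIdeal_of_prime d δ hp (fun hpf => hpd (dvd_of_dvd_conductor d δ hp hpf)) hpP,
    p, hp, hpP, hpd⟩

end

noncomputable section

/-! ### Genus characters and quadratic reciprocity -/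

section genus

open scoped NumberTheorySymbols

/-- The combination of characters modulo `8` that the prime `2` contributes to the Kronecker
symbol of the discriminant `-(2 ^ e * n)`, with `n` odd. -/
def twoPart (e n : ℕ) (x : ℤ) : ℤ :=
  (if n % 4 = 1 then ZMod.χ₄ (x : ZMod 4) else 1) * ZMod.χ₈ (x : ZMod 8) ^ e

theorem chi4_neg {m : ℤ} : ZMod.χ₄ ((-m : ℤ) : ZMod 4) = -ZMod.χ₄ (m : ZMod 4) := by
  rw [ZMod.χ₄_int_eq_if_mod_four, ZMod.χ₄_int_eq_if_mod_four]
  split_ifs <;> omega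

theorem chi8_neg {m : ℤ} : ZMod.χ₈ ((-m : ℤ) : ZMod 8) = ZMod.χ₈ (m : ZMod 8) := by
  rw [ZMod.χ₈_int_eq_if_mod_eight, ZMod.χ₈_int_eq_if_mod_eight]
  split_ifs <;> omega

theorem chi8_sq {m : ℤ} (hm : m % 2 = 1) : ZMod.χ₈ (m : ZMod 8) ^ 2 = 1 := by
  rw [ZMod.χ₈_int_eq_if_mod_eight]
  split_ifs
  · omega
  · rfl
  · rfl

/-- Quadratic reciprocity, in terms of the characters at `-m`. -/
theorem jacobiSym_disc {e n m : ℕ} (hn : Odd n) (hm : Odd m) :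
    jacobiSym (-(2 ^ e * n : ℕ)) m = -(twoPart e n (-m) * jacobiSym (-m) n) := by
  have h1 : jacobiSym (-(2 ^ e * n : ℕ)) m = ZMod.χ₄ (m : ZMod 4) * ZMod.χ₈ (m : ZMod 8) ^ e * jacobiSym n m := by
    rw [← jacobiSym.at_neg_one hm, ← jacobiSym.at_two hm, ← jacobiSym.pow_left, ← jacobiSym.mul_left,
      ← jacobiSym.mul_left]
    push_cast
    ring_nf
  have h2 : jacobiSym (-m) n = ZMod.χ₄ (n : ZMod 4) * jacobiSym m n := by
    rw [← jacobiSym.at_neg_one hn, ← jacobiSym.mul_left]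
    ring_nf
  have h3 : ZMod.χ₄ ((-m : ℤ) : ZMod 4) = -ZMod.χ₄ (m : ZMod 4) := by
    rw [chi4_neg]; simp
  have h4 : ZMod.χ₈ ((-m : ℤ) : ZMod 8) = ZMod.χ₈ (m : ZMod 8) := by
    rw [chi8_neg]; simp
  have hn4 : n % 4 = 1 ∨ n % 4 = 3 := by
    obtain ⟨k, rfl⟩ := hn; omega
  have hm4 : m % 4 = 1 ∨ m % 4 = 3 := by
    obtain ⟨k, rfl⟩ := hm; omega
  rw [h1, h2, twoPart, h3, h4]
  rcases hn4 with h5 | h5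
  · rw [if_pos h5, ZMod.χ₄_nat_one_mod_four h5, jacobiSym.quadratic_reciprocity_one_mod_four h5 hm]
    ring
  · rw [if_neg (by omega), ZMod.χ₄_nat_three_mod_four h5]
    rcases hm4 with h6 | h6
    · rw [ZMod.χ₄_nat_one_mod_four h6, ← jacobiSym.quadratic_reciprocity_one_mod_four h6 hn]
      ring
    · rw [ZMod.χ₄_nat_three_mod_four h6, jacobiSym.quadratic_reciprocity_three_mod_four h5 h6]
      ring

theorem jacobiSym_eq_one_of_primes {x : ℤ} {n : ℕ} (hn : n ≠ 0)
    (hx : ∀ p : ℕ, p.Prime → p ∣ n → jacobiSym x p = 1) : jacobiSym x n = 1 := by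
  induction n using Nat.recOnMul with
  | zero => exact absurd rfl hn
  | one => exact jacobiSym.one_right x
  | prime p hp => exact hx p hp dvd_rfl
  | mul a b iha ihb =>
    have ha := left_ne_zero_of_mul hn
    have hb := right_ne_zero_of_mul hn
    have : NeZero a := ⟨ha⟩
    have : NeZero b := ⟨hb⟩
    rw [jacobiSym.mul_right, iha ha fun p hp hpa => hx p hp (hpa.mul_right b),
      ihb hb fun p hp hpb => hx p hp (hpb.mul_left a), one_mul]

variable {d : ℤ} {ℓ q : ℕ}

theorem chi_eq_of_mem (hq : IsAuxiliaryPrime d ℓ q) {χ : ℤ → ℤ} (hχ : χ ∈ genusChars d)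
    (hne : (ℓ : ℤ) ∣ d → χ ≠ localChar d ℓ) : χ (jSq d ℓ q) = 1 := by
  unfold jSq
  split_ifs with hd
  · exact (hq.2.2.2 hd).1 χ ⟨hχ, hne hd⟩
  · exact hq.2.2.1 hd χ hχ

/-- The character of `p` differs from that of `ℓ`, because it vanishes at `p`. -/
theorem jacobiSym_jSq (hℓ : ℓ.Prime) (hq : IsAuxiliaryPrime d ℓ q) {p : ℕ} (hp : p.Prime)
    (hp2 : p ≠ 2) (hpd : (p : ℤ) ∣ d) (hpℓ : p ≠ ℓ) : jacobiSym (jSq d ℓ q) p = 1 := by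
  refine chi_eq_of_mem hq (χ := fun a => jacobiSym a p)
    (Or.inl (Or.inl (Or.inl ⟨p, hp, hp2, hpd, rfl⟩))) ?_
  intro hℓd heq
  have h1 : jacobiSym (p : ℤ) p = localChar d ℓ p := congrFun heq (p : ℤ)
  have : NeZero p := ⟨hp.ne_zero⟩
  have h0 : jacobiSym (p : ℤ) p = 0 := by
    rw [jacobiSym.eq_zero_iff_not_coprime]
    simpa using hp.one_lt.ne'
  rw [h0] at h1
  have hodd : (p : ℤ) % 2 = 1 := by
    have := hp.eq_two_or_odd; omega
  unfold localChar at h1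
  split_ifs at h1 with h2 h3 h4
  · have : NeZero ℓ := ⟨hℓ.ne_zero⟩
    have h5 := (jacobiSym.eq_zero_iff_not_coprime (a := (p : ℤ)) (b := ℓ)).1 h1.symm
    apply h5
    simpa using (Nat.coprime_primes hp hℓ).2 hpℓ
  · simp only [ZMod.χ₄_int_eq_if_mod_four] at h1
    split_ifs at h1 <;> omega
  · simp only [ZMod.χ₈_int_eq_if_mod_eight] at h1
    split_ifs at h1 <;> omega
  · simp only [ZMod.χ₄_int_eq_if_mod_four, ZMod.χ₈_int_eq_if_mod_eight] at h1
    split_ifs at h1 <;> omega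

theorem localChar_self_of_ne_two (hℓ2 : ℓ ≠ 2) (x : ℤ) : localChar d ℓ x = jacobiSym x ℓ := by
  unfold localChar; rw [if_pos hℓ2]

theorem ne_localChar (hℓ : ℓ.Prime) (hℓ2 : ℓ ≠ 2) {χ : ℤ → ℤ} (hχ : χ ℓ ≠ 0) : χ ≠ localChar d ℓ := by
  rintro rfl
  apply hχ
  have : NeZero ℓ := ⟨hℓ.ne_zero⟩
  rw [localChar_self_of_ne_two hℓ2, jacobiSym.eq_zero_iff_not_coprime]
  simpa using hℓ.one_lt.ne'

theorem two_chars_jSq (hℓ : ℓ.Prime) (hq : IsAuxiliaryPrime d ℓ q) (hℓ2 : (ℓ : ℤ) ∣ d → ℓ ≠ 2) :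
    ((d % 16 = 12 ∨ d % 32 = 16 ∨ d % 32 = 0) → ZMod.χ₄ ((jSq d ℓ q : ℤ) : ZMod 4) = 1) ∧
    ((d % 32 = 8 ∨ d % 32 = 0) → ZMod.χ₈ ((jSq d ℓ q : ℤ) : ZMod 8) = 1) ∧
    (d % 32 = 24 → ZMod.χ₄ ((jSq d ℓ q : ℤ) : ZMod 4) * ZMod.χ₈ ((jSq d ℓ q : ℤ) : ZMod 8) = 1) := by
  have hodd : (ℓ : ℤ) ∣ d → (ℓ : ℤ) % 2 = 1 := fun hd => by
    have := hℓ.eq_two_or_odd; have := hℓ2 hd; omega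
  refine ⟨fun h1 => ?_, fun h1 => ?_, fun h1 => ?_⟩
  · refine chi_eq_of_mem hq (χ := fun a : ℤ => ZMod.χ₄ (a : ZMod 4)) (Or.inl (Or.inl (Or.inr ⟨h1, rfl⟩)))
      fun hd => ne_localChar hℓ (hℓ2 hd) ?_
    have := hodd hd
    rw [ZMod.χ₄_int_eq_if_mod_four]
    split_ifs <;> omega
  · refine chi_eq_of_mem hq (χ := fun a : ℤ => ZMod.χ₈ (a : ZMod 8)) (Or.inl (Or.inr ⟨h1, rfl⟩))
      fun hd => ne_localChar hℓ (hℓ2 hd) ?_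
    have := hodd hd
    rw [ZMod.χ₈_int_eq_if_mod_eight]
    split_ifs <;> omega
  · refine chi_eq_of_mem hq (χ := fun a : ℤ => ZMod.χ₄ (a : ZMod 4) * ZMod.χ₈ (a : ZMod 8))
      (Or.inr ⟨h1, rfl⟩) fun hd => ne_localChar hℓ (hℓ2 hd) ?_
    have := hodd hd
    simp only [ZMod.χ₄_int_eq_if_mod_four, ZMod.χ₈_int_eq_if_mod_eight]
    split_ifs <;> omega

theorem localChar_jSq (hq : IsAuxiliaryPrime d ℓ q) (hd : (ℓ : ℤ) ∣ d) :
    localChar d ℓ (jSq d ℓ q) ≠ 1 := by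
  unfold jSq; rw [if_pos hd]; exact (hq.2.2.2 hd).2

theorem exists_two_pow_mul_odd (hneg : d < 0) : ∃ e n : ℕ, Odd n ∧ d = -(2 ^ e * n : ℕ) := by
  obtain ⟨e, n, hn, he⟩ := Nat.exists_eq_two_pow_mul_odd (n := d.natAbs) (by omega)
  exact ⟨e, n, hn, by rw [← he]; omega⟩

/-- The contribution of the prime `2` is trivial where the genus characters are. -/
theorem twoPart_eq_one {e n : ℕ} (hn : Odd n) (hd : d = -(2 ^ e * n : ℕ)) (hd4 : d % 4 = 0 ∨ d % 4 = 1)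
    {x : ℤ} (hx : x % 2 = 1)
    (h4 : (d % 16 = 12 ∨ d % 32 = 16 ∨ d % 32 = 0) → ZMod.χ₄ (x : ZMod 4) = 1)
    (h8 : (d % 32 = 8 ∨ d % 32 = 0) → ZMod.χ₈ (x : ZMod 8) = 1)
    (h48 : d % 32 = 24 → ZMod.χ₄ (x : ZMod 4) * ZMod.χ₈ (x : ZMod 8) = 1) :
    twoPart e n x = 1 := by
  have hsq := chi8_sq hx
  obtain ⟨k, hk⟩ := hn
  unfold twoPart
  rcases e with _ | _ | _ | _ | _ | e
  · rw [if_neg (by omega)]; simp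
  · omega
  · split_ifs with hn4
    · rw [h4 (by left; omega)]; simpa using hsq
    · simpa using hsq
  · have e3 : ZMod.χ₈ (x : ZMod 8) ^ (0 + 1 + 1 + 1) = ZMod.χ₈ (x : ZMod 8) := by
      have : (0 + 1 + 1 + 1 : ℕ) = 2 + 1 := rfl
      rw [this, pow_succ, hsq, one_mul]
    rw [e3]
    split_ifs with hn4
    · exact h48 (by omega)
    · rw [one_mul]; exact h8 (by omega)
  · have e4 : ZMod.χ₈ (x : ZMod 8) ^ (0 + 1 + 1 + 1 + 1) = 1 := by
      have : (0 + 1 + 1 + 1 + 1 : ℕ) = 2 * 2 := rfl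
      rw [this, pow_mul, hsq, one_pow]
    rw [e4, mul_one]
    split_ifs with hn4
    · exact h4 (by omega)
    · rfl
  · have h32 : d % 32 = 0 := by
      have : d = 32 * (-(2 ^ e * n : ℕ)) := by rw [hd]; push_cast; ring
      omega
    rw [h8 (Or.inr h32), one_pow, h4 (Or.inr (Or.inr h32))]
    simp

/-- For a ramified `2` prime to the conductor the contribution of `2` is the component of the genus
characters at `2`. -/
theorem twoPart_eq_localChar {e n : ℕ} (hn : Odd n) (hd : d = -(2 ^ e * n : ℕ))
    (hreg : d % 16 = 12 ∨ d % 32 = 8 ∨ d % 32 = 24) {x : ℤ} (hx : x % 2 = 1) :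
    twoPart e n x = localChar d 2 x := by
  have hsq := chi8_sq hx
  obtain ⟨k, hk⟩ := hn
  unfold twoPart localChar
  simp only [ne_eq, not_true_eq_false, if_false]
  rcases e with _ | _ | _ | _ | e
  · omega
  · omega
  · rw [if_pos (by omega), if_pos (by omega)]
    change _ * ZMod.χ₈ (x : ZMod 8) ^ 2 = _
    rw [hsq, mul_one]
  · have e3 : ZMod.χ₈ (x : ZMod 8) ^ (0 + 1 + 1 + 1) = ZMod.χ₈ (x : ZMod 8) := by
      have : (0 + 1 + 1 + 1 : ℕ) = 2 + 1 := rfl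
      rw [this, pow_succ, hsq, one_mul]
    rw [e3, if_neg (show ¬ d % 16 = 12 by omega)]
    by_cases hn4 : n % 4 = 1
    · rw [if_pos hn4, if_neg (show ¬ d % 32 = 8 by omega)]
    · rw [if_neg hn4, if_pos (show d % 32 = 8 by omega), one_mul]
  · have : d = 16 * (-(2 ^ e * n : ℕ)) := by rw [hd]; push_cast; ring
    omega

/-- An odd prime `p` not dividing `d` splits if and only if `d` is a square modulo `p`, by completing the
square in `s² + d s + N(ω)`. -/
theorem exists_root_of_jacobiSym {p : ℕ} (hp : p.Prime) (hp2 : p ≠ 2)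
    (h4 : 4 * omNorm d = d ^ 2 - d) (hpd : ¬ (p : ℤ) ∣ d) :
    jacobiSym d p = 1 ↔ ∃ s : ℤ, (p : ℤ) ∣ s ^ 2 + d * s + omNorm d := by
  have : Fact p.Prime := ⟨hp⟩
  have hpz : Prime (p : ℤ) := Nat.prime_iff_prime_int.1 hp
  have hodd : Odd p := hp.odd_of_ne_two hp2
  rw [← jacobiSym.legendreSym.to_jacobiSym]
  have hd0 : ((d : ℤ) : ZMod p) ≠ 0 := by
    rwa [Ne, ZMod.intCast_zmod_eq_zero_iff_dvd]
  rw [legendreSym.eq_one_iff p hd0]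
  have hc4 : IsCoprime (p : ℤ) 4 := by
    have : IsCoprime (p : ℤ) (2 ^ 2 : ℤ) := by
      apply IsCoprime.pow_right
      exact_mod_cast Nat.isCoprime_iff_coprime.2 (Nat.coprime_two_right.2 hodd)
    simpa using this
  constructor
  · rintro ⟨r, hr⟩
    obtain ⟨r, rfl⟩ := ZMod.intCast_surjective r
    have h1 : (p : ℤ) ∣ r ^ 2 - d := by
      rw [← ZMod.intCast_zmod_eq_zero_iff_dvd]
      push_cast
      rw [hr]; ring
    -- `2 s + d ≡ r`
    obtain ⟨k, hk⟩ := hodd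
    refine ⟨(r - d) * (k + 1), hc4.dvd_of_dvd_mul_left ?_⟩
    obtain ⟨j, hj⟩ := h1
    refine ⟨j + (r - d) * (2 * r + (r - d) * p), ?_⟩
    have hk' : (p : ℤ) = 2 * k + 1 := by exact_mod_cast hk
    have e1 : 4 * (((r - d) * (k + 1)) ^ 2 + d * ((r - d) * (k + 1)) + omNorm d) =
      (2 * (r - d) * (k + 1) + d) ^ 2 - d := by linear_combination h4
    rw [e1]
    have e2 : 2 * (r - d) * (k + 1) + d = r + (r - d) * p := by rw [hk']; ring
    rw [e2]
    linear_combination hj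
  · rintro ⟨s, k, hk⟩
    refine ⟨((2 * s + d : ℤ) : ZMod p), ?_⟩
    have h1 : d = (2 * s + d) * (2 * s + d) - p * (4 * k) := by
      linear_combination h4 - 4 * hk
    have h2 := congrArg (Int.cast (R := ZMod p)) h1
    rw [h2]
    push_cast
    simp

theorem jacobiSym_ne_one {x : ℤ} {p : ℕ} (hp : p.Prime) (hx : ¬ (p : ℤ) ∣ x)
    (h1 : jacobiSym x p ≠ 1) : jacobiSym x p = -1 := by
  rcases jacobiSym.trichotomy x p with h2 | h2 | h2
  · exfalso
    have : NeZero p := ⟨hp.ne_zero⟩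
    apply (jacobiSym.eq_zero_iff_not_coprime.1 h2)
    rw [Int.gcd_comm]
    exact Int.isCoprime_iff_gcd_eq_one.1 ((isCoprime_prime_iff hp).2 hx).symm
  · exact absurd h2 h1
  · exact h2

/-- For `d` odd, the prime `2` has a root if `d` is `1` modulo `8`. -/
theorem exists_root_two {n : ℕ} (hd : d = -(n : ℕ)) (h4 : 4 * omNorm d = d ^ 2 - d)
    (h7 : n % 8 = 7) : ∃ s : ℤ, ((2 : ℕ) : ℤ) ∣ s ^ 2 + d * s + omNorm d := by
  refine ⟨0, ?_⟩
  have hk : d = 8 * (d / 8) + 1 := by omega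
  generalize d / 8 = k at hk
  refine ⟨(8 * k + 1) * k, ?_⟩
  have : omNorm d = 2 * ((8 * k + 1) * k) := by
    have : 4 * omNorm d = 4 * (2 * ((8 * k + 1) * k)) := by rw [h4, hk]; ring
    omega
  rw [this]; push_cast; ring

theorem exponent_eq_zero {e n : ℕ} (hd : d = -(2 ^ e * n : ℕ)) (h2 : ¬ (2 : ℤ) ∣ d) : e = 0 := by
  by_contra he
  apply h2
  obtain ⟨e', rfl⟩ := Nat.exists_eq_succ_of_ne_zero he
  rw [hd]
  exact ⟨-(2 ^ e' * n : ℕ), by push_cast; rw [pow_succ]; ring⟩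

theorem mod_eight_of_chi8 {n : ℕ} (hd : d = -(n : ℕ)) (hd4 : d % 4 = 0 ∨ d % 4 = 1)
    (hn : Odd n) (h1 : ZMod.χ₈ (n : ZMod 8) = 1) : n % 8 = 7 := by
  have := Nat.odd_iff.1 hn
  rw [ZMod.χ₈_nat_eq_if_mod_eight] at h1
  split_ifs at h1 with h2 h3 <;> omega

/-- The auxiliary prime splits in the quadratic order. -/
theorem IsAuxiliaryPrime.exists_root (hq : IsAuxiliaryPrime d ℓ q) (hneg : d < 0)
    (hd4 : d % 4 = 0 ∨ d % 4 = 1) (h4 : 4 * omNorm d = d ^ 2 - d) (hℓ : ℓ.Prime)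
    (hinert : ¬ (ℓ : ℤ) ∣ d → ∀ s : ℤ, ¬ (ℓ : ℤ) ∣ s ^ 2 + d * s + omNorm d)
    (hreg : (ℓ : ℤ) ∣ d → ¬ ∃ d' : ℤ, d = (ℓ : ℤ) ^ 2 * d' ∧ (d' % 4 = 0 ∨ d' % 4 = 1)) :
    ∃ s : ℤ, (q : ℤ) ∣ s ^ 2 + d * s + omNorm d := by
  have hqp := hq.1
  have hqd := hq.2.1
  obtain ⟨e, n, hn, hd⟩ := exists_two_pow_mul_odd hneg
  have hn0 : n ≠ 0 := by rintro rfl; simp at hn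
  have hpn : ∀ p : ℕ, p.Prime → p ∣ n → p ≠ 2 ∧ (p : ℤ) ∣ d := by
    intro p hp hpn
    refine ⟨?_, ?_⟩
    · rintro rfl
      obtain ⟨k, hk⟩ := hn
      omega
    · rw [hd, dvd_neg]; exact_mod_cast hpn.mul_left _
  have hoddsub : ∀ p : ℕ, p.Prime → p ≠ 2 → p % 2 = 1 := fun p hp h2 => by
    have := hp.eq_two_or_odd; omega
  by_cases hℓd : (ℓ : ℤ) ∣ d
  · have hc : jSq d ℓ q = -q := by unfold jSq; rw [if_pos hℓd]
    by_cases hℓ2 : ℓ = 2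
    -- `-q` is a square modulo the odd primes dividing `d`, and its character at `2` is `-1`
    · subst hℓ2
      have hq2 : q ≠ 2 := by rintro rfl; exact hqd hℓd
      have hqodd := hoddsub q hqp hq2
      have hr : d % 16 = 12 ∨ d % 32 = 8 ∨ d % 32 = 24 := by
        by_contra hne
        apply hreg hℓd
        refine ⟨d / 4, ?_, ?_⟩ <;> push_cast at * <;> omega
      have hx : (-(q : ℤ)) % 2 = 1 := by omega
      have h1 : jacobiSym (-(q : ℤ)) n = 1 := by
        refine jacobiSym_eq_one_of_primes hn0 fun p hp hpn' => ?_
        rw [← hc]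
        exact jacobiSym_jSq hℓ hq hp (hpn p hp hpn').1 (hpn p hp hpn').2 (hpn p hp hpn').1
      have h2 := localChar_jSq hq hℓd
      rw [hc, ← twoPart_eq_localChar hn hd hr hx] at h2
      have h3 := jacobiSym_disc (e := e) hn (Nat.odd_iff.2 hqodd)
      rw [← hd, h1, mul_one] at h3
      rw [← exists_root_of_jacobiSym hqp hq2 h4 hqd]
      by_contra h5
      rw [jacobiSym_ne_one hqp hqd h5] at h3
      omega
    -- `-q` is a square modulo the odd primes dividing `d` other than `ℓ`, and not modulo `ℓ`
    · have hℓodd := hoddsub ℓ hℓ hℓ2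
      have hℓn : ℓ ∣ n := by
        rw [hd, dvd_neg] at hℓd
        have h1 : ℓ ∣ 2 ^ e * n := by exact_mod_cast hℓd
        refine (Nat.Coprime.dvd_mul_left ?_).1 h1
        exact ((Nat.coprime_primes hℓ Nat.prime_two).2 hℓ2).pow_right e
      obtain ⟨n', rfl⟩ := hℓn
      have hn'0 : n' ≠ 0 := right_ne_zero_of_mul hn0
      have hℓn' : ¬ ℓ ∣ n' := by
        rintro ⟨k, rfl⟩
        apply hreg hℓd
        refine ⟨-(2 ^ e * k : ℕ), by rw [hd]; push_cast; ring, ?_⟩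
        obtain ⟨j, hj⟩ : ∃ j : ℕ, ℓ = 2 * j + 1 := ⟨ℓ / 2, by omega⟩
        have : d = (-(2 ^ e * k : ℕ)) + 4 * ((j ^ 2 + j) * (-(2 ^ e * k : ℕ))) := by
          rw [hd, hj]; push_cast; ring
        omega
      have : NeZero ℓ := ⟨hℓ.ne_zero⟩
      have : NeZero n' := ⟨hn'0⟩
      have hqℓ : ¬ (ℓ : ℤ) ∣ -(q : ℤ) := by
        rw [dvd_neg]
        intro h1
        have h2 : ℓ ∣ q := by exact_mod_cast h1
        rw [(Nat.prime_dvd_prime_iff_eq hℓ hqp).1 h2] at hℓd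
        exact hqd hℓd
      have h1 : jacobiSym (-(q : ℤ)) (ℓ * n') = -1 := by
        rw [jacobiSym.mul_right, jacobiSym_eq_one_of_primes (n := n') hn'0, mul_one]
        · apply jacobiSym_ne_one hℓ hqℓ
          have := localChar_jSq hq hℓd
          rwa [hc, localChar_self_of_ne_two hℓ2] at this
        · intro p hp hpn'
          rw [← hc]
          have h2 := hpn p hp (hpn'.mul_left ℓ)
          refine jacobiSym_jSq hℓ hq hp h2.1 h2.2 ?_
          rintro rfl
          exact hℓn' hpn'
      by_cases hq2 : q = 2
      · subst hq2
        have he := exponent_eq_zero hd (by exact_mod_cast hqd)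
        have hdn := hd
        rw [he, pow_zero, one_mul] at hdn
        refine exists_root_two hdn h4 (mod_eight_of_chi8 hdn hd4 hn ?_)
        have h3 : jacobiSym (-((2 : ℕ) : ℤ)) (ℓ * n') = ZMod.χ₄ ((ℓ * n' : ℕ) : ZMod 4) * ZMod.χ₈ ((ℓ * n' : ℕ) : ZMod 8) := by
          rw [← jacobiSym.at_neg_one hn, ← jacobiSym.at_two hn, ← jacobiSym.mul_left]
          norm_num
        rw [h3] at h1
        subst he
        have h5 : (ℓ * n') % 4 = 3 := by
          simp at hd
          have : d = -((ℓ * n' : ℕ) : ℤ) := by rw [hd]; push_cast; ring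
          have := Nat.odd_iff.1 hn
          omega
        rw [ZMod.χ₄_nat_three_mod_four h5] at h1
        linarith
      · have hqodd := hoddsub q hqp hq2
        have h2 := two_chars_jSq hℓ hq (fun _ => hℓ2)
        rw [hc] at h2
        have h3 := jacobiSym_disc (e := e) hn (Nat.odd_iff.2 hqodd)
        rw [← hd, h1, twoPart_eq_one hn hd hd4 (by omega) h2.1 h2.2.1 h2.2.2] at h3
        rw [← exists_root_of_jacobiSym hqp hq2 h4 hqd, h3]
        rfl
  · have hc : jSq d ℓ q = -(ℓ * q) := by unfold jSq; rw [if_neg hℓd]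
    have hin := hinert hℓd
    have h1 : jacobiSym (-(ℓ * q : ℤ)) n = 1 := by
      refine jacobiSym_eq_one_of_primes hn0 fun p hp hpn' => ?_
      rw [← hc]
      refine jacobiSym_jSq hℓ hq hp (hpn p hp hpn').1 (hpn p hp hpn').2 ?_
      rintro rfl
      exact hℓd (hpn p hp hpn').2
    -- now `ℓ` is inert, so that the symbol of `d` modulo `ℓ` cancels the sign of `-ℓ q`
    by_cases hℓ2 : ℓ = 2
    · subst hℓ2
      have he := exponent_eq_zero hd (by exact_mod_cast hℓd)
      -- inertness of `2` means that `-n` is `5` modulo `8`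
      have hn8 : n % 8 = 3 := by
        have h5 : ¬ n % 8 = 7 := fun h7 => by
          obtain ⟨s, hs⟩ := exists_root_two (by rw [hd, he]; simp) h4 h7
          exact hin s hs
        subst he
        simp at hd
        omega
      by_cases hq2 : q = 2
      -- `-4` would be a square modulo all primes dividing `n`, but `n` is `3` modulo `4`
      · exfalso
        subst hq2
        have h3 : jacobiSym (-(((2 : ℕ) : ℤ) * ((2 : ℕ) : ℤ))) n = ZMod.χ₄ (n : ZMod 4) * (ZMod.χ₈ (n : ZMod 8) * ZMod.χ₈ (n : ZMod 8)) := by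
          rw [← jacobiSym.at_neg_one hn, ← jacobiSym.at_two hn, ← jacobiSym.mul_left, ← jacobiSym.mul_left]
          norm_num
        rw [h3, ZMod.χ₄_nat_three_mod_four (by omega)] at h1
        nlinarith [mul_self_nonneg (ZMod.χ₈ (n : ZMod 8))]
      · have hqodd := hoddsub q hqp hq2
        have h3 : jacobiSym (-(((2 : ℕ) : ℤ) * (q : ℤ))) n = ZMod.χ₈ (n : ZMod 8) * jacobiSym (-(q : ℤ)) n := by
          rw [← jacobiSym.at_two hn, ← jacobiSym.mul_left]
          ring_nf
        have h5 : ZMod.χ₈ (n : ZMod 8) = -1 := by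
          rw [ZMod.χ₈_nat_eq_if_mod_eight, if_neg (by omega), if_neg (by omega)]
        rw [h3, h5] at h1
        have h6 := jacobiSym_disc (e := e) hn (Nat.odd_iff.2 hqodd)
        have h7 : twoPart e n (-q) = 1 := by
          unfold twoPart; rw [if_neg (by omega), he]; simp
        rw [← hd, h7] at h6
        rw [← exists_root_of_jacobiSym hqp hq2 h4 hqd, h6]
        linarith
    · have hℓodd := hoddsub ℓ hℓ hℓ2
      have h2 : jacobiSym d ℓ = -1 := by
        refine jacobiSym_ne_one hℓ hℓd fun h2 => ?_
        obtain ⟨s, hs⟩ := (exists_root_of_jacobiSym hℓ hℓ2 h4 hℓd).1 h2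
        exact hin s hs
      by_cases hq2 : q = 2
      · subst hq2
        have he := exponent_eq_zero hd (by exact_mod_cast hqd)
        have hdn := hd
        rw [he, pow_zero, one_mul] at hdn
        refine exists_root_two hdn h4 (mod_eight_of_chi8 hdn hd4 hn ?_)
        have h3 : jacobiSym (-((ℓ : ℤ) * ((2 : ℕ) : ℤ))) n = ZMod.χ₈ (n : ZMod 8) * jacobiSym (-(ℓ : ℤ)) n := by
          rw [← jacobiSym.at_two hn, ← jacobiSym.mul_left]
          ring_nf
        have h6 := jacobiSym_disc (e := e) hn (Nat.odd_iff.2 hℓodd)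
        have h7 : twoPart e n (-ℓ) = 1 := by
          unfold twoPart
          rw [if_neg (by subst he; simp at hd; omega), he]; simp
        rw [← hd, h7, h2] at h6
        have h8 : jacobiSym (-(ℓ : ℤ)) n = 1 := by linarith
        rw [h3, h8] at h1
        linarith
      · have hqodd := hoddsub q hqp hq2
        have hm : Odd (ℓ * q) := (Nat.odd_iff.2 hℓodd).mul (Nat.odd_iff.2 hqodd)
        have h5 := two_chars_jSq hℓ hq (fun hd' => absurd hd' hℓd)
        rw [hc] at h5
        have h6 := jacobiSym_disc (e := e) hn hm
        have : NeZero ℓ := ⟨hℓ.ne_zero⟩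
        have : NeZero q := ⟨hqp.ne_zero⟩
        have hmodd := Nat.odd_iff.1 hm
        have hcast : ((ℓ * q : ℕ) : ℤ) = (ℓ : ℤ) * q := by push_cast; ring
        rw [← hd, jacobiSym.mul_right, h2, hcast, h1,
          twoPart_eq_one hn hd hd4 (by rw [← hcast]; omega) h5.1 h5.2.1 h5.2.2] at h6
        rw [← exists_root_of_jacobiSym hqp hq2 h4 hqd]
        linarith

end genus

end

noncomputable section

variable {L : Type*} [Field L] [CharZero L] [StarRing L]

/-! ### Elements of the quaternion algebra -/

section quat

variable {c : ℤ}

theorem exists_quat (x : quatAlg L c) : ∃ α β : L, x = quat c α β := by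
  obtain ⟨_, α, β, rfl⟩ := x
  exact ⟨α, β, rfl⟩

theorem quat_inj {α β α' β' : L} : quat c α β = quat c α' β' ↔ α = α' ∧ β = β' := by
  constructor
  · intro h
    have h1 := congrArg Subtype.val h
    exact ⟨congrFun (congrFun h1 0) 0, congrFun (congrFun h1 0) 1⟩
  · rintro ⟨rfl, rfl⟩; rfl

theorem quat_add (α β α' β' : L) : quat c α β + quat c α' β' = quat c (α + α') (β + β') := by
  apply Subtype.ext
  ext i j
  fin_cases i <;> fin_cases j <;> simp [quat, mul_add]

theorem quat_mul (α β α' β' : L) : quat c α β * quat c α' β' =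
    quat c (α * α' + c * β * star β') (α * β' + β * star α') := by
  apply Subtype.ext
  ext i j
  fin_cases i <;> fin_cases j <;> simp [quat, star_intCast] <;> ring

theorem quat_zero : quat c (0 : L) 0 = 0 := by
  apply Subtype.ext
  ext i j
  fin_cases i <;> fin_cases j <;> simp [quat]

theorem quat_one : quat c (1 : L) 0 = 1 := by
  apply Subtype.ext
  ext i j
  fin_cases i <;> fin_cases j <;> simp [quat]

theorem emb_eq (x : L) : emb c x = quat c x 0 := rfl

theorem quat_zsmul (n : ℤ) (α β : L) : n • quat c α β = quat c (n * α) (n * β) := by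
  apply Subtype.ext
  change n • !![α, β; (c : L) * star β, star α] = !![n * α, n * β; (c : L) * star (n * β), star (n * α)]
  ext i j
  fin_cases i <;> fin_cases j <;> simp [star_intCast]; ring

theorem quat_qsmul (r : ℚ) (α β : L) : r • quat c α β = quat c (r * α) (r * β) := by
  apply Subtype.ext
  change r • !![α, β; (c : L) * star β, star α] = !![r * α, r * β; (c : L) * star (r * β), star (r * α)]
  ext i j
  fin_cases i <;> fin_cases j <;> simp [Algebra.smul_def]; ring

theorem zsmul_val_apply (n : ℤ) (x : quatAlg L c) (i j : Fin 2) :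
    (n • x).1 i j = n * x.1 i j := by
  change (n • x.1) i j = _
  rw [Matrix.smul_apply, zsmul_eq_mul]

theorem redTrace_quat (α β : L) : redTrace (quat c α β) = tr α := rfl

end quat

/-! ### The setting -/

section setting

variable (d : ℤ) (δ : L) [h : ImagQuad L d δ]

/-- The standing hypotheses: `ℓ` is a prime that neither divides the conductor nor splits, `𝔩` is
the prime above `ℓ`, `q` is an auxiliary prime and `𝔮` is a prime above `q`. -/
structure Setting (ℓ q : ℕ) (𝔩 𝔮 : Ideal (quadOrder d δ)) : Prop where
  prime_ell : ℓ.Prime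
  ell_not_dvd : ¬ ℓ ∣ conductor (quadOrder d δ)
  isPrime_l : 𝔩.IsPrime
  ell_mem : (ℓ : quadOrder d δ) ∈ 𝔩
  nonsplit : ∀ 𝔭 : Ideal (quadOrder d δ), 𝔭.IsPrime → (ℓ : quadOrder d δ) ∈ 𝔭 → 𝔭 = 𝔩
  aux : IsAuxiliaryPrime d ℓ q
  isPrime_q : 𝔮.IsPrime
  q_mem : (q : quadOrder d δ) ∈ 𝔮

variable {d δ} {ℓ q : ℕ} {𝔩 𝔮 : Ideal (quadOrder d δ)}

namespace Setting

variable (S : Setting d δ ℓ q 𝔩 𝔮)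

include S h

theorem prime_q : q.Prime := S.aux.1

theorem q_not_dvd : ¬ (q : ℤ) ∣ d := S.aux.2.1

theorem ell_inert (hd : ¬ (ℓ : ℤ) ∣ d) (s : ℤ) : ¬ (ℓ : ℤ) ∣ s ^ 2 + d * s + omNorm d :=
  not_exists_root_of_inert d δ S.isPrime_l S.prime_ell S.ell_mem hd S.nonsplit s

theorem exists_root_q : ∃ s : ℤ, (q : ℤ) ∣ s ^ 2 + d * s + omNorm d :=
  S.aux.exists_root h.neg h.mod4 (four_mul_omNorm d δ) S.prime_ell S.ell_inert
    fun _ h1 => S.ell_not_dvd ((prime_dvd_conductor_iff d δ S.prime_ell).2 h1)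

theorem q_not_dvd_conductor : ¬ q ∣ conductor (quadOrder d δ) := fun h1 =>
  S.q_not_dvd (dvd_of_dvd_conductor d δ S.prime_q h1)

theorem q_ne_ell : q ≠ ℓ := by
  rintro rfl
  obtain ⟨s, hs⟩ := S.exists_root_q
  exact S.ell_inert S.q_not_dvd s hs

theorem good_q : IsGoodIdeal 𝔮 := isGoodIdeal_of_prime d δ S.prime_q S.q_not_dvd_conductor S.q_mem

theorem good_l : IsGoodIdeal 𝔩 := isGoodIdeal_of_prime d δ S.prime_ell S.ell_not_dvd S.ell_mem

theorem q_mul_conj : idealLattice 𝔮 * latticeConj (idealLattice 𝔮) =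
    (ℤ ∙ (q : L)) * Subalgebra.toSubmodule (quadOrder d δ) :=
  prime_mul_conj d δ S.isPrime_q S.prime_q S.q_not_dvd_conductor S.q_mem S.exists_root_q

theorem l_mul_conj (hd : (ℓ : ℤ) ∣ d) : idealLattice 𝔩 * latticeConj (idealLattice 𝔩) =
    (ℤ ∙ (ℓ : L)) * Subalgebra.toSubmodule (quadOrder d δ) :=
  prime_mul_conj d δ S.isPrime_l S.prime_ell S.ell_not_dvd S.ell_mem
    (exists_root_of_dvd d δ S.prime_ell hd)

theorem jSq_neg : jSq d ℓ q < 0 := by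
  have h1 := S.prime_ell.pos
  have h2 := S.prime_q.pos
  unfold jSq
  split_ifs
  · simpa using h2
  · have : 0 < (ℓ : ℤ) * q := by positivity
    linarith

theorem normModulus_neg : normModulus d ℓ < 0 := by
  have h1 := S.prime_ell.pos
  unfold normModulus
  split_ifs with hd
  · obtain ⟨k, hk⟩ := hd
    rw [hk, Int.mul_ediv_cancel_left _ (by positivity)]
    have := h.neg
    rw [hk] at this
    exact neg_of_mul_neg_right this (by positivity)
  · exact h.neg

theorem normModulus_dvd : normModulus d ℓ ∣ d := by
  unfold normModulus
  split_ifs with hd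
  · exact Int.ediv_dvd_of_dvd hd
  · exact dvd_rfl

theorem q_dvd_jSq : (q : ℤ) ∣ jSq d ℓ q := by
  unfold jSq
  split_ifs
  · simp
  · simp

theorem isCoprime_q_disc : IsCoprime (q : ℤ) d :=
  ((isCoprime_prime_iff S.prime_q).2 S.q_not_dvd).symm

theorem isCoprime_q_normModulus : IsCoprime (q : ℤ) (normModulus d ℓ) :=
  S.isCoprime_q_disc.of_isCoprime_of_dvd_right S.normModulus_dvd

/-- `c d = ± ℓ D q`, the arithmetic behind the discriminant of `R(𝔞, λ)`. -/
theorem jSq_mul_disc : (jSq d ℓ q * d) ^ 2 = (ℓ * (normModulus d ℓ * q)) ^ 2 := by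
  have h1 := S.prime_ell.pos
  unfold jSq normModulus
  split_ifs with hd
  · obtain ⟨k, hk⟩ := hd
    rw [hk, Int.mul_ediv_cancel_left _ (by positivity)]
    ring
  · ring

end Setting

variable (d δ)
include h

theorem idealLattice_sqrtIdeal : idealLattice (sqrtIdeal d δ) =
    (ℤ ∙ δ) * Subalgebra.toSubmodule (quadOrder d δ) := by
  ext x
  rw [mem_idealLattice, Submodule.mem_span_singleton_mul]
  constructor
  · rintro ⟨hx, h1⟩
    obtain ⟨y, hy⟩ := Ideal.mem_span_singleton'.1 h1
    refine ⟨y, y.2, ?_⟩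
    have := congrArg Subtype.val hy
    simp at this
    rw [← this, mul_comm]
  · rintro ⟨y, hy, rfl⟩
    refine ⟨mul_mem (sqrt_mem_quadOrder d δ) hy, ?_⟩
    refine Ideal.mem_span_singleton'.2 ⟨⟨y, hy⟩, ?_⟩
    apply Subtype.ext
    simp [mul_comm]

theorem latticeInv_span_mul {x : L} (hx : x ≠ 0) :
    latticeInv (quadOrder d δ) ((ℤ ∙ x) * Subalgebra.toSubmodule (quadOrder d δ)) =
      (ℤ ∙ x⁻¹) * Subalgebra.toSubmodule (quadOrder d δ) := by
  have e : ∀ x : L, Subalgebra.toSubmodule (quadOrder d δ) *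
      ((ℤ ∙ x) * Subalgebra.toSubmodule (quadOrder d δ)) =
      (ℤ ∙ x) * Subalgebra.toSubmodule (quadOrder d δ) := fun x => by
    rw [mul_left_comm, toSubmodule_mul_self]
  refine latticeInv_eq_of_mul_eq (e _) ?_
  rw [mul_mul_mul_comm, toSubmodule_mul_self, Submodule.span_mul_span]
  simp [hx, ← Submodule.one_eq_span]

theorem latticeInv_sqrtIdeal : latticeInv (quadOrder d δ) (idealLattice (sqrtIdeal d δ)) =
    (ℤ ∙ δ⁻¹) * Subalgebra.toSubmodule (quadOrder d δ) := by
  rw [idealLattice_sqrtIdeal, latticeInv_span_mul d δ (sqrt_ne_zero d δ)]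

theorem latticeInv_mul_conj {I : Submodule ℤ L} (hI : IsInvertibleFractional (quadOrder d δ) I)
    {x : L} (hx : x ≠ 0)
    (hII : I * latticeConj I = (ℤ ∙ x) * Subalgebra.toSubmodule (quadOrder d δ)) :
    latticeInv (quadOrder d δ) I * latticeConj (latticeInv (quadOrder d δ) I) =
      (ℤ ∙ x⁻¹) * Subalgebra.toSubmodule (quadOrder d δ) := by
  rw [← hI.conj_inv d δ, ← hI.inv_mul (hI.conj d δ), hII, latticeInv_span_mul d δ hx]

omit h in
theorem span_mul_mul (x y : L) : (ℤ ∙ x) * Subalgebra.toSubmodule (quadOrder d δ) *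
    ((ℤ ∙ y) * Subalgebra.toSubmodule (quadOrder d δ)) =
    (ℤ ∙ (x * y)) * Subalgebra.toSubmodule (quadOrder d δ) := by
  rw [mul_mul_mul_comm, toSubmodule_mul_self, Submodule.span_mul_span]
  simp

omit h in
theorem span_neg_mul (x : L) : (ℤ ∙ (-x)) = (ℤ ∙ x) := by
  rw [← Set.neg_singleton, Submodule.span_neg]

variable {d δ}

namespace Setting

variable (S : Setting d δ ℓ q 𝔩 𝔮)
include S

theorem isInvertible_alphaLattice : IsInvertibleFractional (quadOrder d δ) (alphaLattice d δ ℓ 𝔩) := by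
  have h1 : IsInvertibleFractional (quadOrder d δ)
      (latticeInv (quadOrder d δ) (idealLattice (sqrtIdeal d δ))) := by
    rw [latticeInv_sqrtIdeal]
    exact isInvertibleFractional_span_mul (inv_ne_zero (sqrt_ne_zero d δ))
  unfold alphaLattice
  split_ifs
  · exact S.good_l.1.mul h1
  · exact h1

theorem alphaLattice_mul_conj : alphaLattice d δ ℓ 𝔩 * latticeConj (alphaLattice d δ ℓ 𝔩) =
    (ℤ ∙ ((normModulus d ℓ : L)⁻¹)) * Subalgebra.toSubmodule (quadOrder d δ) := by
  have hδ := sqrt_ne_zero d δ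
  have h1 : (ℤ ∙ δ⁻¹) * Subalgebra.toSubmodule (quadOrder d δ) *
      latticeConj ((ℤ ∙ δ⁻¹) * Subalgebra.toSubmodule (quadOrder d δ)) =
      (ℤ ∙ (d : L)⁻¹) * Subalgebra.toSubmodule (quadOrder d δ) := by
    rw [latticeConj_mul, latticeConj_span d δ, latticeConj_quadOrder d δ, span_mul_mul, star_inv₀, h.star_eq,
      ← h.sq, inv_neg, mul_neg, span_neg_mul, ← mul_inv, sq]
  unfold alphaLattice normModulus
  rw [latticeInv_sqrtIdeal]
  split_ifs with hd
  · rw [latticeConj_mul, mul_mul_mul_comm, h1, S.l_mul_conj hd, span_mul_mul]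
    congr 3
    have h0 : (ℓ : L) ≠ 0 := by exact_mod_cast S.prime_ell.ne_zero
    obtain ⟨k, hk⟩ := hd
    rw [hk, Int.mul_ediv_cancel_left _ (by exact_mod_cast S.prime_ell.ne_zero)]
    push_cast
    rw [mul_inv, mul_inv_cancel_left₀ h0]
  · exact h1

theorem one_mem_alphaLattice : (1 : L) ∈ alphaLattice d δ ℓ 𝔩 := by
  have hδ := sqrt_ne_zero d δ
  unfold alphaLattice
  rw [latticeInv_sqrtIdeal]
  split_ifs with hd
  · have h1 : δ ∈ idealLattice 𝔩 :=
      coe_mem_idealLattice (x := sqrtElem d δ).2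
        ((sqrtElem_mem_iff d δ S.isPrime_l S.prime_ell S.ell_mem).2 hd)
    have h2 : δ⁻¹ ∈ (ℤ ∙ δ⁻¹) * Subalgebra.toSubmodule (quadOrder d δ) :=
      Submodule.mem_span_singleton_mul.2 ⟨1, one_mem (quadOrder d δ), mul_one _⟩
    have := Submodule.mul_mem_mul h1 h2
    rwa [mul_inv_cancel₀ hδ] at this
  · exact Submodule.mem_span_singleton_mul.2 ⟨δ, sqrt_mem_quadOrder d δ, inv_mul_cancel₀ hδ⟩

theorem sqrt_mul_mem {x : L} (hx : x ∈ alphaLattice d δ ℓ 𝔩) : δ * x ∈ quadOrder d δ := by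
  have hδ := sqrt_ne_zero d δ
  have key : alphaLattice d δ ℓ 𝔩 ≤ (ℤ ∙ δ⁻¹) * Subalgebra.toSubmodule (quadOrder d δ) := by
    unfold alphaLattice
    rw [latticeInv_sqrtIdeal]
    split_ifs with hd
    · rw [mul_left_comm]
      refine mul_le_mul' le_rfl ?_
      rw [mul_comm, toSubmodule_mul_idealLattice]
      exact idealLattice_le _
    · exact le_rfl
  obtain ⟨y, hy, rfl⟩ := Submodule.mem_span_singleton_mul.1 (key hx)
  rwa [mul_inv_cancel_left₀ hδ]

theorem isInvertible_twistLattice {𝔞 : Ideal (quadOrder d δ)} (ha : IsGoodIdeal 𝔞) :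
    IsInvertibleFractional (quadOrder d δ) (twistLattice d δ 𝔮 𝔞) :=
  (S.good_q.1.inv.mul (ha.1.conj d δ)).mul ha.1.inv

theorem twistLattice_mul_conj {𝔞 : Ideal (quadOrder d δ)} (ha : IsGoodIdeal 𝔞) :
    twistLattice d δ 𝔮 𝔞 * latticeConj (twistLattice d δ 𝔮 𝔞) =
      (ℤ ∙ ((q : L)⁻¹)) * Subalgebra.toSubmodule (quadOrder d δ) := by
  have hq0 : (q : L) ≠ 0 := by exact_mod_cast S.prime_q.ne_zero
  have h1 := latticeInv_mul_conj d δ S.good_q.1 hq0 S.q_mul_conj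
  have h2 := ha.1.2
  have h3 := congrArg latticeConj h2
  rw [latticeConj_mul, latticeConj_quadOrder d δ] at h3
  unfold twistLattice
  rw [latticeConj_mul, latticeConj_mul, latticeConj_latticeConj]
  calc _ = (latticeInv (quadOrder d δ) (idealLattice 𝔮) *
        latticeConj (latticeInv (quadOrder d δ) (idealLattice 𝔮))) *
        (latticeConj (idealLattice 𝔞) * latticeConj (latticeInv (quadOrder d δ) (idealLattice 𝔞))) *
        (idealLattice 𝔞 * latticeInv (quadOrder d δ) (idealLattice 𝔞)) := by ac_rfl
    _ = _ := by
      rw [h1, h2, h3, mul_assoc, mul_assoc, toSubmodule_mul_self, toSubmodule_mul_self]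

/-- The lattice of the second coordinates of `R(𝔞, λ)` is invertible. -/
theorem isInvertible_betaLattice {𝔞 : Ideal (quadOrder d δ)} (ha : IsGoodIdeal 𝔞) :
    IsInvertibleFractional (quadOrder d δ) (alphaLattice d δ ℓ 𝔩 * twistLattice d δ 𝔮 𝔞) :=
  S.isInvertible_alphaLattice.mul (S.isInvertible_twistLattice ha)

theorem betaLattice_mul_conj {𝔞 : Ideal (quadOrder d δ)} (ha : IsGoodIdeal 𝔞) :
    (alphaLattice d δ ℓ 𝔩 * twistLattice d δ 𝔮 𝔞) *
      latticeConj (alphaLattice d δ ℓ 𝔩 * twistLattice d δ 𝔮 𝔞) =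
      (ℤ ∙ ((normModulus d ℓ : L) * q)⁻¹) * Subalgebra.toSubmodule (quadOrder d δ) := by
  rw [latticeConj_mul, mul_mul_mul_comm, S.alphaLattice_mul_conj, S.twistLattice_mul_conj ha,
    span_mul_mul, mul_inv]

section admissible

variable {𝔞 : Ideal (quadOrder d δ)} {lam : quadOrder d δ} (ha : IsGoodIdeal 𝔞)
  (hlam : IsAdmissible d δ ℓ q 𝔮 𝔞 lam)

include hlam in
theorem lam_mul_mem_alphaLattice {β : L}
    (hβ : β ∈ alphaLattice d δ ℓ 𝔩 * twistLattice d δ 𝔮 𝔞) :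
    (lam : L) * β ∈ alphaLattice d δ ℓ 𝔩 := by
  induction hβ using Submodule.mul_induction_on' with
  | mem_mul_mem x hx y hy =>
    have h1 := mul_mem_of_toSubmodule_mul S.isInvertible_alphaLattice.1 (hlam.1 y hy) hx
    convert h1 using 1
    ring
  | add x _ y _ hx hy => rw [mul_add]; exact add_mem hx hy

theorem mem_alphaLattice {x : L} (hx : x ∈ quadOrder d δ) : x ∈ alphaLattice d δ ℓ 𝔩 := by
  have := mul_mem_of_toSubmodule_mul S.isInvertible_alphaLattice.1 hx S.one_mem_alphaLattice
  rwa [mul_one] at this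

include hlam in
theorem quat_mem_quatOrder {α β : L} : quat _ α β ∈ quatOrder d δ ℓ q 𝔩 𝔮 𝔞 lam ↔
    β ∈ alphaLattice d δ ℓ 𝔩 * twistLattice d δ 𝔮 𝔞 ∧ α - (lam : L) * β ∈ quadOrder d δ := by
  constructor
  · rintro ⟨α', β', h1, -, h2, h3⟩
    obtain ⟨rfl, rfl⟩ := quat_inj.1 h1
    exact ⟨h2, h3⟩
  · rintro ⟨h2, h3⟩
    refine ⟨α, β, rfl, ?_, h2, h3⟩
    have := add_mem (S.mem_alphaLattice h3) (S.lam_mul_mem_alphaLattice hlam h2)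
    rwa [sub_add_cancel] at this

include ha hlam in
/-- `N(λ) ≡ c` modulo `q`, since both sides vanish. -/
theorem q_dvd_norm : (q : ℤ) ∣ Algebra.norm ℤ lam := by
  have hq0 : (q : L) ≠ 0 := by exact_mod_cast S.prime_q.ne_zero
  have key : ∀ z ∈ twistLattice d δ 𝔮 𝔞 * latticeConj (twistLattice d δ 𝔮 𝔞),
      (lam : L) * star (lam : L) * z ∈ quadOrder d δ := by
    intro z hz
    induction hz using Submodule.mul_induction_on' with
    | mem_mul_mem x hx y hy =>
      have h1 := hlam.1 x hx
      have h2 := star_mem_quadOrder d δ (hlam.1 _ (mem_latticeConj.1 hy))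
      have := mul_mem h1 h2
      convert this using 1
      rw [star_mul', star_star]; ring
    | add x _ y _ hx hy => rw [mul_add]; exact add_mem hx hy
  rw [S.twistLattice_mul_conj ha] at key
  have h1 := key (q : L)⁻¹ (Submodule.mem_span_singleton_mul.2 ⟨1, one_mem (quadOrder d δ), mul_one _⟩)
  rw [← nm_cast d δ, ← norm_coe d δ] at h1
  have h2 : (((Algebra.norm ℤ lam : ℤ) / q : ℚ) : L) ∈ quadOrder d δ := by
    push_cast at h1 ⊢
    rwa [div_eq_mul_inv]
  obtain ⟨n, hn⟩ := (ratCast_mem_quadOrder d δ).1 h2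
  have hq1 : (q : ℚ) ≠ 0 := by exact_mod_cast S.prime_q.ne_zero
  rw [div_eq_iff hq1] at hn
  exact ⟨n, by rw [mul_comm]; exact_mod_cast hn⟩

include ha hlam in
theorem modulus_dvd : normModulus d ℓ * q ∣ Algebra.norm ℤ lam - jSq d ℓ q :=
  S.isCoprime_q_normModulus.symm.mul_dvd hlam.2.symm.dvd
    (dvd_sub (S.q_dvd_norm ha hlam) S.q_dvd_jSq)

include ha hlam in
/-- `D q` divides `N(λ) - c` and generates the denominators of the products `β β̄'`. -/
theorem norm_sub_mul_mem {β β' : L} (hβ : β ∈ alphaLattice d δ ℓ 𝔩 * twistLattice d δ 𝔮 𝔞)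
    (hβ' : β' ∈ alphaLattice d δ ℓ 𝔩 * twistLattice d δ 𝔮 𝔞) :
    ((lam : L) * star (lam : L) - jSq d ℓ q) * (β * star β') ∈ quadOrder d δ := by
  have h1 : β * star β' ∈ (alphaLattice d δ ℓ 𝔩 * twistLattice d δ 𝔮 𝔞) *
      latticeConj (alphaLattice d δ ℓ 𝔩 * twistLattice d δ 𝔮 𝔞) :=
    Submodule.mul_mem_mul hβ (mem_latticeConj.2 (by rwa [star_star]))
  rw [S.betaLattice_mul_conj ha] at h1
  obtain ⟨y, hy, hz⟩ := Submodule.mem_span_singleton_mul.1 h1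
  obtain ⟨k, hk⟩ := S.modulus_dvd ha hlam
  have hne : ((normModulus d ℓ : L) * q) ≠ 0 := by
    refine mul_ne_zero ?_ (by exact_mod_cast S.prime_q.ne_zero)
    exact_mod_cast S.normModulus_neg.ne
  have h2 : (lam : L) * star (lam : L) - jSq d ℓ q = (normModulus d ℓ : L) * q * k := by
    rw [← nm_cast d δ, ← norm_coe d δ]
    have := congrArg (Int.cast (R := L)) hk
    push_cast at this ⊢
    exact this
  rw [← hz, h2]
  have : (normModulus d ℓ : L) * q * k * (((normModulus d ℓ : L) * q)⁻¹ * y) = k * y := by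
    rw [mul_right_comm, mul_inv_cancel_left₀ hne, mul_comm]
  rw [this]
  exact mul_mem (intCast_mem _ k) hy

include ha hlam in
/-- Write `α = o + λ β` and `α' = o' + λ β'` with `o`, `o'` in the order. The second coordinate of the
product is `o β' + ō' β + tr(λ β') β`. If `o' - ō' = n √d`, then the first coordinate minus `λ` times
the second is `o o' + n √d λ β - (N(λ) - c) β β̄'`. -/
theorem mul_mem_quatOrder {x y : quatAlg L (jSq d ℓ q)}
    (hx : x ∈ quatOrder d δ ℓ q 𝔩 𝔮 𝔞 lam) (hy : y ∈ quatOrder d δ ℓ q 𝔩 𝔮 𝔞 lam) :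
    x * y ∈ quatOrder d δ ℓ q 𝔩 𝔮 𝔞 lam := by
  obtain ⟨α, β, rfl⟩ := exists_quat x
  obtain ⟨α', β', rfl⟩ := exists_quat y
  rw [S.quat_mem_quatOrder hlam] at hx hy
  obtain ⟨hβ, ho⟩ := hx
  obtain ⟨hβ', ho'⟩ := hy
  rw [quat_mul, S.quat_mem_quatOrder hlam]
  have hJ := S.isInvertible_betaLattice ha
  have hδβ := S.sqrt_mul_mem (S.lam_mul_mem_alphaLattice hlam hβ)
  have hδβ' := S.sqrt_mul_mem (S.lam_mul_mem_alphaLattice hlam hβ')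
  have hne := S.norm_sub_mul_mem ha hlam hβ hβ'
  generalize hμ : (lam : L) = μ at *
  obtain ⟨o, rfl⟩ : ∃ o, α = o + μ * β := ⟨α - μ * β, by ring⟩
  obtain ⟨o', rfl⟩ : ∃ o', α' = o' + μ * β' := ⟨α' - μ * β', by ring⟩
  rw [add_sub_cancel_right] at ho ho'
  constructor
  · obtain ⟨n, hn⟩ := (sqrt_mul_mem_iff d δ).1 hδβ' 1 (one_mem _)
    rw [mul_one] at hn
    have h1 := tr_cast d δ (μ * β')
    rw [hn] at h1
    have h2 : (o + μ * β) * β' + β * star (o' + μ * β') =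
        o * β' + star o' * β + ((n : ℤ) : L) * β := by
      have h3 : star (μ * β') = (n : L) - μ * β' := by
        push_cast at h1; rw [h1]; ring
      rw [star_add, h3]; ring
    rw [h2]
    exact add_mem (add_mem (mul_mem_of_toSubmodule_mul hJ.1 ho hβ')
      (mul_mem_of_toSubmodule_mul hJ.1 (star_mem_quadOrder d δ ho') hβ))
      (mul_mem_of_toSubmodule_mul hJ.1 (intCast_mem _ n) hβ)
  · obtain ⟨n, hn⟩ := exists_sub_star d δ ho'
    have h2 : (o + μ * β) * (o' + μ * β') + (jSq d ℓ q : L) * β * star β' -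
        μ * ((o + μ * β) * β' + β * star (o' + μ * β')) =
        o * o' + n * (δ * (μ * β)) - (μ * star μ - jSq d ℓ q) * (β * star β') := by
      have h3 : star o' = o' - n * δ := by rw [← hn]; ring
      rw [star_add, star_mul', h3]; ring
    rw [h2]
    exact sub_mem (add_mem (mul_mem ho ho') (mul_mem (intCast_mem _ n) hδβ)) hne

include hlam in
theorem isOptimal : IsOptimal (quadOrder d δ) (quatOrder d δ ℓ q 𝔩 𝔮 𝔞 lam) := by
  intro α
  rw [emb_eq, S.quat_mem_quatOrder hlam]
  simp

/-- The module isomorphism `R(𝔞, λ) ≃ 𝓞 × J`, `[α, β] ↦ (α - λ β, β)`. -/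
def quatOrderEquiv : quatOrder d δ ℓ q 𝔩 𝔮 𝔞 lam ≃ₗ[ℤ]
    (quadOrder d δ) × (alphaLattice d δ ℓ 𝔩 * twistLattice d δ 𝔮 𝔞 : Submodule ℤ L) where
  toFun x := ⟨⟨x.1.1 0 0 - lam * x.1.1 0 1, by
    obtain ⟨α, β, h1, -, h2, h3⟩ := x.2
    rw [h1]; exact h3⟩, ⟨x.1.1 0 1, by
    obtain ⟨α, β, h1, -, h2, h3⟩ := x.2
    rw [h1]; exact h2⟩⟩
  map_add' x y := by
    apply Prod.ext <;> apply Subtype.ext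
    · simp; ring
    · simp
  map_smul' n x := by
    apply Prod.ext <;> apply Subtype.ext
    · change (n • x.1).1 0 0 - lam * (n • x.1).1 0 1 = n • (x.1.1 0 0 - lam * x.1.1 0 1)
      rw [zsmul_val_apply, zsmul_val_apply, zsmul_eq_mul]
      ring
    · change (n • x.1).1 0 1 = n • x.1.1 0 1
      rw [zsmul_val_apply, zsmul_eq_mul]
  invFun y := ⟨quat _ (y.1 + lam * y.2) y.2, (S.quat_mem_quatOrder hlam).2 ⟨y.2.2, by
    rw [add_sub_cancel_right]; exact y.1.2⟩⟩
  left_inv x := by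
    apply Subtype.ext
    obtain ⟨α, β, h1, -⟩ := x.2
    simp only [h1]
    rw [quat_inj]
    simp [quat]
  right_inv y := by
    apply Prod.ext <;> apply Subtype.ext
    · simp [quat]
    · simp [quat]

theorem quatOrderEquiv_symm_apply (y : (quadOrder d δ) ×
    (alphaLattice d δ ℓ 𝔩 * twistLattice d δ 𝔮 𝔞 : Submodule ℤ L)) :
    (((S.quatOrderEquiv hlam).symm y : quatOrder d δ ℓ q 𝔩 𝔮 𝔞 lam) : quatAlg L (jSq d ℓ q)) =
      quat _ ((y.1 : L) + (lam : L) * (y.2 : L)) (y.2 : L) := rfl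

include ha hlam

/-- The Gram matrix of the reduced trace is `V M Vᵀ`, where `V` has the rows `(α, ᾱ, β, β̄)` for
`[α, β]` in the basis and `M` is the matrix of the form over `L`. -/
theorem hasDiscriminant : HasDiscriminant (quatOrder d δ ℓ q 𝔩 𝔮 𝔞 lam) ((ℓ : ℚ) ^ 2) := by
  have hJ := S.isInvertible_betaLattice ha
  obtain ⟨-, ⟨b⟩⟩ := hJ.exists_basis d δ
  obtain ⟨g, hg, hg1, hg2⟩ := exists_mul_conj_eq d δ b
  have hJO : (alphaLattice d δ ℓ 𝔩 * twistLattice d δ 𝔮 𝔞) /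
      (alphaLattice d δ ℓ 𝔩 * twistLattice d δ 𝔮 𝔞) = Subalgebra.toSubmodule (quadOrder d δ) := by
    apply le_antisymm
    · intro x hx
      exact hJ.mem_of_mul_mem fun y hy => Submodule.mem_div_iff_forall_mul_mem.1 hx y hy
    · intro x hx
      exact Submodule.mem_div_iff_forall_mul_mem.2 fun y hy => mul_mem_of_toSubmodule_mul hJ.1 hx hy
  have hg3 := hg2 hJO
  rw [hJO, S.betaLattice_mul_conj ha] at hg1
  have hD := S.normModulus_neg
  have hq := S.prime_q.pos
  have hg4 : -((normModulus d ℓ : ℚ) * q)⁻¹ = g := by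
    refine span_mul_quadOrder_inj d δ ?_ hg ?_
    · rw [neg_pos, inv_lt_zero]
      refine mul_neg_of_neg_of_pos ?_ ?_
      · exact_mod_cast hD
      · exact_mod_cast hq
    · rw [← hg1]
      push_cast
      rw [span_neg_mul]
  let B := ((omBasis d δ).prod b).map (S.quatOrderEquiv hlam).symm
  let e : Module.Basis (Fin 4) ℤ (quatOrder d δ ℓ q 𝔩 𝔮 𝔞 lam) := B.reindex finSumFinEquiv
  have e0 : (e 0 : quatAlg L (jSq d ℓ q)) = quat _ 1 0 := by
    have : e 0 = B (Sum.inl 0) := by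
      simp only [e, Module.Basis.reindex_apply]; rfl
    rw [this, Module.Basis.map_apply, quatOrderEquiv_symm_apply]
    simp [Module.Basis.prod_apply, omBasis_zero]
  have e1 : (e 1 : quatAlg L (jSq d ℓ q)) = quat _ (om d δ) 0 := by
    have : e 1 = B (Sum.inl 1) := by
      simp only [e, Module.Basis.reindex_apply]; rfl
    rw [this, Module.Basis.map_apply, quatOrderEquiv_symm_apply]
    simp [Module.Basis.prod_apply, omBasis_one]
  have e2 : (e 2 : quatAlg L (jSq d ℓ q)) = quat _ (lam * (b 0 : L)) (b 0 : L) := by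
    have : e 2 = B (Sum.inr 0) := by
      simp only [e, Module.Basis.reindex_apply]; rfl
    rw [this, Module.Basis.map_apply, quatOrderEquiv_symm_apply]
    simp [Module.Basis.prod_apply]
  have e3 : (e 3 : quatAlg L (jSq d ℓ q)) = quat _ (lam * (b 1 : L)) (b 1 : L) := by
    have : e 3 = B (Sum.inr 1) := by
      simp only [e, Module.Basis.reindex_apply]; rfl
    rw [this, Module.Basis.map_apply, quatOrderEquiv_symm_apply]
    simp [Module.Basis.prod_apply]
  refine ⟨e, ?_⟩
  generalize hG : Matrix.of (fun i k => redTrace ((e i : quatAlg L (jSq d ℓ q)) *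
    (e k : quatAlg L (jSq d ℓ q)))) = G
  generalize hb0 : (b 0 : L) = b0 at *
  generalize hb1 : (b 1 : L) = b1 at *
  generalize hμ : (lam : L) = μ at *
  let A : Fin 4 → L := ![1, om d δ, μ * b0, μ * b1]
  let C : Fin 4 → L := ![0, 0, b0, b1]
  have he : ∀ i, (e i : quatAlg L (jSq d ℓ q)) = quat _ (A i) (C i) := by
    intro i
    fin_cases i
    · exact e0
    · exact e1
    · exact e2
    · exact e3
  let V : Matrix (Fin 4) (Fin 4) L := Matrix.of fun i => ![A i, star (A i), C i, star (C i)]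
  let M : Matrix (Fin 4) (Fin 4) L := !![1, 0, 0, 0; 0, 1, 0, 0; 0, 0, 0, (jSq d ℓ q : L);
    0, 0, (jSq d ℓ q : L), 0]
  have hGV : G.map (Rat.cast : ℚ → L) = V * M * V.transpose := by
    ext i k
    rw [← hG, Matrix.map_apply, Matrix.of_apply, he, he, quat_mul, redTrace_quat, tr_cast d δ]
    rw [Matrix.mul_apply]
    simp only [Matrix.mul_apply, Fin.sum_univ_four, Matrix.transpose_apply, V, M, Matrix.of_apply,
      Matrix.cons_val, star_add, star_mul', star_star, star_intCast]
    ring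
  have hdetM : M.det = -(jSq d ℓ q : L) ^ 2 := by
    simp [M, Matrix.det_succ_row_zero, Fin.sum_univ_succ, Fin.succAbove]
    ring
  have hdetV : V.det = (star (om d δ) - om d δ) * (b0 * star b1 - star b0 * b1) := by
    simp [V, A, C, Matrix.det_succ_row_zero, Fin.sum_univ_succ, Fin.succAbove]
    ring
  have hom : (star (om d δ) - om d δ) ^ 2 = (d : L) := by
    have : star (om d δ) - om d δ = -δ := by
      rw [star_om d δ]; linear_combination sqrt_eq_om d δ
    rw [this, neg_sq, h.sq]
  have hdet : ((G.det : ℚ) : L) = -((jSq d ℓ q * d * g : ℚ) ^ 2 : ℚ) := by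
    have h1 : ((G.det : ℚ) : L) = (G.map (Rat.cast : ℚ → L)).det := by
      rw [← eq_ratCast (algebraMap ℚ L), RingHom.map_det, RingHom.mapMatrix_apply]
      congr 2
    rw [h1, hGV, Matrix.det_mul, Matrix.det_mul, Matrix.det_transpose, hdetM, hdetV]
    push_cast
    linear_combination (-(jSq d ℓ q : L) ^ 2 * (b0 * star b1 - star b0 * b1) ^ 2) * hom
      - (jSq d ℓ q : L) ^ 2 * d * hg3
  have hdet' : G.det = -((jSq d ℓ q * d * g : ℚ) ^ 2) := by
    have : ((G.det : ℚ) : L) = ((-((jSq d ℓ q * d * g : ℚ) ^ 2) : ℚ) : L) := by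
      rw [hdet]; push_cast; rfl
    exact_mod_cast this
  rw [hdet', abs_neg, abs_of_nonneg (sq_nonneg _), ← hg4]
  have h1 := congrArg (Int.cast (R := ℚ)) (S.jSq_mul_disc)
  push_cast at h1
  have hD' : (normModulus d ℓ : ℚ) * q ≠ 0 := by
    refine mul_ne_zero ?_ ?_
    · exact_mod_cast hD.ne
    · exact_mod_cast hq.ne'
  rw [mul_pow, h1, neg_sq, inv_pow, mul_pow, mul_assoc, mul_inv_cancel₀ (pow_ne_zero 2 hD'), mul_one]

theorem isOrder : IsOrder (quatOrder d δ ℓ q 𝔩 𝔮 𝔞 lam) where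
  one_mem := by
    rw [← quat_one, S.quat_mem_quatOrder hlam]
    simp
  mul_mem := fun x hx y hy => S.mul_mem_quatOrder ha hlam hx hy
  fg := by
    have hJ := S.isInvertible_betaLattice ha
    obtain ⟨-, ⟨b⟩⟩ := hJ.exists_basis d δ
    have := Module.Finite.of_basis (((omBasis d δ).prod b).map (S.quatOrderEquiv hlam).symm)
    exact Module.Finite.iff_fg.1 this
  span_eq_top := by
    rw [eq_top_iff]
    rintro x -
    have hJ := S.isInvertible_betaLattice ha
    obtain ⟨j, hj, hj0⟩ := hJ.exists_ne_zero
    obtain ⟨α, β, rfl⟩ := exists_quat x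
    obtain ⟨n, hn, hn1⟩ := exists_int_smul_mem d δ (β / j)
    obtain ⟨m, hm, hm1⟩ := exists_int_smul_mem d δ (α - lam * β)
    have h1 : (m * n) • quat (jSq d ℓ q) α β ∈ quatOrder d δ ℓ q 𝔩 𝔮 𝔞 lam := by
      rw [quat_zsmul, S.quat_mem_quatOrder hlam]
      constructor
      · have h2 := mul_mem_of_toSubmodule_mul hJ.1 (mul_mem (intCast_mem (quadOrder d δ) m) hn1) hj
        convert h2 using 1
        rw [zsmul_eq_mul]; push_cast; field_simp
      · have h2 := mul_mem (intCast_mem (quadOrder d δ) n) hm1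
        convert h2 using 1
        rw [zsmul_eq_mul]; push_cast; ring
    have h2 := Submodule.smul_mem _ (((m * n : ℤ) : ℚ)⁻¹) (Submodule.subset_span (R := ℚ) h1)
    rw [quat_zsmul, quat_qsmul] at h2
    have hmn : (((m * n : ℤ) : ℚ) : L) ≠ 0 := by
      simpa using mul_ne_zero hm hn
    have h3 : ∀ x : L, ((((m * n : ℤ) : ℚ)⁻¹ : ℚ) : L) * (((m * n : ℤ) : L) * x) = x := by
      intro x
      rw [Rat.cast_inv, Rat.cast_intCast]
      rw [Rat.cast_intCast] at hmn
      rw [inv_mul_cancel_left₀ hmn]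
    rwa [h3, h3] at h2

end admissible

end Setting

end setting

end

noncomputable section

/-! ### Ramification and the norm form -/

section ramification

variable {L : Type*} [Field L] [CharZero L] [StarRing L]
variable (d : ℤ) (δ : L) [h : ImagQuad L d δ] {c : ℤ}

/-- The coordinates of a quaternion. -/
def quatEquiv : (L × L) ≃ₗ[ℚ] quatAlg L c where
  toFun x := quat c x.1 x.2
  map_add' x y := (quat_add _ _ _ _).symm
  map_smul' r x := by
    simp only [RingHom.id_apply]
    rw [quat_qsmul]
    simp [Rat.smul_def]
  invFun x := (x.1 0 0, x.1 0 1)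
  left_inv x := rfl
  right_inv x := by
    obtain ⟨α, β, rfl⟩ := exists_quat x
    rfl

theorem quatEquiv_apply (x : L × L) : quatEquiv (c := c) x = quat c x.1 x.2 := rfl

include h

/-- The `ℚ`-basis `1, i, j, ij` with `i² = d` and `j² = c`. -/
def quatBasis : Module.Basis (Fin 4) ℚ (quatAlg L c) :=
  (((sqrtBasis d δ).prod (sqrtBasis d δ)).map quatEquiv).reindex finSumFinEquiv

theorem quatBasis_zero : quatBasis d δ 0 = quat c (1 : L) 0 := by
  have : quatBasis d δ (c := c) 0 = (((sqrtBasis d δ).prod (sqrtBasis d δ)).map quatEquiv) (Sum.inl 0) := by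
    simp only [quatBasis, Module.Basis.reindex_apply]; rfl
  rw [this, Module.Basis.map_apply, Module.Basis.prod_apply]
  simp [quatEquiv_apply, sqrtBasis_zero]

theorem quatBasis_one : quatBasis d δ 1 = quat c δ 0 := by
  have : quatBasis d δ (c := c) 1 = (((sqrtBasis d δ).prod (sqrtBasis d δ)).map quatEquiv) (Sum.inl 1) := by
    simp only [quatBasis, Module.Basis.reindex_apply]; rfl
  rw [this, Module.Basis.map_apply, Module.Basis.prod_apply]
  simp [quatEquiv_apply, sqrtBasis_one]

theorem quatBasis_two : quatBasis d δ 2 = quat c (0 : L) 1 := by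
  have : quatBasis d δ (c := c) 2 = (((sqrtBasis d δ).prod (sqrtBasis d δ)).map quatEquiv) (Sum.inr 0) := by
    simp only [quatBasis, Module.Basis.reindex_apply]; rfl
  rw [this, Module.Basis.map_apply, Module.Basis.prod_apply]
  simp [quatEquiv_apply, sqrtBasis_zero]

theorem quatBasis_three : quatBasis d δ 3 = quat c (0 : L) δ := by
  have : quatBasis d δ (c := c) 3 = (((sqrtBasis d δ).prod (sqrtBasis d δ)).map quatEquiv) (Sum.inr 1) := by
    simp only [quatBasis, Module.Basis.reindex_apply]; rfl
  rw [this, Module.Basis.map_apply, Module.Basis.prod_apply]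
  simp [quatEquiv_apply, sqrtBasis_one]

theorem finrank_quatAlg : Module.finrank ℚ (quatAlg L c) = 4 := by
  rw [Module.finrank_eq_card_basis (quatBasis d δ (c := c))]; simp

variable (K : Type*) [Field K] [Algebra ℚ K]

/-- The standard generators of `K ⊗ B`. -/
def baseChangeGenerators :
    QuaternionAlgebra.Basis (K ⊗[ℚ] quatAlg L c) (d : K) (0 : K) (c : K) where
  i := 1 ⊗ₜ quat c δ 0
  j := 1 ⊗ₜ quat c 0 1
  k := 1 ⊗ₜ quat c 0 δ
  i_mul_i := by
    have : quat c δ 0 * quat c δ 0 = (d : ℚ) • (1 : quatAlg L c) := by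
      rw [quat_mul, ← quat_one, quat_qsmul]
      simp [← sq, h.sq]
    rw [Algebra.TensorProduct.tmul_mul_tmul, this, one_mul, TensorProduct.tmul_smul,
      ← Algebra.TensorProduct.one_def, zero_smul, add_zero,
      ← algebraMap_smul K (d : ℚ) (1 : K ⊗[ℚ] quatAlg L c), map_intCast]
  j_mul_j := by
    have : quat c (0 : L) 1 * quat c 0 1 = (c : ℚ) • (1 : quatAlg L c) := by
      rw [quat_mul, ← quat_one, quat_qsmul]
      simp
    rw [Algebra.TensorProduct.tmul_mul_tmul, this, one_mul, TensorProduct.tmul_smul,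
      ← Algebra.TensorProduct.one_def,
      ← algebraMap_smul K (c : ℚ) (1 : K ⊗[ℚ] quatAlg L c), map_intCast]
  i_mul_j := by
    rw [Algebra.TensorProduct.tmul_mul_tmul, quat_mul]
    simp
  j_mul_i := by
    rw [Algebra.TensorProduct.tmul_mul_tmul, quat_mul, zero_smul, zero_sub, ← TensorProduct.tmul_neg]
    congr 1
    · simp
    · rw [← neg_one_smul ℚ, quat_qsmul]
      simp [h.star_eq]

theorem liftHom_eq_sum (x : QuaternionAlgebra K (d : K) 0 (c : K)) :
    (baseChangeGenerators d δ (c := c) K).liftHom x =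
      ∑ i, ![x.re, x.imI, x.imJ, x.imK] i •
        Algebra.TensorProduct.basis K (quatBasis d δ (c := c)) i := by
  rw [QuaternionAlgebra.Basis.liftHom_apply, QuaternionAlgebra.Basis.lift, Fin.sum_univ_four]
  simp only [Algebra.TensorProduct.basis_apply, quatBasis_zero, quatBasis_one, quatBasis_two,
    quatBasis_three, Matrix.cons_val, Algebra.algebraMap_eq_smul_one, quat_one]
  rfl

theorem liftHom_injective :
    Function.Injective (baseChangeGenerators d δ (c := c) K).liftHom := by
  rw [injective_iff_map_eq_zero]
  intro x hx
  rw [liftHom_eq_sum] at hx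
  have h1 := linearIndependent_iff'.1
    (Algebra.TensorProduct.basis K (quatBasis d δ (c := c))).linearIndependent Finset.univ _ hx
  have h0 := h1 0 (Finset.mem_univ _)
  have h2 := h1 1 (Finset.mem_univ _)
  have h3 := h1 2 (Finset.mem_univ _)
  have h4 := h1 3 (Finset.mem_univ _)
  ext
  · simpa using h0
  · simpa using h2
  · simpa using h3
  · simpa using h4

theorem liftHom_surjective :
    Function.Surjective (baseChangeGenerators d δ (c := c) K).liftHom := by
  intro y
  let b := Algebra.TensorProduct.basis K (quatBasis d δ (c := c))
  refine ⟨⟨b.repr y 0, b.repr y 1, b.repr y 2, b.repr y 3⟩, ?_⟩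
  rw [liftHom_eq_sum]
  conv_rhs => rw [← b.sum_repr y]
  refine Finset.sum_congr rfl fun i _ => ?_
  fin_cases i <;> rfl

omit h in
theorem mul_star_quaternion (x : QuaternionAlgebra K (d : K) 0 (c : K)) :
    x * star x = algebraMap K _
      (x.re ^ 2 - d * x.imI ^ 2 - c * x.imJ ^ 2 + c * d * x.imK ^ 2) := by
  ext <;> simp [QuaternionAlgebra.algebraMap_eq] <;> ring

omit h in
theorem star_mul_quaternion (x : QuaternionAlgebra K (d : K) 0 (c : K)) :
    star x * x = algebraMap K _
      (x.re ^ 2 - d * x.imI ^ 2 - c * x.imJ ^ 2 + c * d * x.imK ^ 2) := by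
  ext <;> simp [QuaternionAlgebra.algebraMap_eq] <;> ring

/-- `K ⊗ B` is a division algebra if and only if the norm form is anisotropic over `K`. -/
theorem isRamifiedOver_iff : IsRamifiedOver K (quatAlg L c) ↔
    ∀ s t u v : K, s ^ 2 - d * t ^ 2 - c * u ^ 2 + c * d * v ^ 2 = 0 →
      s = 0 ∧ t = 0 ∧ u = 0 ∧ v = 0 := by
  constructor
  · intro hr s t u v h0
    let x : QuaternionAlgebra K (d : K) 0 (c : K) := ⟨s, t, u, v⟩
    by_contra hne
    have hx : x ≠ 0 := by
      intro hx
      apply hne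
      have := congrArg QuaternionAlgebra.re hx
      have := congrArg QuaternionAlgebra.imI hx
      have := congrArg QuaternionAlgebra.imJ hx
      have := congrArg QuaternionAlgebra.imK hx
      exact ⟨‹_›, ‹_›, ‹_›, ‹_›⟩
    have h1 : x * star x = 0 := by
      rw [mul_star_quaternion]
      change algebraMap K _ (s ^ 2 - d * t ^ 2 - c * u ^ 2 + c * d * v ^ 2) = 0
      rw [h0, map_zero]
    have h2 := hr _ ((map_ne_zero_iff _ (liftHom_injective d δ (c := c) K)).2 hx)
    have h3 := congrArg (baseChangeGenerators d δ (c := c) K).liftHom h1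
    rw [map_mul, map_zero] at h3
    have h4 := (map_eq_zero_iff _ (liftHom_injective d δ (c := c) K)).1 (h2.mul_right_eq_zero.1 h3)
    exact hx (star_eq_zero.1 h4)
  · intro ha y hy
    obtain ⟨x, rfl⟩ := liftHom_surjective d δ (c := c) K y
    have hx : x ≠ 0 := by rintro rfl; exact hy (map_zero _)
    refine IsUnit.map (baseChangeGenerators d δ (c := c) K).liftHom ?_
    set n := x.re ^ 2 - d * x.imI ^ 2 - c * x.imJ ^ 2 + c * d * x.imK ^ 2 with hn
    have hn0 : n ≠ 0 := by
      intro h0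
      obtain ⟨h1, h2, h3, h4⟩ := ha _ _ _ _ h0
      exact hx (QuaternionAlgebra.ext h1 h2 h3 h4)
    refine isUnit_iff_exists.2 ⟨star x * algebraMap K _ n⁻¹, ?_, ?_⟩
    · rw [← mul_assoc, mul_star_quaternion, ← map_mul, ← hn, mul_inv_cancel₀ hn0, map_one]
    · rw [mul_assoc, Algebra.commutes (n⁻¹) x, ← mul_assoc, star_mul_quaternion, ← map_mul, ← hn,
        mul_inv_cancel₀ hn0, map_one]

/-- The quaternary norm form is anisotropic if the ternary form `x² - d y² - c z²` is: the product of
`s + t √d` and the conjugate of `u + v √d` has norm `c N(u + v √d)²`. -/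
theorem isRamifiedOver_of_ternary
    (ha : ∀ x y z : K, x ^ 2 - d * y ^ 2 - c * z ^ 2 = 0 → x = 0 ∧ y = 0 ∧ z = 0) :
    IsRamifiedOver K (quatAlg L c) := by
  rw [isRamifiedOver_iff d δ]
  intro s t u v h0
  obtain ⟨-, -, h1⟩ := ha (s * u - d * t * v) (t * u - s * v) (u ^ 2 - d * v ^ 2)
    (by linear_combination (u ^ 2 - d * v ^ 2) * h0)
  obtain ⟨hu, hv, -⟩ := ha u v 0 (by linear_combination h1)
  rw [hu, hv] at h0
  obtain ⟨hs, ht, -⟩ := ha s t 0 (by linear_combination h0)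
  exact ⟨hs, ht, hu, hv⟩

omit K in
theorem isRamifiedOver_real (hc : c < 0) : IsRamifiedOver ℝ (quatAlg L c) := by
  rw [isRamifiedOver_iff d δ]
  intro s t u v h0
  have hc' : (c : ℝ) < 0 := by exact_mod_cast hc
  have hd' : (d : ℝ) < 0 := by exact_mod_cast h.neg
  have h1 : 0 ≤ -d * t ^ 2 := mul_nonneg (by linarith) (sq_nonneg _)
  have h2 : 0 ≤ -c * u ^ 2 := mul_nonneg (by linarith) (sq_nonneg _)
  have hcd : 0 < (c : ℝ) * d := mul_pos_of_neg_of_neg hc' hd'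
  have h3 : 0 ≤ (c * d : ℝ) * v ^ 2 := mul_nonneg hcd.le (sq_nonneg _)
  have h4 := sq_nonneg s
  have e1 : s ^ 2 = 0 := by linarith
  have e2 : -d * t ^ 2 = 0 := by linarith
  have e3 : -c * u ^ 2 = 0 := by linarith
  have e4 : (c * d : ℝ) * v ^ 2 = 0 := by linarith
  refine ⟨pow_eq_zero_iff two_ne_zero |>.1 e1, ?_, ?_, ?_⟩
  · exact pow_eq_zero_iff two_ne_zero |>.1 ((mul_eq_zero.1 e2).resolve_left (by linarith))
  · exact pow_eq_zero_iff two_ne_zero |>.1 ((mul_eq_zero.1 e3).resolve_left (by linarith))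
  · exact pow_eq_zero_iff two_ne_zero |>.1 ((mul_eq_zero.1 e4).resolve_left hcd.ne')

end ramification

/-! ### Reduced norm and conjugation -/

section nrd

variable {L : Type*} [Field L] [CharZero L] [StarRing L]
variable (d : ℤ) (δ : L) [h : ImagQuad L d δ] {c : ℤ}

/-- The reduced norm `nrd [α, β] = N(α) - c N(β)`. -/
def redNorm (x : quatAlg L c) : ℚ := nm (x.1 0 0) - c * nm (x.1 0 1)

/-- The canonical involution `[α, β] ↦ [ᾱ, -β]`. -/
def quatConj (x : quatAlg L c) : quatAlg L c := quat c (star (x.1 0 0)) (-(x.1 0 1))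

theorem redNorm_quat (α β : L) : redNorm (quat c α β) = nm α - c * nm β := rfl

theorem quatConj_quat (α β : L) : quatConj (quat c α β) = quat c (star α) (-β) := rfl

theorem quatConj_quatConj (x : quatAlg L c) : quatConj (quatConj x) = x := by
  obtain ⟨α, β, rfl⟩ := exists_quat x
  rw [quatConj_quat, quatConj_quat, star_star, neg_neg]

theorem quatConj_mul (x y : quatAlg L c) : quatConj (x * y) = quatConj y * quatConj x := by
  obtain ⟨α, β, rfl⟩ := exists_quat x
  obtain ⟨α', β', rfl⟩ := exists_quat y
  simp only [quatConj_quat, quat_mul, quat_inj, star_add, star_mul', star_star, star_neg, star_intCast]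
  constructor <;> ring

theorem algebraMap_eq_quat (r : ℚ) : algebraMap ℚ (quatAlg L c) r = quat c (r : L) 0 := by
  rw [Algebra.algebraMap_eq_smul_one, ← quat_one, quat_qsmul]
  simp

theorem quat_neg (α β : L) : -quat c α β = quat c (-α) (-β) := by
  rw [← neg_one_zsmul, quat_zsmul]; simp

theorem quat_sub (α β α' β' : L) : quat c α β - quat c α' β' = quat c (α - α') (β - β') := by
  rw [sub_eq_add_neg, quat_neg, quat_add, sub_eq_add_neg, sub_eq_add_neg]

include h

theorem mul_quatConj (x : quatAlg L c) : x * quatConj x = algebraMap ℚ _ (redNorm x) := by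
  obtain ⟨α, β, rfl⟩ := exists_quat x
  rw [quatConj_quat, quat_mul, redNorm_quat, algebraMap_eq_quat, quat_inj]
  push_cast
  rw [nm_cast d δ, nm_cast d δ, star_neg, star_star]
  constructor <;> ring

theorem quatConj_mul_self (x : quatAlg L c) : quatConj x * x = algebraMap ℚ _ (redNorm x) := by
  obtain ⟨α, β, rfl⟩ := exists_quat x
  rw [quatConj_quat, quat_mul, redNorm_quat, algebraMap_eq_quat, quat_inj]
  push_cast
  rw [nm_cast d δ, nm_cast d δ]
  constructor <;> ring

theorem add_quatConj (x : quatAlg L c) : x + quatConj x = algebraMap ℚ _ (redTrace x) := by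
  obtain ⟨α, β, rfl⟩ := exists_quat x
  rw [quatConj_quat, quat_add, redTrace_quat, algebraMap_eq_quat, quat_inj, tr_cast d δ]
  simp

theorem redNorm_mul (x y : quatAlg L c) : redNorm (x * y) = redNorm x * redNorm y := by
  apply (algebraMap ℚ (quatAlg L c)).injective
  rw [← mul_quatConj d δ, quatConj_mul, mul_assoc, ← mul_assoc y, mul_quatConj d δ,
    Algebra.commutes, ← mul_assoc, mul_quatConj d δ, map_mul]

theorem redNorm_one : redNorm (1 : quatAlg L c) = 1 := by
  apply (algebraMap ℚ (quatAlg L c)).injective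
  rw [← mul_quatConj d δ, ← quat_one, quatConj_quat, quat_mul]
  simp [quat_one]

theorem redNorm_quatConj (x : quatAlg L c) : redNorm (quatConj x) = redNorm x := by
  apply (algebraMap ℚ (quatAlg L c)).injective
  rw [← mul_quatConj d δ, quatConj_quatConj, quatConj_mul_self d δ]

theorem redTrace_add (x y : quatAlg L c) : redTrace (x + y) = redTrace x + redTrace y := by
  obtain ⟨α, β, rfl⟩ := exists_quat x
  obtain ⟨α', β', rfl⟩ := exists_quat y
  rw [quat_add, redTrace_quat, redTrace_quat, redTrace_quat, tr_add]

theorem redTrace_qsmul (r : ℚ) (x : quatAlg L c) : redTrace (r • x) = r * redTrace x := by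
  obtain ⟨α, β, rfl⟩ := exists_quat x
  rw [quat_qsmul, redTrace_quat, redTrace_quat, tr_ratCast_mul]

theorem redNorm_add (x y : quatAlg L c) :
    redNorm (x + y) = redNorm x + redNorm y + redTrace (x * quatConj y) := by
  obtain ⟨α, β, rfl⟩ := exists_quat x
  obtain ⟨α', β', rfl⟩ := exists_quat y
  rw [quat_add, quatConj_quat, quat_mul, redTrace_quat, redNorm_quat, redNorm_quat, redNorm_quat,
    nm_add d δ, nm_add d δ, tr_add]
  have : (c : L) * β * star (-β') = ((-c : ℚ) : L) * (β * star β') := by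
    rw [star_neg]; push_cast; ring
  rw [this, tr_ratCast_mul]
  ring

theorem redNorm_ratCast (r : ℚ) : redNorm (algebraMap ℚ (quatAlg L c) r) = r ^ 2 := by
  rw [algebraMap_eq_quat, redNorm_quat, nm_ratCast d δ, ← Rat.cast_zero, nm_ratCast d δ]
  ring

theorem redNorm_eq_zero (hc : c < 0) {x : quatAlg L c} : redNorm x = 0 ↔ x = 0 := by
  constructor
  · obtain ⟨α, β, rfl⟩ := exists_quat x
    rw [redNorm_quat]
    intro h0
    have h1 := nm_nonneg d δ α
    have h2 := nm_nonneg d δ β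
    have hc' : (c : ℚ) < 0 := by exact_mod_cast hc
    have h3 : 0 ≤ -c * nm β := mul_nonneg (by linarith) h2
    have hα : nm α = 0 := by linarith
    have hβ : nm β = 0 := (mul_eq_zero.1 (show (c : ℚ) * nm β = 0 by linarith)).resolve_left hc'.ne
    rw [nm_eq_zero d δ] at hα hβ
    rw [hα, hβ, quat_zero]
  · rintro rfl
    have := redNorm_ratCast d δ (c := c) 0
    simpa using this

theorem isUnit_of_ne_zero (hc : c < 0) {x : quatAlg L c} (hx : x ≠ 0) : IsUnit x := by
  have hn : redNorm x ≠ 0 := fun h0 => hx ((redNorm_eq_zero d δ hc).1 h0)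
  refine isUnit_iff_exists.2 ⟨quatConj x * algebraMap ℚ _ (redNorm x)⁻¹, ?_, ?_⟩
  · rw [← mul_assoc, mul_quatConj d δ, ← map_mul, mul_inv_cancel₀ hn, map_one]
  · rw [mul_assoc, Algebra.commutes (redNorm x)⁻¹ x, ← mul_assoc, quatConj_mul_self d δ, ← map_mul,
      mul_inv_cancel₀ hn, map_one]

theorem isSimpleRing_quatAlg (hc : c < 0) : IsSimpleRing (quatAlg L c) := by
  have : Nontrivial (quatAlg L c) := inferInstance
  let _ := DivisionRing.ofIsUnitOrEqZero (R := quatAlg L c) fun x => by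
    by_cases hx : x = 0
    · exact Or.inr hx
    · exact Or.inl (isUnit_of_ne_zero d δ hc hx)
  exact DivisionRing.isSimpleRing (quatAlg L c)

theorem isCentral_quatAlg : Algebra.IsCentral ℚ (quatAlg L c) := by
  refine ⟨fun x hx => ?_⟩
  rw [Subalgebra.mem_center_iff] at hx
  obtain ⟨α, β, rfl⟩ := exists_quat x
  have h1 := hx (quat c δ 0)
  have h2 := hx (quat c 0 1)
  rw [quat_mul, quat_mul, quat_inj] at h1 h2
  have hβ : β = 0 := by
    have h3 := h1.2
    simp only [h.star_eq, zero_mul, add_zero, mul_zero, zero_add, mul_neg] at h3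
    have h4 : δ * β = 0 := by linear_combination h3 / 2
    exact (mul_eq_zero.1 h4).resolve_left (sqrt_ne_zero d δ)
  have hα : star α = α := by
    have h3 := h2.2
    simpa using h3
  obtain ⟨r, hr⟩ := (star_eq_self_iff d δ α).1 hα
  rw [Algebra.mem_bot]
  exact ⟨r, by rw [algebraMap_eq_quat, hr, hβ]⟩

end nrd

end

noncomputable section

/-! ### Ramification at `ℓ` -/

section padic

theorem form_ne_one_of_dvd {p : ℕ} [hp : Fact p.Prime] {d c : ℤ} {N : ℕ} (hN : N ≠ 0)
    (hdvd : ∀ x y z : ℤ, (p : ℤ) ^ N ∣ x ^ 2 - d * y ^ 2 - c * z ^ 2 →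
      (p : ℤ) ∣ x ∧ (p : ℤ) ∣ y ∧ (p : ℤ) ∣ z) {x y z : ℤ_[p]}
    (h0 : x ^ 2 - d * y ^ 2 - c * z ^ 2 = 0) : x ≠ 1 ∧ y ≠ 1 ∧ z ≠ 1 := by
  let f := PadicInt.toZModPow (p := p) N
  obtain ⟨x', hx⟩ := ZMod.intCast_surjective (f x)
  obtain ⟨y', hy⟩ := ZMod.intCast_surjective (f y)
  obtain ⟨z', hz⟩ := ZMod.intCast_surjective (f z)
  have h1 : ((p ^ N : ℕ) : ℤ) ∣ x' ^ 2 - d * y' ^ 2 - c * z' ^ 2 := by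
    rw [← ZMod.intCast_zmod_eq_zero_iff_dvd]
    push_cast
    rw [hx, hy, hz]
    have := congrArg f h0
    simpa using this
  obtain ⟨h2, h3, h4⟩ := hdvd x' y' z' (by exact_mod_cast h1)
  have key : ∀ (w : ℤ_[p]) (w' : ℤ), (w' : ZMod (p ^ N)) = f w → (p : ℤ) ∣ w' → w ≠ 1 := by
    rintro _ w' hw hpw rfl
    rw [map_one, ← Int.cast_one, ZMod.intCast_eq_intCast_iff] at hw
    have h5 : (p : ℤ) ∣ ((p ^ N : ℕ) : ℤ) := by
      push_cast; exact dvd_pow_self _ hN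
    have h6 : (p : ℤ) ∣ 1 - w' := h5.trans hw.dvd
    have h7 := dvd_add h6 hpw
    rw [sub_add_cancel] at h7
    exact (Nat.prime_iff_prime_int.1 hp.out).not_dvd_one h7
  exact ⟨key x x' hx h2, key y y' hy h3, key z z' hz h4⟩

/-- A ternary form is anisotropic over `ℚ_p` if its zeros modulo a power of `p` are imprimitive. -/
theorem ternary_anisotropic {p : ℕ} [hp : Fact p.Prime] {d c : ℤ} {N : ℕ} (hN : N ≠ 0)
    (hdvd : ∀ x y z : ℤ, (p : ℤ) ^ N ∣ x ^ 2 - d * y ^ 2 - c * z ^ 2 →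
      (p : ℤ) ∣ x ∧ (p : ℤ) ∣ y ∧ (p : ℤ) ∣ z) {x y z : ℚ_[p]}
    (h0 : x ^ 2 - d * y ^ 2 - c * z ^ 2 = 0) : x = 0 ∧ y = 0 ∧ z = 0 := by
  -- divide by the coordinate of largest norm
  have key : ∀ w : ℚ_[p], w ≠ 0 → ‖x‖ ≤ ‖w‖ → ‖y‖ ≤ ‖w‖ → ‖z‖ ≤ ‖w‖ → x ≠ w ∧ y ≠ w ∧ z ≠ w := by
    intro w hw hx hy hz
    have hle : ∀ u : ℚ_[p], ‖u‖ ≤ ‖w‖ → ∃ U : ℤ_[p], (U : ℚ_[p]) = u / w := fun u hu =>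
      ⟨⟨u / w, by rw [norm_div]; exact div_le_one_of_le₀ hu (norm_nonneg _)⟩, rfl⟩
    obtain ⟨X, hX⟩ := hle x hx
    obtain ⟨Y, hY⟩ := hle y hy
    obtain ⟨Z, hZ⟩ := hle z hz
    have h1 := form_ne_one_of_dvd hN hdvd (x := X) (y := Y) (z := Z) (by
        apply Subtype.coe_injective
        push_cast
        rw [hX, hY, hZ]
        field_simp
        linear_combination h0)
    have h2 : ∀ (u : ℚ_[p]) (U : ℤ_[p]), (U : ℚ_[p]) = u / w → U ≠ 1 → u ≠ w := by
      rintro u U hU hne rfl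
      apply hne
      apply Subtype.coe_injective
      push_cast
      rw [hU, div_self hw]
    exact ⟨h2 x X hX h1.1, h2 y Y hY h1.2.1, h2 z Z hZ h1.2.2⟩
  have hall : ∀ w : ℚ_[p], (w = x ∨ w = y ∨ w = z) → ‖x‖ ≤ ‖w‖ → ‖y‖ ≤ ‖w‖ → ‖z‖ ≤ ‖w‖ →
      x = 0 ∧ y = 0 ∧ z = 0 := by
    intro w hw hx hy hz
    by_cases hw0 : w = 0
    · subst hw0
      simp only [norm_zero, norm_le_zero_iff] at hx hy hz
      exact ⟨hx, hy, hz⟩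
    · obtain ⟨h1, h2, h3⟩ := key w hw0 hx hy hz
      rcases hw with rfl | rfl | rfl
      · exact absurd rfl h1
      · exact absurd rfl h2
      · exact absurd rfl h3
  rcases le_total ‖x‖ ‖y‖ with h1 | h1
  · rcases le_total ‖y‖ ‖z‖ with h2 | h2
    · exact hall z (by simp) (h1.trans h2) h2 le_rfl
    · exact hall y (by simp) h1 le_rfl h2
  · rcases le_total ‖x‖ ‖z‖ with h2 | h2
    · exact hall z (by simp) h2 (h1.trans h2) le_rfl
    · exact hall x (by simp) le_rfl h1 h2

theorem two_dvd_of_zmod_eight {x : ℤ} (hx : 4 * (x : ZMod 8) = 0) : (2 : ℤ) ∣ x := by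
  have : ((4 * x : ℤ) : ZMod 8) = 0 := by push_cast; exact hx
  rw [ZMod.intCast_zmod_eq_zero_iff_dvd] at this
  omega

theorem two_dvd_of_zmod_four {x : ℤ} (hx : 2 * (x : ZMod 4) = 0) : (2 : ℤ) ∣ x := by
  have : ((2 * x : ℤ) : ZMod 4) = 0 := by push_cast; exact hx
  rw [ZMod.intCast_zmod_eq_zero_iff_dvd] at this
  omega

theorem zmod_eight_eq {x : ℤ} {k : ℤ} (hx : x % 8 = k) : (x : ZMod 8) = (k : ZMod 8) := by
  rw [ZMod.intCast_eq_intCast_iff]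
  change x % 8 = k % 8
  omega

theorem zmod_four_eq {x : ℤ} {k : ℤ} (hx : x % 4 = k) : (x : ZMod 4) = (k : ZMod 4) := by
  rw [ZMod.intCast_eq_intCast_iff]
  change x % 4 = k % 4
  omega

/-- At an inert prime `2`, where `d ≡ 5` modulo `8` and `c` is exactly divisible by `2`. -/
theorem imprimitive_two_inert {d c x y z : ℤ} (hd : d % 8 = 5) (hc : c % 8 = 2 ∨ c % 8 = 6)
    (h0 : (2 : ℤ) ^ 3 ∣ x ^ 2 - d * y ^ 2 - c * z ^ 2) : (2 : ℤ) ∣ x ∧ (2 : ℤ) ∣ y ∧ (2 : ℤ) ∣ z := by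
  have h1 : ((x ^ 2 - d * y ^ 2 - c * z ^ 2 : ℤ) : ZMod 8) = 0 :=
    (ZMod.intCast_zmod_eq_zero_iff_dvd _ 8).2 (by exact_mod_cast h0)
  push_cast at h1
  rw [zmod_eight_eq hd] at h1
  have h2 : 4 * (x : ZMod 8) = 0 ∧ 4 * (y : ZMod 8) = 0 ∧ 4 * (z : ZMod 8) = 0 := by
    generalize (x : ZMod 8) = X at *
    generalize (y : ZMod 8) = Y at *
    generalize (z : ZMod 8) = Z at *
    rcases hc with hc | hc
    all_goals
      rw [zmod_eight_eq hc] at h1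
      revert X Y Z
      decide
  exact ⟨two_dvd_of_zmod_eight h2.1, two_dvd_of_zmod_eight h2.2.1, two_dvd_of_zmod_eight h2.2.2⟩

/-- At a ramified prime `2` with `d ≡ 12` modulo `16`, where `c` is not in the kernel of `χ₋₄`. Modulo `4`
the coordinates `x` and `z` are even, and after division by `4` so is `y`. -/
theorem imprimitive_two_of_four {d c x y z : ℤ} (hd : d % 16 = 12) (hc : c % 4 = 3)
    (h0 : (2 : ℤ) ^ 4 ∣ x ^ 2 - d * y ^ 2 - c * z ^ 2) : (2 : ℤ) ∣ x ∧ (2 : ℤ) ∣ y ∧ (2 : ℤ) ∣ z := by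
  obtain ⟨m, rfl⟩ : ∃ m, d = 4 * m := ⟨d / 4, by omega⟩
  have hm : m % 4 = 3 := by omega
  have h1 : ((x ^ 2 - 4 * m * y ^ 2 - c * z ^ 2 : ℤ) : ZMod 4) = 0 :=
    (ZMod.intCast_zmod_eq_zero_iff_dvd _ 4).2 (dvd_trans (by norm_num) h0)
  have h4 : (4 : ZMod 4) = 0 := rfl
  push_cast at h1
  rw [zmod_four_eq hc, h4] at h1
  have h2 : 2 * (x : ZMod 4) = 0 ∧ 2 * (z : ZMod 4) = 0 := by
    rw [zero_mul, zero_mul, sub_zero] at h1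
    generalize (x : ZMod 4) = X at *
    generalize (z : ZMod 4) = Z at *
    revert X Z
    decide
  have hx := two_dvd_of_zmod_four h2.1
  have hz := two_dvd_of_zmod_four h2.2
  refine ⟨hx, ?_, hz⟩
  obtain ⟨x', rfl⟩ := hx
  obtain ⟨z', rfl⟩ := hz
  have h3 : (4 : ℤ) ∣ x' ^ 2 - m * y ^ 2 - c * z' ^ 2 := by
    obtain ⟨k, hk⟩ := h0
    exact ⟨k, by linarith⟩
  have h5 : ((x' ^ 2 - m * y ^ 2 - c * z' ^ 2 : ℤ) : ZMod 4) = 0 :=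
    (ZMod.intCast_zmod_eq_zero_iff_dvd _ 4).2 h3
  push_cast at h5
  rw [zmod_four_eq hc, zmod_four_eq hm] at h5
  apply two_dvd_of_zmod_four
  clear h1 h2
  generalize (x' : ZMod 4) = X at *
  generalize (y : ZMod 4) = Y at *
  generalize (z' : ZMod 4) = Z at *
  revert X Y Z
  decide

/-- At a ramified prime `2` with `d` exactly divisible by `8`, where `c` is not in the kernel of `χ₈` or
of `χ₋₄ χ₈`. Modulo `8` the coordinates `x` and `z` are even, and after division by `4` so is `y`. -/
theorem imprimitive_two_of_eight {d c x y z : ℤ}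
    (hdc : d % 32 = 8 ∧ (c % 8 = 3 ∨ c % 8 = 5) ∨ d % 32 = 24 ∧ (c % 8 = 5 ∨ c % 8 = 7))
    (h0 : (2 : ℤ) ^ 5 ∣ x ^ 2 - d * y ^ 2 - c * z ^ 2) : (2 : ℤ) ∣ x ∧ (2 : ℤ) ∣ y ∧ (2 : ℤ) ∣ z := by
  obtain ⟨m, rfl⟩ : ∃ m, d = 8 * m := ⟨d / 8, by omega⟩
  have h1 : ((x ^ 2 - 8 * m * y ^ 2 - c * z ^ 2 : ℤ) : ZMod 8) = 0 :=
    (ZMod.intCast_zmod_eq_zero_iff_dvd _ 8).2 (dvd_trans (by norm_num) h0)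
  have h8 : (8 : ZMod 8) = 0 := rfl
  push_cast at h1
  rw [h8, zero_mul, zero_mul, sub_zero] at h1
  have hc : c % 8 = 3 ∨ c % 8 = 5 ∨ c % 8 = 7 := by omega
  have h2 : 4 * (x : ZMod 8) = 0 ∧ 4 * (z : ZMod 8) = 0 := by
    generalize (x : ZMod 8) = X at *
    generalize (z : ZMod 8) = Z at *
    rcases hc with hc | hc | hc
    all_goals
      rw [zmod_eight_eq hc] at h1
      revert X Z
      decide
  have hx := two_dvd_of_zmod_eight h2.1
  have hz := two_dvd_of_zmod_eight h2.2
  refine ⟨hx, ?_, hz⟩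
  obtain ⟨x', rfl⟩ := hx
  obtain ⟨z', rfl⟩ := hz
  have h3 : (8 : ℤ) ∣ x' ^ 2 - (2 * m) * y ^ 2 - c * z' ^ 2 := by
    obtain ⟨k, hk⟩ := h0
    exact ⟨k, by linarith⟩
  have h5 : ((x' ^ 2 - (2 * m) * y ^ 2 - c * z' ^ 2 : ℤ) : ZMod 8) = 0 :=
    (ZMod.intCast_zmod_eq_zero_iff_dvd _ 8).2 h3
  have hm2 : ((2 * m) % 8 = 2 ∧ (c % 8 = 3 ∨ c % 8 = 5)) ∨ ((2 * m) % 8 = 6 ∧ (c % 8 = 5 ∨ c % 8 = 7)) := by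
    omega
  generalize 2 * m = m' at *
  push_cast at h5
  apply two_dvd_of_zmod_eight
  clear h1 h2
  generalize (x' : ZMod 8) = X at *
  generalize (y : ZMod 8) = Y at *
  generalize (z' : ZMod 8) = Z at *
  rcases hm2 with ⟨hm, hc | hc⟩ | ⟨hm, hc | hc⟩
  all_goals
    rw [zmod_eight_eq hc, zmod_eight_eq hm] at h5
    revert X Y Z
    decide

end padic

section regular

variable {L : Type*} [Field L] [CharZero L] [StarRing L]
variable (d : ℤ) (δ : L) [h : ImagQuad L d δ]
include h

/-- If `p²` divided `d`, then `d / p²` would be a discriminant, and `p` would divide the conductor. -/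
theorem not_sq_dvd_of_regular {p : ℕ} (hp : p.Prime) (hp2 : p ≠ 2)
    (hpf : ¬ p ∣ conductor (quadOrder d δ)) : ¬ (p : ℤ) ^ 2 ∣ d := by
  rintro ⟨k, hk⟩
  apply hpf
  rw [prime_dvd_conductor_iff d δ hp]
  refine ⟨k, hk, ?_⟩
  have hm := h.mod4
  obtain ⟨j, hj⟩ : ∃ j : ℕ, p = 2 * j + 1 := ⟨p / 2, by have := hp.eq_two_or_odd; omega⟩
  have : d = k + 4 * ((j ^ 2 + j) * k) := by
    rw [hk, hj]; push_cast; ring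
  omega

theorem mod_of_regular_two (h2 : (2 : ℤ) ∣ d) (hpf : ¬ 2 ∣ conductor (quadOrder d δ)) :
    d % 16 = 12 ∨ d % 32 = 8 ∨ d % 32 = 24 := by
  by_contra hne
  apply hpf
  rw [prime_dvd_conductor_iff d δ Nat.prime_two]
  have hm := h.mod4
  refine ⟨d / 4, ?_, ?_⟩ <;> push_cast at * <;> omega

variable {d δ} {ℓ q : ℕ} {𝔩 𝔮 : Ideal (quadOrder d δ)}

namespace Setting

variable (S : Setting d δ ℓ q 𝔩 𝔮)
include S

/-- Primitive zeros of the ternary form modulo `ℓ^N` do not exist, for a suitable `N`. If `ℓ` is odd, then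
`N = 2` will do: one of `x² - d y²` (if `ℓ ∤ d`) and `x² - c z²` (if `ℓ ∣ d`) is anisotropic modulo `ℓ`,
and dividing by `ℓ` deals with the third variable. -/
theorem exists_imprimitive : ∃ N : ℕ, N ≠ 0 ∧
    ∀ x y z : ℤ, (ℓ : ℤ) ^ N ∣ x ^ 2 - d * y ^ 2 - jSq d ℓ q * z ^ 2 →
      (ℓ : ℤ) ∣ x ∧ (ℓ : ℤ) ∣ y ∧ (ℓ : ℤ) ∣ z := by
  have hℓ := S.prime_ell
  have hℓz : Prime (ℓ : ℤ) := Nat.prime_iff_prime_int.1 hℓ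
  have hℓ0 : (ℓ : ℤ) ≠ 0 := hℓz.ne_zero
  have : Fact ℓ.Prime := ⟨hℓ⟩
  have hqℓ : ¬ (ℓ : ℤ) ∣ q := by
    intro h1
    have h2 : ℓ ∣ q := by exact_mod_cast h1
    exact S.q_ne_ell ((Nat.prime_dvd_prime_iff_eq hℓ S.prime_q).1 h2).symm
  by_cases hd : (ℓ : ℤ) ∣ d
  · have hc : jSq d ℓ q = -q := by unfold jSq; rw [if_pos hd]
    have hψ := localChar_jSq S.aux hd
    by_cases hℓ2 : ℓ = 2
    · subst hℓ2
      have hqodd : q % 2 = 1 := by omega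
      unfold localChar at hψ
      simp only [ne_eq, not_true_eq_false, if_false] at hψ
      have hcodd : jSq d 2 q % 2 = 1 := by rw [hc]; omega
      rcases mod_of_regular_two d δ hd S.ell_not_dvd with h1 | h1 | h1
      -- the component of `Ψ` at `2` is `χ₋₄`, `χ₈` and `χ₋₄ χ₈` in the three cases
      · rw [if_pos h1, ZMod.χ₄_int_eq_if_mod_four] at hψ
        refine ⟨4, by norm_num, fun x y z => imprimitive_two_of_four h1 ?_⟩
        split_ifs at hψ <;> omega
      · rw [if_neg (by omega), if_pos h1, ZMod.χ₈_int_eq_if_mod_eight] at hψ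
        refine ⟨5, by norm_num, fun x y z => imprimitive_two_of_eight (Or.inl ⟨h1, ?_⟩)⟩
        split_ifs at hψ <;> omega
      · rw [if_neg (by omega), if_neg (by omega)] at hψ
        simp only [ZMod.χ₄_int_eq_if_mod_four, ZMod.χ₈_int_eq_if_mod_eight] at hψ
        refine ⟨5, by norm_num, fun x y z => imprimitive_two_of_eight (Or.inr ⟨h1, ?_⟩)⟩
        split_ifs at hψ <;> omega
    · rw [localChar_self_of_ne_two hℓ2] at hψ
      have hcℓ : ¬ (ℓ : ℤ) ∣ jSq d ℓ q := by rwa [hc, dvd_neg]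
      have h1 : legendreSym ℓ (jSq d ℓ q) = -1 := by
        rw [jacobiSym.legendreSym.to_jacobiSym]
        exact jacobiSym_ne_one hℓ hcℓ hψ
      refine ⟨2, by norm_num, fun x y z h0 => ?_⟩
      obtain ⟨d1, hd1⟩ := hd
      have hd1ℓ : ¬ (ℓ : ℤ) ∣ d1 := by
        rintro ⟨k, hk⟩
        exact not_sq_dvd_of_regular d δ hℓ hℓ2 S.ell_not_dvd ⟨k, by rw [hd1, hk]; ring⟩
      have h2 : (ℓ : ℤ) ∣ x ^ 2 - jSq d ℓ q * z ^ 2 := by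
        have h3 : (ℓ : ℤ) ∣ x ^ 2 - d * y ^ 2 - jSq d ℓ q * z ^ 2 :=
          (dvd_pow_self _ two_ne_zero).trans h0
        have h4 : (ℓ : ℤ) ∣ d * y ^ 2 := ⟨d1 * y ^ 2, by nth_rw 1 [hd1]; ring⟩
        have := dvd_add h3 h4
        rwa [sub_right_comm, sub_add_cancel] at this
      obtain ⟨hx, hz⟩ := legendreSym.prime_dvd_of_eq_neg_one h1 h2
      refine ⟨hx, ?_, hz⟩
      obtain ⟨x', rfl⟩ := hx
      obtain ⟨z', rfl⟩ := hz
      obtain ⟨k, hk⟩ := h0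
      have h5 : (ℓ : ℤ) ∣ d1 * y ^ 2 := by
        refine ⟨x' ^ 2 - jSq d ℓ q * z' ^ 2 - k, mul_left_cancel₀ hℓ0 ?_⟩
        linear_combination -hk - y ^ 2 * hd1
      exact hℓz.dvd_of_dvd_pow ((hℓz.dvd_or_dvd h5).resolve_left hd1ℓ)
  · have hc : jSq d ℓ q = -(ℓ * q) := by unfold jSq; rw [if_neg hd]
    by_cases hℓ2 : ℓ = 2
    · subst hℓ2
      have hqodd : q % 2 = 1 := by omega
      have hd8 : d % 8 = 5 := by
        have hm := h.mod4
        by_contra hne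
        have h1 : d % 8 = 1 := by omega
        have h2 : 0 ≤ -d := by have := h.neg; omega
        obtain ⟨n, hn⟩ := Int.eq_ofNat_of_zero_le h2
        obtain ⟨s, hs⟩ := exists_root_two (d := d) (n := n) (by omega) (four_mul_omNorm d δ) (by omega)
        exact S.ell_inert hd s hs
      refine ⟨3, by norm_num, fun x y z => imprimitive_two_inert hd8 ?_⟩
      rw [hc]; push_cast; omega
    · have h1 : legendreSym ℓ d = -1 := by
        rw [jacobiSym.legendreSym.to_jacobiSym]
        refine jacobiSym_ne_one hℓ hd fun h2 => ?_
        obtain ⟨s, hs⟩ := (exists_root_of_jacobiSym hℓ hℓ2 (four_mul_omNorm d δ) hd).1 h2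
        exact S.ell_inert hd s hs
      refine ⟨2, by norm_num, fun x y z h0 => ?_⟩
      have h2 : (ℓ : ℤ) ∣ x ^ 2 - d * y ^ 2 := by
        have h3 : (ℓ : ℤ) ∣ x ^ 2 - d * y ^ 2 - jSq d ℓ q * z ^ 2 :=
          (dvd_pow_self _ two_ne_zero).trans h0
        have h4 : (ℓ : ℤ) ∣ jSq d ℓ q * z ^ 2 := ⟨-q * z ^ 2, by rw [hc]; ring⟩
        have := dvd_add h3 h4
        rwa [sub_add_cancel] at this
      obtain ⟨hx, hy⟩ := legendreSym.prime_dvd_of_eq_neg_one h1 h2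
      refine ⟨hx, hy, ?_⟩
      obtain ⟨x', rfl⟩ := hx
      obtain ⟨y', rfl⟩ := hy
      obtain ⟨k, hk⟩ := h0
      have h5 : (ℓ : ℤ) ∣ q * z ^ 2 := by
        refine ⟨k - x' ^ 2 + d * y' ^ 2, mul_left_cancel₀ hℓ0 ?_⟩
        rw [hc] at hk
        linear_combination hk
      exact hℓz.dvd_of_dvd_pow ((hℓz.dvd_or_dvd h5).resolve_left hqℓ)

theorem isRamifiedOver_ell [Fact ℓ.Prime] : IsRamifiedOver ℚ_[ℓ] (quatAlg L (jSq d ℓ q)) := by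
  obtain ⟨N, hN, h1⟩ := S.exists_imprimitive
  exact isRamifiedOver_of_ternary d δ _ fun x y z => ternary_anisotropic hN h1

end Setting

end regular

end

noncomputable section

/-! ### Orders, discriminants and maximality -/

/-- A rational number whose powers have a common denominator is an integer. -/
theorem isInt_of_forall_pow {r : ℚ} {m : ℤ} (hm : m ≠ 0)
    (hr : ∀ n : ℕ, ∃ k : ℤ, m * r ^ n = k) : ∃ k : ℤ, r = k := by
  have hden : ∀ n : ℕ, r.den ^ n ∣ m.natAbs := by
    intro n
    obtain ⟨k, hk⟩ := hr n
    have h1 : (m : ℚ) * r.num ^ n = k * r.den ^ n := by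
      rw [← hk, mul_assoc, ← mul_pow, Rat.mul_den_eq_num]
    have h2 : m * r.num ^ n = k * (r.den : ℤ) ^ n := by exact_mod_cast h1
    have h3 : (r.den : ℤ) ^ n ∣ m * r.num ^ n := ⟨k, by rw [h2, mul_comm]⟩
    have h4 : IsCoprime ((r.den : ℤ) ^ n) (r.num ^ n) := by
      apply IsCoprime.pow
      rw [Int.isCoprime_iff_gcd_eq_one, Int.gcd_comm]
      exact r.reduced
    have h5 := h4.dvd_of_dvd_mul_right h3
    have := Int.natAbs_dvd_natAbs.2 h5
    rwa [Int.natAbs_pow, Int.natAbs_natCast] at this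
  have h1 : r.den = 1 := by
    by_contra h1
    have h2 : 1 < r.den := lt_of_le_of_ne r.den_pos (Ne.symm h1)
    have h3 := Nat.le_of_dvd (Int.natAbs_pos.2 hm) (hden m.natAbs)
    exact absurd h3 (not_le.2 (Nat.lt_pow_self h2))
  exact ⟨r.num, by rw [← Rat.den_eq_one_iff r |>.1 h1]; simp⟩

/-- A quadratic form in four variables has a nontrivial zero modulo `p`. -/
theorem exists_isotropic_mod {p : ℕ} (hp : p.Prime) (m : Fin 4 → Fin 4 → ℤ) :
    ∃ x : Fin 4 → ℤ, (∃ i, ¬ (p : ℤ) ∣ x i) ∧ (p : ℤ) ∣ ∑ i, ∑ j, m i j * x i * x j := by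
  classical
  have : Fact p.Prime := ⟨hp⟩
  let f : MvPolynomial (Fin 4) (ZMod p) :=
    ∑ i, ∑ j, MvPolynomial.C (m i j : ZMod p) * MvPolynomial.X i * MvPolynomial.X j
  have hdeg : f.totalDegree < Fintype.card (Fin 4) := by
    have : f.totalDegree ≤ 2 := by
      refine MvPolynomial.totalDegree_finsetSum_le fun i _ =>
        MvPolynomial.totalDegree_finsetSum_le fun j _ => ?_
      refine (MvPolynomial.totalDegree_mul _ _).trans ?_
      have h1 := MvPolynomial.totalDegree_mul (MvPolynomial.C (m i j : ZMod p)) (MvPolynomial.X i : MvPolynomial (Fin 4) (ZMod p))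
      rw [MvPolynomial.totalDegree_C, MvPolynomial.totalDegree_X] at h1
      rw [MvPolynomial.totalDegree_X]
      omega
    simp; omega
  have h1 := char_dvd_card_solutions p hdeg
  have heval : ∀ x : Fin 4 → ZMod p, MvPolynomial.eval x f = ∑ i, ∑ j, m i j * x i * x j := by
    intro x
    simp [f]
  let z : {x : Fin 4 → ZMod p // MvPolynomial.eval x f = 0} := ⟨0, by rw [heval]; simp⟩
  have hpos : 0 < Fintype.card {x : Fin 4 → ZMod p // MvPolynomial.eval x f = 0} :=
    Fintype.card_pos_iff.2 ⟨z⟩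
  have hlt := lt_of_lt_of_le hp.one_lt (Nat.le_of_dvd hpos h1)
  obtain ⟨y, hy⟩ := Fintype.exists_ne_of_one_lt_card hlt z
  choose x hx using fun i => ZMod.intCast_surjective (y.1 i)
  refine ⟨x, ?_, ?_⟩
  · by_contra hne
    push Not at hne
    apply hy
    apply Subtype.ext
    funext i
    change y.1 i = 0
    rw [← hx i, ZMod.intCast_zmod_eq_zero_iff_dvd]
    exact hne i
  · rw [← ZMod.intCast_zmod_eq_zero_iff_dvd]
    have h2 := y.2
    rw [heval] at h2
    push_cast
    simp only [hx]
    exact h2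

/-- Hensel's lemma for a quadratic polynomial with a simple root at `0` modulo `p`. -/
theorem exists_root_near_zero {p : ℕ} [hp : Fact p.Prime] {n b a : ℤ} (hn : (p : ℤ) ∣ n)
    (hb : ¬ (p : ℤ) ∣ b) : ∃ t : ℤ_[p], (n : ℤ_[p]) + b * t + a * t ^ 2 = 0 ∧ ‖t‖ < 1 := by
  let F : Polynomial ℤ_[p] := Polynomial.C (n : ℤ_[p]) + Polynomial.C (b : ℤ_[p]) * Polynomial.X +
    Polynomial.C (a : ℤ_[p]) * Polynomial.X ^ 2
  have hF : ∀ t : ℤ_[p], Polynomial.aeval t F = n + b * t + a * t ^ 2 := fun t => by simp [F]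
  have hF' : Polynomial.aeval (0 : ℤ_[p]) F.derivative = b := by simp [F]
  have hb1 : ‖(b : ℤ_[p])‖ = 1 := by
    refine le_antisymm (PadicInt.norm_le_one _) (not_lt.1 fun h1 => hb ?_)
    exact (PadicInt.norm_int_lt_one_iff_dvd b).1 h1
  have hn1 : ‖(n : ℤ_[p])‖ < 1 := (PadicInt.norm_int_lt_one_iff_dvd n).2 hn
  obtain ⟨t, h1, h2, -⟩ := hensels_lemma (F := F) (a := (0 : ℤ_[p])) (by
    rw [hF, hF', hb1]; simpa using hn1)
  rw [hF', hb1, sub_zero] at h2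
  rw [hF] at h1
  exact ⟨t, h1, h2⟩

section order

variable {L : Type*} [Field L] [CharZero L] [StarRing L]
variable (d : ℤ) (δ : L) [h : ImagQuad L d δ] {c : ℤ}

theorem IsOrder.pow_mem {A : Type*} [Ring A] [Algebra ℚ A] {R : Submodule ℤ A} (hR : IsOrder R)
    {x : A} (hx : x ∈ R) (n : ℕ) : x ^ n ∈ R := by
  induction n with
  | zero => rw [pow_zero]; exact hR.one_mem
  | succ n ih => rw [pow_succ]; exact hR.mul_mem _ ih _ hx

/-- The quaternions with coordinates in the quadratic order. -/
def quatSpan (c : ℤ) : Submodule ℤ (quatAlg L c) where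
  carrier := {x | ∃ α ∈ quadOrder d δ, ∃ β ∈ quadOrder d δ, x = quat c α β}
  add_mem' := by
    rintro _ _ ⟨α, hα, β, hβ, rfl⟩ ⟨α', hα', β', hβ', rfl⟩
    exact ⟨_, add_mem hα hα', _, add_mem hβ hβ', quat_add _ _ _ _⟩
  zero_mem' := ⟨0, zero_mem _, 0, zero_mem _, quat_zero.symm⟩
  smul_mem' := by
    rintro n _ ⟨α, hα, β, hβ, rfl⟩
    exact ⟨_, mul_mem (intCast_mem _ n) hα, _, mul_mem (intCast_mem _ n) hβ, quat_zsmul _ _ _⟩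

/-- The nonzero integers. -/
def nonzeroInt : Submonoid ℤ where
  carrier := {n | n ≠ 0}
  one_mem' := one_ne_zero
  mul_mem' := mul_ne_zero

include h

theorem exists_smul_mem_quatSpan (x : quatAlg L c) : ∃ n : ℤ, n ≠ 0 ∧ n • x ∈ quatSpan d δ c := by
  obtain ⟨α, β, rfl⟩ := exists_quat x
  obtain ⟨m, hm, hm1⟩ := exists_int_smul_mem d δ α
  obtain ⟨n, hn, hn1⟩ := exists_int_smul_mem d δ β
  rw [zsmul_eq_mul] at hm1 hn1
  refine ⟨m * n, mul_ne_zero hm hn, (m * n : ℤ) * α, ?_, (m * n : ℤ) * β, ?_, quat_zsmul _ _ _⟩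
  · have := mul_mem (intCast_mem (quadOrder d δ) n) hm1
    convert this using 1
    push_cast; ring
  · have := mul_mem (intCast_mem (quadOrder d δ) m) hn1
    convert this using 1
    push_cast; ring

theorem redNorm_zsmul (n : ℤ) (x : quatAlg L c) : redNorm (n • x) = (n : ℚ) ^ 2 * redNorm x := by
  rw [← redNorm_ratCast d δ (c := c), ← redNorm_mul d δ, ← Algebra.smul_def, Int.cast_smul_eq_zsmul]

/-- The reduced norm is integral on orders, as the powers of an element have bounded
denominators. -/
theorem IsOrder.exists_redNorm_eq {R : Submodule ℤ (quatAlg L c)} (hR : IsOrder R)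
    {x : quatAlg L c} (hx : x ∈ R) : ∃ n : ℤ, redNorm x = n := by
  obtain ⟨n, hn, hn1⟩ := exists_uniform_smul_mem nonzeroInt (Λ' := quatSpan d δ c) hR.fg
    fun x _ => exists_smul_mem_quatSpan d δ x
  have hn0 : n ≠ 0 := hn
  refine isInt_of_forall_pow (m := n ^ 2) (pow_ne_zero 2 hn0) fun k => ?_
  have hpow : ∀ k : ℕ, redNorm (x ^ k) = redNorm x ^ k := by
    intro k
    induction k with
    | zero => rw [pow_zero, pow_zero, redNorm_one d δ]
    | succ k ih => rw [pow_succ, pow_succ, redNorm_mul d δ, ih]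
  obtain ⟨α, hα, β, hβ, h1⟩ := hn1 _ (hR.pow_mem hx k)
  obtain ⟨a, ha⟩ := exists_nm_eq d δ hα
  obtain ⟨b, hb⟩ := exists_nm_eq d δ hβ
  refine ⟨a - c * b, ?_⟩
  push_cast
  rw [← hpow, ← redNorm_zsmul d δ, h1, redNorm_quat, ha, hb]

theorem IsOrder.exists_redTrace_eq {R : Submodule ℤ (quatAlg L c)} (hR : IsOrder R)
    {x : quatAlg L c} (hx : x ∈ R) : ∃ n : ℤ, redTrace x = n := by
  obtain ⟨a, ha⟩ := hR.exists_redNorm_eq d δ hx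
  obtain ⟨b, hb⟩ := hR.exists_redNorm_eq d δ (add_mem hx hR.one_mem)
  have h1 := redNorm_add d δ x 1
  have h2 : quatConj (1 : quatAlg L c) = 1 := by
    rw [← quat_one, quatConj_quat]; simp
  rw [h2, mul_one, redNorm_one d δ, ha, hb] at h1
  exact ⟨b - a - 1, by push_cast; linarith⟩

theorem quatConj_eq (x : quatAlg L c) : quatConj x = algebraMap ℚ _ (redTrace x) - x := by
  rw [← add_quatConj d δ]; abel

theorem IsOrder.quatConj_mem {R : Submodule ℤ (quatAlg L c)} (hR : IsOrder R)
    {x : quatAlg L c} (hx : x ∈ R) : quatConj x ∈ R := by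
  obtain ⟨n, hn⟩ := hR.exists_redTrace_eq d δ hx
  rw [quatConj_eq d δ, hn]
  refine sub_mem ?_ hx
  have := R.smul_mem n hR.one_mem
  rwa [zsmul_eq_mul, mul_one, ← map_intCast (algebraMap ℚ (quatAlg L c))] at this

omit h in
theorem basis_sum_coe {ι : Type*} [Fintype ι] {R : Submodule ℤ (quatAlg L c)}
    (b : Module.Basis ι ℤ R) {x : quatAlg L c} (hx : x ∈ R) :
    x = ∑ i, b.repr ⟨x, hx⟩ i • (b i : quatAlg L c) := by
  have h1 := congrArg R.subtype (b.sum_repr ⟨x, hx⟩)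
  rw [map_sum] at h1
  exact h1.symm

/-- An order has a `ℤ`-basis of four elements. -/
theorem IsOrder.exists_basis {R : Submodule ℤ (quatAlg L c)} (hR : IsOrder R) :
    Nonempty (Module.Basis (Fin 4) ℤ R) := by
  have : Module.Finite ℤ R := Module.Finite.iff_fg.2 hR.fg
  have : Module.Finite ℚ (quatAlg L c) := Module.Finite.of_basis (quatBasis d δ (c := c))
  have : IsAddTorsionFree (quatAlg L c) := IsAddTorsionFree.of_module_rat _
  have : Module.Free ℤ R := inferInstance
  let b := Module.finBasis ℤ R
  have hli : LinearIndependent ℚ fun i => (b i : quatAlg L c) := by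
    rw [← LinearIndependent.iff_fractionRing ℤ ℚ]
    exact b.linearIndependent.map' R.subtype (by simp)
  have hsp : Submodule.span ℚ (Set.range fun i => (b i : quatAlg L c)) = ⊤ := by
    rw [eq_top_iff, ← hR.span_eq_top, Submodule.span_le]
    intro x hx
    rw [basis_sum_coe b hx]
    refine Submodule.sum_mem _ fun i _ => ?_
    rw [← Int.cast_smul_eq_zsmul ℚ]
    exact Submodule.smul_mem _ _ (Submodule.subset_span ⟨i, rfl⟩)
  have h1 := Module.finrank_eq_card_basis (Module.Basis.mk hli hsp.ge)
  rw [finrank_quatAlg d δ, Fintype.card_fin] at h1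
  exact ⟨b.reindex (finCongr h1.symm)⟩

omit h in
theorem linearIndependent_basis {R : Submodule ℤ (quatAlg L c)} (e : Module.Basis (Fin 4) ℤ R) :
    LinearIndependent ℚ fun i => (e i : quatAlg L c) := by
  rw [← LinearIndependent.iff_fractionRing ℤ ℚ]
  exact e.linearIndependent.map' R.subtype (by simp)

/-- The Gram matrix of the reduced trace. -/
def gram {R : Submodule ℤ (quatAlg L c)} (e : Module.Basis (Fin 4) ℤ R) : Matrix (Fin 4) (Fin 4) ℚ :=
  Matrix.of fun i k => redTrace ((e i : quatAlg L c) * (e k : quatAlg L c))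

theorem IsOrder.exists_gram_eq {R : Submodule ℤ (quatAlg L c)} (hR : IsOrder R)
    (e : Module.Basis (Fin 4) ℤ R) : ∃ G : Matrix (Fin 4) (Fin 4) ℤ,
      gram e = G.map (Int.cast : ℤ → ℚ) ∧ (gram e).det = (G.det : ℤ) := by
  choose G hG using fun i k => hR.exists_redTrace_eq d δ (hR.mul_mem _ (e i).2 _ (e k).2)
  have h1 : gram e = (Matrix.of G).map (Int.cast : ℤ → ℚ) := by
    ext i k
    exact hG i k
  refine ⟨Matrix.of G, h1, ?_⟩
  rw [h1]
  have := (Int.castRingHom ℚ).map_det (Matrix.of G)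
  exact this.symm

theorem redTrace_zero : redTrace (0 : quatAlg L c) = 0 := by
  have := redTrace_qsmul d δ 0 (0 : quatAlg L c)
  simpa using this

theorem redTrace_sum {ι : Type*} (s : Finset ι) (f : ι → quatAlg L c) :
    redTrace (∑ i ∈ s, f i) = ∑ i ∈ s, redTrace (f i) := by
  classical
  induction s using Finset.induction_on with
  | empty => simp [redTrace_zero d δ]
  | insert a s ha ih => rw [Finset.sum_insert ha, Finset.sum_insert ha, redTrace_add d δ, ih]

theorem redTrace_zsmul (n : ℤ) (x : quatAlg L c) : redTrace (n • x) = n * redTrace x := by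
  rw [← Int.cast_smul_eq_zsmul ℚ, redTrace_qsmul d δ]

theorem quatConj_zsmul (n : ℤ) (x : quatAlg L c) : quatConj (n • x) = n • quatConj x := by
  rw [quatConj_eq d δ, quatConj_eq d δ, redTrace_zsmul d δ, zsmul_eq_mul, zsmul_eq_mul, mul_sub,
    map_mul, map_intCast]

theorem redNorm_eq_coord (s t u v : ℚ) :
    redNorm (quat c ((s : L) + t * δ) ((u : L) + v * δ)) =
      s ^ 2 - d * t ^ 2 - c * u ^ 2 + c * d * v ^ 2 := by
  rw [redNorm_quat, nm_coord d δ, nm_coord d δ]; ring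

/-- If some `v`, `w` satisfy `nrd v ≡ 0` and `trd (v w̄) ≢ 0` modulo `p`, then `B` splits at `p`. -/
theorem not_isRamifiedOver_of_isotropic {p : ℕ} [hp : Fact p.Prime] {v w : quatAlg L c} {n b a : ℤ}
    (hn : redNorm v = n) (hb : redTrace (v * quatConj w) = b) (ha : redNorm w = a)
    (hpn : (p : ℤ) ∣ n) (hpb : ¬ (p : ℤ) ∣ b) : ¬ IsRamifiedOver ℚ_[p] (quatAlg L c) := by
  intro hram
  rw [isRamifiedOver_iff d δ] at hram
  obtain ⟨t, h1, h2⟩ := exists_root_near_zero (a := a) hpn hpb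
  have h3 := redNorm_add d δ v w
  rw [hb] at h3
  obtain ⟨α, β, rfl⟩ := exists_quat v
  obtain ⟨α', β', rfl⟩ := exists_quat w
  obtain ⟨x1, x2, rfl⟩ := exists_coord d δ α
  obtain ⟨x3, x4, rfl⟩ := exists_coord d δ β
  obtain ⟨y1, y2, rfl⟩ := exists_coord d δ α'
  obtain ⟨y3, y4, rfl⟩ := exists_coord d δ β'
  have e1 : ((x1 : L) + x2 * δ) + (y1 + y2 * δ) = ((x1 + y1 : ℚ) : L) + ((x2 + y2 : ℚ) : L) * δ := by
    push_cast; ring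
  have e2 : ((x3 : L) + x4 * δ) + (y3 + y4 * δ) = ((x3 + y3 : ℚ) : L) + ((x4 + y4 : ℚ) : L) * δ := by
    push_cast; ring
  rw [quat_add, e1, e2, redNorm_eq_coord d δ, redNorm_eq_coord d δ, redNorm_eq_coord d δ] at h3
  rw [redNorm_eq_coord d δ] at hn ha
  have hb' : 2 * (x1 * y1 - d * x2 * y2 - c * x3 * y3 + c * d * x4 * y4) = b := by
    linear_combination h3
  have hn2 := congrArg (Rat.cast (K := ℚ_[p])) hn
  have ha2 := congrArg (Rat.cast (K := ℚ_[p])) ha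
  have hb2 := congrArg (Rat.cast (K := ℚ_[p])) hb'
  push_cast at hn2 ha2 hb2
  have ht := congrArg (fun z : ℤ_[p] => (z : ℚ_[p])) h1
  simp only [PadicInt.coe_add, PadicInt.coe_mul, PadicInt.coe_pow, PadicInt.coe_intCast,
    PadicInt.coe_zero] at ht
  obtain ⟨z1, z2, z3, z4⟩ := hram (x1 + t * y1) (x2 + t * y2) (x3 + t * y3) (x4 + t * y4) (by
    rw [← hn2, ← ha2, ← hb2] at ht
    linear_combination ht)
  have hbt : (b : ℤ_[p]) = -(t * (a + a : ℤ)) := by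
    apply Subtype.coe_injective
    push_cast
    rw [← hb2, ← ha2]
    linear_combination 2 * y1 * z1 - 2 * d * y2 * z2 - 2 * c * y3 * z3 + 2 * c * d * y4 * z4
  apply hpb
  rw [← PadicInt.norm_int_lt_one_iff_dvd, hbt, norm_neg, norm_mul]
  calc ‖t‖ * ‖((a + a : ℤ) : ℤ_[p])‖ ≤ ‖t‖ * 1 :=
        mul_le_mul_of_nonneg_left (PadicInt.norm_le_one _) (norm_nonneg _)
    _ < 1 := by rwa [mul_one]

/-- An algebra that contains an order of discriminant prime to `p` splits at `p`: the norm form is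
isotropic modulo `p` by the theorem of Chevalley and Warning, and nondegenerate, so that a zero
lifts. -/
theorem IsOrder.not_isRamifiedOver {R : Submodule ℤ (quatAlg L c)} (hR : IsOrder R)
    (e : Module.Basis (Fin 4) ℤ R) {p : ℕ} [hp : Fact p.Prime] {D : ℤ} (hD : (gram e).det = D)
    (hpD : ¬ (p : ℤ) ∣ D) : ¬ IsRamifiedOver ℚ_[p] (quatAlg L c) := by
  obtain ⟨G, hG, hGD⟩ := hR.exists_gram_eq d δ e
  have hdet : G.det = D := by rw [hD] at hGD; exact_mod_cast hGD.symm
  choose N hN using fun i => hR.exists_redNorm_eq d δ (e i).2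
  choose T hT using fun i k => hR.exists_redTrace_eq d δ
    (hR.mul_mem _ (e i).2 _ (hR.quatConj_mem d δ (e k).2))
  -- the norm form on the basis, with its mixed terms above the diagonal
  obtain ⟨x, ⟨i0, hi0⟩, hx⟩ := exists_isotropic_mod hp.out
    fun i j => if i = j then N i else if i < j then T i j else 0
  let v : quatAlg L c := ∑ i, x i • (e i : quatAlg L c)
  have hnv : redNorm v = ((∑ i, ∑ j, (if i = j then N i else if i < j then T i j else 0) * x i * x j : ℤ) : ℚ) := by
    simp only [v, Fin.sum_univ_four]
    rw [redNorm_add d δ, redNorm_add d δ, redNorm_add d δ]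
    simp only [quatConj_zsmul d δ, add_mul, redTrace_add d δ, smul_mul_assoc, mul_smul_comm,
      redTrace_zsmul d δ, redNorm_zsmul d δ, hN, hT]
    simp
    ring
  have hvG : ∀ k, redTrace (v * (e k : quatAlg L c)) = ((Matrix.vecMul x G k : ℤ) : ℚ) := by
    intro k
    simp only [v, Finset.sum_mul, redTrace_sum d δ, smul_mul_assoc, redTrace_zsmul d δ,
      Matrix.vecMul, dotProduct]
    push_cast
    refine Finset.sum_congr rfl fun i _ => ?_
    have : gram e i k = (G i k : ℚ) := by rw [hG]; rfl
    rw [← this]; rfl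
  -- the Gram matrix is invertible modulo `p`, so some basis element pairs nontrivially with `v`
  obtain ⟨k, hk⟩ : ∃ k, ¬ (p : ℤ) ∣ Matrix.vecMul x G k := by
    by_contra hne
    push Not at hne
    apply hi0
    have h1 : Matrix.vecMul (fun i => (x i : ZMod p)) (G.map (Int.cast : ℤ → ZMod p)) = 0 := by
      funext k
      have := (ZMod.intCast_zmod_eq_zero_iff_dvd _ p).2 (hne k)
      simp only [Matrix.vecMul, dotProduct] at this ⊢
      push_cast at this
      simpa using this
    have h2 : (G.map (Int.cast : ℤ → ZMod p)).det ≠ 0 := by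
      have h3 := (Int.castRingHom (ZMod p)).map_det G
      have h4 : (G.map (Int.cast : ℤ → ZMod p)).det = ((G.det : ℤ) : ZMod p) := h3.symm
      rw [h4, hdet, Ne, ZMod.intCast_zmod_eq_zero_iff_dvd]
      exact hpD
    have h3 := congrFun (Matrix.eq_zero_of_vecMul_eq_zero h2 h1) i0
    exact (ZMod.intCast_zmod_eq_zero_iff_dvd _ p).1 h3
  refine not_isRamifiedOver_of_isotropic d δ (w := quatConj (e k : quatAlg L c)) hnv ?_ ?_ hx hk
    (a := N k)
  · rw [quatConj_quatConj]; exact hvG k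
  · rw [redNorm_quatConj d δ, hN]

/-- If the pairings of `y` with an order of discriminant `D` are `m`-integral, then `D y` lies in
the order at `m`. -/
theorem IsOrder.smul_mem_locAt_of_dual {R : Submodule ℤ (quatAlg L c)}
    (hR : IsOrder R) (e : Module.Basis (Fin 4) ℤ R) {m : ℤ} {D : ℤ} (hD : (gram e).det = D)
    {y : quatAlg L c}
    (hy : ∀ r ∈ R, ∃ n : ℤ, IsCoprime n m ∧ ∃ k : ℤ, n * redTrace (y * r) = k) : D • y ∈ locAt m R := by
  obtain ⟨G, hG, hGD⟩ := hR.exists_gram_eq d δ e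
  have hdet : G.det = D := by rw [hD] at hGD; exact_mod_cast hGD.symm
  choose n hn k hk using fun i => hy _ (e i).2
  have hsp := hR.span_eq_top
  let b : Module.Basis (Fin 4) ℚ (quatAlg L c) := basisOfLinearIndependentOfCardEqFinrank
    (linearIndependent_basis e) (by rw [finrank_quatAlg d δ]; simp)
  have hb : ∀ i, b i = (e i : quatAlg L c) := fun i => by simp [b]
  let y' : Fin 4 → ℚ := fun i => b.repr y i
  have hy' : y = ∑ i, y' i • (e i : quatAlg L c) := by
    conv_lhs => rw [← b.sum_repr y]
    simp [hb, y']
  have htr : ∀ i, Matrix.vecMul y' (gram e) i = redTrace (y * (e i : quatAlg L c)) := by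
    intro i
    conv_rhs => rw [hy']
    simp only [Finset.sum_mul, redTrace_sum d δ, smul_mul_assoc, redTrace_qsmul d δ,
      Matrix.vecMul, dotProduct]
    rfl
  let n0 := ∏ i, n i
  have hn0 : IsCoprime n0 m := IsCoprime.prod_left fun i _ => hn i
  have hk0 : ∀ i, ∃ k : ℤ, n0 * redTrace (y * (e i : quatAlg L c)) = k := by
    intro i
    refine ⟨(∏ j ∈ Finset.univ.erase i, n j) * k i, ?_⟩
    have : n0 = (∏ j ∈ Finset.univ.erase i, n j) * n i := by
      rw [mul_comm]
      exact (Finset.mul_prod_erase Finset.univ n (Finset.mem_univ i)).symm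
    rw [this]
    push_cast
    rw [mul_assoc, hk]
  choose k0 hk0 using hk0
  -- Cramer's rule
  have hcr : ∀ i, (n0 : ℚ) * D * y' i = ((Matrix.vecMul k0 G.adjugate i : ℤ) : ℚ) := by
    intro i
    have h1 : Matrix.vecMul (Matrix.vecMul y' (gram e)) (gram e).adjugate = (D : ℚ) • y' := by
      rw [Matrix.vecMul_vecMul, Matrix.mul_adjugate, hD, Matrix.vecMul_smul, Matrix.vecMul_one]
    have h2 : (n0 : ℚ) • Matrix.vecMul y' (gram e) = fun i => ((k0 i : ℤ) : ℚ) := by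
      funext i
      rw [Pi.smul_apply, htr, smul_eq_mul, hk0]
    have h3 : (gram e).adjugate = G.adjugate.map (Int.cast : ℤ → ℚ) := by
      rw [hG]
      exact ((Int.castRingHom ℚ).map_adjugate G).symm
    have h4 := congrFun (congrArg (fun v => (n0 : ℚ) • v) h1) i
    simp only [← Matrix.smul_vecMul, h2, h3] at h4
    rw [Pi.smul_apply, Pi.smul_apply, smul_eq_mul, smul_eq_mul] at h4
    rw [mul_assoc, ← h4]
    simp [Matrix.vecMul, dotProduct]
  refine mem_locAt.2 ⟨n0, hn0, ?_⟩
  have h5 : n0 • D • y = ∑ i, (Matrix.vecMul k0 G.adjugate i) • (e i : quatAlg L c) := by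
    conv_lhs => rw [hy']
    rw [← mul_zsmul, ← Int.cast_smul_eq_zsmul ℚ, Finset.smul_sum]
    refine Finset.sum_congr rfl fun i _ => ?_
    rw [← Int.cast_smul_eq_zsmul ℚ, smul_smul, ← hcr]
    push_cast; rfl
  rw [h5]
  exact Submodule.sum_mem _ fun i _ => R.smul_mem _ (e i).2

theorem IsOrder.mem_locAt_of_dual {R : Submodule ℤ (quatAlg L c)}
    (hR : IsOrder R) (e : Module.Basis (Fin 4) ℤ R) {m : ℤ} {D : ℤ} (hD : (gram e).det = D)
    (hmD : IsCoprime D m) {y : quatAlg L c}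
    (hy : ∀ r ∈ R, ∃ n : ℤ, IsCoprime n m ∧ ∃ k : ℤ, n * redTrace (y * r) = k) : y ∈ locAt m R :=
  mem_locAt_of_smul_mem hmD (hR.smul_mem_locAt_of_dual d δ e hD hy)

/-- An order of discriminant `ℓ²` is maximal if `B` is ramified at `ℓ`, as a larger order would
have discriminant `1`. -/
theorem IsOrder.isMaximalOrder {R : Submodule ℤ (quatAlg L c)} (hR : IsOrder R) {ℓ : ℕ}
    [hℓ : Fact ℓ.Prime] (hdisc : HasDiscriminant R ((ℓ : ℚ) ^ 2))
    (hram : IsRamifiedOver ℚ_[ℓ] (quatAlg L c)) : IsMaximalOrder R := by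
  refine ⟨hR, fun S hS hRS => ?_⟩
  obtain ⟨e, he⟩ := hdisc
  obtain ⟨f⟩ := hS.exists_basis d δ
  let P : Matrix (Fin 4) (Fin 4) ℤ := Matrix.of fun i j => f.repr ⟨e i, hRS (e i).2⟩ j
  have hP : ∀ i, (e i : quatAlg L c) = ∑ j, P i j • (f j : quatAlg L c) := by
    intro i
    exact basis_sum_coe f (hRS (e i).2)
  have hGP : gram e = P.map (Int.cast : ℤ → ℚ) * gram f * (P.map (Int.cast : ℤ → ℚ)).transpose := by
    ext i k
    change redTrace ((e i : quatAlg L c) * (e k : quatAlg L c)) = _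
    rw [hP i, hP k]
    simp only [Finset.sum_mul, Finset.mul_sum, redTrace_sum d δ, smul_mul_assoc, mul_smul_comm,
      redTrace_zsmul d δ, Matrix.mul_apply, Matrix.transpose_apply, Matrix.map_apply]
    refine Finset.sum_congr rfl fun j _ => ?_
    refine Finset.sum_congr rfl fun i' _ => ?_
    change _ = _ * redTrace ((f i' : quatAlg L c) * (f j : quatAlg L c)) * _
    ring
  obtain ⟨G, hG, hGD⟩ := hS.exists_gram_eq d δ f
  have hdet : (gram e).det = ((P.det ^ 2 * G.det : ℤ) : ℚ) := by
    have h1 : (P.map (Int.cast : ℤ → ℚ)).det = ((P.det : ℤ) : ℚ) :=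
      ((Int.castRingHom ℚ).map_det P).symm
    rw [hGP, Matrix.det_mul, Matrix.det_mul, Matrix.det_transpose, hGD, h1]
    push_cast; ring
  have hdet2 : P.det.natAbs ^ 2 * G.det.natAbs = ℓ ^ 2 := by
    have h1 : |(gram e).det| = (ℓ : ℚ) ^ 2 := he
    rw [hdet] at h1
    have h2 : |P.det ^ 2 * G.det| = ((ℓ ^ 2 : ℕ) : ℤ) := by
      have h3 : ((|P.det ^ 2 * G.det| : ℤ) : ℚ) = (((ℓ ^ 2 : ℕ) : ℤ) : ℚ) := by
        rw [Int.cast_abs, h1]; push_cast; rfl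
      exact_mod_cast h3
    rw [Int.abs_eq_natAbs, Int.natAbs_mul, Int.natAbs_pow] at h2
    exact_mod_cast h2
  have hℓG : (ℓ : ℤ) ∣ G.det := by
    by_contra hne
    exact hS.not_isRamifiedOver d δ f hGD hne hram
  have hℓG' : ℓ ∣ G.det.natAbs := Int.natCast_dvd.1 hℓG
  -- `det P² · disc S = ℓ²` and `ℓ` divides `disc S`
  have hPunit : IsUnit P.det := by
    obtain ⟨k, hk⟩ := hℓG'
    have hℓ0 := hℓ.out.pos
    have h1 : P.det.natAbs ^ 2 * k = ℓ := by
      apply Nat.eq_of_mul_eq_mul_left hℓ0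
      rw [hk] at hdet2
      linarith
    have h2 : P.det.natAbs ^ 2 ∣ ℓ := ⟨k, h1.symm⟩
    rw [Int.isUnit_iff_natAbs_eq]
    rcases (Nat.dvd_prime hℓ.out).1 h2 with h3 | h3
    · exact (Nat.pow_eq_one.1 h3).resolve_right two_ne_zero
    · exfalso
      rw [← h3] at hℓ
      have := hℓ.out
      exact Nat.Prime.not_prime_pow (n := 2) le_rfl this
  obtain ⟨Q, hQ⟩ : ∃ Q : Matrix (Fin 4) (Fin 4) ℤ, Q * P = 1 := ⟨P⁻¹, Matrix.nonsing_inv_mul P hPunit⟩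
  refine le_antisymm ?_ hRS
  intro x hx
  have h1 : ∀ j, (f j : quatAlg L c) ∈ R := by
    intro j
    have h2 : (f j : quatAlg L c) = ∑ i, Q j i • (e i : quatAlg L c) := by
      have h3 : ∀ k, ∑ i, Q j i * P i k = (1 : Matrix (Fin 4) (Fin 4) ℤ) j k := by
        intro k
        rw [← hQ, Matrix.mul_apply]
      simp only [hP, zsmul_eq_mul, Finset.mul_sum, ← mul_assoc, ← Int.cast_mul]
      rw [Finset.sum_comm]
      simp only [← Finset.sum_mul, ← Int.cast_sum, h3]
      simp [Matrix.one_apply]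
    rw [h2]
    exact Submodule.sum_mem _ fun i _ => R.smul_mem _ (e i).2
  rw [basis_sum_coe f hx]
  exact Submodule.sum_mem _ fun j _ => R.smul_mem _ (h1 j)

variable {d δ} {ℓ q : ℕ} {𝔩 𝔮 : Ideal (quadOrder d δ)}

namespace Setting

variable (S : Setting d δ ℓ q 𝔩 𝔮)
  {𝔞 : Ideal (quadOrder d δ)} {lam : quadOrder d δ} (ha : IsGoodIdeal 𝔞)
  (hlam : IsAdmissible d δ ℓ q 𝔮 𝔞 lam)
include S ha hlam

theorem isMaximalOrder : IsMaximalOrder (quatOrder d δ ℓ q 𝔩 𝔮 𝔞 lam) := by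
  have : Fact ℓ.Prime := ⟨S.prime_ell⟩
  exact (S.isOrder ha hlam).isMaximalOrder d δ (S.hasDiscriminant ha hlam) S.isRamifiedOver_ell

theorem exists_basis_gram : ∃ (e : Module.Basis (Fin 4) ℤ (quatOrder d δ ℓ q 𝔩 𝔮 𝔞 lam)) (D : ℤ),
    (gram e).det = D ∧ D.natAbs = ℓ ^ 2 := by
  obtain ⟨e, he⟩ := S.hasDiscriminant ha hlam
  obtain ⟨G, hG, hGD⟩ := (S.isOrder ha hlam).exists_gram_eq d δ e
  refine ⟨e, G.det, hGD, ?_⟩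
  have h1 : |(gram e).det| = (ℓ : ℚ) ^ 2 := he
  rw [hGD] at h1
  have h2 : ((|G.det| : ℤ) : ℚ) = (((ℓ ^ 2 : ℕ) : ℤ) : ℚ) := by
    rw [Int.cast_abs, h1]; push_cast; rfl
  have h3 : |G.det| = ((ℓ ^ 2 : ℕ) : ℤ) := by exact_mod_cast h2
  rw [Int.abs_eq_natAbs] at h3
  exact_mod_cast h3

/-- `B` is ramified exactly at `ℓ` and `∞`. -/
theorem isQuaternionRamifiedExactlyAt :
    IsQuaternionRamifiedExactlyAt ℓ (quatAlg L (jSq d ℓ q)) where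
  central := isCentral_quatAlg d δ
  simple := isSimpleRing_quatAlg d δ S.jSq_neg
  finrank := finrank_quatAlg d δ
  finite_place := by
    intro p hp
    constructor
    · intro hram
      by_contra hne
      obtain ⟨e, D, hD, hDℓ⟩ := S.exists_basis_gram ha hlam
      refine (S.isOrder ha hlam).not_isRamifiedOver d δ e hD ?_ hram
      intro hpD
      have h1 : p ∣ ℓ ^ 2 := by rw [← hDℓ]; exact Int.natCast_dvd.1 hpD
      exact hne ((Nat.prime_dvd_prime_iff_eq hp.out S.prime_ell).1 (hp.out.dvd_of_dvd_pow h1))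
    · rintro rfl
      exact S.isRamifiedOver_ell
  infinite_place := isRamifiedOver_real d δ S.jSq_neg

end Setting

end order

end

noncomputable section

/-! ### Existence of the local choices -/

theorem exists_sq_modEq {p : ℕ} (hp : p.Prime) (hp2 : p ≠ 2) {a s : ℤ} (ha : ¬ (p : ℤ) ∣ a)
    (hs : (p : ℤ) ∣ s ^ 2 - a) (k : ℕ) : ∃ t : ℤ, (p : ℤ) ^ k ∣ t ^ 2 - a := by
  have hpz : Prime (p : ℤ) := Nat.prime_iff_prime_int.1 hp
  suffices H : ∀ k : ℕ, ∃ t : ℤ, (p : ℤ) ^ (k + 1) ∣ t ^ 2 - a by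
    obtain ⟨t, ht⟩ := H k
    exact ⟨t, (pow_dvd_pow _ (Nat.le_succ k)).trans ht⟩
  intro k
  induction k with
  | zero => exact ⟨s, by simpa using hs⟩
  | succ k ih =>
    obtain ⟨t, j, hj⟩ := ih
    have hpt : ¬ (p : ℤ) ∣ 2 * t := by
      intro h1
      rcases hpz.dvd_or_dvd h1 with h2 | h2
      · exact hp2 ((Nat.prime_dvd_prime_iff_eq hp Nat.prime_two).1 (by exact_mod_cast h2))
      · apply ha
        have h3 : (p : ℤ) ∣ t ^ 2 := dvd_pow h2 two_ne_zero
        have h4 : (p : ℤ) ∣ t ^ 2 - a := ⟨p ^ k * j, by rw [hj]; ring⟩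
        have := dvd_sub h3 h4
        rwa [sub_sub_cancel] at this
    obtain ⟨u, w, huw⟩ := (isCoprime_prime_iff hp).2 hpt
    refine ⟨t + p ^ (k + 1) * (-(j * u)), j * w + p ^ k * (j * u) ^ 2, ?_⟩
    have : a = t ^ 2 - p ^ (k + 1) * j := by rw [← hj]; ring
    rw [this]
    linear_combination p ^ (k + 1) * j * (-huw)

theorem exists_sq_modEq_two {a : ℤ} (ha : a % 8 = 1) (k : ℕ) : ∃ t : ℤ, (2 : ℤ) ^ k ∣ t ^ 2 - a := by
  suffices H : ∀ k : ℕ, ∃ t : ℤ, t % 2 = 1 ∧ (2 : ℤ) ^ (k + 3) ∣ t ^ 2 - a by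
    obtain ⟨t, -, ht⟩ := H k
    exact ⟨t, (pow_dvd_pow _ (by omega)).trans ht⟩
  intro k
  induction k with
  | zero => exact ⟨1, rfl, by norm_num; omega⟩
  | succ k ih =>
    obtain ⟨t, ht, j, hj⟩ := ih
    have hj' : a = t ^ 2 - 2 ^ (k + 3) * j := by rw [← hj]; ring
    rcases Int.even_or_odd' j with ⟨i, hi | hi⟩
    · exact ⟨t, ht, i, by rw [hj, hi]; ring⟩
    · obtain ⟨r, rfl⟩ : ∃ r, t = 2 * r + 1 := ⟨t / 2, by omega⟩
      refine ⟨2 * r + 1 + 2 ^ (k + 2), ?_, i + r + 1 + 2 ^ k, ?_⟩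
      · have : (2 : ℤ) ^ (k + 2) = 2 * 2 ^ (k + 1) := by ring
        omega
      · rw [hj', hi]; ring

theorem two_pow_dvd_of_mod {v k : ℕ} {a : ℤ} (hv : (2 : ℤ) ^ v ∣ a) {b : ℤ} (hb : b % 2 = 1)
    (ha : a = 2 ^ k * b) : (2 : ℤ) ^ v ∣ 2 ^ k := by
  rw [ha] at hv
  refine (IsCoprime.pow_left ?_).dvd_of_dvd_mul_right hv
  exact ⟨-(b / 2), 1, by omega⟩

section choice

variable {L : Type*} [Field L] [CharZero L] [StarRing L]
variable (d : ℤ) (δ : L) [h : ImagQuad L d δ]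
include h

theorem norm_sqrtElem_mul (z : quadOrder d δ) :
    Algebra.norm ℤ (z * sqrtElem d δ) = -d * Algebra.norm ℤ z := by
  have h1 : ((Algebra.norm ℤ (z * sqrtElem d δ) : ℤ) : ℚ) = ((-d * Algebra.norm ℤ z : ℤ) : ℚ) := by
    rw [norm_coe d δ]
    push_cast
    rw [norm_coe d δ]
    change nm ((z : L) * δ) = _
    rw [nm_mul, nm_sqrt d δ]
    ring
  exact_mod_cast h1

theorem norm_intCast_mul (n : ℤ) (z : quadOrder d δ) :
    Algebra.norm ℤ ((n : quadOrder d δ) * z) = n ^ 2 * Algebra.norm ℤ z := by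
  have h1 : ((Algebra.norm ℤ ((n : quadOrder d δ) * z) : ℤ) : ℚ) = ((n ^ 2 * Algebra.norm ℤ z : ℤ) : ℚ) := by
    rw [norm_coe d δ]
    push_cast
    rw [norm_coe d δ, nm_mul]
    have := nm_ratCast d δ (n : ℚ)
    rw [Rat.cast_intCast] at this
    rw [this]
  exact_mod_cast h1

variable {d δ}

theorem CongrModLocal.pow_dvd {p : ℕ} (hp : p.Prime) {x y : quadOrder d δ}
    (hc : CongrModLocal p x y) {k : ℕ} (hk : (p : ℤ) ^ k ∣ d) :
    (p : ℤ) ^ k ∣ Algebra.norm ℤ (x - y) := by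
  obtain ⟨n, hn, hmem⟩ := hc
  obtain ⟨z, hz⟩ := Ideal.mem_span_singleton'.1 hmem
  have h1 : (n : quadOrder d δ) * (x - y) = z * sqrtElem d δ := by
    rw [← zsmul_eq_mul]; exact hz.symm
  have h2 := congrArg (Algebra.norm ℤ) h1
  rw [norm_intCast_mul, norm_sqrtElem_mul] at h2
  have h3 : (p : ℤ) ^ k ∣ n ^ 2 * Algebra.norm ℤ (x - y) := by
    rw [h2]; exact (hk.neg_right).mul_right _
  exact (((isCoprime_prime_iff hp).2 hn).symm.pow).dvd_of_dvd_mul_left h3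

variable (d δ)

/-- Over a discriminant `4 m`, the order is `ℤ[√m]`. -/
theorem exists_elem_of_four_dvd {m : ℤ} (hm : d = 4 * m) (a b : ℤ) :
    ∃ x : quadOrder d δ, (x : L) = a + b * (δ / 2) ∧ Algebra.norm ℤ x = a ^ 2 - m * b ^ 2 := by
  have e1 : (a : L) + b * (δ / 2) = ((a : ℚ) : L) + ((b / 2 : ℚ) : L) * δ := by
    push_cast; ring
  have hx : (a : L) + b * (δ / 2) ∈ quadOrder d δ := by
    rw [mem_quadOrder_iff]
    refine ⟨a - 2 * m * b, b, ?_⟩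
    unfold om
    rw [hm]; push_cast; ring
  refine ⟨⟨_, hx⟩, rfl, ?_⟩
  have h1 : ((Algebra.norm ℤ (⟨_, hx⟩ : quadOrder d δ) : ℤ) : ℚ) = ((a ^ 2 - m * b ^ 2 : ℤ) : ℚ) := by
    rw [norm_coe d δ]
    change nm ((a : L) + b * (δ / 2)) = _
    rw [e1, nm_coord d δ, hm]
    push_cast; ring
  exact_mod_cast h1

theorem norm_intCast (a : ℤ) : Algebra.norm ℤ (a : quadOrder d δ) = a ^ 2 := by
  have := norm_intCast_mul d δ a 1
  simpa using this

theorem norm_neg_eq (x : quadOrder d δ) : Algebra.norm ℤ (-x) = Algebra.norm ℤ x := by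
  have := norm_intCast_mul d δ (-1) x
  simpa using this

theorem norm_sub_neg (x : quadOrder d δ) : Algebra.norm ℤ (x - -x) = 4 * Algebra.norm ℤ x := by
  have := norm_intCast_mul d δ 2 x
  rw [sub_neg_eq_add, ← two_mul]
  simpa using this

variable {d δ} {ℓ q : ℕ} {𝔩 𝔮 : Ideal (quadOrder d δ)}

namespace Setting

variable (S : Setting d δ ℓ q 𝔩 𝔮)
include S

theorem not_dvd_jSq {p : ℕ} (hp : p.Prime) (hpd : (p : ℤ) ∣ d) : ¬ (p : ℤ) ∣ jSq d ℓ q := by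
  have hpz : Prime (p : ℤ) := Nat.prime_iff_prime_int.1 hp
  have hpq : ¬ (p : ℤ) ∣ q := by
    intro h1
    have h2 := (Nat.prime_dvd_prime_iff_eq hp S.prime_q).1 (by exact_mod_cast h1)
    rw [h2] at hpd
    exact S.q_not_dvd hpd
  unfold jSq
  split_ifs with hℓ
  · rwa [dvd_neg]
  · rw [dvd_neg]
    intro h1
    rcases hpz.dvd_or_dvd h1 with h2 | h2
    · have h3 := (Nat.prime_dvd_prime_iff_eq hp S.prime_ell).1 (by exact_mod_cast h2)
      rw [h3] at hpd
      exact hℓ hpd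
    · exact hpq h2

theorem jSq_modEq_two_pow (hd : (2 : ℤ) ∣ d) (hℓ2 : ℓ ≠ 2) :
    jSq d ℓ q % 2 = 1 ∧ (d % 16 = 12 ∨ d % 32 = 16 ∨ d % 32 = 0 → jSq d ℓ q % 4 = 1) ∧
    (d % 32 = 8 ∨ d % 32 = 0 → jSq d ℓ q % 8 = 1 ∨ jSq d ℓ q % 8 = 7) ∧
    (d % 32 = 24 → jSq d ℓ q % 8 = 1 ∨ jSq d ℓ q % 8 = 3) := by
  have h0 := S.not_dvd_jSq Nat.prime_two (by exact_mod_cast hd)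
  obtain ⟨h1, h2, h3⟩ := two_chars_jSq S.prime_ell S.aux fun _ => hℓ2
  rw [ZMod.χ₄_int_eq_if_mod_four] at h1 h3
  rw [ZMod.χ₈_int_eq_if_mod_eight] at h2 h3
  push_cast at h0
  refine ⟨by omega, fun h4 => ?_, fun h4 => ?_, fun h4 => ?_⟩
  · have := h1 h4
    split_ifs at this <;> omega
  · have := h2 h4
    split_ifs at this <;> omega
  · have := h3 h4
    split_ifs at this <;> omega

/-- The elements `λ^(p)` and `λ̃^(p)` at an odd prime. -/
theorem exists_local_choice_odd {p : ℕ} (hp : p.Prime) (hp2 : p ≠ 2) (hpd : (p : ℤ) ∣ d) :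
    ∃ x y : quadOrder d δ,
      Algebra.norm ℤ x ≡ jSq d ℓ q [ZMOD (p : ℤ) ^ padicValInt p (normModulus d ℓ)] ∧
      Algebra.norm ℤ y ≡ jSq d ℓ q [ZMOD (p : ℤ) ^ padicValInt p (normModulus d ℓ)] ∧
      ¬ CongrModLocal p x y ∧ x = -y := by
  have hpz : Prime (p : ℤ) := Nat.prime_iff_prime_int.1 hp
  have key : ∀ s : ℤ, ¬ (p : ℤ) ∣ s →
      s ^ 2 ≡ jSq d ℓ q [ZMOD (p : ℤ) ^ padicValInt p (normModulus d ℓ)] →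
      ∃ x y : quadOrder d δ,
      Algebra.norm ℤ x ≡ jSq d ℓ q [ZMOD (p : ℤ) ^ padicValInt p (normModulus d ℓ)] ∧
      Algebra.norm ℤ y ≡ jSq d ℓ q [ZMOD (p : ℤ) ^ padicValInt p (normModulus d ℓ)] ∧
      ¬ CongrModLocal p x y ∧ x = -y := by
    intro s hs h1
    refine ⟨s, -s, by rwa [norm_intCast], by rwa [norm_neg_eq, norm_intCast], ?_, by rw [neg_neg]⟩
    intro hc
    have h2 := hc.pow_dvd hp (k := 1) (by simpa using hpd)
    rw [pow_one, norm_sub_neg, norm_intCast] at h2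
    rcases hpz.dvd_or_dvd h2 with h3 | h3
    · have h4 : (p : ℤ) ∣ 2 ^ 2 := by norm_num; exact h3
      have h5 := hpz.dvd_of_dvd_pow h4
      exact hp2 ((Nat.prime_dvd_prime_iff_eq hp Nat.prime_two).1 (by exact_mod_cast h5))
    · exact hs (hpz.dvd_of_dvd_pow h3)
  by_cases hpℓ : p = ℓ
  -- `d` is exactly divisible by `ℓ`, and the congruence is trivial
  · subst hpℓ
    refine key 1 hpz.not_dvd_one ?_
    have hv : padicValInt p (normModulus d p) = 0 := by
      apply padicValInt.eq_zero_of_not_dvd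
      rintro ⟨k, hk⟩
      unfold normModulus at hk
      rw [if_pos hpd] at hk
      apply not_sq_dvd_of_regular d δ hp hp2 S.ell_not_dvd
      refine ⟨k, ?_⟩
      rw [← Int.mul_ediv_cancel' hpd, hk]
      ring
    rw [hv, pow_zero]
    exact Int.modEq_one
  · have hc := S.not_dvd_jSq hp hpd
    have hj := jacobiSym_jSq S.prime_ell S.aux hp hp2 hpd hpℓ
    have : Fact p.Prime := ⟨hp⟩
    rw [← jacobiSym.legendreSym.to_jacobiSym,
      legendreSym.eq_one_iff p (by rwa [Ne, ZMod.intCast_zmod_eq_zero_iff_dvd])] at hj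
    obtain ⟨r, hr⟩ := hj
    obtain ⟨r, rfl⟩ := ZMod.intCast_surjective r
    have h1 : (p : ℤ) ∣ r ^ 2 - jSq d ℓ q := by
      rw [← ZMod.intCast_zmod_eq_zero_iff_dvd]
      push_cast
      rw [hr]; ring
    obtain ⟨s, hs⟩ := exists_sq_modEq hp hp2 hc h1 (padicValInt p (normModulus d ℓ) + 1)
    refine key s ?_ ?_
    · intro hps
      apply hc
      have h2 : (p : ℤ) ∣ s ^ 2 - jSq d ℓ q := (dvd_pow_self _ (Nat.succ_ne_zero _)).trans hs
      have := dvd_sub (dvd_pow hps two_ne_zero) h2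
      rwa [sub_sub_cancel] at this
    · exact (Int.modEq_iff_dvd.2 ((pow_dvd_pow _ (Nat.le_succ _)).trans hs)).symm

/-- The elements `λ^(2)` and `λ̃^(2)`. In the order `ℤ[√m]`, where `d = 4 m`, they are taken among
`1`, `√m`, `1 + √m`, up to sign, if `2` is regular. If `2` is irregular, then `j²` is a square
modulo the power of `2` in question, or congruent to the norm of some `s + √m`. -/
theorem exists_local_choice_two (hpd : (2 : ℤ) ∣ d) :
    ∃ x y : quadOrder d δ,
      Algebra.norm ℤ x ≡ jSq d ℓ q [ZMOD (2 : ℤ) ^ padicValInt 2 (normModulus d ℓ)] ∧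
      (¬ 2 ∣ conductor (quadOrder d δ) →
        Algebra.norm ℤ y ≡ jSq d ℓ q [ZMOD (2 : ℤ) ^ padicValInt 2 (normModulus d ℓ)] ∧
        ¬ CongrModLocal 2 x y) := by
  have hd4 := h.mod4
  obtain ⟨m, hm⟩ : ∃ m, d = 4 * m := ⟨d / 4, by omega⟩
  have hv : (2 : ℤ) ^ padicValInt 2 (normModulus d ℓ) ∣ normModulus d ℓ := by
    exact_mod_cast padicValInt_dvd (p := 2) (normModulus d ℓ)
  generalize padicValInt 2 (normModulus d ℓ) = v at *
  have hcodd : jSq d ℓ q % 2 = 1 := by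
    have := S.not_dvd_jSq Nat.prime_two (by exact_mod_cast hpd)
    push_cast at this
    omega
  have hmod : ∀ {k : ℕ} {a : ℤ}, (2 : ℤ) ^ v ∣ 2 ^ k → 2 ^ k ∣ a - jSq d ℓ q →
      a ≡ jSq d ℓ q [ZMOD (2 : ℤ) ^ v] := fun h1 h2 =>
    (Int.modEq_iff_dvd.2 (h1.trans h2)).symm
  have hnc : ∀ {x y : quadOrder d δ} (k : ℕ), (2 : ℤ) ^ k ∣ d → ¬ (2 : ℤ) ^ k ∣ Algebra.norm ℤ (x - y) →
      ¬ CongrModLocal 2 x y := fun k h1 h2 hc => h2 (by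
    have := hc.pow_dvd Nat.prime_two (k := k) (by exact_mod_cast h1)
    exact_mod_cast this)
  obtain ⟨x1, hx1, hn1⟩ := exists_elem_of_four_dvd d δ hm 1 0
  obtain ⟨x2, hx2, hn2⟩ := exists_elem_of_four_dvd d δ hm 0 1
  obtain ⟨x3, hx3, hn3⟩ := exists_elem_of_four_dvd d δ hm 1 1
  obtain ⟨x4, hx4, hn4⟩ := exists_elem_of_four_dvd d δ hm 1 (-1)
  ring_nf at hn1 hn2 hn3 hn4
  have h12 : x1 - x2 = x4 := by
    apply Subtype.ext
    push_cast
    rw [hx1, hx2, hx4]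
    push_cast; ring
  by_cases hreg : 2 ∣ conductor (quadOrder d δ)
  · -- the irregular case, where `ℓ ≠ 2`
    have hℓ2 : ℓ ≠ 2 := by
      rintro rfl; exact S.ell_not_dvd hreg
    obtain ⟨-, hc1, hc2, -⟩ := S.jSq_modEq_two_pow hpd hℓ2
    obtain ⟨d', hd', hd'4⟩ := (prime_dvd_conductor_iff d δ Nat.prime_two).1 hreg
    push_cast at hd'
    have hvd := hv.trans S.normModulus_dvd
    suffices H : ∃ x : quadOrder d δ, Algebra.norm ℤ x ≡ jSq d ℓ q [ZMOD (2 : ℤ) ^ v] by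
      obtain ⟨x, hx⟩ := H
      exact ⟨x, 0, hx, fun h1 => absurd hreg h1⟩
    have hsq : jSq d ℓ q % 8 = 1 →
        ∃ x : quadOrder d δ, Algebra.norm ℤ x ≡ jSq d ℓ q [ZMOD (2 : ℤ) ^ v] := by
      intro h1
      obtain ⟨s, hs⟩ := exists_sq_modEq_two h1 v
      exact ⟨s, by rw [norm_intCast]; exact (Int.modEq_iff_dvd.2 hs).symm⟩
    by_cases hm1 : m % 4 = 1
    · have hv4 : (2 : ℤ) ^ v ∣ 2 ^ 2 := two_pow_dvd_of_mod hvd (b := m) (by omega) (by omega)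
      by_cases hc4 : jSq d ℓ q % 4 = 1
      · exact ⟨x1, hmod hv4 (by rw [hn1]; omega)⟩
      · exact ⟨x2, hmod hv4 (by rw [hn2]; omega)⟩
    · by_cases hm8 : m % 8 = 4
      · have hv16 : (2 : ℤ) ^ v ∣ 2 ^ 4 := two_pow_dvd_of_mod hvd (b := m / 4) (by omega) (by omega)
        have hc4 := hc1 (by omega)
        by_cases hc8 : jSq d ℓ q % 8 = 1
        · exact hsq hc8
        · obtain ⟨s, hs⟩ := exists_sq_modEq_two (a := jSq d ℓ q + m) (by omega) 4
          obtain ⟨x, -, hx⟩ := exists_elem_of_four_dvd d δ hm s 1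
          refine ⟨x, hmod hv16 ?_⟩
          rw [hx]
          convert hs using 1
          ring
      · refine hsq ?_
        have := hc1 (by omega)
        have := hc2 (by omega)
        omega
  · have hr := mod_of_regular_two d δ hpd hreg
    by_cases hm3 : d % 16 = 12
    · refine ⟨x1, x2, ?_⟩
      have hnc' : ¬ CongrModLocal 2 x1 x2 := by
        refine hnc 2 (by norm_num; omega) ?_
        rw [h12, hn4]; norm_num; omega
      have hk : ∃ k : ℕ, (2 : ℤ) ^ v ∣ 2 ^ k ∧ 2 ^ k ∣ 1 - jSq d ℓ q ∧ 2 ^ k ∣ -m - jSq d ℓ q := by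
        by_cases hℓ2 : ℓ = 2
        · subst hℓ2
          unfold normModulus at hv
          rw [if_pos (by exact_mod_cast hpd)] at hv
          push_cast at hv
          refine ⟨1, two_pow_dvd_of_mod hv (b := d / 4) (by omega) (by push_cast; omega), ?_, ?_⟩ <;> omega
        · have hvd := hv.trans S.normModulus_dvd
          have := (S.jSq_modEq_two_pow hpd hℓ2).2.1 (by omega)
          refine ⟨2, two_pow_dvd_of_mod hvd (b := m) (by omega) (by omega), ?_, ?_⟩ <;> norm_num <;> omega
      obtain ⟨k, hk1, hk2, hk3⟩ := hk
      exact ⟨hmod hk1 (by rw [hn1]; exact hk2), fun _ => ⟨hmod hk1 (by rw [hn2]; exact hk3), hnc'⟩⟩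
    · have hm2 : m % 4 = 2 := by omega
      have hk : ∃ k : ℕ, (2 : ℤ) ^ v ∣ 2 ^ k ∧ (2 ^ k ∣ 1 - jSq d ℓ q ∨ 2 ^ k ∣ 1 - m - jSq d ℓ q) := by
        by_cases hℓ2 : ℓ = 2
        · subst hℓ2
          unfold normModulus at hv
          rw [if_pos (by exact_mod_cast hpd)] at hv
          push_cast at hv
          refine ⟨2, two_pow_dvd_of_mod hv (b := d / 8) (by omega) (by push_cast; omega), ?_⟩
          norm_num; omega
        · have hvd := hv.trans S.normModulus_dvd
          obtain ⟨-, -, hc1, hc2⟩ := S.jSq_modEq_two_pow hpd hℓ2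
          refine ⟨3, two_pow_dvd_of_mod hvd (b := d / 8) (by omega) (by omega), ?_⟩
          rcases hr with hr | hr | hr
          · exact absurd hr hm3
          · have := hc1 (by omega)
            norm_num; omega
          · have := hc2 (by omega)
            norm_num; omega
      obtain ⟨k, hk1, hk2⟩ := hk
      have hfin : ∀ x : quadOrder d δ, Algebra.norm ℤ x % 2 = 1 → 2 ^ k ∣ Algebra.norm ℤ x - jSq d ℓ q →
          Algebra.norm ℤ x ≡ jSq d ℓ q [ZMOD (2 : ℤ) ^ v] ∧
          (¬ 2 ∣ conductor (quadOrder d δ) →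
            Algebra.norm ℤ (-x) ≡ jSq d ℓ q [ZMOD (2 : ℤ) ^ v] ∧ ¬ CongrModLocal 2 x (-x)) := by
        intro x hx h1
        refine ⟨hmod hk1 h1, fun _ => ⟨?_, ?_⟩⟩
        · rw [norm_neg_eq]; exact hmod hk1 h1
        · refine hnc 3 (by norm_num; omega) ?_
          rw [norm_sub_neg]; norm_num; omega
      rcases hk2 with hk2 | hk2
      · exact ⟨x1, -x1, hfin x1 (by rw [hn1]; rfl) (by rw [hn1]; exact hk2)⟩
      · exact ⟨x3, -x3, hfin x3 (by rw [hn3]; omega) (by rw [hn3]; exact hk2)⟩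

theorem exists_local_choice (p : ℕ) : ∃ x y : quadOrder d δ, p.Prime → (p : ℤ) ∣ d →
      Algebra.norm ℤ x ≡ jSq d ℓ q [ZMOD (p : ℤ) ^ padicValInt p (normModulus d ℓ)] ∧
      (¬ p ∣ conductor (quadOrder d δ) →
        Algebra.norm ℤ y ≡ jSq d ℓ q [ZMOD (p : ℤ) ^ padicValInt p (normModulus d ℓ)] ∧
        ¬ CongrModLocal p x y) ∧ (p = ℓ → ℓ ≠ 2 → x = -y) := by
  by_cases hp : p.Prime
  · by_cases hpd : (p : ℤ) ∣ d
    · by_cases hp2 : p = 2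
      · subst hp2
        obtain ⟨x, y, h1, h2⟩ := S.exists_local_choice_two hpd
        exact ⟨x, y, fun _ _ => ⟨h1, h2, fun h3 h4 => absurd h3.symm h4⟩⟩
      · obtain ⟨x, y, h1, h2, h3, h4⟩ := S.exists_local_choice_odd hp hp2 hpd
        exact ⟨x, y, fun _ _ => ⟨h1, fun _ => ⟨h2, h3⟩, fun _ _ => h4⟩⟩
    · exact ⟨0, 0, fun _ h1 => absurd h1 hpd⟩
  · exact ⟨0, 0, fun h1 => absurd h1 hp⟩

omit S in
/-- The Chinese remainder theorem for the congruences modulo the `𝔇_p`. -/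
theorem exists_congrModLocal (τ : ℕ → quadOrder d δ) :
    ∃ μ : quadOrder d δ, ∀ p : ℕ, p.Prime → (p : ℤ) ∣ d → CongrModLocal p μ (τ p) := by
  classical
  have hd0 : d ≠ 0 := h.neg.ne
  have hcop : ∀ p : ℕ, p.Prime → ∃ d' : ℤ, ¬ (p : ℤ) ∣ d' ∧ d = (p : ℤ) ^ padicValInt p d * d' := by
    intro p hp
    have : Fact p.Prime := ⟨hp⟩
    obtain ⟨d', hd'⟩ := padicValInt_dvd (p := p) d
    refine ⟨d', ?_, hd'⟩
    rintro ⟨k, rfl⟩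
    have h1 : (p : ℤ) ^ (padicValInt p d + 1) ∣ d := ⟨k, by rw [pow_succ, mul_assoc]; exact hd'⟩
    have := (padicValInt_dvd_iff (p := p) (padicValInt p d + 1) d).1 h1
    rcases this with h2 | h2
    · exact hd0 h2
    · omega
  -- orthogonal idempotents modulo `d`
  have he : ∀ p : ℕ, ∃ e : ℤ, p.Prime → (p : ℤ) ^ padicValInt p d ∣ e - 1 ∧
      ∀ p' : ℕ, p'.Prime → p' ≠ p → (p' : ℤ) ^ padicValInt p' d ∣ e := by
    intro p
    by_cases hp : p.Prime
    · obtain ⟨d', h1, h2⟩ := hcop p hp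
      obtain ⟨u, w, huw⟩ := ((isCoprime_prime_iff hp).2 h1).pow_right (n := padicValInt p d)
      refine ⟨u * d', fun _ => ⟨⟨-w, by linear_combination huw⟩, fun p' hp' hne => ?_⟩⟩
      have h3 : (p' : ℤ) ^ padicValInt p' d ∣ (p : ℤ) ^ padicValInt p d * d' := by
        rw [← h2]; exact padicValInt_dvd d
      have h4 : IsCoprime ((p' : ℤ) ^ padicValInt p' d) ((p : ℤ) ^ padicValInt p d) :=
        (Nat.isCoprime_iff_coprime.2 ((Nat.coprime_primes hp' hp).2 hne)).pow
      exact (h4.dvd_of_dvd_mul_left h3).mul_left u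
    · exact ⟨0, fun h1 => absurd h1 hp⟩
  choose e he using he
  let s := d.natAbs.primeFactors
  refine ⟨∑ p ∈ s, (e p : quadOrder d δ) * τ p, fun p hp hpd => ?_⟩
  have hps : p ∈ s := Nat.mem_primeFactors.2 ⟨hp, Int.natCast_dvd.1 hpd, Int.natAbs_ne_zero.2 hd0⟩
  obtain ⟨d', h1, h2⟩ := hcop p hp
  refine ⟨d', h1, ?_⟩
  have h3 : ∑ p' ∈ s, (e p' : quadOrder d δ) * τ p' - τ p =
      ((e p - 1 : ℤ) : quadOrder d δ) * τ p + ∑ p' ∈ s.erase p, (e p' : quadOrder d δ) * τ p' := by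
    rw [← Finset.add_sum_erase s _ hps]
    push_cast; ring
  have h4 : (((p : ℤ) ^ padicValInt p d : ℤ) : quadOrder d δ) ∣
      ∑ p' ∈ s, (e p' : quadOrder d δ) * τ p' - τ p := by
    rw [h3]
    refine dvd_add ?_ (Finset.dvd_sum fun p' hp' => ?_)
    · exact (map_dvd (Int.castRingHom (quadOrder d δ)) ((he p) hp).1).mul_right _
    · have hp'1 := Finset.mem_erase.1 hp'
      have hp'2 := (Nat.mem_primeFactors.1 hp'1.2).1
      exact (map_dvd (Int.castRingHom (quadOrder d δ)) (((he p') hp'2).2 p hp hp'1.1.symm)).mul_right _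
  obtain ⟨z, hz⟩ := h4
  rw [hz]
  refine Ideal.mem_span_singleton'.2 ⟨z * sqrtElem d δ, ?_⟩
  change z * sqrtElem d δ * sqrtElem d δ = _
  rw [mul_assoc, ← sq, sqrtElem_sq, zsmul_eq_mul, ← mul_assoc, ← Int.cast_mul, mul_comm d', ← h2, mul_comm]

omit S in
/-- The integers `M(𝔭)` exist since `N(𝔭)` is prime to `d` if `𝔭` is prime to `√d`. -/
theorem exists_multiple_modEq_one (𝔭 : Ideal (quadOrder d δ)) :
    ∃ M : ℤ, 𝔭.IsPrime → IsCoprime 𝔭 (sqrtIdeal d δ) →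
      (idealNorm 𝔭 : ℤ) ∣ M ∧ M ≡ 1 [ZMOD d] := by
  by_cases hP : 𝔭.IsPrime
  · by_cases hc : IsCoprime 𝔭 (sqrtIdeal d δ)
    · obtain ⟨hg, p, hp, hpP, hpd⟩ := isGoodIdeal_of_isCoprime d δ hP hc
      have h1 : IsCoprime (idealNorm 𝔭 : ℤ) d := by
        by_contra hne
        rw [Int.isCoprime_iff_gcd_eq_one] at hne
        obtain ⟨r, hr, hrd⟩ := Nat.exists_prime_and_dvd hne
        have h2 : (r : ℤ) ∣ idealNorm 𝔭 := (Int.natCast_dvd_natCast.2 hrd).trans (Int.gcd_dvd_left ..)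
        have h3 : (r : ℤ) ∣ d := (Int.natCast_dvd_natCast.2 hrd).trans (Int.gcd_dvd_right ..)
        have h4 := dvd_of_dvd_idealNorm d δ (m := p) (by exact_mod_cast hp.ne_zero)
          (by exact_mod_cast hpP) hr (by exact_mod_cast h2)
        rw [(Nat.prime_dvd_prime_iff_eq hr hp).1 (by exact_mod_cast h4)] at h3
        exact hpd h3
      obtain ⟨u, w, huw⟩ := h1
      exact ⟨u * idealNorm 𝔭, fun _ _ => ⟨dvd_mul_left _ _,
        Int.modEq_iff_dvd.2 ⟨w, by linear_combination -huw⟩⟩⟩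
    · exact ⟨0, fun _ h1 => absurd h1 hc⟩
  · exact ⟨0, fun h1 => absurd h1 hP⟩

theorem nonempty_lambdaChoice : Nonempty (LambdaChoice d δ ℓ q) := by
  classical
  choose x y hxy using S.exists_local_choice
  choose M hM using exists_multiple_modEq_one (d := d) (δ := δ)
  have hP : ∀ p : ℕ, ∃ P : Ideal (quadOrder d δ), p.Prime → P.IsPrime ∧ (p : quadOrder d δ) ∈ P := by
    intro p
    by_cases hp : p.Prime
    · obtain ⟨P, h1, h2⟩ := exists_isPrime_mem d δ hp
      exact ⟨P, fun _ => ⟨h1, h2⟩⟩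
    · exact ⟨⊤, fun h1 => absurd h1 hp⟩
  choose P hP using hP
  choose μ hμ using fun 𝔟 : Ideal (quadOrder d δ) => exists_congrModLocal (d := d) (δ := δ)
    fun p => if p ∣ conductor (quadOrder d δ) then x p
      else if Even (multiplicity (P p) 𝔟) then x p else y p
  refine ⟨⟨x, y, M, μ, fun p hp hpd => (hxy p hp hpd).1,
    fun p hp hpd hpf => ((hxy p hp hpd).2.1 hpf).1,
    fun p hp hpd hpf => ((hxy p hp hpd).2.1 hpf).2,
    fun hd h2 => (hxy ℓ S.prime_ell hd).2.2 rfl h2,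
    fun 𝔭 h1 h2 => (hM 𝔭 h1 h2).1, fun 𝔭 h1 h2 => (hM 𝔭 h1 h2).2, ?_, ?_⟩⟩
  · intro 𝔟 p hp hpd hpf 𝔭 h𝔭 hp𝔭
    have h1 := hμ 𝔟 p hp hpd
    rw [if_neg hpf, eq_of_ramified d δ (hP p hp).1 h𝔭 hp (hP p hp).2 hp𝔭 hpd] at h1
    exact h1
  · intro 𝔟 p hp hpf
    have h1 := hμ 𝔟 p hp (dvd_of_dvd_conductor d δ hp hpf)
    rwa [if_pos hpf] at h1

end Setting

end choice

end

noncomputable section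

/-! ### Admissibility of the chosen elements -/

section admissible

variable {L : Type*} [Field L] [CharZero L] [StarRing L]

section choice

variable {d : ℤ} {δ : L} {ℓ q : ℕ} {𝔩 𝔮 : Ideal (quadOrder d δ)} (C : LambdaChoice d δ ℓ q)

/-- The integer `∏ M(𝔭) ^ v_𝔭(𝔞)`, over the primes `𝔭 ∣ 𝔞` prime to `𝔇`. -/
def LambdaChoice.coprimeFactor (𝔞 : Ideal (quadOrder d δ)) : ℤ :=
  ∏ᶠ 𝔭 ∈ {𝔭 : Ideal (quadOrder d δ) | 𝔭.IsPrime ∧ IsCoprime 𝔭 (sqrtIdeal d δ) ∧ 𝔭 ∣ 𝔞},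
    C.M 𝔭 ^ multiplicity 𝔭 𝔞

theorem LambdaChoice.lambda_eq (𝔞 : Ideal (quadOrder d δ)) :
    C.lambda 𝔮 𝔞 = ((C.coprimeFactor 𝔞 * C.M 𝔮 : ℤ) : quadOrder d δ) * C.lamRam 𝔞 := rfl

theorem LambdaChoice.coprimeFactor_modEq (𝔞 : Ideal (quadOrder d δ)) :
    C.coprimeFactor 𝔞 ≡ 1 [ZMOD d] := by
  unfold LambdaChoice.coprimeFactor
  refine finprod_mem_induction (fun x : ℤ => x ≡ 1 [ZMOD d]) rfl ?_ ?_
  · intro x y hx hy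
    simpa using hx.mul hy
  · intro P hP
    simpa using (C.M_modEq P hP.1 hP.2.1).pow (multiplicity P 𝔞)

end choice

variable (d : ℤ) (δ : L) [h : ImagQuad L d δ]
include h

theorem congrModLocal_iff {p : ℕ} {x y : quadOrder d δ} : CongrModLocal p x y ↔
    ∃ n : ℤ, ¬ (p : ℤ) ∣ n ∧ ∃ z ∈ quadOrder d δ, (n : L) * ((x : L) - y) = δ * z := by
  constructor
  · rintro ⟨n, hn, hz⟩
    obtain ⟨z, hz⟩ := Ideal.mem_span_singleton'.1 hz
    refine ⟨n, hn, z, z.2, ?_⟩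
    have := congrArg (fun t : quadOrder d δ => (t : L)) hz
    simp only [zsmul_eq_mul] at this
    push_cast at this
    rw [← this, mul_comm]
  · rintro ⟨n, hn, z, hz, hzn⟩
    refine ⟨n, hn, Ideal.mem_span_singleton'.2 ⟨⟨z, hz⟩, ?_⟩⟩
    apply Subtype.ext
    rw [zsmul_eq_mul]
    push_cast
    rw [hzn, mul_comm]

theorem exists_tr_sqrt_mul {z : L} (hz : z ∈ quadOrder d δ) : ∃ n : ℤ, tr (δ * z) = d * n := by
  obtain ⟨s, t, rfl⟩ := (mem_quadOrder_iff d δ).1 hz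
  refine ⟨t, ?_⟩
  have h1 : δ * (s + t * om d δ) = ((t * d / 2 : ℚ) : L) + ((s + t * d / 2 : ℚ) : L) * δ := by
    rw [om]
    push_cast
    linear_combination ((t : L) / 2) * h.sq
  rw [h1, tr_coord d δ]
  ring

/-- Elements that are congruent modulo `𝔇_p` have norms congruent modulo the `p`-part of `d`. -/
theorem CongrModLocal.norm_modEq {p : ℕ} (hp : p.Prime) {x y : quadOrder d δ}
    (hxy : CongrModLocal p x y) {k : ℕ} (hk : (p : ℤ) ^ k ∣ d) :
    Algebra.norm ℤ x ≡ Algebra.norm ℤ y [ZMOD (p : ℤ) ^ k] := by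
  obtain ⟨n, hn, z, hz, hzn⟩ := (congrModLocal_iff d δ).1 hxy
  obtain ⟨a, ha⟩ := exists_tr_sqrt_mul d δ (mul_mem hz (star_mem_quadOrder d δ y.2))
  obtain ⟨b, hb⟩ := exists_nm_eq d δ hz
  have h1 : ((n ^ 2 * (Algebra.norm ℤ x - Algebra.norm ℤ y) : ℤ) : ℚ) = ((d * (n * a - b) : ℤ) : ℚ) := by
    push_cast
    rw [norm_coe, norm_coe, ← (algebraMap ℚ L).injective.eq_iff]
    have h2 := (tr_cast d δ (δ * (z * star (y : L))))
    have h3 := nm_cast d δ z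
    rw [ha] at h2; rw [hb] at h3
    simp only [map_mul, map_sub, map_pow, map_intCast, eq_ratCast, nm_cast d δ]
    push_cast at h2 h3
    simp only [star_mul', star_star, h.star_eq] at h2
    have hstar := congrArg star hzn
    simp only [star_mul', star_sub, star_intCast, h.star_eq] at hstar
    have hs2 := h.sq
    linear_combination ((n : L) * star (x : L)) * hzn + (n : L) * y * hstar + δ * z * hstar - n * h2 +
      d * h3 - z * star z * hs2
  have h2 : (p : ℤ) ^ k ∣ n ^ 2 * (Algebra.norm ℤ x - Algebra.norm ℤ y) := by
    rw [show n ^ 2 * (Algebra.norm ℤ x - Algebra.norm ℤ y) = d * (n * a - b) by exact_mod_cast h1]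
    exact hk.mul_right _
  have h3 : IsCoprime ((p : ℤ) ^ k) (n ^ 2) := ((isCoprime_prime_iff hp).2 hn).symm.pow
  exact (Int.modEq_iff_dvd.2 (h3.dvd_of_dvd_mul_left h2)).symm

variable {d δ}

section factor

variable {ℓ q : ℕ} {𝔩 𝔮 : Ideal (quadOrder d δ)} (C : LambdaChoice d δ ℓ q)

namespace LambdaChoice

/-- The condition `𝔭 ∣ 𝔞` in the index set is automatic where the exponent does not vanish. -/
theorem coprimeFactor_eq (𝔞 : Ideal (quadOrder d δ)) : C.coprimeFactor 𝔞 =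
    ∏ᶠ 𝔭 ∈ {𝔭 : Ideal (quadOrder d δ) | 𝔭.IsPrime ∧ IsCoprime 𝔭 (sqrtIdeal d δ)},
      C.M 𝔭 ^ multiplicity 𝔭 𝔞 := by
  refine finprod_mem_inter_mulSupport_eq' _ _ _ fun P hP => ?_
  constructor
  · rintro ⟨h1, h2, -⟩; exact ⟨h1, h2⟩
  · rintro ⟨h1, h2⟩
    refine ⟨h1, h2, ?_⟩
    by_contra hdvd
    refine hP ?_
    change C.M P ^ multiplicity P 𝔞 = 1
    rw [multiplicity_eq_zero.2 hdvd, pow_zero]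

theorem finite_support {𝔞 : Ideal (quadOrder d δ)} (ha : IsGoodIdeal 𝔞) :
    {𝔭 : Ideal (quadOrder d δ) | 𝔭.IsPrime ∧ IsCoprime 𝔭 (sqrtIdeal d δ) ∧
      multiplicity 𝔭 𝔞 ≠ 0}.Finite := by
  refine IsGoodIdeal.induction d δ (motive := fun 𝔞 => {𝔭 : Ideal (quadOrder d δ) | 𝔭.IsPrime ∧
    IsCoprime 𝔭 (sqrtIdeal d δ) ∧ multiplicity 𝔭 𝔞 ≠ 0}.Finite) ?_ ?_ ha
  · refine Set.finite_empty.subset ?_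
    rintro P ⟨h1, -, h3⟩
    exact h3 (multiplicity_top d δ h1)
  · intro P b hP hPg hb hfin
    refine (hfin.insert P).subset ?_
    rintro Q ⟨h1, h2, h3⟩
    by_cases hQP : Q = P
    · exact Or.inl hQP
    · refine Or.inr ⟨h1, h2, ?_⟩
      rwa [multiplicity_mul_of_ne d δ h1 (isGoodIdeal_of_isCoprime d δ h1 h2).1 hP hPg hb hQP] at h3

theorem coprimeFactor_top : C.coprimeFactor ⊤ = 1 := by
  rw [coprimeFactor_eq]
  refine finprod_mem_eq_one_of_forall_eq_one fun P hP => ?_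
  rw [multiplicity_top d δ hP.1, pow_zero]

/-- Multiplication by a prime ideal `P` prime to `√d` raises the exponent of `M(P)` by one and leaves the
others unchanged. -/
theorem coprimeFactor_mul_of_isCoprime {P b : Ideal (quadOrder d δ)} (hP : P.IsPrime)
    (hPc : IsCoprime P (sqrtIdeal d δ)) (hb : IsGoodIdeal b) :
    C.coprimeFactor (P * b) = C.M P * C.coprimeFactor b := by
  classical
  have hPg := (isGoodIdeal_of_isCoprime d δ hP hPc).1
  set s := {𝔭 : Ideal (quadOrder d δ) | 𝔭.IsPrime ∧ IsCoprime 𝔭 (sqrtIdeal d δ)} with hs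
  rw [coprimeFactor_eq, coprimeFactor_eq, ← hs]
  have h1 : ∏ᶠ Q ∈ s, (if Q = P then C.M P else 1) = C.M P := by
    rw [finprod_mem_def, finprod_eq_single _ P]
    · rw [Set.mulIndicator_of_mem (show P ∈ s from ⟨hP, hPc⟩), if_pos rfl]
    · intro Q hQ
      rw [Set.mulIndicator_apply, if_neg hQ, ite_self]
  have hfin1 : (s ∩ Function.mulSupport fun Q => (if Q = P then C.M P else 1)).Finite := by
    refine (Set.finite_singleton P).subset ?_
    rintro Q ⟨-, hQ⟩
    by_contra hne
    exact hQ (if_neg hne)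
  have hfin2 : (s ∩ Function.mulSupport fun Q => C.M Q ^ multiplicity Q b).Finite := by
    refine (finite_support hb).subset ?_
    rintro Q ⟨⟨h2, h3⟩, hQ⟩
    refine ⟨h2, h3, fun h0 => hQ ?_⟩
    change C.M Q ^ multiplicity Q b = 1
    rw [h0, pow_zero]
  rw [← h1, ← finprod_mem_mul_distrib' hfin1 hfin2]
  refine finprod_mem_congr rfl fun Q hQ => ?_
  by_cases hQP : Q = P
  · subst hQP
    rw [if_pos rfl, multiplicity_mul_self d δ hP hPg hb, pow_succ, mul_comm]
  · rw [if_neg hQP, one_mul, multiplicity_mul_of_ne d δ hQ.1 (isGoodIdeal_of_isCoprime d δ hQ.1 hQ.2).1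
      hP hPg hb hQP]

theorem coprimeFactor_mul_of_not_isCoprime {P b : Ideal (quadOrder d δ)} (hP : P.IsPrime)
    (hPg : IsGoodIdeal P) (hPc : ¬ IsCoprime P (sqrtIdeal d δ)) (hb : IsGoodIdeal b) :
    C.coprimeFactor (P * b) = C.coprimeFactor b := by
  rw [coprimeFactor_eq, coprimeFactor_eq]
  refine finprod_mem_congr rfl fun Q hQ => ?_
  rw [multiplicity_mul_of_ne d δ hQ.1 (isGoodIdeal_of_isCoprime d δ hQ.1 hQ.2).1
      hP hPg hb (by rintro rfl; exact hPc hQ.2)]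

end LambdaChoice

theorem M_mul_mem {P : Ideal (quadOrder d δ)} (hP : P.IsPrime)
    (hPc : IsCoprime P (sqrtIdeal d δ)) {x : L}
    (hx : x ∈ latticeInv (quadOrder d δ) (idealLattice P)) : (C.M P : L) * x ∈ quadOrder d δ := by
  obtain ⟨k, hk⟩ := C.dvd_M P hP hPc
  have h1 := mem_latticeInv.1 hx _ (coe_mem_idealLattice.2 (idealNorm_mem d δ P))
  have h2 : (C.M P : L) * x = (k : L) * (x * ((idealNorm P : quadOrder d δ) : L)) := by
    rw [hk]; push_cast; ring
  rw [h2]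
  exact mul_mem (intCast_mem _ k) h1

theorem sqrtElem_mem_of_not_isCoprime {P : Ideal (quadOrder d δ)} (hP : P.IsPrime)
    (hPg : IsGoodIdeal P) (hPc : ¬ IsCoprime P (sqrtIdeal d δ)) : sqrtElem d δ ∈ P := by
  obtain ⟨m, hm, hmP⟩ := exists_int_mem d δ hPg.ne_bot
  obtain ⟨p, hp, -, hpP⟩ := exists_prime_mem d δ hP hm hmP
  rw [isCoprime_sqrtIdeal_iff d δ hP hp hpP, not_not] at hPc
  exact (sqrtElem_mem_iff d δ hP hp hpP).2 hPc

/-- The integer `∏ M(𝔭) ^ v_𝔭(𝔞)` is a denominator of `𝔞̄ 𝔞⁻¹`. -/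
theorem coprimeFactor_mul_mem {𝔞 : Ideal (quadOrder d δ)} (ha : IsGoodIdeal 𝔞) :
    ∀ x ∈ latticeConj (idealLattice 𝔞) * latticeInv (quadOrder d δ) (idealLattice 𝔞),
      (C.coprimeFactor 𝔞 : L) * x ∈ quadOrder d δ := by
  refine IsGoodIdeal.induction d δ (motive := fun 𝔞 => ∀ x ∈ latticeConj (idealLattice 𝔞) *
    latticeInv (quadOrder d δ) (idealLattice 𝔞), (C.coprimeFactor 𝔞 : L) * x ∈ quadOrder d δ)
    ?_ ?_ ha
  · intro x hx
    rw [idealLattice_top, latticeConj_quadOrder] at hx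
    rw [C.coprimeFactor_top, Int.cast_one, one_mul]
    rwa [toSubmodule_mul_latticeInv, latticeInv_eq_of_mul_eq
      (toSubmodule_mul_self _) (toSubmodule_mul_self _)] at hx
  · intro P b hP hPg hb ih x hx
    rw [idealLattice_mul, latticeConj_mul, hPg.1.inv_mul hb.1, mul_mul_mul_comm] at hx
    induction hx using Submodule.mul_induction_on' with
    | add y _ z _ hy hz => rw [mul_add]; exact add_mem hy hz
    | mem_mul_mem y hy z hz =>
      have hz' := ih z hz
      by_cases hPc : IsCoprime P (sqrtIdeal d δ)
      · rw [C.coprimeFactor_mul_of_isCoprime hP hPc hb]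
        have hy' : (C.M P : L) * y ∈ quadOrder d δ := by
          clear hz hz'
          induction hy using Submodule.mul_induction_on' with
          | add y _ z _ hy hz => rw [mul_add]; exact add_mem hy hz
          | mem_mul_mem u hu v hv =>
            have h1 := M_mul_mem C hP hPc hv
            have h2 := star_mem_quadOrder_iff d δ |>.1 (idealLattice_le P (mem_latticeConj.1 hu))
            have := mul_mem h2 h1
            convert this using 1; ring
        have := mul_mem hy' hz'
        convert this using 1; push_cast; ring
      · rw [C.coprimeFactor_mul_of_not_isCoprime hP hPg hPc hb]
        rw [latticeConj_eq_of_sqrtElem_mem d δ (sqrtElem_mem_of_not_isCoprime hP hPg hPc), hPg.1.2] at hy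
        have := mul_mem (show y ∈ quadOrder d δ from hy) hz'
        convert this using 1; ring

end factor

namespace Setting

variable {ℓ q : ℕ} {𝔩 𝔮 : Ideal (quadOrder d δ)} (S : Setting d δ ℓ q 𝔩 𝔮) (C : LambdaChoice d δ ℓ q)
include S

theorem isCoprime_q_sqrtIdeal : IsCoprime 𝔮 (sqrtIdeal d δ) :=
  (isCoprime_sqrtIdeal_iff d δ S.isPrime_q S.prime_q S.q_mem).2 S.q_not_dvd

theorem M_q_modEq : C.M 𝔮 ≡ 1 [ZMOD d] := C.M_modEq 𝔮 S.isPrime_q S.isCoprime_q_sqrtIdeal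

/-- The integral factor of `λ_𝔞` is a denominator of `𝔮⁻¹ 𝔞̄ 𝔞⁻¹`. -/
theorem factor_mul_mem {𝔞 : Ideal (quadOrder d δ)} (ha : IsGoodIdeal 𝔞) {x : L}
    (hx : x ∈ twistLattice d δ 𝔮 𝔞) :
    ((C.coprimeFactor 𝔞 * C.M 𝔮 : ℤ) : L) * x ∈ quadOrder d δ := by
  rw [twistLattice, mul_assoc] at hx
  induction hx using Submodule.mul_induction_on' with
  | add y _ z _ hy hz => rw [mul_add]; exact add_mem hy hz
  | mem_mul_mem y hy z hz =>
    have h1 := M_mul_mem C S.isPrime_q S.isCoprime_q_sqrtIdeal hy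
    have := mul_mem h1 (coprimeFactor_mul_mem C ha z hz)
    convert this using 1; push_cast; ring

theorem factor_modEq (𝔞 : Ideal (quadOrder d δ)) : C.coprimeFactor 𝔞 * C.M 𝔮 ≡ 1 [ZMOD d] := by
  simpa using (C.coprimeFactor_modEq 𝔞).mul (S.M_q_modEq C)

theorem lambda_sub_lamRam (𝔞 : Ideal (quadOrder d δ)) : ∃ k : ℤ,
    (C.lambda 𝔮 𝔞 : L) - (C.lamRam 𝔞 : L) = d * (k * (C.lamRam 𝔞 : L)) := by
  obtain ⟨k, hk⟩ := Int.modEq_iff_dvd.1 (S.factor_modEq C 𝔞).symm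
  refine ⟨k, ?_⟩
  rw [C.lambda_eq, eq_add_of_sub_eq hk]
  push_cast; ring

theorem congrModLocal_lambda {𝔞 : Ideal (quadOrder d δ)} {p : ℕ} {x : quadOrder d δ}
    (hx : CongrModLocal p (C.lamRam 𝔞) x) : CongrModLocal p (C.lambda 𝔮 𝔞) x := by
  obtain ⟨n, hn, z, hz, hzn⟩ := (congrModLocal_iff d δ).1 hx
  obtain ⟨k, hk⟩ := S.lambda_sub_lamRam C 𝔞
  refine (congrModLocal_iff d δ).2 ⟨n, hn, z + n * k * (δ * C.lamRam 𝔞), ?_, ?_⟩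
  · exact add_mem hz (mul_mem (mul_mem (intCast_mem _ n) (intCast_mem _ k))
      (mul_mem (sqrt_mem_quadOrder d δ) (C.lamRam 𝔞).2))
  · linear_combination hzn + n * hk - n * k * C.lamRam 𝔞 * h.sq

/-- At each prime `p ∣ d`, the element `λ_𝔞` is congruent to one of the chosen local solutions. -/
theorem exists_congrModLocal_lambda (𝔞 : Ideal (quadOrder d δ)) {p : ℕ} (hp : p.Prime)
    (hpd : (p : ℤ) ∣ d) : ∃ x, CongrModLocal p (C.lambda 𝔮 𝔞) x ∧
      Algebra.norm ℤ x ≡ jSq d ℓ q [ZMOD (p : ℤ) ^ padicValInt p (normModulus d ℓ)] := by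
  by_cases hpf : p ∣ conductor (quadOrder d δ)
  · exact ⟨C.lam p, S.congrModLocal_lambda C (C.lamRam_irregular 𝔞 p hp hpf), C.norm_lam p hp hpd⟩
  · obtain ⟨P, hP, hpP⟩ := exists_isPrime_mem d δ hp
    have h1 := C.lamRam_regular 𝔞 p hp hpd hpf P hP hpP
    refine ⟨_, S.congrModLocal_lambda C h1, ?_⟩
    split_ifs
    · exact C.norm_lam p hp hpd
    · exact C.norm_lamTilde p hp hpd hpf

theorem norm_lambda_modEq (𝔞 : Ideal (quadOrder d δ)) :
    Algebra.norm ℤ (C.lambda 𝔮 𝔞) ≡ jSq d ℓ q [ZMOD normModulus d ℓ] := by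
  refine (Int.modEq_iff_dvd.2 (Int.natAbs_dvd_natAbs.1 ?_)).symm
  refine Nat.dvd_iff_prime_pow_dvd_dvd _ _ |>.2 fun p k hp hk => ?_
  have hk' : (p : ℤ) ^ k ∣ normModulus d ℓ := by
    rw [← Nat.cast_pow]; exact Int.natCast_dvd.2 hk
  suffices H : (p : ℤ) ^ k ∣ Algebra.norm ℤ (C.lambda 𝔮 𝔞) - jSq d ℓ q by
    rw [← Nat.cast_pow] at H; exact Int.natCast_dvd.1 H
  rcases Nat.eq_zero_or_pos k with rfl | hk0
  · simp
  · have hpd : (p : ℤ) ∣ d := ((dvd_pow_self _ hk0.ne').trans hk').trans S.normModulus_dvd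
    have : Fact p.Prime := ⟨hp⟩
    obtain ⟨x, h1, h2⟩ := S.exists_congrModLocal_lambda C 𝔞 hp hpd
    have h3 := h1.norm_modEq d δ hp (hk'.trans S.normModulus_dvd)
    have h4 : k ≤ padicValInt p (normModulus d ℓ) := by
      rcases (padicValInt_dvd_iff (p := p) k _).1 hk' with h5 | h5
      · exact absurd h5 S.normModulus_neg.ne
      · exact h5
    exact Int.modEq_iff_dvd.1 (h3.trans (h2.of_dvd (pow_dvd_pow _ h4))).symm

theorem isAdmissible_lambda {𝔞 : Ideal (quadOrder d δ)} (ha : IsGoodIdeal 𝔞) :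
    IsAdmissible d δ ℓ q 𝔮 𝔞 (C.lambda 𝔮 𝔞) := by
  refine ⟨fun x hx => ?_, S.norm_lambda_modEq C 𝔞⟩
  have := mul_mem (S.factor_mul_mem C ha hx) (C.lamRam 𝔞).2
  convert this using 1
  rw [C.lambda_eq]
  push_cast; ring

end Setting

end admissible

end

noncomputable section

/-! ### Two local solutions of the norm congruence at a ramified prime -/

section toggle

variable {L : Type*} [Field L] [CharZero L] [StarRing L]
variable (d : ℤ) (δ : L) [h : ImagQuad L d δ]
include h

theorem coe_two_quadOrder : ((2 : quadOrder d δ) : L) = 2 := rfl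

theorem norm_mem_of_mem {P : Ideal (quadOrder d δ)} (hP : P.IsPrime) {p : ℕ} (hp : p.Prime)
    (hpP : (p : quadOrder d δ) ∈ P) {w : quadOrder d δ} (hw : w ∈ P) : (p : ℤ) ∣ Algebra.norm ℤ w := by
  rw [← mem_iff_dvd d δ hP hp hpP]
  have h2 : ((Algebra.norm ℤ w : ℤ) : quadOrder d δ) = w * starHom d δ w := by
    apply Subtype.ext
    have h3 := nm_cast d δ (w : L)
    rw [← norm_coe d δ] at h3
    push_cast [coe_starHom] at h3 ⊢
    exact h3
  rw [h2]
  exact P.mul_mem_right _ hw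

/-- If `2 x` and `2 y` have rational parts `x₀` and `y₀`, then `p ∣ N(x) - N(y)` says that
`x₀ ≡ ± y₀` modulo `p`. The sign is `-`, since `x ≢ y` modulo `𝔇_p`. -/
theorem exists_toggle_odd {p : ℕ} (hp : p.Prime) (hp2 : p ≠ 2) (hpd : (p : ℤ) ∣ d)
    (hpf : ¬ p ∣ conductor (quadOrder d δ)) {P : Ideal (quadOrder d δ)} (hP : P.IsPrime)
    (hpP : (p : quadOrder d δ) ∈ P) {x y w : quadOrder d δ} (hw : w ∈ P)
    (hN : (p : ℤ) ∣ Algebra.norm ℤ x - Algebra.norm ℤ y) (hxy : ¬ CongrModLocal p x y) :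
    ∃ n : ℤ, ¬ (p : ℤ) ∣ n ∧ ∃ z ∈ P, (n : L) * ((x : L) * w - y * star (w : L)) = δ * z := by
  have hpZ := Nat.prime_iff_prime_int.1 hp
  have h2p : ¬ (p : ℤ) ∣ 2 := by
    intro h2
    exact hp2 ((Nat.prime_dvd_prime_iff_eq hp Nat.prime_two).1 (by exact_mod_cast h2))
  have hsq := not_sq_dvd_of_regular d δ hp hp2 hpf
  obtain ⟨d', hd'⟩ := hpd
  have hd'p : ¬ (p : ℤ) ∣ d' := by
    rintro ⟨k, rfl⟩
    exact hsq ⟨k, by rw [hd']; ring⟩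
  have hδ2 : δ ^ 2 = (p : L) * d' := by rw [h.sq, hd']; push_cast; rfl
  have hcoord : ∀ u : quadOrder d δ, ∃ a b : ℤ, 2 * (u : L) = a + b * δ ∧
      4 * Algebra.norm ℤ u = a ^ 2 - d * b ^ 2 := by
    intro u
    obtain ⟨s, t, hst⟩ := (mem_quadOrder_iff d δ).1 u.2
    refine ⟨2 * s + t * d, t, ?_, ?_⟩
    · rw [hst, om]; push_cast; ring
    · have h1 := norm_coe d δ u
      rw [hst, nm_om_coord d δ] at h1
      have h2 : Algebra.norm ℤ u = s ^ 2 + d * s * t + omNorm d * t ^ 2 := by exact_mod_cast h1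
      have h3 := four_mul_omNorm d δ
      rw [h2]
      linear_combination t ^ 2 * h3
  obtain ⟨x0, x1, hx, hNx⟩ := hcoord x
  obtain ⟨y0, y1, hy, hNy⟩ := hcoord y
  obtain ⟨w0, w1, hw', hNw⟩ := hcoord w
  have hwP : (p : ℤ) ∣ w0 := by
    have h1 := norm_mem_of_mem d δ hP hp hpP hw
    refine hpZ.dvd_of_dvd_pow (n := 2) ?_
    rw [show w0 ^ 2 = 4 * Algebra.norm ℤ w + d * w1 ^ 2 by rw [hNw]; ring]
    exact dvd_add (h1.mul_left _) ((Dvd.intro _ hd'.symm).mul_right _)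
  obtain ⟨w0', rfl⟩ := hwP
  have hdvd : (p : ℤ) ∣ (x0 - y0) * (x0 + y0) := by
    have : (x0 - y0) * (x0 + y0) =
        4 * (Algebra.norm ℤ x - Algebra.norm ℤ y) + d * (x1 ^ 2 - y1 ^ 2) := by
      linear_combination -hNx + hNy
    rw [this]
    exact dvd_add (hN.mul_left _) ((Dvd.intro _ hd'.symm).mul_right _)
  have hsum : (p : ℤ) ∣ x0 + y0 := by
    refine (hpZ.dvd_or_dvd hdvd).resolve_left ?_
    rintro ⟨k, hk⟩
    refine hxy ((congrModLocal_iff d δ).2 ⟨2 * d', ?_, δ * k + d' * (x1 - y1), ?_, ?_⟩)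
    · exact fun h1 => (hpZ.dvd_or_dvd h1).elim h2p hd'p
    · exact add_mem (mul_mem (sqrt_mem_quadOrder d δ) (intCast_mem _ k))
        (mul_mem (intCast_mem _ d') (sub_mem (intCast_mem _ x1) (intCast_mem _ y1)))
    · have hk' : (x0 : L) - y0 = p * k := by exact_mod_cast congrArg (Int.cast : ℤ → L) hk
      push_cast
      linear_combination (d' : L) * hx - d' * hy + d' * hk' - k * hδ2
  obtain ⟨k, hk⟩ := hsum
  have hk' : (x0 : L) + y0 = p * k := by exact_mod_cast congrArg (Int.cast : ℤ → L) hk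
  have hws : 2 * star (w : L) = p * w0' - w1 * δ := by
    have := congrArg star hw'
    simp only [star_mul', star_add, star_intCast, h.star_eq, star_ofNat] at this
    rw [this]; push_cast; ring
  push_cast at hw'
  refine ⟨4 * d', ?_, sqrtElem d δ * (2 * (x - y) * (w0' : ℤ) + ((sqrtElem d δ) * (k : ℤ) +
    (d' : ℤ) * ((x1 : ℤ) + (y1 : ℤ))) * (w1 : ℤ)), ?_, ?_⟩
  · exact fun h1 => (hpZ.dvd_or_dvd h1).elim
      (fun h4 => (hpZ.dvd_or_dvd (show (p : ℤ) ∣ 2 * 2 from h4)).elim h2p h2p) hd'p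
  · exact P.mul_mem_right _ ((sqrtElem_mem_iff d δ hP hp hpP).2 (Dvd.intro _ hd'.symm))
  · have hsE : ((sqrtElem d δ : quadOrder d δ) : L) = δ := rfl
    push_cast
    rw [hsE, coe_two_quadOrder]
    linear_combination (2 * (d' : L) * x) * hw' - 2 * (d' : L) * y * hws + (d' : L) * w1 * δ * (hx + hy + hk')
      - (2 * ((x : L) - y) * w0' + k * w1 * δ) * hδ2

variable {d δ}

/-- Membership in the prime above `2` of `ℤ[√m]`, for odd `m`. -/
theorem mem_of_two_mem {P : Ideal (quadOrder d δ)} (hP : P.IsPrime) (h2P : (2 : quadOrder d δ) ∈ P)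
    {m : ℤ} (hm : d = 4 * m) (hm2 : m % 2 = 1) {a b : ℤ} (hab : a % 2 = b % 2) {x : quadOrder d δ}
    (hx : (x : L) = a + b * (δ / 2)) : x ∈ P := by
  obtain ⟨r, hr, -⟩ := exists_elem_of_four_dvd d δ hm 1 1
  have hr2 : r ^ 2 = 2 * (r + ((m - 1) / 2 : ℤ)) := by
    apply Subtype.ext
    obtain ⟨j, rfl⟩ : ∃ j, m = 2 * j + 1 := ⟨m / 2, by omega⟩
    push_cast
    rw [hr, show (2 * j + 1 - 1) / 2 = j by omega, coe_two_quadOrder]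
    have := h.sq
    rw [hm] at this
    push_cast at this ⊢
    linear_combination this / 4
  have hrP : r ∈ P := by
    refine hP.mem_of_pow_mem 2 ?_
    rw [hr2]
    exact P.mul_mem_right _ h2P
  have hx' : x = b * r + 2 * ((a - b) / 2 : ℤ) := by
    apply Subtype.ext
    obtain ⟨j, hj⟩ : ∃ j, a = b + 2 * j := ⟨(a - b) / 2, by omega⟩
    push_cast
    rw [hx, hr, hj, show (b + 2 * j - b) / 2 = j by omega, coe_two_quadOrder]
    push_cast
    ring
  rw [hx']
  exact add_mem (P.mul_mem_left _ hrP) (P.mul_mem_right _ h2P)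

variable (d δ)

/-- For `d = 4 m` the order is `ℤ[√m]`, with `√m = √d / 2`. -/
theorem exists_coord_of_four_dvd {m : ℤ} (hm : d = 4 * m) (u : quadOrder d δ) :
    ∃ a b : ℤ, (u : L) = a + b * (δ / 2) ∧ Algebra.norm ℤ u = a ^ 2 - m * b ^ 2 := by
  obtain ⟨s, t, hst⟩ := (mem_quadOrder_iff d δ).1 u.2
  refine ⟨s + 2 * m * t, t, ?_, ?_⟩
  · rw [hst, om, hm]; push_cast; ring
  · have h1 := norm_coe d δ u
    rw [hst, nm_om_coord d δ] at h1
    have h2 : Algebra.norm ℤ u = s ^ 2 + d * s * t + omNorm d * t ^ 2 := by exact_mod_cast h1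
    have h3 : omNorm d = 4 * m ^ 2 - m := by
      have := four_mul_omNorm d δ
      rw [hm] at this ⊢
      linarith
    rw [h2, h3, hm]
    ring

/-- In `ℤ[√m]` with `m ≡ 3` modulo `4`, the two elements of odd norm that are incongruent modulo `2`
are `1` and `√m`. -/
theorem exists_toggle_two_of_mod_four {m : ℤ} (hm : d = 4 * m) (hm4 : m % 4 = 3)
    {P : Ideal (quadOrder d δ)} (hP : P.IsPrime)
    (h2P : (2 : quadOrder d δ) ∈ P) {x y w : quadOrder d δ} (hw : w ∈ P)
    (hNx : Algebra.norm ℤ x % 2 = 1) (hNy : Algebra.norm ℤ y % 2 = 1)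
    (hxy : ¬ CongrModLocal 2 x y) :
    ∃ z : quadOrder d δ, (m : L) * ((x : L) * w - y * star (w : L)) = δ * z ∧
      (Algebra.norm ℤ x % 4 = 1 → Algebra.norm ℤ y % 4 = 1 → z ∈ P) := by
  obtain ⟨x0, x1, hx, hx'⟩ := exists_coord_of_four_dvd d δ hm x
  obtain ⟨y0, y1, hy, hy'⟩ := exists_coord_of_four_dvd d δ hm y
  obtain ⟨s, t, hs, hs'⟩ := exists_coord_of_four_dvd d δ hm w
  have hδ2 : δ ^ 2 = 4 * m := by rw [h.sq, hm]; push_cast; rfl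
  have hws : star (w : L) = s - t * (δ / 2) := by
    rw [hs]
    simp only [star_mul', star_add, star_intCast, h.star_eq, star_div₀, star_ofNat]
    ring
  have hmod : ∀ a b : ℤ, (a ^ 2 - m * b ^ 2) % 2 = (a + b) % 2 := by
    intro a b
    obtain ⟨j, rfl⟩ : ∃ j, m = 4 * j + 3 := ⟨m / 4, by omega⟩
    rcases Int.emod_two_eq_zero_or_one a with ha | ha <;>
      rcases Int.emod_two_eq_zero_or_one b with hb | hb <;>
      [obtain ⟨a', rfl⟩ : ∃ a', a = 2 * a' := ⟨a / 2, by omega⟩;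
       obtain ⟨a', rfl⟩ : ∃ a', a = 2 * a' := ⟨a / 2, by omega⟩;
       obtain ⟨a', rfl⟩ : ∃ a', a = 2 * a' + 1 := ⟨a / 2, by omega⟩;
       obtain ⟨a', rfl⟩ : ∃ a', a = 2 * a' + 1 := ⟨a / 2, by omega⟩] <;>
      [obtain ⟨b', rfl⟩ : ∃ b', b = 2 * b' := ⟨b / 2, by omega⟩;
       obtain ⟨b', rfl⟩ : ∃ b', b = 2 * b' + 1 := ⟨b / 2, by omega⟩;
       obtain ⟨b', rfl⟩ : ∃ b', b = 2 * b' := ⟨b / 2, by omega⟩;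
       obtain ⟨b', rfl⟩ : ∃ b', b = 2 * b' + 1 := ⟨b / 2, by omega⟩] <;> ring_nf <;> omega
  rw [hx', hmod] at hNx
  rw [hy', hmod] at hNy
  have hst : (s + t) % 2 = 0 := by
    rw [← hmod, ← hs']
    have := norm_mem_of_mem d δ hP Nat.prime_two (by exact_mod_cast h2P) hw
    omega
  -- opposite parities of the coordinates
  have hpar : (x0 + y0) % 2 = 1 := by
    by_contra hne
    refine hxy ((congrModLocal_iff d δ).2 ⟨m, by omega,
      (δ / 2) * (((x0 - y0) / 2 : ℤ) + ((x1 - y1) / 2 : ℤ) * (δ / 2)), ?_, ?_⟩)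
    · obtain ⟨u, hu, -⟩ := exists_elem_of_four_dvd d δ hm ((x1 - y1) / 2 * m) ((x0 - y0) / 2)
      convert u.2 using 1
      rw [hu]
      push_cast
      linear_combination (((x1 - y1) / 2 : ℤ) : L) / 4 * hδ2
    · obtain ⟨u, hu⟩ : ∃ u, x0 = y0 + 2 * u := ⟨(x0 - y0) / 2, by omega⟩
      obtain ⟨v, hv⟩ : ∃ v, x1 = y1 + 2 * v := ⟨(x1 - y1) / 2, by omega⟩
      rw [hx, hy, hu, hv, show (y0 + 2 * u - y0) / 2 = u by omega,
        show (y1 + 2 * v - y1) / 2 = v by omega]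
      push_cast
      linear_combination (-(u : L) / 2 - v * δ / 4) * hδ2
  -- the element is `2 (A + B √m)`
  obtain ⟨A, hA⟩ : ∃ A, (x0 - y0) * s + (x1 + y1) * t * m = 2 * A := by
    refine ⟨((x0 - y0) * s + (x1 + y1) * t * m) / 2, ?_⟩
    obtain ⟨u, hu⟩ : ∃ u, x0 - y0 = 2 * u + 1 := ⟨(x0 - y0) / 2, by omega⟩
    obtain ⟨v, hv⟩ : ∃ v, x1 + y1 = 2 * v + 1 := ⟨(x1 + y1) / 2, by omega⟩
    obtain ⟨j, hj⟩ : ∃ j, m = 4 * j + 3 := ⟨m / 4, by omega⟩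
    obtain ⟨k, hk⟩ : ∃ k, s = -t + 2 * k := ⟨(s + t) / 2, by omega⟩
    rw [hu, hv, hj, hk]
    ring_nf; omega
  obtain ⟨B, hB⟩ : ∃ B, (x1 - y1) * s + (x0 + y0) * t = 2 * B := by
    refine ⟨((x1 - y1) * s + (x0 + y0) * t) / 2, ?_⟩
    obtain ⟨u, hu⟩ : ∃ u, x1 - y1 = 2 * u + 1 := ⟨(x1 - y1) / 2, by omega⟩
    obtain ⟨v, hv⟩ : ∃ v, x0 + y0 = 2 * v + 1 := ⟨(x0 + y0) / 2, by omega⟩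
    obtain ⟨k, hk⟩ : ∃ k, s = -t + 2 * k := ⟨(s + t) / 2, by omega⟩
    rw [hu, hv, hk]
    ring_nf; omega
  obtain ⟨z, hz, -⟩ := exists_elem_of_four_dvd d δ hm (B * m) A
  have hA' : ((x0 : L) - y0) * s + (x1 + y1) * t * m = 2 * A := by exact_mod_cast congrArg (Int.cast : ℤ → L) hA
  have hB' : ((x1 : L) - y1) * s + (x0 + y0) * t = 2 * B := by exact_mod_cast congrArg (Int.cast : ℤ → L) hB
  refine ⟨z, ?_, fun hx4 hy4 => ?_⟩
  · rw [hx, hy, hws, hs, hz]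
    push_cast
    linear_combination (m : L) * hA' + m * δ / 2 * hB' + (m * t * (x1 + y1) / 4 - A / 2 : L) * hδ2
  · refine mem_of_two_mem hP h2P hm (by omega) ?_ hz
    rw [hx'] at hx4
    rw [hy'] at hy4
    obtain ⟨j, rfl⟩ : ∃ j, m = 4 * j + 3 := ⟨m / 4, by omega⟩
    obtain ⟨k, rfl⟩ : ∃ k, s = -t + 2 * k := ⟨(s + t) / 2, by omega⟩
    rcases Int.emod_two_eq_zero_or_one x0 with hx0 | hx0
    · obtain ⟨a, rfl⟩ : ∃ a, x0 = 2 * a := ⟨x0 / 2, by omega⟩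
      obtain ⟨b, rfl⟩ : ∃ a, x1 = 2 * a + 1 := ⟨x1 / 2, by omega⟩
      obtain ⟨c, rfl⟩ : ∃ a, y0 = 2 * a + 1 := ⟨y0 / 2, by omega⟩
      obtain ⟨e, rfl⟩ : ∃ a, y1 = 2 * a := ⟨y1 / 2, by omega⟩
      rcases Int.emod_two_eq_zero_or_one t with ht | ht <;>
      [obtain ⟨t', rfl⟩ : ∃ a, t = 2 * a := ⟨t / 2, by omega⟩;
       obtain ⟨t', rfl⟩ : ∃ a, t = 2 * a + 1 := ⟨t / 2, by omega⟩] <;>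
      · ring_nf at hA hB ⊢; omega
    · obtain ⟨a, rfl⟩ : ∃ a, x0 = 2 * a + 1 := ⟨x0 / 2, by omega⟩
      obtain ⟨b, rfl⟩ : ∃ a, x1 = 2 * a := ⟨x1 / 2, by omega⟩
      obtain ⟨c, rfl⟩ : ∃ a, y0 = 2 * a := ⟨y0 / 2, by omega⟩
      obtain ⟨e, rfl⟩ : ∃ a, y1 = 2 * a + 1 := ⟨y1 / 2, by omega⟩
      rcases Int.emod_two_eq_zero_or_one t with ht | ht <;>
      [obtain ⟨t', rfl⟩ : ∃ a, t = 2 * a := ⟨t / 2, by omega⟩;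
       obtain ⟨t', rfl⟩ : ∃ a, t = 2 * a + 1 := ⟨t / 2, by omega⟩] <;>
      · ring_nf at hA hB ⊢; omega

/-- In `ℤ[√m]` with `m ≡ 2` modulo `4`, two elements of odd norm that are congruent to each other
in norm modulo `4` but are incongruent modulo `2 √m` are congruent up to sign. -/
theorem exists_toggle_two_of_mod_eight {m : ℤ} (hm : d = 4 * m) (hm4 : m % 4 = 2)
    {P : Ideal (quadOrder d δ)} (hP : P.IsPrime)
    (h2P : (2 : quadOrder d δ) ∈ P) {x y w : quadOrder d δ} (hw : w ∈ P)
    (hNx : Algebra.norm ℤ x % 2 = 1)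
    (hNxy : 4 ∣ Algebra.norm ℤ x - Algebra.norm ℤ y) (hxy : ¬ CongrModLocal 2 x y) :
    ∃ z ∈ P, ((m / 2 : ℤ) : L) * ((x : L) * w - y * star (w : L)) = δ * z := by
  obtain ⟨x0, x1, hx, hx'⟩ := exists_coord_of_four_dvd d δ hm x
  obtain ⟨y0, y1, hy, hy'⟩ := exists_coord_of_four_dvd d δ hm y
  obtain ⟨s, t, hs, hs'⟩ := exists_coord_of_four_dvd d δ hm w
  have hδ2 : δ ^ 2 = 4 * m := by rw [h.sq, hm]; push_cast; rfl
  have hws : star (w : L) = s - t * (δ / 2) := by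
    rw [hs]
    simp only [star_mul', star_add, star_intCast, h.star_eq, star_div₀, star_ofNat]
    ring
  obtain ⟨j, rfl⟩ : ∃ j, m = 4 * j + 2 := ⟨m / 4, by omega⟩
  have hmod : ∀ a b : ℤ, (a ^ 2 - (4 * j + 2) * b ^ 2) % 2 = a % 2 := by
    intro a b
    rcases Int.emod_two_eq_zero_or_one a with ha | ha <;>
      [obtain ⟨a', rfl⟩ : ∃ a', a = 2 * a' := ⟨a / 2, by omega⟩;
       obtain ⟨a', rfl⟩ : ∃ a', a = 2 * a' + 1 := ⟨a / 2, by omega⟩] <;> ring_nf <;> omega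
  have hNy : Algebra.norm ℤ y % 2 = 1 := by omega
  rw [hx', hmod] at hNx
  rw [hy', hmod] at hNy
  have hst : s % 2 = 0 := by
    rw [← hmod s t, ← hs']
    have := norm_mem_of_mem d δ hP Nat.prime_two (by exact_mod_cast h2P) hw
    omega
  rw [hx', hy'] at hNxy
  have hpar : (x1 - y1) % 2 = 0 := by
    obtain ⟨a, rfl⟩ : ∃ a, x0 = 2 * a + 1 := ⟨x0 / 2, by omega⟩
    obtain ⟨c, rfl⟩ : ∃ a, y0 = 2 * a + 1 := ⟨y0 / 2, by omega⟩
    rcases Int.emod_two_eq_zero_or_one x1 with hx0 | hx0 <;>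
      rcases Int.emod_two_eq_zero_or_one y1 with hb | hb
    · omega
    · obtain ⟨b, rfl⟩ : ∃ a, x1 = 2 * a := ⟨x1 / 2, by omega⟩
      obtain ⟨e, rfl⟩ : ∃ a, y1 = 2 * a + 1 := ⟨y1 / 2, by omega⟩
      ring_nf at hNxy; omega
    · obtain ⟨b, rfl⟩ : ∃ a, x1 = 2 * a + 1 := ⟨x1 / 2, by omega⟩
      obtain ⟨e, rfl⟩ : ∃ a, y1 = 2 * a := ⟨y1 / 2, by omega⟩
      ring_nf at hNxy; omega
    · omega
  have hpar0 : (x0 + y0) % 4 = 0 := by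
    by_contra hne
    obtain ⟨u, hu⟩ : ∃ u, x0 = y0 + 4 * u := ⟨(x0 - y0) / 4, by omega⟩
    obtain ⟨v, hv⟩ : ∃ v, x1 = y1 + 2 * v := ⟨(x1 - y1) / 2, by omega⟩
    refine hxy ((congrModLocal_iff d δ).2 ⟨2 * j + 1, by push_cast; omega,
      ((2 * j + 1) * v : ℤ) + u * (δ / 2), ?_, ?_⟩)
    · obtain ⟨z, hz, -⟩ := exists_elem_of_four_dvd d δ hm ((2 * j + 1) * v) u
      convert z.2 using 1
      exact hz.symm
    · rw [hx, hy, hu, hv]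
      push_cast at hδ2 ⊢
      linear_combination -(u : L) / 2 * hδ2
  obtain ⟨s', rfl⟩ : ∃ a, s = 2 * a := ⟨s / 2, by omega⟩
  obtain ⟨A, hA⟩ : ∃ A, (x0 - y0) * (2 * s') + (x1 + y1) * t * (4 * j + 2) = 4 * A := by
    obtain ⟨u, hu⟩ : ∃ u, x0 - y0 = 2 * u := ⟨(x0 - y0) / 2, by omega⟩
    obtain ⟨v, hv⟩ : ∃ v, x1 + y1 = 2 * v := ⟨(x1 + y1) / 2, by omega⟩
    exact ⟨u * s' + v * t * (2 * j + 1), by rw [hu, hv]; ring⟩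
  obtain ⟨B, hB⟩ : ∃ B, (x1 - y1) * (2 * s') + (x0 + y0) * t = 4 * B := by
    obtain ⟨u, hu⟩ : ∃ u, x1 - y1 = 2 * u := ⟨(x1 - y1) / 2, by omega⟩
    obtain ⟨v, hv⟩ : ∃ v, x0 + y0 = 4 * v := ⟨(x0 + y0) / 4, by omega⟩
    exact ⟨u * s' + v * t, by rw [hu, hv]; ring⟩
  obtain ⟨r, hr, -⟩ := exists_elem_of_four_dvd d δ hm 0 1
  obtain ⟨z, hz, -⟩ := exists_elem_of_four_dvd d δ hm A B
  have hrP : r ∈ P := by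
    refine hP.mem_of_pow_mem 2 ?_
    have : r ^ 2 = 2 * ((2 * j + 1 : ℤ) : quadOrder d δ) := by
      apply Subtype.ext
      push_cast
      rw [hr, coe_two_quadOrder]
      push_cast at hδ2 ⊢
      linear_combination hδ2 / 4
    rw [this]
    exact P.mul_mem_right _ h2P
  have hA' : ((x0 : L) - y0) * (2 * s') + (x1 + y1) * t * (4 * j + 2) = 4 * A := by
    exact_mod_cast congrArg (Int.cast : ℤ → L) hA
  have hB' : ((x1 : L) - y1) * (2 * s') + (x0 + y0) * t = 4 * B := by
    exact_mod_cast congrArg (Int.cast : ℤ → L) hB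
  refine ⟨r * z, P.mul_mem_right _ hrP, ?_⟩
  rw [hx, hy, hws, hs, show (4 * j + 2) / 2 = 2 * j + 1 by omega]
  push_cast at hδ2 ⊢
  rw [hz, hr]
  push_cast
  linear_combination (2 * (j : L) + 1) * (hA' + δ / 2 * hB') +
    ((2 * j + 1) * t * (x1 + y1) / 4 - (A + B * δ / 2) / 2 : L) * hδ2

end toggle

end

noncomputable section

/-! ### Conjugating the orders by ideals -/

section conjugate

variable {L : Type*} [Field L] [CharZero L] [StarRing L]
theorem mem_locAt_of_eq {Λ : Submodule ℤ L} {p n : ℤ} (hn : IsCoprime n p) {x y : L}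
    (hxy : (n : L) * x = y) (hy : y ∈ locAt p Λ) : x ∈ locAt p Λ := by
  refine mem_locAt_of_smul_mem hn ?_
  rwa [zsmul_eq_mul, hxy]

variable {d : ℤ} {δ : L} [h : ImagQuad L d δ]
include h

theorem quadOrder_le_locAt_idealLattice {P : Ideal (quadOrder d δ)} (hP : P ≠ ⊥)
    (hPp : P.IsPrime) {p : ℕ} (hp : p.Prime) (hpP : (p : quadOrder d δ) ∉ P) {x : L}
    (hx : x ∈ quadOrder d δ) : x ∈ locAt (p : ℤ) (idealLattice P) := by
  obtain ⟨m, hm, hmP⟩ := exists_int_mem d δ hP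
  obtain ⟨r, hr, -, hrP⟩ := exists_prime_mem d δ hPp hm hmP
  have hrp : r ≠ p := by rintro rfl; exact hpP hrP
  refine mem_locAt.2 ⟨r, Nat.isCoprime_iff_coprime.2 ((Nat.coprime_primes hr hp).2 hrp), ?_⟩
  rw [zsmul_eq_mul, mul_comm]
  refine mul_mem_of_toSubmodule_mul (toSubmodule_mul_idealLattice P) hx ?_
  have := coe_mem_idealLattice.2 hrP
  simpa using this

namespace Setting

variable {ℓ q : ℕ} {𝔩 𝔮 : Ideal (quadOrder d δ)} (S : Setting d δ ℓ q 𝔩 𝔮)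
include S

theorem pow_dvd_norm_sub {p : ℕ} (hp : p.Prime) {x : quadOrder d δ} {k : ℕ}
    (hk : (p : ℤ) ^ k ∣ normModulus d ℓ)
    (hx : Algebra.norm ℤ x ≡ jSq d ℓ q [ZMOD (p : ℤ) ^ padicValInt p (normModulus d ℓ)]) :
    (p : ℤ) ^ k ∣ Algebra.norm ℤ x - jSq d ℓ q := by
  have : Fact p.Prime := ⟨hp⟩
  have h4 : k ≤ padicValInt p (normModulus d ℓ) := by
    rcases (padicValInt_dvd_iff (p := p) k _).1 hk with h5 | h5
    · exact absurd h5 S.normModulus_neg.ne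
    · exact h5
  exact (pow_dvd_pow _ h4).trans (Int.modEq_iff_dvd.1 hx.symm)

/-- Passing from `𝔞` to `𝔭 𝔞` at the ramified prime `𝔭` exchanges the two local solutions. -/
theorem toggle_mem {p : ℕ} (hp : p.Prime) (hpd : (p : ℤ) ∣ d)
    (hpf : ¬ p ∣ conductor (quadOrder d δ)) {P : Ideal (quadOrder d δ)} (hP : P.IsPrime)
    (hpP : (p : quadOrder d δ) ∈ P) {x y : quadOrder d δ}
    (hx : Algebra.norm ℤ x ≡ jSq d ℓ q [ZMOD (p : ℤ) ^ padicValInt p (normModulus d ℓ)])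
    (hy : Algebra.norm ℤ y ≡ jSq d ℓ q [ZMOD (p : ℤ) ^ padicValInt p (normModulus d ℓ)])
    (hxy : ¬ CongrModLocal p x y) (hℓ : p = ℓ → ℓ ≠ 2 → x = -y) {w : quadOrder d δ} (hw : w ∈ P)
    {e : L} (he : e ∈ alphaLattice d δ ℓ 𝔩) :
    ((x : L) * w - y * star (w : L)) * e ∈ locAt (p : ℤ) (idealLattice P) := by
  suffices H : ∃ n : ℤ, ¬ (p : ℤ) ∣ n ∧ ∃ z : quadOrder d δ,
      (n : L) * ((x : L) * w - y * star (w : L)) = δ * z ∧ (z ∈ P ∨ p = ℓ) by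
    obtain ⟨n, hn, z, hz, hzP⟩ := H
    refine mem_locAt_of_eq ((isCoprime_prime_iff hp).2 hn) (y := (z : L) * (δ * e)) ?_
      (le_locAt _ _ ?_)
    · rw [← mul_assoc, hz]; ring
    · rcases hzP with hzP | rfl
      · rw [mul_comm]
        exact mul_mem_of_toSubmodule_mul (toSubmodule_mul_idealLattice P) (S.sqrt_mul_mem he)
          (coe_mem_idealLattice.2 hzP)
      -- for `p = ℓ` the factor `𝔩` of `𝔈` is `P`
      · refine mul_mem_of_toSubmodule_mul (toSubmodule_mul_idealLattice P) z.2 ?_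
        rw [alphaLattice, if_pos hpd, latticeInv_sqrtIdeal d δ, eq_of_ramified d δ S.isPrime_l hP hp S.ell_mem
          hpP hpd] at he
        induction he using Submodule.mul_induction_on' with
        | add y _ z _ hy hz => rw [mul_add]; exact add_mem hy hz
        | mem_mul_mem u hu v hv =>
          have hδv : δ * v ∈ quadOrder d δ := by
            rw [Submodule.mem_span_singleton_mul] at hv
            obtain ⟨v', hv', rfl⟩ := hv
            rwa [← mul_assoc, mul_inv_cancel₀ (sqrt_ne_zero d δ), one_mul]
          rw [mul_left_comm, mul_comm]
          exact mul_mem_of_toSubmodule_mul (toSubmodule_mul_idealLattice P) hδv hu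
  have hmodulus : p ≠ ℓ → normModulus d ℓ = d ∨ ((ℓ : ℤ) ∣ d ∧ d = ℓ * normModulus d ℓ) := by
    intro _
    unfold normModulus
    by_cases hℓd : (ℓ : ℤ) ∣ d
    · rw [if_pos hℓd]; exact Or.inr ⟨hℓd, (Int.mul_ediv_cancel' hℓd).symm⟩
    · rw [if_neg hℓd]; exact Or.inl rfl
  have hpow : ∀ k : ℕ, p ≠ ℓ → (p : ℤ) ^ k ∣ d → (p : ℤ) ^ k ∣ normModulus d ℓ := by
    intro k hne hk
    rcases hmodulus hne with h1 | ⟨-, h1⟩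
    · rwa [h1]
    · rw [h1] at hk
      refine (IsCoprime.pow_left ?_).dvd_of_dvd_mul_left hk
      exact Nat.isCoprime_iff_coprime.2 ((Nat.coprime_primes hp S.prime_ell).2 hne)
  have hdiff : ∀ k : ℕ, (p : ℤ) ^ k ∣ normModulus d ℓ →
      (p : ℤ) ^ k ∣ Algebra.norm ℤ x - Algebra.norm ℤ y := by
    intro k hk
    have := dvd_sub (S.pow_dvd_norm_sub hp hk hx) (S.pow_dvd_norm_sub hp hk hy)
    rwa [sub_sub_sub_cancel_right] at this
  by_cases hp2 : p = 2
  · subst hp2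
    have h2P : (2 : quadOrder d δ) ∈ P := by exact_mod_cast hpP
    have hcodd : jSq d ℓ q % 2 = 1 := by
      have := S.not_dvd_jSq hp hpd
      push_cast at this
      omega
    have hreg := mod_of_regular_two d δ hpd hpf
    obtain ⟨m, hm⟩ : ∃ m, d = 4 * m := ⟨d / 4, by omega⟩
    have hN : ∀ k : ℕ, k ≤ 2 → (ℓ = 2 → k ≤ 1 ∨ d % 8 = 0) →
        (2 : ℤ) ^ k ∣ Algebra.norm ℤ x - jSq d ℓ q ∧ (2 : ℤ) ^ k ∣ Algebra.norm ℤ y - jSq d ℓ q := by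
      intro k hk hk'
      have hkD : ((2 : ℕ) : ℤ) ^ k ∣ normModulus d ℓ := by
        by_cases hne : 2 = ℓ
        · subst hne
          unfold normModulus
          rw [if_pos hpd]
          interval_cases k
          · simp
          · push_cast; omega
          · push_cast
            have := hk' rfl
            omega
        · refine hpow k hne ?_
          push_cast
          exact (pow_dvd_pow 2 hk).trans ⟨m, by rw [hm]; norm_num⟩
      exact ⟨S.pow_dvd_norm_sub hp hkD hx, S.pow_dvd_norm_sub hp hkD hy⟩
    obtain ⟨h1x, h1y⟩ := hN 1 (by norm_num) (fun _ => Or.inl le_rfl)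
    by_cases hm3 : m % 4 = 3
    · obtain ⟨z, hz, hzP⟩ := exists_toggle_two_of_mod_four d δ hm hm3 hP h2P hw (by omega) (by omega) hxy
      refine ⟨m, by push_cast; omega, z, hz, ?_⟩
      by_cases hne : 2 = ℓ
      · exact Or.inr hne
      · obtain ⟨h2x, h2y⟩ := hN 2 le_rfl (fun h1 => absurd h1.symm hne)
        have hc4 := (S.jSq_modEq_two_pow hpd (Ne.symm hne)).2.1 (by omega)
        exact Or.inl (hzP (by omega) (by omega))
    · obtain ⟨h2x, h2y⟩ := hN 2 le_rfl (fun _ => Or.inr (by omega))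
      obtain ⟨z, hzP, hz⟩ := exists_toggle_two_of_mod_eight d δ hm (by omega) hP h2P hw (by omega)
        (by omega) hxy
      exact ⟨m / 2, by push_cast; omega, z, hz, Or.inl hzP⟩
  · have hN : (p : ℤ) ∣ Algebra.norm ℤ x - Algebra.norm ℤ y := by
      by_cases hne : p = ℓ
      · subst hne
        rw [hℓ rfl hp2, norm_neg_eq, sub_self]
        exact dvd_zero _
      · simpa using hdiff 1 (by simpa using hpow 1 hne (by simpa using hpd))
    obtain ⟨n, hn, z, hzP, hz⟩ := exists_toggle_odd d δ hp hp2 hpd hpf hP hpP hw hN hxy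
    exact ⟨n, hn, z, hz, Or.inl hzP⟩

omit S in
theorem twistLattice_mul {P 𝔞 : Ideal (quadOrder d δ)} (hP : IsGoodIdeal P) (ha : IsGoodIdeal 𝔞) :
    twistLattice d δ 𝔮 (P * 𝔞) = latticeConj (idealLattice P) *
      latticeInv (quadOrder d δ) (idealLattice P) * twistLattice d δ 𝔮 𝔞 := by
  simp only [twistLattice]
  rw [idealLattice_mul, latticeConj_mul, hP.1.inv_mul ha.1]
  ac_rfl

theorem idealLattice_mul_twistLattice {P 𝔞 : Ideal (quadOrder d δ)} (hP : IsGoodIdeal P)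
    (ha : IsGoodIdeal 𝔞) : idealLattice P * twistLattice d δ 𝔮 (P * 𝔞) =
      latticeConj (idealLattice P) * twistLattice d δ 𝔮 𝔞 := by
  rw [twistLattice_mul hP ha]
  calc _ = (idealLattice P * latticeInv (quadOrder d δ) (idealLattice P)) * twistLattice d δ 𝔮 𝔞 *
        latticeConj (idealLattice P) := by ac_rfl
    _ = _ := by rw [hP.1.2, (S.isInvertible_twistLattice ha).1, mul_comm]

variable (C : LambdaChoice d δ ℓ q)

/-- A congruence modulo `𝔇_p` compensates the denominators of `𝔈`, which divide `√d`. -/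
theorem congr_mul_mem {p : ℕ} (hp : p.Prime) {I : Ideal (quadOrder d δ)} {u x : quadOrder d δ}
    (hux : CongrModLocal p u x) {w e : L} (hw : w ∈ idealLattice I) (he : e ∈ alphaLattice d δ ℓ 𝔩) :
    ((u : L) - x) * w * e ∈ locAt (p : ℤ) (idealLattice I) := by
  obtain ⟨n, hn, v, hv, hvn⟩ := (congrModLocal_iff d δ).1 hux
  refine mem_locAt_of_eq ((isCoprime_prime_iff hp).2 hn) (y := (v * (δ * e)) * w) ?_ (le_locAt _ _ ?_)
  · linear_combination w * e * hvn
  · exact mul_mem_of_toSubmodule_mul (toSubmodule_mul_idealLattice I) (mul_mem hv (S.sqrt_mul_mem he)) hw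

/-- The congruence that lets a prime ideal pass from one side of the orders to the other. It is
checked one prime number at a time. -/
theorem lambda_sub_mul_mem {P 𝔞 : Ideal (quadOrder d δ)} (hP : P.IsPrime) (hPg : IsGoodIdeal P)
    (ha : IsGoodIdeal 𝔞) {w z : L} (hw : w ∈ idealLattice P)
    (hz : z ∈ alphaLattice d δ ℓ 𝔩 * twistLattice d δ 𝔮 𝔞) :
    ((C.lambda 𝔮 𝔞 : L) * w - (C.lambda 𝔮 (P * 𝔞) : L) * star w) * z ∈ idealLattice P := by
  obtain ⟨hwO, hwP⟩ := mem_idealLattice.1 hw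
  have hwc : star w ∈ latticeConj (idealLattice P) := by rwa [mem_latticeConj, star_star]
  refine mem_of_forall_prime fun p hp => ?_
  by_cases hpd : (p : ℤ) ∣ d
  · -- here `z` may be taken in the first lattice
    have hz' : ((C.coprimeFactor 𝔞 * C.M 𝔮 : ℤ) : L) * z ∈ alphaLattice d δ ℓ 𝔩 := by
      induction hz using Submodule.mul_induction_on' with
      | add y _ z _ hy hz => rw [mul_add]; exact add_mem hy hz
      | mem_mul_mem e he t ht =>
        rw [mul_left_comm, mul_comm]
        exact mul_mem_of_toSubmodule_mul S.isInvertible_alphaLattice.1 (S.factor_mul_mem C ha ht) he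
    have hcop : IsCoprime (C.coprimeFactor 𝔞 * C.M 𝔮) (p : ℤ) := by
      obtain ⟨k, hk⟩ := Int.modEq_iff_dvd.1 ((S.factor_modEq C 𝔞).of_dvd hpd)
      exact ⟨1, k, by linear_combination -hk⟩
    refine mem_locAt_of_eq hcop (y := ((C.lambda 𝔮 𝔞 : L) * w - (C.lambda 𝔮 (P * 𝔞) : L) * star w) *
      (((C.coprimeFactor 𝔞 * C.M 𝔮 : ℤ) : L) * z)) (by ring) ?_
    generalize ((C.coprimeFactor 𝔞 * C.M 𝔮 : ℤ) : L) * z = e at hz'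
    by_cases hpP : (p : quadOrder d δ) ∈ P
    -- `P` is the ramified prime above `p`: the parity of its exponent changes
    · have hpf : ¬ p ∣ conductor (quadOrder d δ) := by
        intro hpf
        obtain ⟨m, hm, hmf, hmP⟩ := hPg.exists_coprime
        have h1 : (p : ℤ) ∣ m := (mem_iff_dvd d δ hP hp hpP).1 hmP
        exact ((isCoprime_prime_iff hp).1 (hmf.of_isCoprime_of_dvd_right
          (Int.natCast_dvd_natCast.2 hpf))) h1
      have hconj := latticeConj_eq_of_sqrtElem_mem d δ ((sqrtElem_mem_iff d δ hP hp hpP).2 hpd)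
      have key : ∀ x y : quadOrder d δ, CongrModLocal p (C.lambda 𝔮 𝔞) x →
          CongrModLocal p (C.lambda 𝔮 (P * 𝔞)) y →
          Algebra.norm ℤ x ≡ jSq d ℓ q [ZMOD (p : ℤ) ^ padicValInt p (normModulus d ℓ)] →
          Algebra.norm ℤ y ≡ jSq d ℓ q [ZMOD (p : ℤ) ^ padicValInt p (normModulus d ℓ)] →
          ¬ CongrModLocal p x y → (p = ℓ → ℓ ≠ 2 → x = -y) →
          ((C.lambda 𝔮 𝔞 : L) * w - (C.lambda 𝔮 (P * 𝔞) : L) * star w) * e ∈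
            locAt (p : ℤ) (idealLattice P) := by
        intro x y hx hy hNx hNy hxy hℓ
        have h1 := S.congr_mul_mem hp hx hw hz'
        have h2 := S.congr_mul_mem hp hy (hconj ▸ hwc) hz'
        have h3 := S.toggle_mem hp hpd hpf hP hpP hNx hNy hxy hℓ hwP hz'
        convert add_mem (sub_mem h1 h2) h3 using 1
        ring
      have hmul := multiplicity_mul_self d δ hP hPg ha
      have h1 := S.congrModLocal_lambda C (C.lamRam_regular 𝔞 p hp hpd hpf P hP hpP)
      have h2 := S.congrModLocal_lambda C (C.lamRam_regular (P * 𝔞) p hp hpd hpf P hP hpP)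
      rw [hmul] at h2
      by_cases heven : Even (multiplicity P 𝔞)
      · rw [if_pos heven] at h1
        rw [if_neg (by rwa [Nat.even_add_one, not_not])] at h2
        exact key _ _ h1 h2 (C.norm_lam p hp hpd) (C.norm_lamTilde p hp hpd hpf)
          (C.not_congr p hp hpd hpf) (fun h3 h4 => by subst h3; exact C.lam_ell hpd h4)
      · rw [if_neg heven] at h1
        rw [if_pos (by rwa [Nat.even_add_one])] at h2
        refine key _ _ h1 h2 (C.norm_lamTilde p hp hpd hpf) (C.norm_lam p hp hpd)
          (fun h3 => C.not_congr p hp hpd hpf ?_)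
          (fun h3 h4 => by subst h3; rw [C.lam_ell hpd h4, neg_neg])
        obtain ⟨n, hn, hnz⟩ := h3
        refine ⟨-n, by rwa [dvd_neg], ?_⟩
        rwa [neg_smul, ← smul_neg, neg_sub]
    -- both elements are congruent to the same `τ`, and `w - w̄` is a multiple of `√d`
    · obtain ⟨τ, h1, h2⟩ : ∃ τ, CongrModLocal p (C.lambda 𝔮 𝔞) τ ∧
          CongrModLocal p (C.lambda 𝔮 (P * 𝔞)) τ := by
        by_cases hpf : p ∣ conductor (quadOrder d δ)
        · exact ⟨_, S.congrModLocal_lambda C (C.lamRam_irregular _ p hp hpf),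
            S.congrModLocal_lambda C (C.lamRam_irregular _ p hp hpf)⟩
        · obtain ⟨Q, hQ, hpQ⟩ := exists_isPrime_mem d δ hp
          have h2 := S.congrModLocal_lambda C (C.lamRam_regular (P * 𝔞) p hp hpd hpf Q hQ hpQ)
          rw [multiplicity_mul_of_ne d δ hQ (isGoodIdeal_of_prime d δ hp hpf hpQ) hP hPg ha
            (by rintro rfl; exact hpP hpQ)] at h2
          exact ⟨_, S.congrModLocal_lambda C (C.lamRam_regular 𝔞 p hp hpd hpf Q hQ hpQ), h2⟩
      have hle : locAt (p : ℤ) (idealLattice (⊤ : Ideal (quadOrder d δ))) ≤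
          locAt (p : ℤ) (idealLattice P) := by
        intro x hx
        obtain ⟨n, hn, hnx⟩ := mem_locAt.1 hx
        refine mem_locAt_of_smul_mem hn ?_
        rw [idealLattice_top] at hnx
        exact quadOrder_le_locAt_idealLattice hPg.ne_bot hP hp hpP hnx
      refine hle ?_
      have hwT : w ∈ idealLattice (⊤ : Ideal (quadOrder d δ)) := by rw [idealLattice_top]; exact hwO
      have hwT' : star w ∈ idealLattice (⊤ : Ideal (quadOrder d δ)) := by
        rw [idealLattice_top]; exact star_mem_quadOrder d δ hwO
      have h3 := S.congr_mul_mem hp h1 hwT hz'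
      have h4 := S.congr_mul_mem hp h2 hwT' hz'
      have h5 : (τ : L) * (w - star w) * e ∈ idealLattice (⊤ : Ideal (quadOrder d δ)) := by
        rw [idealLattice_top]
        obtain ⟨n, hn⟩ := exists_sub_star d δ hwO
        rw [hn, Subalgebra.mem_toSubmodule]
        have := mul_mem (mul_mem τ.2 (intCast_mem (quadOrder d δ) n)) (S.sqrt_mul_mem hz')
        convert this using 1
        ring
      convert add_mem (sub_mem h3 h4) (le_locAt (p : ℤ) _ h5) using 1
      ring
  · -- here `z` may be taken in `𝔮⁻¹ 𝔞̄ 𝔞⁻¹`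
    have hT := (S.isInvertible_twistLattice ha).1
    have hz' : (d : L) * z ∈ twistLattice d δ 𝔮 𝔞 := by
      have h1 : δ * z ∈ twistLattice d δ 𝔮 𝔞 := by
        induction hz using Submodule.mul_induction_on' with
        | add y _ z _ hy hz => rw [mul_add]; exact add_mem hy hz
        | mem_mul_mem e he t ht =>
          rw [← mul_assoc]
          exact mul_mem_of_toSubmodule_mul hT (S.sqrt_mul_mem he) ht
      rw [← h.sq, sq, mul_assoc]
      exact mul_mem_of_toSubmodule_mul hT (sqrt_mem_quadOrder d δ) h1
    refine mem_locAt.2 ⟨d, ((isCoprime_prime_iff hp).2 hpd), ?_⟩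
    have h1 := mul_mem_of_toSubmodule_mul (toSubmodule_mul_idealLattice P)
      ((S.isAdmissible_lambda C ha).1 _ hz') hw
    have h2 : (C.lambda 𝔮 (P * 𝔞) : L) * (star w * (d * z)) ∈ idealLattice P := by
      have h3 : star w * (d * z) ∈ idealLattice P * twistLattice d δ 𝔮 (P * 𝔞) := by
        rw [S.idealLattice_mul_twistLattice hPg ha]
        exact Submodule.mul_mem_mul hwc hz'
      clear hz' hwc
      generalize star w * (d * z) = y at h3
      induction h3 using Submodule.mul_induction_on' with
      | add y _ z _ hy hz => rw [mul_add]; exact add_mem hy hz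
      | mem_mul_mem u hu t ht =>
        rw [mul_left_comm, mul_comm]
        exact mul_mem_of_toSubmodule_mul (toSubmodule_mul_idealLattice P)
          ((S.isAdmissible_lambda C (hPg.mul d δ ha)).1 _ ht) hu
    rw [zsmul_eq_mul]
    convert sub_mem h1 h2 using 1
    ring

omit h S in
theorem mem_embLattice {c : ℤ} {I : Submodule ℤ L} {x : quatAlg L c} :
    x ∈ embLattice c I ↔ ∃ w ∈ I, emb c w = x := Iff.rfl

omit h S in
theorem embLattice_mul {c : ℤ} (I J : Submodule ℤ L) :
    embLattice c (I * J) = embLattice c I * embLattice c J := by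
  refine le_antisymm ?_ (Submodule.mul_le.2 ?_)
  · rintro _ ⟨x, hx, rfl⟩
    change emb c x ∈ _
    induction hx using Submodule.mul_induction_on' with
    | add y _ z _ hy hz => rw [map_add]; exact add_mem hy hz
    | mem_mul_mem y hy z hz =>
      rw [map_mul]
      exact Submodule.mul_mem_mul (mem_embLattice.2 ⟨y, hy, rfl⟩) (mem_embLattice.2 ⟨z, hz, rfl⟩)
  · rintro _ ⟨y, hy, rfl⟩ _ ⟨z, hz, rfl⟩
    exact ⟨y * z, Submodule.mul_mem_mul hy hz, map_mul (emb c) y z⟩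

omit h S in
theorem submodule_mul_assoc {c : ℤ} (I J K : Submodule ℤ (quatAlg L c)) : I * J * K = I * (J * K) := by
  refine le_antisymm (Submodule.mul_le.2 ?_) (Submodule.mul_le.2 ?_)
  · intro x hx z hz
    induction hx using Submodule.mul_induction_on' with
    | add x _ y _ hx hy => rw [add_mul]; exact add_mem hx hy
    | mem_mul_mem x hx y hy =>
      rw [mul_assoc]
      exact Submodule.mul_mem_mul hx (Submodule.mul_mem_mul hy hz)
  · intro x hx z hz
    induction hz using Submodule.mul_induction_on' with
    | add y _ z _ hy hz => rw [mul_add]; exact add_mem hy hz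
    | mem_mul_mem y hy z hz =>
      rw [← mul_assoc]
      exact Submodule.mul_mem_mul (Submodule.mul_mem_mul hx hy) hz

omit h S in
theorem quat_mul_emb {c : ℤ} (α β w : L) : quat c α β * emb c w = quat c (α * w) (β * star w) := by
  rw [emb_eq, quat_mul, mul_zero, star_zero, mul_zero, add_zero, zero_add]

omit h S in
theorem emb_mul_quat {c : ℤ} (α β w : L) : emb c w * quat c α β = quat c (w * α) (w * β) := by
  rw [emb_eq, quat_mul, mul_zero, zero_mul, add_zero, zero_mul, add_zero]

theorem quat_mem_order {𝔞 : Ideal (quadOrder d δ)} (ha : IsGoodIdeal 𝔞) {α β : L} :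
    quat _ α β ∈ C.order 𝔩 𝔮 𝔞 ↔ β ∈ alphaLattice d δ ℓ 𝔩 * twistLattice d δ 𝔮 𝔞 ∧
      α - (C.lambda 𝔮 𝔞 : L) * β ∈ quadOrder d δ :=
  S.quat_mem_quatOrder (S.isAdmissible_lambda C ha)

/-- `R(𝔞) P` consists of the `[α : β]` with `β ∈ 𝔅 P̄` and `α - λ_{P𝔞} β ∈ P`, where `𝔅` is the lattice of
second coordinates of `R(𝔞)`, and so does `P R(P 𝔞)`. -/
theorem order_mul_embLattice_prime {P 𝔞 : Ideal (quadOrder d δ)} (hP : P.IsPrime)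
    (hPg : IsGoodIdeal P) (ha : IsGoodIdeal 𝔞) :
    C.order 𝔩 𝔮 𝔞 * embLattice (jSq d ℓ q) (idealLattice P) =
      embLattice (jSq d ℓ q) (idealLattice P) * C.order 𝔩 𝔮 (P * 𝔞) := by
  have hPa := IsGoodIdeal.mul d δ hPg ha
  have hET : idealLattice P * (alphaLattice d δ ℓ 𝔩 * twistLattice d δ 𝔮 (P * 𝔞)) =
      latticeConj (idealLattice P) * (alphaLattice d δ ℓ 𝔩 * twistLattice d δ 𝔮 𝔞) := by
    rw [mul_left_comm, S.idealLattice_mul_twistLattice hPg ha, mul_left_comm]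
  have hOP : ∀ {x y : L}, x ∈ quadOrder d δ → y ∈ idealLattice P → x * y ∈ idealLattice P :=
    fun hx hy => mul_mem_of_toSubmodule_mul (toSubmodule_mul_idealLattice P) hx hy
  refine le_antisymm (Submodule.mul_le.2 ?_) (Submodule.mul_le.2 ?_)
  · have key : ∀ β ∈ idealLattice P * (alphaLattice d δ ℓ 𝔩 * twistLattice d δ 𝔮 (P * 𝔞)), ∀ α : L,
        α - (C.lambda 𝔮 (P * 𝔞) : L) * β ∈ idealLattice P →
        quat _ α β ∈ embLattice (jSq d ℓ q) (idealLattice P) * C.order 𝔩 𝔮 (P * 𝔞) := by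
      intro β hβ
      induction hβ using Submodule.mul_induction_on' with
      | add y _ z _ hy hz =>
        intro α hα
        have h1 := add_mem (hy (C.lambda 𝔮 (P * 𝔞) * y) (by rw [sub_self]; exact zero_mem _))
          (hz (α - C.lambda 𝔮 (P * 𝔞) * y) (by convert hα using 1; ring))
        rwa [quat_add, add_sub_cancel] at h1
      | mem_mul_mem w hw β hβ =>
        intro α hα
        have h1 : quat _ (C.lambda 𝔮 (P * 𝔞) * β) β ∈ C.order 𝔩 𝔮 (P * 𝔞) :=
          (S.quat_mem_order C hPa).2 ⟨hβ, by rw [sub_self]; exact zero_mem _⟩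
        have h2 : (1 : quatAlg L (jSq d ℓ q)) ∈ C.order 𝔩 𝔮 (P * 𝔞) :=
          (S.isOrder hPa (S.isAdmissible_lambda C hPa)).one_mem
        have h3 := add_mem (Submodule.mul_mem_mul (mem_embLattice.2 ⟨w, hw, rfl⟩) h1)
          (Submodule.mul_mem_mul (mem_embLattice.2 ⟨_, hα, rfl⟩) h2)
        rw [mul_one, emb_mul_quat, emb_eq, quat_add] at h3
        convert h3 using 2 <;> ring
    intro r hr x hx
    obtain ⟨w, hw, rfl⟩ := mem_embLattice.1 hx
    obtain ⟨α, β, rfl⟩ := exists_quat r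
    obtain ⟨h1, h2⟩ := (S.quat_mem_order C ha).1 hr
    rw [quat_mul_emb]
    refine key _ ?_ _ ?_
    · rw [hET, mul_comm]
      exact Submodule.mul_mem_mul h1 (by rwa [mem_latticeConj, star_star])
    · convert add_mem (hOP h2 hw) (S.lambda_sub_mul_mem C hP hPg ha hw h1) using 1
      ring
  · have key : ∀ β ∈ latticeConj (idealLattice P) * (alphaLattice d δ ℓ 𝔩 * twistLattice d δ 𝔮 𝔞),
        ∀ α : L, α - (C.lambda 𝔮 (P * 𝔞) : L) * β ∈ idealLattice P →
        quat _ α β ∈ C.order 𝔩 𝔮 𝔞 * embLattice (jSq d ℓ q) (idealLattice P) := by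
      intro β hβ
      induction hβ using Submodule.mul_induction_on' with
      | add y _ z _ hy hz =>
        intro α hα
        have h1 := add_mem (hy (C.lambda 𝔮 (P * 𝔞) * y) (by rw [sub_self]; exact zero_mem _))
          (hz (α - C.lambda 𝔮 (P * 𝔞) * y) (by convert hα using 1; ring))
        rwa [quat_add, add_sub_cancel] at h1
      | mem_mul_mem w hw β hβ =>
        intro α hα
        rw [mem_latticeConj] at hw
        have h1 : quat _ (C.lambda 𝔮 𝔞 * β) β ∈ C.order 𝔩 𝔮 𝔞 :=
          (S.quat_mem_order C ha).2 ⟨hβ, by rw [sub_self]; exact zero_mem _⟩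
        have h2 : (1 : quatAlg L (jSq d ℓ q)) ∈ C.order 𝔩 𝔮 𝔞 :=
          (S.isOrder ha (S.isAdmissible_lambda C ha)).one_mem
        have hα' := sub_mem hα (S.lambda_sub_mul_mem C hP hPg ha hw hβ)
        rw [star_star] at hα'
        have h3 := add_mem (Submodule.mul_mem_mul h1 (mem_embLattice.2 ⟨_, hw, rfl⟩))
          (Submodule.mul_mem_mul h2 (mem_embLattice.2 ⟨_, hα', rfl⟩))
        rw [one_mul, quat_mul_emb, emb_eq, quat_add, star_star] at h3
        convert h3 using 2 <;> ring
    intro x hx r hr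
    obtain ⟨w, hw, rfl⟩ := mem_embLattice.1 hx
    obtain ⟨α, β, rfl⟩ := exists_quat r
    obtain ⟨h1, h2⟩ := (S.quat_mem_order C hPa).1 hr
    rw [emb_mul_quat]
    refine key _ ?_ _ ?_
    · rw [← hET]
      exact Submodule.mul_mem_mul hw h1
    · convert hOP h2 hw using 1
      ring

theorem order_mul_embLattice_quadOrder {𝔞 : Ideal (quadOrder d δ)} (ha : IsGoodIdeal 𝔞) :
    C.order 𝔩 𝔮 𝔞 * embLattice (jSq d ℓ q) (Subalgebra.toSubmodule (quadOrder d δ)) = C.order 𝔩 𝔮 𝔞 ∧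
    embLattice (jSq d ℓ q) (Subalgebra.toSubmodule (quadOrder d δ)) * C.order 𝔩 𝔮 𝔞 =
      C.order 𝔩 𝔮 𝔞 := by
  have hR := S.isOrder ha (S.isAdmissible_lambda C ha)
  have hO := S.isOptimal (S.isAdmissible_lambda C ha)
  have h1 : (1 : quatAlg L (jSq d ℓ q)) ∈
      embLattice (jSq d ℓ q) (Subalgebra.toSubmodule (quadOrder d δ)) :=
    mem_embLattice.2 ⟨1, one_mem (quadOrder d δ), map_one _⟩
  refine ⟨le_antisymm (Submodule.mul_le.2 ?_) ?_, le_antisymm (Submodule.mul_le.2 ?_) ?_⟩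
  · rintro r hr _ ⟨w, hw, rfl⟩
    exact hR.mul_mem _ hr _ ((hO w).2 hw)
  · intro r hr
    simpa using Submodule.mul_mem_mul hr h1
  · rintro _ ⟨w, hw, rfl⟩ r hr
    exact hR.mul_mem _ ((hO w).2 hw) _ hr
  · intro r hr
    simpa using Submodule.mul_mem_mul h1 hr

theorem order_mul_embLattice_ideal {𝔟 : Ideal (quadOrder d δ)} (hb : IsGoodIdeal 𝔟) :
    ∀ {𝔞 : Ideal (quadOrder d δ)}, IsGoodIdeal 𝔞 →
      C.order 𝔩 𝔮 𝔞 * embLattice (jSq d ℓ q) (idealLattice 𝔟) =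
        embLattice (jSq d ℓ q) (idealLattice 𝔟) * C.order 𝔩 𝔮 (𝔟 * 𝔞) := by
  refine IsGoodIdeal.induction d δ (motive := fun 𝔟 => ∀ {𝔞 : Ideal (quadOrder d δ)}, IsGoodIdeal 𝔞 →
    C.order 𝔩 𝔮 𝔞 * embLattice (jSq d ℓ q) (idealLattice 𝔟) =
      embLattice (jSq d ℓ q) (idealLattice 𝔟) * C.order 𝔩 𝔮 (𝔟 * 𝔞)) ?_ ?_ hb
  · intro 𝔞 ha
    obtain ⟨h1, h2⟩ := S.order_mul_embLattice_quadOrder C ha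
    rw [idealLattice_top, Ideal.top_mul, h1, h2]
  · intro P b hP hPg hb ih 𝔞 ha
    rw [idealLattice_mul, embLattice_mul, ← submodule_mul_assoc, S.order_mul_embLattice_prime C hP hPg ha,
      submodule_mul_assoc, ih (hPg.mul d δ ha), ← submodule_mul_assoc, mul_left_comm, ← mul_assoc P b]

theorem order_mul_embLattice {𝔞 𝔠 : Ideal (quadOrder d δ)} {𝔟 : Submodule ℤ L} (ha : IsGoodIdeal 𝔞)
    (hb : IsGoodFractional (quadOrder d δ) 𝔟) (hc : idealLattice 𝔠 = idealLattice 𝔞 * 𝔟) :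
    IsGoodIdeal 𝔠 ∧ C.order 𝔩 𝔮 𝔞 * embLattice (jSq d ℓ q) 𝔟 =
      embLattice (jSq d ℓ q) 𝔟 * C.order 𝔩 𝔮 𝔠 := by
  obtain ⟨hbi, J, K, hJ, hK, hJK⟩ := hb
  have hcK : K * 𝔠 = J * 𝔞 := by
    refine idealLattice_injective ?_
    rw [idealLattice_mul, idealLattice_mul, hc, ← hJK]
    ac_rfl
  have hcg : IsGoodIdeal 𝔠 := IsGoodIdeal.of_mul_right d δ (hcK ▸ hJ.mul d δ ha)
  refine ⟨hcg, ?_⟩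
  have h1 := S.order_mul_embLattice_ideal C hJ ha
  have h2 := S.order_mul_embLattice_ideal C hK hcg
  rw [← hJK, embLattice_mul, ← hcK, submodule_mul_assoc (embLattice _ 𝔟), ← h2, ← submodule_mul_assoc,
    ← submodule_mul_assoc] at h1
  have h3 := congrArg (· * embLattice (jSq d ℓ q) (latticeInv (quadOrder d δ) (idealLattice K))) h1
  simp only [submodule_mul_assoc, ← embLattice_mul, hK.1.2] at h3
  rwa [(S.order_mul_embLattice_quadOrder C hcg).1, mul_assoc 𝔟, hK.1.2, mul_comm 𝔟, hbi.1] at h3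

end Setting

end conjugate

end

noncomputable section

/-! ### The local structure of maximal orders -/

section lattice

variable {A : Type*} [Ring A] [Algebra ℚ A]

theorem exists_zsmul_mem_of_span_eq_top {R : Submodule ℤ A} (hR : Submodule.span ℚ (R : Set A) = ⊤)
    (z : A) : ∃ n : ℤ, n ≠ 0 ∧ n • z ∈ R := by
  have hz : z ∈ Submodule.span ℚ (R : Set A) := hR ▸ Submodule.mem_top
  induction hz using Submodule.span_induction with
  | mem x hx => exact ⟨1, one_ne_zero, by rwa [one_smul]⟩
  | zero => exact ⟨1, one_ne_zero, by rw [smul_zero]; exact zero_mem _⟩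
  | add x y _ _ hx hy =>
    obtain ⟨m, hm, hx⟩ := hx
    obtain ⟨n, hn, hy⟩ := hy
    refine ⟨m * n, mul_ne_zero hm hn, ?_⟩
    rw [zsmul_add]
    refine add_mem ?_ ?_
    · rw [mul_comm, mul_zsmul]; exact R.smul_mem n hx
    · rw [mul_zsmul]; exact R.smul_mem m hy
  | smul r x _ hx =>
    obtain ⟨m, hm, hx⟩ := hx
    refine ⟨m * r.den, mul_ne_zero hm (by exact_mod_cast r.den_ne_zero), ?_⟩
    have h1 : (m * r.den : ℤ) • (r • x) = r.num • (m • x) := by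
      rw [← Int.cast_smul_eq_zsmul ℚ, ← Int.cast_smul_eq_zsmul ℚ r.num, ← Int.cast_smul_eq_zsmul ℚ m,
        smul_smul, smul_smul]
      congr 1
      push_cast
      rw [mul_assoc, Rat.den_mul_eq_num, mul_comm]
    rw [h1]
    exact R.smul_mem _ hx

theorem span_eq_top_of_forall_smul_mem {R : Submodule ℤ A}
    (hR : ∀ z : A, ∃ n : ℤ, n ≠ 0 ∧ n • z ∈ R) : Submodule.span ℚ (R : Set A) = ⊤ := by
  refine eq_top_iff.2 fun z _ => ?_
  obtain ⟨n, hn, hz⟩ := hR z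
  have h1 : z = (n : ℚ)⁻¹ • (n • z) := by
    rw [← Int.cast_smul_eq_zsmul ℚ, smul_smul, inv_mul_cancel₀ (by exact_mod_cast hn), one_smul]
  rw [h1]
  exact Submodule.smul_mem _ _ (Submodule.subset_span hz)

theorem zsmul_injective {n : ℤ} (hn : n ≠ 0) : Function.Injective fun z : A => n • z := by
  intro x y hxy
  have h1 : (n : ℚ) • x = (n : ℚ) • y := by
    rw [Int.cast_smul_eq_zsmul, Int.cast_smul_eq_zsmul]; exact hxy
  exact smul_right_injective A (show (n : ℚ) ≠ 0 by exact_mod_cast hn) h1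

theorem IsOrder.of_le {R S : Submodule ℤ A} (hR : IsOrder R) (hle : R ≤ S)
    (hmul : ∀ x ∈ S, ∀ y ∈ S, x * y ∈ S) {N : ℤ} (hN : N ≠ 0) (hS : ∀ y ∈ S, N • y ∈ R) :
    IsOrder S where
  one_mem := hle hR.one_mem
  mul_mem := hmul
  fg := by
    have := isNoetherian_of_fg_of_noetherian R hR.fg
    refine Submodule.fg_of_fg_map_injective (LinearMap.lsmul ℤ A N) (zsmul_injective hN) ?_
    refine isNoetherian_submodule.1 this _ ?_
    rintro _ ⟨y, hy, rfl⟩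
    exact hS y hy
  span_eq_top := by
    rw [eq_top_iff, ← hR.span_eq_top]
    exact Submodule.span_mono hle

/-- The conjugate `x R x⁻¹`, where `x'` is the inverse of `x`. -/
def conjLattice (x x' : A) (R : Submodule ℤ A) : Submodule ℤ A where
  carrier := {z | x' * z * x ∈ R}
  add_mem' := fun {a b} ha hb => by
    change x' * (a + b) * x ∈ R
    rw [mul_add, add_mul]
    exact add_mem ha hb
  zero_mem' := by
    change x' * 0 * x ∈ R
    rw [mul_zero, zero_mul]
    exact zero_mem _
  smul_mem' := fun n a ha => by
    change x' * (n • a) * x ∈ R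
    rw [mul_smul_comm, smul_mul_assoc]
    exact R.smul_mem n ha

theorem mem_conjLattice {x x' z : A} {R : Submodule ℤ A} :
    z ∈ conjLattice x x' R ↔ x' * z * x ∈ R := Iff.rfl

theorem IsOrder.conjLattice {R : Submodule ℤ A} (hR : IsOrder R) {x x' : A} (h1 : x * x' = 1)
    (h2 : x' * x = 1) : IsOrder (conjLattice x x' R) where
  one_mem := by
    rw [mem_conjLattice, mul_one, h2]
    exact hR.one_mem
  mul_mem := fun a ha b hb => by
    have h3 := hR.mul_mem _ ha _ hb
    rw [mem_conjLattice]
    convert h3 using 1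
    calc x' * (a * b) * x = x' * a * 1 * b * x := by noncomm_ring
      _ = x' * a * x * (x' * b * x) := by rw [← h1]; noncomm_ring
  fg := by
    have hle : QuatOrders.conjLattice x x' R =
        R.map ((AddMonoidHom.mulLeft x).comp (AddMonoidHom.mulRight x')).toIntLinearMap := by
      ext z
      constructor
      · intro hz
        refine ⟨_, hz, ?_⟩
        change x * (x' * z * x * x') = z
        calc x * (x' * z * x * x') = (x * x') * z * (x * x') := by noncomm_ring
          _ = z := by rw [h1, one_mul, mul_one]
      · rintro ⟨y, hy, rfl⟩
        change x' * (x * (y * x')) * x ∈ R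
        rw [show x' * (x * (y * x')) * x = (x' * x) * y * (x' * x) by noncomm_ring, h2, one_mul, mul_one]
        exact hy
    rw [hle]
    exact hR.fg.map _
  span_eq_top := span_eq_top_of_forall_smul_mem fun z => by
    obtain ⟨n, hn, hz⟩ := exists_zsmul_mem_of_span_eq_top hR.span_eq_top (x' * z * x)
    refine ⟨n, hn, ?_⟩
    rw [mem_conjLattice, mul_smul_comm, smul_mul_assoc]
    exact hz

end lattice

section integral

/-- The rational number `r` is integral at the primes that divide `p`. -/
def IsIntAt (p : ℤ) (r : ℚ) : Prop := ∃ n : ℤ, IsCoprime n p ∧ ∃ k : ℤ, n * r = k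

theorem isIntAt_intCast (p k : ℤ) : IsIntAt p k := ⟨1, isCoprime_one_left, k, by simp⟩

theorem IsIntAt.add {p : ℤ} {r s : ℚ} (hr : IsIntAt p r) (hs : IsIntAt p s) : IsIntAt p (r + s) := by
  obtain ⟨m, hm, a, ha⟩ := hr
  obtain ⟨n, hn, b, hb⟩ := hs
  refine ⟨m * n, hm.mul_left hn, n * a + m * b, ?_⟩
  push_cast
  rw [← ha, ← hb]; ring

theorem IsIntAt.mul {p : ℤ} {r s : ℚ} (hr : IsIntAt p r) (hs : IsIntAt p s) : IsIntAt p (r * s) := by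
  obtain ⟨m, hm, a, ha⟩ := hr
  obtain ⟨n, hn, b, hb⟩ := hs
  refine ⟨m * n, hm.mul_left hn, a * b, ?_⟩
  push_cast
  rw [← ha, ← hb]; ring

theorem IsIntAt.of_mul {p n : ℤ} (hn : IsCoprime n p) {r : ℚ} (hr : IsIntAt p (n * r)) :
    IsIntAt p r := by
  obtain ⟨m, hm, a, ha⟩ := hr
  exact ⟨m * n, hm.mul_left hn, a, by push_cast; rw [← ha]; ring⟩

theorem exists_eq_pow_mul_coprime {p : ℕ} (hp : p.Prime) {n : ℤ} (hn : n ≠ 0) :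
    ∃ (k : ℕ) (m : ℤ), IsCoprime m (p : ℤ) ∧ n = (p : ℤ) ^ k * m := by
  obtain ⟨k, m, hm, h1⟩ := WfDvdMonoid.max_power_factor hn (Nat.prime_iff_prime_int.1 hp).irreducible
  exact ⟨k, m, (isCoprime_prime_iff hp).2 hm, h1⟩

end integral

section quaternion

variable {L : Type*} [Field L] [CharZero L] [StarRing L]
variable (d : ℤ) (δ : L) [h : ImagQuad L d δ] {c : ℤ}
include h

theorem redTrace_mul_comm (x y : quatAlg L c) : redTrace (x * y) = redTrace (y * x) := by
  obtain ⟨α, β, rfl⟩ := exists_quat x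
  obtain ⟨α', β', rfl⟩ := exists_quat y
  rw [quat_mul, quat_mul, redTrace_quat, redTrace_quat, tr_add, tr_add, mul_comm α α',
    ← tr_star d δ (c * β * star β')]
  congr 2
  simp only [star_mul', star_star, star_intCast]
  ring

/-- In an algebra ramified at `p`, an element whose norm is integral at `p` has a trace that is
integral at `p`: otherwise its characteristic polynomial would have a root in `ℚ_p`, by Hensel's
lemma. -/
theorem isIntAt_redTrace {p : ℕ} [hp : Fact p.Prime] (hram : IsRamifiedOver ℚ_[p] (quatAlg L c))
    {z : quatAlg L c} (hz : IsIntAt p (redNorm z)) : IsIntAt p (redTrace z) := by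
  obtain ⟨M, hM, a, ha⟩ := hz
  set t := redTrace z with ht
  by_cases hden : (p : ℤ) ∣ t.den
  · exfalso
    have htr : redTrace (((t.den * M : ℤ) • z) * quatConj (1 : quatAlg L c)) = (t.num * M : ℤ) := by
      have h2 : quatConj (1 : quatAlg L c) = 1 := by
        rw [← quat_one, quatConj_quat]; simp
      rw [h2, mul_one, redTrace_zsmul d δ, ← ht]
      push_cast
      rw [mul_right_comm, Rat.den_mul_eq_num]
    have hnm : redNorm ((t.den * M : ℤ) • z) = (t.den ^ 2 * M * a : ℤ) := by
      rw [redNorm_zsmul d δ]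
      push_cast
      rw [← ha]; ring
    refine not_isRamifiedOver_of_isotropic d δ (w := 1) (a := 1) hnm htr
      (by rw [redNorm_one d δ]; simp) ?_ ?_ hram
    · exact Dvd.dvd.mul_right (Dvd.dvd.mul_right (dvd_pow hden two_ne_zero) _) _
    · rw [← isCoprime_prime_iff hp.1]
      refine IsCoprime.mul_left ?_ hM
      refine (IsCoprime.of_isCoprime_of_dvd_right ?_ hden)
      rw [Int.isCoprime_iff_gcd_eq_one]
      exact t.reduced
  · exact ⟨t.den, (isCoprime_prime_iff hp.1).2 hden, t.num, by
      push_cast; exact Rat.den_mul_eq_num t⟩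

theorem isIntAt_redNorm_add {p : ℕ} [hp : Fact p.Prime] (hram : IsRamifiedOver ℚ_[p] (quatAlg L c))
    {x y : quatAlg L c} (hx : IsIntAt p (redNorm x)) (hy : IsIntAt p (redNorm y)) :
    IsIntAt p (redNorm (x + y)) := by
  rw [redNorm_add d δ]
  refine (hx.add hy).add (isIntAt_redTrace d δ hram ?_)
  rw [redNorm_mul d δ, redNorm_quatConj d δ]
  exact hx.mul hy

/-- At a ramified prime, a maximal order contains all elements of integral norm. -/
theorem IsMaximalOrder.mem_locAt_of_isIntAt {R : Submodule ℤ (quatAlg L c)} (hR : IsMaximalOrder R)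
    (e : Module.Basis (Fin 4) ℤ R) {D : ℤ} (hD : (gram e).det = D) (hD0 : D ≠ 0)
    {p : ℕ} [hp : Fact p.Prime] (hram : IsRamifiedOver ℚ_[p] (quatAlg L c))
    {y : quatAlg L c} (hy : IsIntAt p (redNorm y)) : y ∈ locAt (p : ℤ) R := by
  let S : Submodule ℤ (quatAlg L c) :=
    { carrier := {y | IsIntAt p (redNorm y) ∧ ∃ k : ℕ, ((p : ℤ) ^ k) • y ∈ R}
      add_mem' := by
        rintro x y ⟨hx, j, hj⟩ ⟨hy, k, hk⟩
        refine ⟨isIntAt_redNorm_add d δ hram hx hy, j + k, ?_⟩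
        rw [zsmul_add, pow_add]
        refine add_mem ?_ ?_
        · rw [mul_comm, mul_zsmul]; exact R.smul_mem _ hj
        · rw [mul_zsmul]; exact R.smul_mem _ hk
      zero_mem' := by
        refine ⟨?_, 0, R.smul_mem _ (zero_mem _)⟩
        rw [← quat_zero, redNorm_quat, (nm_eq_zero d δ).2 rfl]
        simpa using isIntAt_intCast p 0
      smul_mem' := by
        rintro n x ⟨hx, k, hk⟩
        refine ⟨?_, k, by rw [smul_comm]; exact R.smul_mem n hk⟩
        rw [redNorm_zsmul d δ]
        exact IsIntAt.mul (by exact_mod_cast isIntAt_intCast p (n ^ (2 : ℕ))) hx }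
  have hint : ∀ r ∈ R, IsIntAt p (redNorm r) := by
    intro r hr
    obtain ⟨k, hk⟩ := hR.1.exists_redNorm_eq d δ hr
    rw [hk]
    exact isIntAt_intCast _ _
  have hRS : R ≤ S := fun r hr => ⟨hint r hr, 0, by rwa [pow_zero, one_smul]⟩
  have hSO : IsOrder S := by
    refine hR.1.of_le hRS ?_ hD0 ?_
    · rintro x ⟨hx, j, hj⟩ y ⟨hy, k, hk⟩
      refine ⟨by rw [redNorm_mul d δ]; exact hx.mul hy, j + k, ?_⟩
      have := hR.1.mul_mem _ hj _ hk
      rwa [smul_mul_assoc, mul_smul_comm, ← mul_zsmul, ← pow_add] at this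
    · rintro y ⟨hy, k, hk⟩
      have h1 : D • y ∈ locAt (p : ℤ) R := by
        refine hR.1.smul_mem_locAt_of_dual d δ e hD fun r hr => ?_
        refine isIntAt_redTrace d δ hram ?_
        rw [redNorm_mul d δ]
        exact hy.mul (hint r hr)
      refine mem_of_mem_locAt_of_pow h1 (k := k) ?_
      rw [smul_comm]
      exact R.smul_mem D hk
  have hSR := hR.2 S hSO hRS
  obtain ⟨N, hN, hNy⟩ := exists_zsmul_mem_of_span_eq_top hR.1.span_eq_top y
  obtain ⟨k, n, hn, rfl⟩ := exists_eq_pow_mul_coprime hp.1 hN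
  refine mem_locAt.2 ⟨n, hn, hSR.le ⟨?_, k, by rwa [← mul_zsmul]⟩⟩
  rw [redNorm_zsmul d δ]
  exact IsIntAt.mul (by exact_mod_cast isIntAt_intCast p (n ^ (2 : ℕ))) hy

theorem exists_quat_inv (hc : c < 0) {x : quatAlg L c} (hx : x ≠ 0) :
    ∃ x' : quatAlg L c, x * x' = 1 ∧ x' * x = 1 ∧
      ∀ z : quatAlg L c, redNorm x * redTrace (z * x') = redTrace (z * quatConj x) := by
  have h0 : redNorm x ≠ 0 := (redNorm_eq_zero d δ hc).not.2 hx
  refine ⟨(redNorm x)⁻¹ • quatConj x, ?_, ?_, fun z => ?_⟩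
  · rw [mul_smul_comm, mul_quatConj d δ, Algebra.smul_def, ← map_mul, inv_mul_cancel₀ h0, map_one]
  · rw [smul_mul_assoc, quatConj_mul_self d δ, Algebra.smul_def, ← map_mul, inv_mul_cancel₀ h0, map_one]
  · rw [mul_smul_comm, redTrace_qsmul d δ, mul_inv_cancel_left₀ h0]

/-- At a prime `p` where `R₁` is self-dual, every order is locally conjugate into `R₁`: the lattice
`R₁ R` is locally generated by any element `x` of minimal norm, and `x R x⁻¹` is contained in `R₁`
locally at `p`. -/
theorem IsOrder.exists_conj_mem_locAt (hc : c < 0) {R R₁ : Submodule ℤ (quatAlg L c)}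
    (hR : IsOrder R) (hR₁ : IsOrder R₁) (e : Module.Basis (Fin 4) ℤ R₁) {D : ℤ}
    (hD : (gram e).det = D) {p : ℕ} (hp : p.Prime) (hpD : IsCoprime D (p : ℤ)) :
    ∃ x x' : quatAlg L c, x * x' = 1 ∧ x' * x = 1 ∧ ∀ r ∈ R, x * r * x' ∈ locAt (p : ℤ) R₁ := by
  classical
  set I := R₁ * R with hI
  have hI1 : ∀ r ∈ R₁, ∀ y ∈ I, r * y ∈ I := by
    intro r hr y hy
    induction hy using Submodule.mul_induction_on' with
    | add y _ z _ hy hz => rw [mul_add]; exact add_mem hy hz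
    | mem_mul_mem y hy z hz =>
      rw [← mul_assoc]
      exact Submodule.mul_mem_mul (hR₁.mul_mem _ hr _ hy) hz
  have hI2 : ∀ y ∈ I, ∀ r ∈ R, y * r ∈ I := by
    intro y hy r hr
    induction hy using Submodule.mul_induction_on' with
    | add y _ z _ hy hz => rw [add_mul]; exact add_mem hy hz
    | mem_mul_mem y hy z hz =>
      rw [mul_assoc]
      exact Submodule.mul_mem_mul hy (hR.mul_mem _ hz _ hr)
  have h1I : (1 : quatAlg L c) ∈ I := by
    simpa using Submodule.mul_mem_mul hR₁.one_mem hR.one_mem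
  -- norms on `I` have a common denominator
  obtain ⟨N, hN, hNI⟩ : ∃ N : ℤ, N ≠ 0 ∧ ∀ y ∈ I, N • y ∈ R := by
    obtain ⟨N, hN, h1⟩ := exists_uniform_smul_mem nonzeroInt (Λ' := R) hR₁.fg
      fun x _ => exists_zsmul_mem_of_span_eq_top hR.span_eq_top x
    refine ⟨N, hN, fun y hy => ?_⟩
    induction hy using Submodule.mul_induction_on' with
    | add y _ z _ hy hz => rw [zsmul_add]; exact add_mem hy hz
    | mem_mul_mem y hy z hz =>
      rw [← smul_mul_assoc]
      exact hR.mul_mem _ (h1 y hy) _ hz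
  have hnorm : ∀ y ∈ I, ∃ m : ℤ, (N : ℚ) ^ 2 * redNorm y = m := by
    intro y hy
    rw [← redNorm_zsmul d δ]
    exact hR.exists_redNorm_eq d δ (hNI y hy)
  have hex : ∃ k : ℕ, ∃ x ∈ I, ∃ m : ℤ, (N : ℚ) ^ 2 * redNorm x = m ∧ ¬ (p : ℤ) ^ (k + 1) ∣ m := by
    have hN2 : N ^ 2 ≠ 0 := pow_ne_zero 2 hN
    obtain ⟨k, m, hm, h1⟩ := exists_eq_pow_mul_coprime hp hN2
    refine ⟨k, 1, h1I, N ^ 2, by rw [redNorm_one d δ]; push_cast; ring, ?_⟩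
    rw [h1, pow_succ]
    rintro ⟨j, hj⟩
    rw [mul_assoc] at hj
    have hpk : (p : ℤ) ^ k ≠ 0 := pow_ne_zero _ (by exact_mod_cast hp.ne_zero)
    exact (isCoprime_prime_iff hp).1 hm ⟨j, mul_left_cancel₀ hpk hj⟩
  obtain ⟨x, hxI, m, hm, hpm⟩ := Nat.find_spec hex
  set k := Nat.find hex with hk
  have hmin : ∀ y ∈ I, ∀ n : ℤ, (N : ℚ) ^ 2 * redNorm y = n → (p : ℤ) ^ k ∣ n := by
    intro y hy n hn
    by_contra hne
    have hk0 : k ≠ 0 := by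
      intro h0
      rw [h0] at hne
      exact hne (by simp)
    have : k - 1 < Nat.find hex := by omega
    refine Nat.find_min hex this ⟨y, hy, n, hn, ?_⟩
    rwa [Nat.sub_add_cancel (Nat.one_le_iff_ne_zero.2 hk0)]
  obtain ⟨s, hs⟩ := hmin x hxI m hm
  have hps : IsCoprime s (p : ℤ) := by
    rw [isCoprime_prime_iff hp]
    rintro ⟨j, rfl⟩
    exact hpm ⟨j, by rw [hs, pow_succ, mul_assoc]⟩
  have hNq : (N : ℚ) ≠ 0 := by exact_mod_cast hN
  have hpq : ((p : ℚ)) ^ k ≠ 0 := pow_ne_zero _ (by exact_mod_cast hp.ne_zero)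
  have hx0 : x ≠ 0 := by
    rintro rfl
    have h2 : m = 0 := by
      have h3 : redNorm (0 : quatAlg L c) = 0 := (redNorm_eq_zero d δ hc).2 rfl
      rw [h3, mul_zero] at hm
      exact_mod_cast hm.symm
    exact hpm (h2 ▸ dvd_zero _)
  have hnx : redNorm x ≠ 0 := (redNorm_eq_zero d δ hc).not.2 hx0
  obtain ⟨x', hxx', hx'x, htr⟩ := exists_quat_inv d δ hc hx0
  have hquot : ∀ y ∈ I, ∃ n : ℤ, (s : ℚ) * redNorm y = n * redNorm x := by
    intro y hy
    obtain ⟨n, hn⟩ := hnorm y hy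
    obtain ⟨n', rfl⟩ := hmin y hy n hn
    refine ⟨n', ?_⟩
    refine mul_left_cancel₀ (pow_ne_zero 2 hNq) (mul_left_cancel₀ hpq ?_)
    rw [hs] at hm
    push_cast at hm hn
    linear_combination (p : ℚ) ^ k * s * hn - (p : ℚ) ^ k * n' * hm
  have key : ∀ y ∈ I, y * x' ∈ locAt (p : ℤ) R₁ := by
    intro y hy
    refine hR₁.mem_locAt_of_dual d δ e hD hpD fun r hr => ?_
    have hry := hI1 r hr y hy
    obtain ⟨n1, hn1⟩ := hquot _ hry
    obtain ⟨n2, hn2⟩ := hquot _ (add_mem hry hxI)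
    refine ⟨s, hps, n2 - n1 - s, ?_⟩
    rw [redTrace_mul_comm d δ, ← mul_assoc]
    refine mul_left_cancel₀ hnx ?_
    rw [redNorm_add d δ] at hn2
    push_cast
    linear_combination (s : ℚ) * htr (r * y) + hn2 - hn1
  refine ⟨x, x', hxx', hx'x, fun r hr => key _ (hI2 _ hxI _ hr)⟩

/-- A maximal order is self-dual at the primes where another order is. -/
theorem IsMaximalOrder.mem_locAt_of_dual (hc : c < 0) {R R₁ : Submodule ℤ (quatAlg L c)}
    (hR : IsMaximalOrder R) (hR₁ : IsOrder R₁) (e : Module.Basis (Fin 4) ℤ R₁) {D : ℤ}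
    (hD : (gram e).det = D) {p : ℕ} (hp : p.Prime) (hpD : IsCoprime D (p : ℤ))
    {y : quatAlg L c} (hy : ∀ r ∈ R, IsIntAt p (redTrace (y * r))) : y ∈ locAt (p : ℤ) R := by
  obtain ⟨x, x', h1, h2, hxR⟩ := hR.1.exists_conj_mem_locAt d δ hc hR₁ e hD hp hpD
  -- the elements of `x⁻¹ R₁ x` at `p`, and of `R` elsewhere
  let S : Submodule ℤ (quatAlg L c) :=
    { carrier := {z | x * z * x' ∈ locAt (p : ℤ) R₁ ∧ ∃ k : ℕ, ((p : ℤ) ^ k) • z ∈ R}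
      add_mem' := by
        rintro u v ⟨hu, j, hj⟩ ⟨hv, k, hk⟩
        refine ⟨by rw [mul_add, add_mul]; exact add_mem hu hv, j + k, ?_⟩
        rw [zsmul_add, pow_add]
        refine add_mem ?_ ?_
        · rw [mul_comm, mul_zsmul]; exact R.smul_mem _ hj
        · rw [mul_zsmul]; exact R.smul_mem _ hk
      zero_mem' := ⟨by rw [mul_zero, zero_mul]; exact zero_mem _, 0, R.smul_mem _ (zero_mem _)⟩
      smul_mem' := by
        rintro n u ⟨hu, k, hk⟩
        refine ⟨?_, k, by rw [smul_comm]; exact R.smul_mem n hk⟩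
        rw [mul_smul_comm, smul_mul_assoc]
        exact Submodule.smul_mem _ n hu }
  have hconj : ∀ z, x' * (x * z * x') * x = z := by
    intro z
    calc x' * (x * z * x') * x = (x' * x) * z * (x' * x) := by noncomm_ring
      _ = z := by rw [h2, one_mul, mul_one]
  have hconj' : ∀ z, x * (x' * z * x) * x' = z := by
    intro z
    calc x * (x' * z * x) * x' = (x * x') * z * (x * x') := by noncomm_ring
      _ = z := by rw [h1, one_mul, mul_one]
  have hRS : R ≤ S := fun r hr => ⟨hxR r hr, 0, by rwa [pow_zero, one_smul]⟩
  obtain ⟨N, hN, hN1⟩ := exists_uniform_smul_mem nonzeroInt (Λ' := conjLattice x x' R) hR₁.fg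
    fun z _ => exists_zsmul_mem_of_span_eq_top (hR.1.conjLattice h1 h2).span_eq_top z
  have hSO : IsOrder S := by
    refine hR.1.of_le hRS ?_ (N := N) hN ?_
    · rintro u ⟨hu, j, hj⟩ v ⟨hv, k, hk⟩
      refine ⟨?_, j + k, ?_⟩
      · have := mul_mem_locAt hR₁.mul_mem hu hv
        convert this using 1
        calc x * (u * v) * x' = x * u * 1 * v * x' := by noncomm_ring
          _ = _ := by rw [← h2]; noncomm_ring
      · have := hR.1.mul_mem _ hj _ hk
        rwa [smul_mul_assoc, mul_smul_comm, ← mul_zsmul, ← pow_add] at this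
    · rintro u ⟨⟨n, hn, hnu⟩, k, hk⟩
      have h3 : N • u ∈ locAt (p : ℤ) R := by
        refine mem_locAt.2 ⟨n, hn, ?_⟩
        have h4 := hN1 _ hnu
        rw [mem_conjLattice, smul_comm, mul_smul_comm, smul_mul_assoc, mul_smul_comm, smul_mul_assoc,
          hconj] at h4
        exact h4
      refine mem_of_mem_locAt_of_pow h3 (k := k) ?_
      rw [smul_comm]
      exact R.smul_mem N hk
  have hSR := hR.2 S hSO hRS
  have hloc : ∀ z, x * z * x' ∈ locAt (p : ℤ) R₁ → z ∈ locAt (p : ℤ) R := by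
    intro z hz
    obtain ⟨M, hM, hMz⟩ := exists_zsmul_mem_of_span_eq_top hR.1.span_eq_top z
    obtain ⟨k, n, hn, rfl⟩ := exists_eq_pow_mul_coprime hp hM
    refine mem_locAt.2 ⟨n, hn, hSR.le ⟨?_, k, by rwa [← mul_zsmul]⟩⟩
    rw [mul_smul_comm, smul_mul_assoc]
    exact Submodule.smul_mem _ n hz
  refine hloc y (hR₁.mem_locAt_of_dual d δ e hD hpD fun z hz => ?_)
  obtain ⟨n, hn, hnz⟩ := mem_locAt.1 (hloc (x' * z * x) (by rw [hconj']; exact le_locAt _ _ hz))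
  refine IsIntAt.of_mul hn ?_
  have h3 := hy _ hnz
  rw [mul_smul_comm, redTrace_zsmul d δ] at h3
  convert h3 using 2
  calc redTrace (x * y * x' * z) = redTrace (x * (y * x' * z)) := by simp only [mul_assoc]
    _ = redTrace (y * x' * z * x) := redTrace_mul_comm d δ _ _
    _ = _ := by simp only [mul_assoc]

end quaternion

end

noncomputable section

/-! ### Optimally embedded maximal orders at the primes of the discriminant -/

section arithmetic

/-- The fixed point of `t ↦ e + e² + d e t + C t²`, a contraction at the primes dividing `d`. For
`p = 2` this uses that the iterates of `0` remain even. -/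
theorem exists_fixed_point {d : ℤ} (hC : 4 * omNorm d = d ^ 2 - d) (e : ℤ) (M : ℕ) :
    ∃ t : ℤ, ∀ p : ℕ, p.Prime → (p : ℤ) ∣ d →
      (p : ℤ) ^ M ∣ t - (e ^ 2 + d * e * t + omNorm d * t ^ 2) - e := by
  suffices H : ∃ t : ℤ, ((2 : ℤ) ∣ d → (2 : ℤ) ∣ t) ∧ ∀ p : ℕ, p.Prime → (p : ℤ) ∣ d →
      (p : ℤ) ^ M ∣ t - (e ^ 2 + d * e * t + omNorm d * t ^ 2) - e by
    obtain ⟨t, -, ht⟩ := H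
    exact ⟨t, ht⟩
  have hee : (2 : ℤ) ∣ e ^ 2 + e := by
    rw [show e ^ 2 + e = e * (e + 1) by ring]
    exact even_iff_two_dvd.1 (Int.even_mul_succ_self e)
  induction M with
  | zero => exact ⟨0, fun _ => dvd_zero _, fun p _ _ => by simp⟩
  | succ M ih =>
    obtain ⟨t, h2, ht⟩ := ih
    have h2' : (2 : ℤ) ∣ d → (2 : ℤ) ∣ e ^ 2 + d * e * t + omNorm d * t ^ 2 + e := by
      intro hd
      obtain ⟨t', ht'⟩ := h2 hd
      obtain ⟨a, ha⟩ := hee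
      obtain ⟨b, hb⟩ := hd
      exact ⟨a + b * e * t + omNorm d * t' * t, by rw [hb, ht']; linear_combination ha⟩
    refine ⟨e ^ 2 + d * e * t + omNorm d * t ^ 2 + e, h2', fun p hp hpd => ?_⟩
    obtain ⟨j, hj⟩ := ht p hp hpd
    set t' := e ^ 2 + d * e * t + omNorm d * t ^ 2 + e with ht'
    have h3 : (p : ℤ) ∣ d * e + omNorm d * (t + t') := by
      refine dvd_add (hpd.mul_right _) ?_
      by_cases hp2 : p = 2
      · subst hp2
        exact (dvd_add (h2 (by exact_mod_cast hpd)) (h2' (by exact_mod_cast hpd))).mul_left _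
      · refine Dvd.dvd.mul_right ?_ _
        have h4 : (p : ℤ) ∣ 4 * omNorm d := by
          rw [hC, sq]; exact dvd_sub (hpd.mul_right _) hpd
        refine ((Nat.prime_iff_prime_int.1 hp).dvd_or_dvd h4).resolve_left fun h5 => hp2 ?_
        have h6 : p ∣ 2 ^ 2 := by exact_mod_cast h5
        exact (Nat.prime_dvd_prime_iff_eq hp Nat.prime_two).1 (hp.dvd_of_dvd_pow h6)
    obtain ⟨i, hi⟩ := h3
    refine ⟨j * i, ?_⟩
    have h5 : t' - (e ^ 2 + d * e * t' + omNorm d * t' ^ 2) - e =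
        (t - t') * (d * e + omNorm d * (t + t')) := by rw [ht']; ring
    have h6 : t - t' = (p : ℤ) ^ M * j := by rw [← hj, ht']; ring
    rw [h5, h6, hi]; ring

/-- Two integers not divisible by `p ^ K` have a product that divides `p ^ (2 K)` up to factors prime to
`p`. -/
theorem exists_coprime_mul_dvd {p : ℕ} (hp : p.Prime) {K : ℕ} {x y E : ℤ}
    (hx : ¬ (p : ℤ) ^ K ∣ x) (hy : ¬ (p : ℤ) ^ K ∣ y) (hE : (p : ℤ) ^ (2 * K) ∣ E) :
    ∃ n : ℤ, IsCoprime n (p : ℤ) ∧ x * y ∣ n * E := by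
  have hx0 : x ≠ 0 := by rintro rfl; exact hx (dvd_zero _)
  have hy0 : y ≠ 0 := by rintro rfl; exact hy (dvd_zero _)
  obtain ⟨i, a, ha, rfl⟩ := exists_eq_pow_mul_coprime hp hx0
  obtain ⟨j, b, hb, rfl⟩ := exists_eq_pow_mul_coprime hp hy0
  have hi : i < K := by
    by_contra hne
    exact hx ((pow_dvd_pow _ (not_lt.1 hne)).mul_right _)
  have hj : j < K := by
    by_contra hne
    exact hy ((pow_dvd_pow _ (not_lt.1 hne)).mul_right _)
  refine ⟨a * b, ha.mul_left hb, ?_⟩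
  rw [show (p : ℤ) ^ i * a * ((p : ℤ) ^ j * b) = a * b * (p : ℤ) ^ (i + j) by rw [pow_add]; ring]
  exact mul_dvd_mul_left _ ((pow_dvd_pow _ (by omega)).trans hE)

theorem not_pow_natAbs_dvd {p : ℕ} (hp : p.Prime) {x : ℤ} (hx : x ≠ 0) :
    ¬ (p : ℤ) ^ x.natAbs ∣ x := by
  intro h1
  have h2 : p ^ x.natAbs ∣ x.natAbs := by
    rw [← Int.natAbs_dvd_natAbs, Int.natAbs_pow, Int.natAbs_natCast] at h1
    exact h1
  exact absurd (Nat.le_of_dvd (Int.natAbs_pos.2 hx) h2) (not_le.2 (Nat.lt_pow_self hp.one_lt))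

end arithmetic

section optimal

variable {L : Type*} [Field L] [CharZero L] [StarRing L]
variable (d : ℤ) (δ : L) [h : ImagQuad L d δ] {c : ℤ}
include h

/-- The first coordinates of `R` have integral traces against `𝓞`, hence lie in the inverse different
`(√d)⁻¹ 𝓞`. -/
theorem isOptimal_sqrt_mul_mem {R : Submodule ℤ (quatAlg L c)} (hR : IsOrder R)
    (hO : IsOptimal (quadOrder d δ) R) {α β : L} (hx : quat c α β ∈ R) : δ * α ∈ quadOrder d δ := by
  refine (sqrt_mul_mem_iff d δ).2 fun y hy => ?_
  have h1 := hR.mul_mem _ hx _ ((hO y).2 hy)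
  rw [Setting.quat_mul_emb] at h1
  exact hR.exists_redTrace_eq d δ h1

/-- The ideal `√d π(R)`, where `π [α : β] = α`. -/
def projIdeal (R : Submodule ℤ (quatAlg L c)) (hR : IsOrder R) (hO : IsOptimal (quadOrder d δ) R) :
    Ideal (quadOrder d δ) where
  carrier := {x | ∃ β : L, quat c (x / δ) β ∈ R}
  add_mem' := by
    rintro x y ⟨β, hx⟩ ⟨β', hy⟩
    refine ⟨β + β', ?_⟩
    have := add_mem hx hy
    rw [quat_add] at this
    convert this using 2
    push_cast; ring
  zero_mem' := ⟨0, by simp [quat_zero]⟩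
  smul_mem' := by
    rintro y x ⟨β, hx⟩
    refine ⟨(y : L) * β, ?_⟩
    have := hR.mul_mem _ ((hO y).2 y.2) _ hx
    rw [Setting.emb_mul_quat] at this
    convert this using 2
    rw [smul_eq_mul]; push_cast; ring

theorem quat_mem_of_mem_projIdeal {R : Submodule ℤ (quatAlg L c)} {hR : IsOrder R}
    {hO : IsOptimal (quadOrder d δ) R} {α β : L} (hx : quat c α β ∈ R) :
    (⟨δ * α, isOptimal_sqrt_mul_mem d δ hR hO hx⟩ : quadOrder d δ) ∈ projIdeal d δ R hR hO := by
  refine ⟨β, ?_⟩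
  rwa [mul_div_cancel_left₀ _ (sqrt_ne_zero d δ)]

/-- The ideal `√d π(R)` is prime to `p` if the lattice `R` is self-dual at `p`. -/
theorem projIdeal_not_le {R : Submodule ℤ (quatAlg L c)} (hR : IsOrder R)
    (hO : IsOptimal (quadOrder d δ) R) {p : ℕ} (hp : p.Prime) (hpd : (p : ℤ) ∣ d)
    (hdual : ∀ y : quatAlg L c, (∀ r ∈ R, IsIntAt p (redTrace (y * r))) → y ∈ locAt (p : ℤ) R)
    {P : Ideal (quadOrder d δ)} (hP : P.IsPrime) (hpP : (p : quadOrder d δ) ∈ P) :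
    ¬ projIdeal d δ R hR hO ≤ P := by
  intro hle
  obtain ⟨s, hs⟩ := exists_root_of_dvd d δ hp hpd
  obtain ⟨j, hj⟩ := hs
  have hp0 : (p : L) ≠ 0 := by exact_mod_cast hp.ne_zero
  let w : quadOrder d δ := ⟨s + om d δ, add_mem (intCast_mem _ s) (om_mem d δ)⟩
  have hw : (w : L) = s + om d δ := rfl
  have hws : star (w : L) = s + d - om d δ := by
    rw [hw, star_add, star_intCast, star_om]; ring
  have hom := om_sq d δ
  have hjL : (s : L) ^ 2 + d * s + omNorm d = p * j := by
    exact_mod_cast congrArg (Int.cast : ℤ → L) hj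
  have hww : (w : L) * star (w : L) = p * j := by
    rw [hws, hw]; linear_combination hjL - hom
  have hwP : w ∈ P := by
    have h1 : w * starHom d δ w ∈ P := by
      have h2 : w * starHom d δ w = (p : quadOrder d δ) * (j : ℤ) := by
        apply Subtype.ext
        push_cast [coe_starHom]
        exact hww
      rw [h2]; exact P.mul_mem_right _ hpP
    have hδP : sqrtElem d δ ∈ P := (sqrtElem_mem_iff d δ hP hp hpP).2 hpd
    rcases hP.mem_or_mem h1 with h2 | h2
    · exact h2
    · have h3 := starHom_mem_of_sqrtElem_mem d δ hδP h2
      have h4 : starHom d δ (starHom d δ w) = w := by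
        apply Subtype.ext
        rw [coe_starHom, coe_starHom, star_star]
      rwa [h4] at h3
  -- `w̄ / p` multiplies `P` into the order
  have hmul : ∀ z ∈ P, star (w : L) / p * z ∈ quadOrder d δ := by
    intro z hz
    obtain ⟨a, b, hab⟩ := (mem_quadOrder_iff d δ).1 z.2
    have h1 : ((a - b * s : ℤ) : quadOrder d δ) ∈ P := by
      have h2 : ((a - b * s : ℤ) : quadOrder d δ) = z - b * w := by
        apply Subtype.ext
        push_cast
        rw [hab, hw]; ring
      rw [h2]
      exact sub_mem hz (P.mul_mem_left _ hwP)
    obtain ⟨i, hi⟩ := (mem_iff_dvd d δ hP hp hpP).1 h1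
    have h3 : (a : L) - b * s = p * i := by exact_mod_cast congrArg (Int.cast : ℤ → L) hi
    have h4 : star (w : L) / p * z = b * j + star (w : L) * i := by
      rw [div_mul_eq_mul_div, div_eq_iff hp0, hab]
      rw [hw] at hww ⊢
      linear_combination star ((s : L) + om d δ) * h3 + b * hww
    rw [h4]
    exact add_mem (mul_mem (intCast_mem _ b) (intCast_mem _ j))
      (mul_mem (star_mem_quadOrder d δ w.2) (intCast_mem _ i))
  -- so it is `p`-integrally paired with `R`, and lies in `R` at `p`, contrary to optimality
  have hloc : emb c (star (w : L) / p) ∈ locAt (p : ℤ) R := by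
    refine hdual _ fun r hr => ?_
    obtain ⟨α, β, rfl⟩ := exists_quat r
    rw [Setting.emb_mul_quat, redTrace_quat]
    have h1 := hmul _ (hle (quat_mem_of_mem_projIdeal d δ (hR := hR) (hO := hO) hr))
    have h2 : δ * (star (w : L) / p * α) ∈ quadOrder d δ := by
      convert h1 using 1
      change _ = star (w : L) / p * (δ * α)
      ring
    obtain ⟨n, hn⟩ := (sqrt_mul_mem_iff d δ).1 h2 1 (one_mem _)
    rw [mul_one] at hn
    rw [hn]
    exact isIntAt_intCast _ n
  obtain ⟨n, hn, hnR⟩ := mem_locAt.1 hloc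
  rw [emb_eq, quat_zsmul, mul_zero, ← emb_eq] at hnR
  obtain ⟨a, b, hab⟩ := (mem_quadOrder_iff d δ).1 ((hO _).1 hnR)
  rw [mul_div_assoc', div_eq_iff hp0, hws] at hab
  have h1 : ((n * (s + d) : ℤ) : L) + ((-n : ℤ) : L) * om d δ =
      ((p * a : ℤ) : L) + ((p * b : ℤ) : L) * om d δ := by
    push_cast
    linear_combination hab
  have h2 := (om_coord_inj d δ h1).2
  exact (isCoprime_prime_iff hp).1 hn ⟨-b, by linear_combination -h2⟩

/-- If `R` is self-dual at the primes dividing `d₁`, then the ideal `√d π(R)` is prime to `d₁`, and so is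
the integer `n` that generates its intersection with `ℤ`. -/
theorem exists_int_mem_projIdeal {R : Submodule ℤ (quatAlg L c)} (hR : IsOrder R)
    (hO : IsOptimal (quadOrder d δ) R) {d₁ : ℤ} (hd₁ : d₁ ∣ d)
    (hdual : ∀ p : ℕ, p.Prime → (p : ℤ) ∣ d₁ →
      ∀ y : quatAlg L c, (∀ r ∈ R, IsIntAt p (redTrace (y * r))) → y ∈ locAt (p : ℤ) R) :
    ∃ (n : ℤ) (b : L), IsCoprime n d₁ ∧ quat c (n / δ) (b / δ) ∈ R := by
  let J : Ideal ℤ := (projIdeal d δ R hR hO).comap (Int.castRingHom (quadOrder d δ))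
  obtain ⟨m, hm⟩ := (IsPrincipalIdealRing.principal J).principal
  have hmJ : m ∈ J := by rw [hm]; exact Submodule.mem_span_singleton_self m
  obtain ⟨β, hβ⟩ : ∃ β : L, quat c (((m : quadOrder d δ) : L) / δ) β ∈ R := hmJ
  refine ⟨m, β * δ, ?_, ?_⟩
  · rw [Int.isCoprime_iff_gcd_eq_one]
    by_contra hne
    obtain ⟨p, hp, hpg⟩ := Nat.exists_prime_and_dvd hne
    have hpm : (p : ℤ) ∣ m := (Int.natCast_dvd_natCast.2 hpg).trans (Int.gcd_dvd_left ..)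
    have hpd₁ : (p : ℤ) ∣ d₁ := (Int.natCast_dvd_natCast.2 hpg).trans (Int.gcd_dvd_right ..)
    obtain ⟨P, hP, hpP⟩ := exists_isPrime_mem d δ hp
    have hnle := projIdeal_not_le d δ hR hO hp (hpd₁.trans hd₁) (hdual p hp hpd₁) hP hpP
    obtain ⟨a, haA, haP⟩ := SetLike.not_le_iff_exists.1 hnle
    have hδP : sqrtElem d δ ∈ P := (sqrtElem_mem_iff d δ hP hp hpP).2 (hpd₁.trans hd₁)
    have h1 : ((Algebra.norm ℤ a : ℤ) : quadOrder d δ) = a * starHom d δ a := by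
      apply Subtype.ext
      have h3 := nm_cast d δ (a : L)
      rw [← norm_coe d δ] at h3
      push_cast [coe_starHom] at h3 ⊢
      exact h3
    -- the norm of an element of the ideal outside `P` is an integer of the ideal prime to `p`
    have h2 : Algebra.norm ℤ a ∈ J := by
      change ((Algebra.norm ℤ a : ℤ) : quadOrder d δ) ∈ projIdeal d δ R hR hO
      rw [h1]
      exact Ideal.mul_mem_right _ _ haA
    rw [hm, Submodule.mem_span_singleton] at h2
    obtain ⟨i, hi⟩ := h2
    have h3 : a * starHom d δ a ∈ P := by
      rw [← h1, mem_iff_dvd d δ hP hp hpP, ← hi, smul_eq_mul]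
      exact hpm.mul_left i
    rcases hP.mem_or_mem h3 with h4 | h4
    · exact haP h4
    · have h5 := starHom_mem_of_sqrtElem_mem d δ hδP h4
      have h6 : starHom d δ (starHom d δ a) = a := by
        apply Subtype.ext
        rw [coe_starHom, coe_starHom, star_star]
      rw [h6] at h5
      exact haP h5
  · rw [mul_div_cancel_right₀ _ (sqrt_ne_zero d δ)]
    simpa using hβ

/-- The second coordinates of an order that contains `[n / √d : b / √d]` are multiples of `b` up to
denominators prime to `p`. -/
theorem sub_mul_star_mem {R : Submodule ℤ (quatAlg L c)} (hR : IsOrder R)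
    (hO : IsOptimal (quadOrder d δ) R) {n : ℤ} {b : L} (hr : quat c (n / δ) (b / δ) ∈ R) {α β : L}
    (hx : quat c α β ∈ R) : c * (n * β - α * b) * star b ∈ quadOrder d δ := by
  have hδ := sqrt_ne_zero d δ
  have h1 := hR.mul_mem _ ((hO _).2 (isOptimal_sqrt_mul_mem d δ hR hO hx)) _ hr
  have h2 := sub_mem (R.smul_mem n hx) h1
  rw [Setting.emb_mul_quat, quat_zsmul, quat_sub] at h2
  have h3 := isOptimal_sqrt_mul_mem d δ hR hO (by
    have := hR.mul_mem _ h2 _ hr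
    rwa [quat_mul] at this)
  have h4 := neg_mem h3
  convert h4 using 1
  rw [star_div₀, h.star_eq]
  field_simp
  ring

theorem exists_norm_eq_of_mem {R : Submodule ℤ (quatAlg L c)} (hR : IsOrder R) {n : ℤ} {b : L}
    (hr : quat c (n / δ) (b / δ) ∈ R) : ∃ k : ℤ, c * nm b = (n ^ 2 + d * k : ℤ) := by
  obtain ⟨k, hk⟩ := hR.exists_redNorm_eq d δ hr
  refine ⟨k, ?_⟩
  have hδ := sqrt_ne_zero d δ
  have hnm : ∀ x : L, nm x = -d * nm (x / δ) := by
    intro x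
    rw [← nm_sqrt d δ, ← nm_mul, mul_div_cancel₀ _ hδ]
  rw [redNorm_quat] at hk
  have h1 := hnm n
  have h2 := hnm b
  have h3 : nm ((n : L)) = n ^ 2 := by
    have := nm_ratCast d δ (n : ℚ)
    simpa using this
  rw [h3] at h1
  push_cast
  rw [h2, ← hk]
  linear_combination -h1

end optimal

end

noncomputable section

/-! ### Rotating an element of given norm into a prescribed congruence class -/

/-- At each prime in `F`, one prescribed of the two integers is highly divisible and the other is a
unit. -/
theorem exists_pow_dvd_and_isCoprime (F : Finset ℕ) (hF : ∀ p ∈ F, p.Prime) (K : ℕ)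
    (P : ℕ → Prop) : ∃ s t : ℤ, ∀ p ∈ F,
      (P p → (p : ℤ) ^ K ∣ s ∧ IsCoprime t (p : ℤ)) ∧
      (¬ P p → (p : ℤ) ^ K ∣ t ∧ IsCoprime s (p : ℤ)) := by
  classical
  have key : ∀ Q : ℕ → Prop, ∀ p ∈ F,
      (Q p → (p : ℤ) ^ K ∣ ∏ r ∈ F.filter Q, (r : ℤ) ^ K) ∧
      (¬ Q p → IsCoprime (∏ r ∈ F.filter Q, (r : ℤ) ^ K) (p : ℤ)) := by
    refine fun Q p hp => ⟨fun h => Finset.dvd_prod_of_mem (fun r : ℕ => (r : ℤ) ^ K)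
      (Finset.mem_filter.2 ⟨hp, h⟩), fun h => IsCoprime.prod_left fun r hr => ?_⟩
    obtain ⟨hr, hQ⟩ := Finset.mem_filter.1 hr
    refine IsCoprime.pow_left (Nat.isCoprime_iff_coprime.2 ?_)
    exact (Nat.coprime_primes (hF r hr) (hF p hp)).2 fun h' => h (h' ▸ hQ)
  refine ⟨_, _, fun p hp => ⟨fun h => ⟨(key P p hp).1 h, (key (fun r => ¬ P r) p hp).2 ?_⟩,
    fun h => ⟨(key (fun r => ¬ P r) p hp).1 h, (key P p hp).2 h⟩⟩⟩
  exact not_not.2 h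

section rotation

variable {L : Type*} [Field L] [CharZero L] [StarRing L]
variable (d : ℤ) (δ : L) [h : ImagQuad L d δ]
include h

theorem norm_starHom (x : quadOrder d δ) :
    Algebra.norm ℤ (starHom d δ x) = Algebra.norm ℤ x := by
  have h1 := norm_coe d δ (starHom d δ x)
  rw [coe_starHom, nm_star d δ, ← norm_coe d δ] at h1
  exact_mod_cast h1

/-- The norm of `s x + t y` is a quadratic form in `s` and `t`. -/
theorem exists_norm_combination (x y : quadOrder d δ) : ∃ i : ℤ, ∀ s t : ℤ,
    Algebra.norm ℤ ((s : quadOrder d δ) * x + (t : quadOrder d δ) * y) =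
      s ^ 2 * Algebra.norm ℤ x + t ^ 2 * Algebra.norm ℤ y + s * t * i := by
  obtain ⟨i, hi⟩ := exists_tr_eq d δ (mul_mem x.2 (star_mem_quadOrder d δ y.2))
  refine ⟨i, fun s t => ?_⟩
  have h1 := norm_coe d δ ((s : quadOrder d δ) * x + (t : quadOrder d δ) * y)
  have h2 : (((s : quadOrder d δ) * x : quadOrder d δ) : L) *
      star (((t : quadOrder d δ) * y : quadOrder d δ) : L) =
      (((s * t : ℤ) : ℚ) : L) * ((x : L) * star (y : L)) := by
    push_cast
    rw [star_mul', star_intCast]; ring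
  rw [AddMemClass.coe_add, nm_add d δ, h2, tr_ratCast_mul, hi, ← norm_coe d δ, ← norm_coe d δ,
    norm_intCast_mul, norm_intCast_mul] at h1
  exact_mod_cast h1

/-- The norms of the elements `1 + √d y`: they are `1` modulo `d`, and the coefficient of `d` is `t`
minus a norm, which `exists_fixed_point` makes arbitrary at the primes dividing `d`. -/
theorem norm_one_add_sqrt_mul (s t : ℤ) :
    Algebra.norm ℤ (1 + sqrtElem d δ * (s + t * ⟨om d δ, om_mem d δ⟩) : quadOrder d δ) =
      1 + d * (t - (s ^ 2 + d * s * t + omNorm d * t ^ 2)) := by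
  have h1 := norm_coe d δ (1 + sqrtElem d δ * (s + t * ⟨om d δ, om_mem d δ⟩) : quadOrder d δ)
  have h2 : ((1 + sqrtElem d δ * (s + t * ⟨om d δ, om_mem d δ⟩) : quadOrder d δ) : L) =
      ((1 - s * d - 2 * omNorm d * t : ℤ) : L) + ((2 * s + d * t : ℤ) : L) * om d δ := by
    have h3 := om_sq d δ
    have h4 := sqrt_eq_om d δ
    push_cast
    change 1 + δ * _ = _
    linear_combination 2 * (t : L) * h3 + (s + t * om d δ) * h4
  rw [h2, nm_om_coord d δ] at h1
  rw [Int.cast_injective (α := ℚ) h1]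
  linear_combination (s ^ 2 + d * s * t + omNorm d * t ^ 2 - t) * four_mul_omNorm d δ

/-- If `n² + dk ≡ c N(n c⁻¹ λ̄)` modulo `d₁`, the element `n c⁻¹ λ̄` can be corrected modulo `√d` so
that this holds modulo a high power of every prime dividing `d₁`. -/
theorem exists_norm_approx {c n k d₁ w : ℤ} (hd : d = w * d₁) (hw : IsCoprime w d₁)
    (hc : IsCoprime c d₁) (hn : IsCoprime n d₁) {lam : quadOrder d δ}
    (hlam : d₁ ∣ Algebra.norm ℤ lam - c) (M : ℕ) :
    ∃ u : quadOrder d δ, (∃ z : quadOrder d δ, (w : L) * ((lam : L) * u - n) = δ * z) ∧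
      ∀ p : ℕ, p.Prime → (p : ℤ) ∣ d₁ → (p : ℤ) ^ M ∣ n ^ 2 + d * k - c * Algebra.norm ℤ u := by
  obtain ⟨e₁, he₁⟩ := hlam
  obtain ⟨c', e₀, hc'⟩ := id hc
  have hdL : δ ^ 2 = (d : L) := h.sq
  let u₀ : quadOrder d δ := ((n * c' : ℤ) : quadOrder d δ) * starHom d δ lam
  have hN₀ : Algebra.norm ℤ u₀ = (n * c') ^ 2 * Algebra.norm ℤ lam := by
    rw [norm_intCast_mul, norm_starHom]
  have hc'₁ : IsCoprime c' d₁ := ⟨c, e₀, by linear_combination hc'⟩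
  have hl₁ : IsCoprime (Algebra.norm ℤ lam) d₁ := by
    rw [show Algebra.norm ℤ lam = c + d₁ * e₁ by linear_combination he₁]
    exact hc.add_mul_left_left e₁
  have hG : IsCoprime (c * Algebra.norm ℤ u₀ * w) (d₁ ^ M) := by
    refine IsCoprime.pow_right ((hc.mul_left ?_).mul_left hw)
    rw [hN₀]
    exact ((hn.mul_left hc'₁).pow_left).mul_left hl₁
  obtain ⟨X, hX⟩ : ∃ X : ℤ, n ^ 2 + d * k - c * Algebra.norm ℤ u₀ = d₁ * X := by
    refine ⟨w * k + n ^ 2 * (2 * e₀ - d₁ * e₀ ^ 2 - c * c' ^ 2 * e₁), ?_⟩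
    rw [hN₀, show Algebra.norm ℤ lam = c + d₁ * e₁ by linear_combination he₁, hd]
    linear_combination (-n ^ 2 * (c' * c + 1 - e₀ * d₁)) * hc'
  -- `u = u₀ (1 + √d y)`, where `y` makes `c N(u) - c N(u₀)` equal to `d₁ X` to high precision
  obtain ⟨g, g', hg⟩ := hG
  obtain ⟨t, ht⟩ := exists_fixed_point (four_mul_omNorm d δ) (g * X) M
  let y : quadOrder d δ := ((g * X : ℤ) : quadOrder d δ) + (t : quadOrder d δ) * ⟨om d δ, om_mem d δ⟩
  refine ⟨u₀ * (1 + sqrtElem d δ * y),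
    ⟨sqrtElem d δ * ((n * (c' * e₁ - e₀) : ℤ) : quadOrder d δ) + w * lam * u₀ * y, ?_⟩,
    fun p hp hpd => ?_⟩
  · have hll : (lam : L) * star (lam : L) = c + d₁ * e₁ := by
      rw [← nm_cast d δ, ← norm_coe d δ,
        show Algebra.norm ℤ lam = c + d₁ * e₁ by linear_combination he₁]
      push_cast; ring
    have hu₀ : (lam : L) * (u₀ : L) = n * c' * (c + d₁ * e₁) := by
      rw [← hll]
      change (lam : L) * (((n * c' : ℤ) : quadOrder d δ) * starHom d δ lam : quadOrder d δ) = _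
      push_cast [coe_starHom]; ring
    have hcL : (c' : L) * c + e₀ * d₁ = 1 := by exact_mod_cast congrArg (Int.cast : ℤ → L) hc'
    have hdw : (d : L) = w * d₁ := by exact_mod_cast congrArg (Int.cast : ℤ → L) hd
    have hs : ((sqrtElem d δ : quadOrder d δ) : L) = δ := rfl
    push_cast
    rw [hs]
    linear_combination w * hu₀ + w * n * hcL - n * (c' * e₁ - e₀) * (hdL.trans hdw)
  · obtain ⟨j, hj⟩ := ht p hp (hd ▸ hpd.mul_left w)
    obtain ⟨i, hi⟩ := pow_dvd_pow_of_dvd hpd M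
    refine ⟨d₁ * (X * g' * i - c * Algebra.norm ℤ u₀ * w * j), ?_⟩
    rw [map_mul, norm_one_add_sqrt_mul]
    linear_combination hX - c * Algebra.norm ℤ u₀ * d * hj - d₁ * X * hg + d₁ * X * g' * hi -
      c * Algebra.norm ℤ u₀ * (g * X + (p : ℤ) ^ M * j) * hd

/-- If `N(b) - N(u)` is highly divisible by the primes dividing `d₁`, some multiplication by
`θ / θ̄` moves `b` into the class of `u` modulo `d` at these primes. The element `θ = u w̄ + b̄ w`
satisfies `b θ - u θ̄ = (N(b) - N(u)) w`, and `w` is chosen to bound the divisibility of `N(θ)`. -/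
theorem exists_rotation {c n k d₁ : ℤ} (hd : d₁ ∣ d) (hc : IsCoprime c d₁) (hn : IsCoprime n d₁)
    {b : L} (hb : c * nm b = (n ^ 2 + d * k : ℤ)) {m : ℤ} (hm : m ≠ 0) {b' : quadOrder d δ}
    (hb' : (b' : L) = m * b) {u : quadOrder d δ}
    (hu : ∀ p : ℕ, p.Prime → (p : ℤ) ∣ d₁ →
      (p : ℤ) ^ (2 * (4 * m ^ 2 * d).natAbs) ∣ n ^ 2 + d * k - c * Algebra.norm ℤ u) :
    ∃ θ : L, θ ≠ 0 ∧ ∀ p : ℕ, p.Prime → (p : ℤ) ∣ d₁ →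
      ∃ r : ℤ, IsCoprime r (p : ℤ) ∧ ∃ z : quadOrder d δ, (r : L) * (b * θ / star θ - u) = d * z := by
  by_cases hex : ∃ p : ℕ, p.Prime ∧ (p : ℤ) ∣ d₁
  swap
  · exact ⟨1, one_ne_zero, fun p hp hpd => absurd ⟨p, hp, hpd⟩ hex⟩
  have hd0 : d ≠ 0 := h.neg.ne
  have hmL : (m : L) ≠ 0 := by exact_mod_cast hm
  have hx0 : 4 * m ^ 2 * d ≠ 0 := mul_ne_zero (mul_ne_zero (by norm_num) (pow_ne_zero 2 hm)) hd0
  have hδ : ((sqrtElem d δ : quadOrder d δ) : L) = δ := rfl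
  set K := (4 * m ^ 2 * d).natAbs with hK
  have hK0 : K ≠ 0 := Int.natAbs_ne_zero.2 hx0
  set E := Algebra.norm ℤ b' - m ^ 2 * Algebra.norm ℤ u with hE
  have hNb : ((Algebra.norm ℤ b' : ℤ) : ℚ) = m ^ 2 * nm b := by
    rw [norm_coe d δ, hb', nm_mul, ← nm_ratCast d δ (m : ℚ), Rat.cast_intCast]
  have hcE : c * E = m ^ 2 * (n ^ 2 + d * k - c * Algebra.norm ℤ u) := by
    have h1 : ((c * E : ℤ) : ℚ) = ((m ^ 2 * (n ^ 2 + d * k - c * Algebra.norm ℤ u) : ℤ) : ℚ) := by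
      rw [hE]
      push_cast at hb ⊢
      rw [hNb]
      linear_combination m ^ 2 * hb
    exact_mod_cast h1
  have hpc : ∀ {p : ℕ} {x : ℤ}, (p : ℤ) ∣ d₁ → IsCoprime x d₁ → IsCoprime x (p : ℤ) :=
    fun hpd hx => hx.of_isCoprime_of_dvd_right hpd
  have hpE : ∀ p : ℕ, p.Prime → (p : ℤ) ∣ d₁ → (p : ℤ) ^ (2 * K) ∣ E := fun p hp hpd =>
    ((hpc hpd hc).symm.pow_left).dvd_of_dvd_mul_left (hcE ▸ (hu p hp hpd).mul_left _)
  have hpu : ∀ p : ℕ, p.Prime → (p : ℤ) ∣ d₁ → IsCoprime (Algebra.norm ℤ u) (p : ℤ) := by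
    intro p hp hpd
    rw [isCoprime_prime_iff hp]
    intro h1
    have h2 : (p : ℤ) ∣ n ^ 2 + d * k - c * Algebra.norm ℤ u :=
      (dvd_pow_self _ (by omega)).trans (hu p hp hpd)
    have h3 : (p : ℤ) ∣ n ^ 2 := by
      rw [show n ^ 2 = n ^ 2 + d * k - c * Algebra.norm ℤ u + c * Algebra.norm ℤ u - d * k by ring]
      exact dvd_sub (dvd_add h2 (h1.mul_left c)) ((hpd.trans hd).mul_right k)
    exact (isCoprime_prime_iff hp).1 (hpc hpd hn)
      ((Nat.prime_iff_prime_int.1 hp).dvd_of_dvd_pow h3)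
  have hpx : ∀ p : ℕ, p.Prime → ∀ x : ℤ, x ∣ 4 * m ^ 2 * d → ¬ (p : ℤ) ^ K ∣ x :=
    fun p hp x hx h1 => not_pow_natAbs_dvd hp hx0 (h1.trans hx)
  -- the values of `θ` at `w = 1` and at `w = √d`
  set a₁ : quadOrder d δ := m * u + starHom d δ b' with ha₁
  set a₂ : quadOrder d δ := (starHom d δ b' - m * u) * sqrtElem d δ with ha₂
  have hN : Algebra.norm ℤ a₂ - d * Algebra.norm ℤ a₁ =
      -(4 * m ^ 2 * d * Algebra.norm ℤ u) - 2 * d * E := by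
    obtain ⟨i, hi⟩ := exists_norm_combination d δ ((m : quadOrder d δ) * u) (starHom d δ b')
    have h1 := hi 1 1
    have h2 := hi (-1) 1
    rw [norm_starHom, norm_intCast_mul] at h1 h2
    have h3 : ((1 : ℤ) : quadOrder d δ) * (m * u) + ((1 : ℤ) : quadOrder d δ) * starHom d δ b' =
      a₁ := by rw [ha₁]; push_cast; ring
    have h4 : ((-1 : ℤ) : quadOrder d δ) * (m * u) + ((1 : ℤ) : quadOrder d δ) * starHom d δ b' =
      starHom d δ b' - m * u := by push_cast; ring
    rw [h3] at h1
    rw [h4] at h2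
    rw [ha₂, norm_sqrtElem_mul, h1, h2, hE]
    ring
  have hpa : ∀ p : ℕ, p.Prime → (p : ℤ) ∣ d₁ → (p : ℤ) ^ K ∣ Algebra.norm ℤ a₁ →
      ¬ (p : ℤ) ^ K ∣ Algebra.norm ℤ a₂ := by
    intro p hp hpd h1 h2
    have h3 : (p : ℤ) ^ K ∣ E := (pow_dvd_pow _ (by omega)).trans (hpE p hp hpd)
    have h4 : (p : ℤ) ^ K ∣ 4 * m ^ 2 * d * Algebra.norm ℤ u := by
      rw [show 4 * m ^ 2 * d * Algebra.norm ℤ u = d * Algebra.norm ℤ a₁ - Algebra.norm ℤ a₂ -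
        2 * d * E by linear_combination hN]
      exact dvd_sub (dvd_sub (h1.mul_left d) h2) (h3.mul_left (2 * d))
    exact hpx p hp _ dvd_rfl (((hpu p hp hpd).symm.pow_left).dvd_of_dvd_mul_right h4)
  -- at each prime, follow whichever of `a₁` and `a₂` has a norm not divisible by `p ^ K`
  obtain ⟨s, t, hst⟩ := exists_pow_dvd_and_isCoprime d₁.natAbs.primeFactors
    (fun p hp => Nat.prime_of_mem_primeFactors hp) K fun p => (p : ℤ) ^ K ∣ Algebra.norm ℤ a₁
  obtain ⟨i, hi⟩ := exists_norm_combination d δ a₁ a₂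
  set θ : quadOrder d δ := s * a₁ + t * a₂ with hθ
  have hNθ := hi s t
  have hpθ : ∀ p : ℕ, p.Prime → (p : ℤ) ∣ d₁ → ¬ (p : ℤ) ^ K ∣ Algebra.norm ℤ θ := by
    intro p hp hpd h1
    have hpF : p ∈ d₁.natAbs.primeFactors := Nat.mem_primeFactors.2
      ⟨hp, Int.natCast_dvd.1 hpd, Int.natAbs_ne_zero.2 fun h0 => hd0 (zero_dvd_iff.1 (h0 ▸ hd))⟩
    rw [hNθ] at h1
    by_cases hP : (p : ℤ) ^ K ∣ Algebra.norm ℤ a₁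
    · obtain ⟨h2, h3⟩ := (hst p hpF).1 hP
      refine hpa p hp hpd hP ((h3.symm.pow (n := 2) (m := K)).dvd_of_dvd_mul_left ?_)
      have := h1.sub (h2.mul_right (s * Algebra.norm ℤ a₁ + t * i))
      convert this using 1; ring
    · obtain ⟨h2, h3⟩ := (hst p hpF).2 hP
      refine hP ((h3.symm.pow (n := 2) (m := K)).dvd_of_dvd_mul_left ?_)
      have := h1.sub (h2.mul_right (t * Algebra.norm ℤ a₂ + s * i))
      convert this using 1; ring
  have hθ0 : (θ : L) ≠ 0 := by
    obtain ⟨p, hp, hpd⟩ := hex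
    intro h0
    refine hpθ p hp hpd ?_
    have h1 := norm_coe d δ θ
    rw [h0, (nm_eq_zero d δ).2 rfl] at h1
    rw [show Algebra.norm ℤ θ = 0 by exact_mod_cast h1]
    exact dvd_zero _
  have hsθ0 : star (θ : L) ≠ 0 := star_ne_zero.2 hθ0
  let w : quadOrder d δ := s + t * sqrtElem d δ
  have hmain : (m : L) * (b * θ / star (θ : L) - u) * Algebra.norm ℤ θ = E * (w * θ) := by
    have h1 : ((Algebra.norm ℤ θ : ℤ) : L) = θ * star (θ : L) := by
      rw [← nm_cast d δ, ← norm_coe d δ, Rat.cast_intCast]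
    have h2 : ((E : ℤ) : L) = m ^ 2 * (b * star b - u * star (u : L)) := by
      have h3 : ((E : ℤ) : L) = ((m ^ 2 * nm b - m ^ 2 * nm (u : L) : ℚ) : L) := by
        rw [← hNb, ← norm_coe d δ, hE]; push_cast; ring
      rw [h3, ← nm_cast d δ, ← nm_cast d δ]; push_cast; ring
    have h4 : (θ : L) = m * (u * (s - t * δ) + star b * (s + t * δ)) := by
      rw [hθ, ha₁, ha₂]
      push_cast [coe_starHom]
      rw [hδ, hb', star_mul', star_intCast]; ring
    have h5 : star (θ : L) = m * (star (u : L) * (s + t * δ) + b * (s - t * δ)) := by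
      rw [h4]
      simp only [star_mul', star_add, star_sub, star_intCast, star_star, h.star_eq]
      ring
    have h6 : (w : L) = s + t * δ := by push_cast [w]; rw [hδ]
    have h7 : b * θ - u * star (θ : L) = m * (b * star b - u * star (u : L)) * w := by
      rw [h5, h4, h6]; ring
    rw [h1, h2]
    field_simp
    linear_combination h7
  refine ⟨θ, hθ0, fun p hp hpd => ?_⟩
  obtain ⟨r, hr, e, he⟩ := exists_coprime_mul_dvd hp (x := m * d)
    (hpx p hp _ ⟨4 * m, by ring⟩) (hpθ p hp hpd) (hpE p hp hpd)
  refine ⟨r, hr, (e : quadOrder d δ) * (w * θ), ?_⟩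
  have hNθ0 : ((Algebra.norm ℤ θ : ℤ) : L) ≠ 0 := by
    rw [← Rat.cast_intCast, norm_coe d δ, nm_cast d δ]
    exact mul_ne_zero hθ0 hsθ0
  have heL : (r : L) * E = m * d * Algebra.norm ℤ θ * e := by
    exact_mod_cast congrArg (Int.cast : ℤ → L) he
  refine mul_left_cancel₀ (mul_ne_zero hmL hNθ0) ?_
  push_cast
  linear_combination r * hmain + (w : L) * θ * heL

end rotation

end

noncomputable section

/-! ### The ideal attached to an optimally embedded order -/

theorem exists_dvd_pow_mul {D : ℤ} : ∀ {N : ℤ}, N ≠ 0 →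
    ∃ (k : ℕ) (m : ℤ), IsCoprime m D ∧ N ∣ D ^ k * m := by
  suffices H : ∀ j : ℕ, ∀ N : ℤ, N ≠ 0 → N.natAbs ≤ j →
      ∃ (k : ℕ) (m : ℤ), IsCoprime m D ∧ N ∣ D ^ k * m from fun {N} hN => H _ N hN le_rfl
  intro j
  induction j with
  | zero => exact fun N hN hj => absurd (Int.natAbs_eq_zero.1 (by omega)) hN
  | succ j ih =>
    intro N hN hj
    by_cases hND : IsCoprime N D
    · exact ⟨0, N, hND, by simp⟩
    rw [Int.isCoprime_iff_gcd_eq_one] at hND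
    obtain ⟨p, hp, hpg⟩ := Nat.exists_prime_and_dvd hND
    obtain ⟨N', hN'⟩ := (Int.natCast_dvd_natCast.2 hpg).trans (Int.gcd_dvd_left ..)
    have hpD : (p : ℤ) ∣ D := (Int.natCast_dvd_natCast.2 hpg).trans (Int.gcd_dvd_right ..)
    have hN0 : N' ≠ 0 := by rintro rfl; exact hN (by rw [hN', mul_zero])
    obtain ⟨k, m, hm, hk⟩ := ih N' hN0 (by
      rw [hN', Int.natAbs_mul, Int.natAbs_natCast] at hj
      have := hp.two_le
      have := Int.natAbs_pos.2 hN0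
      nlinarith)
    refine ⟨k + 1, m, hm, ?_⟩
    rw [hN', pow_succ', mul_assoc]
    exact mul_dvd_mul hpD hk

section ideal

variable {L : Type*} [Field L] [CharZero L] [StarRing L]
variable (d : ℤ) (δ : L) {c : ℤ}

/-- For an order `R` whose elements `[0 : β]` have second coordinates in the lattice `J`, the ideal
of all `x` in the quadratic order with `g x 𝔮 J` contained in the quadratic order. -/
def quotientIdeal (g : ℤ) (𝔮 : Ideal (quadOrder d δ)) (R : Submodule ℤ (quatAlg L c)) :
    Ideal (quadOrder d δ) where
  carrier := {x | ∀ y ∈ 𝔮, ∀ β : L, quat c 0 β ∈ R → (g : L) * x * (y * β) ∈ quadOrder d δ}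
  add_mem' := by
    intro x x' hx hx' y hy β hβ
    convert add_mem (hx y hy β hβ) (hx' y hy β hβ) using 1
    push_cast; ring
  zero_mem' := by
    intro y _ β _
    simp
  smul_mem' := by
    intro z x hx y hy β hβ
    convert mul_mem z.2 (hx y hy β hβ) using 1
    rw [smul_eq_mul]; push_cast; ring

variable [h : ImagQuad L d δ]
include h

/-- If `x I J` lies in `K̄`, then `x` lies in `I⁻¹ K̄ J⁻¹`. -/
theorem mul_mem_of_mem_mul {I J K : Ideal (quadOrder d δ)} (hI : IsGoodIdeal I)
    (hJ : IsGoodIdeal J) {x : L}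
    (hx : ∀ y ∈ I, ∀ a ∈ J, x * y * a ∈ latticeConj (idealLattice K)) :
    x ∈ latticeInv (quadOrder d δ) (idealLattice I) * latticeConj (idealLattice K) *
      latticeInv (quadOrder d δ) (idealLattice J) := by
  have h1 : (ℤ ∙ x) * (idealLattice I * idealLattice J) ≤ latticeConj (idealLattice K) := by
    refine Submodule.mul_le.2 fun w hw v hv => ?_
    obtain ⟨s, rfl⟩ := Submodule.mem_span_singleton.1 hw
    rw [smul_mul_assoc]
    refine Submodule.smul_mem _ s ?_
    have h2 : idealLattice I * idealLattice J ≤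
        (latticeConj (idealLattice K)).comap (LinearMap.mulLeft ℤ x) := by
      refine Submodule.mul_le.2 fun y hy a ha => ?_
      obtain ⟨hy', hy⟩ := mem_idealLattice.1 hy
      obtain ⟨ha', ha⟩ := mem_idealLattice.1 ha
      have := hx _ hy _ ha
      rwa [mul_assoc] at this
    exact h2 hv
  have h3 : (1 : L) ∈ (idealLattice I * idealLattice J) *
      (latticeInv (quadOrder d δ) (idealLattice I) *
        latticeInv (quadOrder d δ) (idealLattice J)) := by
    rw [mul_mul_mul_comm, hI.1.2, hJ.1.2, toSubmodule_mul_self]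
    exact one_mem (quadOrder d δ)
  have h4 := Submodule.mul_mem_mul (Submodule.mem_span_singleton_self x) h3
  rw [mul_one, ← mul_assoc] at h4
  have h5 := mul_le_mul' h1 le_rfl h4
  convert h5 using 1
  ac_rfl

end ideal

namespace Setting

variable {L : Type*} [Field L] [CharZero L] [StarRing L]
variable {d : ℤ} {δ : L} [h : ImagQuad L d δ]
variable {ℓ q : ℕ} {𝔩 𝔮 : Ideal (quadOrder d δ)} (S : Setting d δ ℓ q 𝔩 𝔮)
variable {R : Submodule ℤ (quatAlg L (jSq d ℓ q))} (hR : IsOrder R)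
  (hO : IsOptimal (quadOrder d δ) R)
include S h hR

/-- The factor `(d ℓ) ^ (k + 1)` clears the denominators of `R` at `d ℓ`, and then the ideal
contains an integer prime to `d ℓ`. -/
theorem exists_mem_quotientIdeal : ∃ (k : ℕ) (m : ℤ), IsCoprime m (d * ℓ) ∧
    (m : quadOrder d δ) ∈ quotientIdeal d δ ((d * ℓ) ^ (k + 1)) 𝔮 R := by
  obtain ⟨N, hN, hN1⟩ := exists_uniform_smul_mem nonzeroInt (Λ' := quatSpan d δ (jSq d ℓ q)) hR.fg
    fun x _ => exists_smul_mem_quatSpan d δ x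
  obtain ⟨k, m, hm, j, hj⟩ := exists_dvd_pow_mul (D := d * ℓ) hN
  refine ⟨k, m, hm, fun y _ β hβ => ?_⟩
  have h1 := hN1 _ hβ
  rw [quat_zsmul] at h1
  obtain ⟨α', -, β', hβ', h2⟩ := h1
  obtain ⟨-, h3⟩ := quat_inj.1 h2
  have hjL : ((d : L) * ℓ) ^ k * m = N * j := by exact_mod_cast congrArg (Int.cast : ℤ → L) hj
  have h4 : (((d * ℓ) ^ (k + 1) : ℤ) : L) * ((m : quadOrder d δ) : L) * (y * β) =
      ((d * ℓ * j : ℤ) : L) * (y * β') := by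
    rw [← h3]; push_cast
    linear_combination d * ℓ * y * β * hjL
  rw [h4]
  exact mul_mem (intCast_mem _ _) (mul_mem y.2 hβ')

include hO

/-- Let `J` be the lattice of all `β` with `[0 : β] ∈ R`, and `g = (d ℓ) ^ (k + 1)`. Since
`[0 : β'] [0 : β] = [c β' β̄ : 0]`, optimality of `R` gives `c J J̄ ⊆ 𝓞`, and `𝔮 𝔮̄ = q 𝓞` then implies
`g J 𝔮 𝔞 ⊆ 𝔞̄` for the ideal `𝔞` of all `x` with `g x 𝔮 J ⊆ 𝓞`. -/
theorem mul_mem_conj_quotientIdeal {k : ℕ} {a y : quadOrder d δ}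
    (ha : a ∈ quotientIdeal d δ ((d * ℓ) ^ (k + 1)) 𝔮 R) (hy : y ∈ 𝔮) {β : L}
    (hβ : quat _ 0 β ∈ R) : (((d * ℓ) ^ (k + 1) : ℤ) : L) * β * y * a ∈
      latticeConj (idealLattice (quotientIdeal d δ ((d * ℓ) ^ (k + 1)) 𝔮 R)) := by
  rw [mem_latticeConj, mem_idealLattice]
  have h1 : (((d * ℓ) ^ (k + 1) : ℤ) : L) * β * y * a ∈ quadOrder d δ := by
    convert ha y hy β hβ using 1; ring
  refine ⟨star_mem_quadOrder d δ h1, fun y' hy' β' hβ' => ?_⟩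
  have h2 : star (y : L) * y' ∈ (ℤ ∙ (q : L)) * Subalgebra.toSubmodule (quadOrder d δ) := by
    rw [← S.q_mul_conj, mul_comm (star (y : L))]
    exact Submodule.mul_mem_mul (coe_mem_idealLattice.2 hy')
      (mem_latticeConj.2 (by rw [star_star]; exact coe_mem_idealLattice.2 hy))
  obtain ⟨o, ho, h3⟩ := Submodule.mem_span_singleton_mul.1 h2
  have h4 := hR.mul_mem _ hβ' _ hβ
  rw [quat_mul, zero_mul, zero_add, zero_mul, star_zero, mul_zero, add_zero, ← emb_eq, hO] at h4
  obtain ⟨i, hi⟩ : ∃ i : ℤ, (ℓ * q : ℤ) = jSq d ℓ q * i := by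
    unfold jSq
    split_ifs
    · exact ⟨-ℓ, by ring⟩
    · exact ⟨-1, by ring⟩
  have hiL : (ℓ : L) * q = jSq d ℓ q * i := by exact_mod_cast congrArg (Int.cast : ℤ → L) hi
  change (((d * ℓ) ^ (k + 1) : ℤ) : L) * star ((((d * ℓ) ^ (k + 1) : ℤ) : L) * β * y * a) *
    (y' * β') ∈ _
  have h5 : (((d * ℓ) ^ (k + 1) : ℤ) : L) * star ((((d * ℓ) ^ (k + 1) : ℤ) : L) * β * y * a) *
      (y' * β') = (((d * ℓ) ^ (k + 1) * (d * ℓ) ^ k * d * i : ℤ) : L) *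
        (jSq d ℓ q * β' * star β * (o * star (a : L))) := by
    simp only [star_mul', star_intCast]
    push_cast
    rw [pow_succ ((d : L) * ℓ) k]
    linear_combination (-((d : L) * ℓ) ^ k * (d * ℓ) * (((d : L) * ℓ) ^ k * (d * ℓ)) * β' *
      star β * star (a : L)) * h3 + (((d : L) * ℓ) ^ k * (d * ℓ) * ((d : L) * ℓ) ^ k * d * o *
      β' * star β * star (a : L)) * hiL
  rw [h5]
  exact mul_mem (intCast_mem _ _) (mul_mem h4 (mul_mem ho (star_mem_quadOrder d δ a.2)))

theorem mem_twistLattice_quotientIdeal {k : ℕ}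
    (hg : IsGoodIdeal (quotientIdeal d δ ((d * ℓ) ^ (k + 1)) 𝔮 R)) {β : L}
    (hβ : quat _ 0 β ∈ R) : (((d * ℓ) ^ (k + 1) : ℤ) : L) * β ∈
      twistLattice d δ 𝔮 (quotientIdeal d δ ((d * ℓ) ^ (k + 1)) 𝔮 R) :=
  mul_mem_of_mem_mul d δ S.good_q hg fun _ hy _ ha =>
    S.mul_mem_conj_quotientIdeal hR hO ha hy hβ

end Setting

namespace Setting

variable {L : Type*} [Field L] [CharZero L] [StarRing L]
variable {d : ℤ} {δ : L} [h : ImagQuad L d δ]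
variable {ℓ q : ℕ} {𝔩 𝔮 : Ideal (quadOrder d δ)} (S : Setting d δ ℓ q 𝔩 𝔮)
variable (C : LambdaChoice d δ ℓ q)
include S h

/-- If `𝔞` is prime to `p`, the parity conditions select `λ^(p)`. -/
theorem congrModLocal_lambda_of_mem {𝔞 : Ideal (quadOrder d δ)} {m : ℤ}
    (hm : (m : quadOrder d δ) ∈ 𝔞) {p : ℕ} (hp : p.Prime) (hpd : (p : ℤ) ∣ d)
    (hpm : IsCoprime m (p : ℤ)) : CongrModLocal p (C.lambda 𝔮 𝔞) (C.lam p) := by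
  refine S.congrModLocal_lambda C ?_
  by_cases hpf : p ∣ conductor (quadOrder d δ)
  · exact C.lamRam_irregular 𝔞 p hp hpf
  obtain ⟨P, hP, hpP⟩ := exists_isPrime_mem d δ hp
  have h1 := C.lamRam_regular 𝔞 p hp hpd hpf P hP hpP
  have h2 : multiplicity P 𝔞 = 0 := multiplicity_eq_zero.2 fun hdvd =>
    (isCoprime_prime_iff hp).1 hpm ((mem_iff_dvd d δ hP hp hpP).1 (Ideal.le_of_dvd hdvd hm))
  rwa [h2, if_pos Even.zero] at h1

/-- The element `λ_𝔞` is congruent to `λ_⊤` modulo `√d`, locally at the primes prime to `𝔞`. -/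
theorem exists_lambda_sub_eq {𝔞 : Ideal (quadOrder d δ)} {m : ℤ}
    (hm : (m : quadOrder d δ) ∈ 𝔞) {p : ℕ} (hp : p.Prime) (hpd : (p : ℤ) ∣ d)
    (hpm : IsCoprime m (p : ℤ)) : ((C.lambda 𝔮 𝔞 : L) - C.lambda 𝔮 ⊤) / δ ∈
      locAt (p : ℤ) (Subalgebra.toSubmodule (quadOrder d δ)) := by
  have hδ := sqrt_ne_zero d δ
  obtain ⟨n, hn, z, hz, h1⟩ := (congrModLocal_iff d δ).1
    (S.congrModLocal_lambda_of_mem C hm hp hpd hpm)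
  obtain ⟨n', hn', z', hz', h2⟩ := (congrModLocal_iff d δ).1
    (S.congrModLocal_lambda_of_mem C (𝔞 := ⊤) (m := 1) Submodule.mem_top hp hpd isCoprime_one_left)
  have h3 : ∀ {n : ℤ} {x z : L}, ¬ (p : ℤ) ∣ n → z ∈ quadOrder d δ → n * x = δ * z →
      x / δ ∈ locAt (p : ℤ) (Subalgebra.toSubmodule (quadOrder d δ)) := by
    intro n x z hn hz hx
    refine mem_locAt_of_eq ((isCoprime_prime_iff hp).2 hn) (y := z) ?_ (le_locAt _ _ hz)
    rw [mul_div_assoc', hx, mul_div_cancel_left₀ _ hδ]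
  convert sub_mem (h3 hn hz h1) (h3 hn' hz' h2) using 1
  ring

variable {R : Submodule ℤ (quatAlg L (jSq d ℓ q))}

/-- An optimally embedded order which, at the primes dividing `d` other than `ℓ`, contains an element
`[n / √d : u / √d]` with `n ≡ λ_⊤ u` is contained in some `R(𝔞)`. -/
theorem exists_le_order (hR : IsOrder R) (hO : IsOptimal (quadOrder d δ) R) {n : ℤ} {u : L}
    (hr : quat _ (n / δ) (u / δ) ∈ R)
    (hu : ∀ p : ℕ, p.Prime → (p : ℤ) ∣ d → p ≠ ℓ → IsCoprime n (p : ℤ) ∧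
      u ∈ locAt (p : ℤ) (Subalgebra.toSubmodule (quadOrder d δ)) ∧
      ((n : L) - C.lambda 𝔮 ⊤ * u) / δ ∈
        locAt (p : ℤ) (Subalgebra.toSubmodule (quadOrder d δ))) :
    ∃ 𝔞 : Ideal (quadOrder d δ), IsGoodIdeal 𝔞 ∧ R ≤ C.order 𝔩 𝔮 𝔞 := by
  have hδ := sqrt_ne_zero d δ
  obtain ⟨k, m, hm, hm𝔞⟩ := S.exists_mem_quotientIdeal hR
  set 𝔞 := quotientIdeal d δ ((d * ℓ) ^ (k + 1)) 𝔮 R with h𝔞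
  have hmd : IsCoprime m d := hm.of_mul_right_left
  have hm0 : m ≠ 0 := by
    rintro rfl
    have h1 := Int.isUnit_iff.1 (isCoprime_zero_left.1 hm)
    have h2 := S.prime_ell.two_le
    have h3 : (d * ℓ).natAbs = 1 := by rcases h1 with h1 | h1 <;> rw [h1] <;> rfl
    rw [Int.natAbs_mul, Int.natAbs_natCast] at h3
    have := Nat.eq_one_of_mul_eq_one_left h3
    omega
  have ha : IsGoodIdeal 𝔞 := isGoodIdeal_of_coprime d δ hm0 (isCoprime_conductor d δ hmd) hm𝔞
  have hadm := S.isAdmissible_lambda C ha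
  have hT := S.isInvertible_twistLattice ha
  have hOT : ∀ x ∈ quadOrder d δ, ∀ t ∈ twistLattice d δ 𝔮 𝔞, x * t ∈ twistLattice d δ 𝔮 𝔞 :=
    fun x hx t ht => mul_mem_of_toSubmodule_mul hT.1 hx ht
  have hmT : (m : L) ∈ twistLattice d δ 𝔮 𝔞 := by
    have h1 : ∀ I : Ideal (quadOrder d δ), (1 : L) ∈ latticeInv (quadOrder d δ) (idealLattice I) :=
      fun I => mem_latticeInv.2 fun y hy => by rw [one_mul]; exact idealLattice_le I hy
    have h2 : (m : L) ∈ latticeConj (idealLattice 𝔞) := by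
      rw [mem_latticeConj, star_intCast]
      exact (intCast_mem_iff d δ).1 hm𝔞
    have := Submodule.mul_mem_mul (Submodule.mul_mem_mul (h1 𝔮) h2) (h1 𝔞)
    rwa [one_mul, mul_one] at this
  have hloc : ∀ {p : ℕ}, (p : ℤ) ∣ d → ∀ {e x : L}, e ∈ alphaLattice d δ ℓ 𝔩 →
      x ∈ locAt (p : ℤ) (Subalgebra.toSubmodule (quadOrder d δ)) →
      e * x ∈ locAt (p : ℤ) (alphaLattice d δ ℓ 𝔩 * twistLattice d δ 𝔮 𝔞) := by
    intro p hpd e x he hx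
    refine mem_locAt_of_eq (hmd.of_isCoprime_of_dvd_right hpd) (y := e * (x * m)) (by ring) ?_
    exact mul_mem_locAt (C := alphaLattice d δ ℓ 𝔩 * twistLattice d δ 𝔮 𝔞)
      (fun a ha b hb => Submodule.mul_mem_mul ha hb) (le_locAt _ _ he)
      (mul_mem_locAt hOT hx (le_locAt _ _ hmT))
  have hmulO : ∀ {p : ℤ} {x y : L}, x ∈ locAt p (Subalgebra.toSubmodule (quadOrder d δ)) →
      y ∈ locAt p (Subalgebra.toSubmodule (quadOrder d δ)) →
      x * y ∈ locAt p (Subalgebra.toSubmodule (quadOrder d δ)) :=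
    fun hx hy => mul_mem_locAt (fun a ha b hb => mul_mem (S := Subalgebra ℤ L) ha hb) hx hy
  have hell : (ℓ : L) / δ ∈ alphaLattice d δ ℓ 𝔩 := by
    have h2 : ∀ x ∈ quadOrder d δ, x / δ ∈ (ℤ ∙ δ⁻¹) * Subalgebra.toSubmodule (quadOrder d δ) :=
      fun x hx => Submodule.mem_span_singleton_mul.2 ⟨x, hx, by rw [div_eq_inv_mul]⟩
    unfold alphaLattice
    rw [latticeInv_sqrtIdeal]
    split_ifs
    · have := Submodule.mul_mem_mul (coe_mem_idealLattice.2 S.ell_mem) (h2 1 (one_mem _))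
      rwa [mul_one_div, SubringClass.coe_natCast] at this
    · exact h2 _ (natCast_mem _ ℓ)
  refine ⟨𝔞, ha, fun x hx => mem_of_forall_prime fun p hp => ?_⟩
  obtain ⟨α, β, rfl⟩ := exists_quat x
  by_cases hpℓ : p = ℓ
  -- at `ℓ` the order `R(𝔞)` contains all elements of integral norm
  · subst hpℓ
    have : Fact p.Prime := ⟨hp⟩
    obtain ⟨e, D, hD, hDℓ⟩ := S.exists_basis_gram ha hadm
    obtain ⟨i, hi⟩ := hR.exists_redNorm_eq d δ hx
    refine (S.isMaximalOrder ha hadm).mem_locAt_of_isIntAt d δ e hD ?_ S.isRamifiedOver_ell ?_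
    · rintro rfl
      exact pow_ne_zero 2 hp.ne_zero hDℓ.symm
    · rw [hi]; exact isIntAt_intCast _ i
  have hα := isOptimal_sqrt_mul_mem d δ hR hO hx
  have hδβ : quat (jSq d ℓ q) 0 (δ * β) ∈ R := by
    have h1 := sub_mem (hR.mul_mem _ ((hO δ).2 (sqrt_mem_quadOrder d δ)) _ hx) ((hO _).2 hα)
    rwa [Setting.emb_mul_quat, emb_eq, quat_sub, sub_self, sub_zero] at h1
  by_cases hpd : (p : ℤ) ∣ d
  swap
  · -- away from `dℓ`
    refine mem_locAt.2 ⟨(d * ℓ) ^ (k + 1) * d, ?_, ?_⟩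
    · have h1 : IsCoprime d (p : ℤ) := (isCoprime_prime_iff hp).2 hpd
      have h2 : IsCoprime (ℓ : ℤ) (p : ℤ) :=
        Nat.isCoprime_iff_coprime.2 ((Nat.coprime_primes S.prime_ell hp).2 (Ne.symm hpℓ))
      exact ((h1.mul_left h2).pow_left).mul_left h1
    · have h1 := S.mem_twistLattice_quotientIdeal hR hO ha hδβ
      have h2 : (((d * ℓ) ^ (k + 1) * d : ℤ) : L) * β =
          δ * ((((d * ℓ) ^ (k + 1) : ℤ) : L) * (δ * β)) := by
        have := h.sq
        push_cast
        linear_combination (-((d : L) * ℓ) ^ (k + 1) * β) * this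
      have h3 : (((d * ℓ) ^ (k + 1) * d : ℤ) : L) * α =
          (((d * ℓ) ^ (k + 1) : ℤ) : L) * (δ * (δ * α)) := by
        have := h.sq
        push_cast
        linear_combination (-((d : L) * ℓ) ^ (k + 1) * α) * this
      have h4 := hOT δ (sqrt_mem_quadOrder d δ) _ h1
      rw [← h2] at h4
      rw [quat_zsmul, S.quat_mem_order C ha]
      refine ⟨?_, sub_mem ?_ (hadm.1 _ h4)⟩
      · have := Submodule.mul_mem_mul (S.one_mem_alphaLattice) h4
        rwa [one_mul] at this
      · rw [h3]
        exact mul_mem (intCast_mem _ _) (mul_mem (sqrt_mem_quadOrder d δ) hα)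
  -- at the primes dividing `d` other than `ℓ`
  obtain ⟨hnp, hup, hlp⟩ := hu p hp hpd hpℓ
  obtain ⟨i, hi⟩ := exists_norm_eq_of_mem d δ hR hr
  -- subtracting a multiple of the distinguished element leaves `[0 : β' / n]` with `β'` integral at `p`
  set β' := n * β - α * u with hβ'
  have hβ'p : β' ∈ locAt (p : ℤ) (Subalgebra.toSubmodule (quadOrder d δ)) := by
    have h1 := hmulO (le_locAt (p : ℤ) _ (sub_mul_star_mem d δ hR hO hr hx)) hup
    have h2 : IsCoprime (n ^ 2 + d * i) (p : ℤ) := by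
      obtain ⟨j, hj⟩ := hpd
      rw [hj, mul_assoc]
      exact hnp.pow_left.add_mul_left_left _
    refine mem_locAt_of_eq h2 ?_ h1
    have h3 := congrArg (Rat.cast : ℚ → L) hi
    rw [Rat.cast_mul, nm_cast d δ, Rat.cast_intCast, Rat.cast_intCast] at h3
    rw [← h3, hβ']; ring
  have hβp : β ∈ locAt (p : ℤ) (alphaLattice d δ ℓ 𝔩 * twistLattice d δ 𝔮 𝔞) := by
    have h2 : IsCoprime (ℓ : ℤ) (p : ℤ) :=
      Nat.isCoprime_iff_coprime.2 ((Nat.coprime_primes S.prime_ell hp).2 (Ne.symm hpℓ))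
    refine mem_locAt_of_eq (h2.mul_left hnp) ?_ (add_mem
      (hloc hpd hell (hmulO (le_locAt _ _ hα) hup))
      (Submodule.smul_mem _ (ℓ : ℤ) (hloc hpd S.one_mem_alphaLattice hβ'p)))
    rw [hβ', zsmul_eq_mul]
    push_cast
    field_simp
    ring
  have hαp : α - C.lambda 𝔮 𝔞 * β ∈ locAt (p : ℤ) (Subalgebra.toSubmodule (quadOrder d δ)) := by
    have h1 := S.exists_lambda_sub_eq C hm𝔞 hp hpd (hmd.of_isCoprime_of_dvd_right hpd)
    refine mem_locAt_of_eq hnp ?_ (sub_mem (hmulO (le_locAt _ _ hα) (sub_mem hlp (hmulO h1 hup)))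
      (hmulO (le_locAt _ _ (C.lambda 𝔮 𝔞).2) hβ'p))
    rw [hβ']
    field_simp
    ring
  obtain ⟨r₁, hr₁, h1⟩ := mem_locAt.1 hβp
  obtain ⟨r₂, hr₂, h2⟩ := mem_locAt.1 hαp
  refine mem_locAt.2 ⟨r₁ * r₂, hr₁.mul_left hr₂, ?_⟩
  rw [quat_zsmul, S.quat_mem_order C ha]
  constructor
  · convert Submodule.smul_mem _ r₂ h1 using 1
    simp only [zsmul_eq_mul]; push_cast; ring
  · have h3 : r₁ • r₂ • (α - (C.lambda 𝔮 𝔞 : L) * β) ∈ quadOrder d δ := Submodule.smul_mem _ r₁ h2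
    convert h3 using 1
    simp only [zsmul_eq_mul]; push_cast; ring

end Setting

end

noncomputable section

/-! ### Every optimally embedded maximal order is conjugate to some `R(𝔞)` -/

namespace Setting

variable {L : Type*} [Field L] [CharZero L] [StarRing L]
variable {d : ℤ} {δ : L} [h : ImagQuad L d δ]
variable {ℓ q : ℕ} {𝔩 𝔮 : Ideal (quadOrder d δ)} (S : Setting d δ ℓ q 𝔩 𝔮)
variable (C : LambdaChoice d δ ℓ q) {R : Submodule ℤ (quatAlg L (jSq d ℓ q))}
include S h

/-- An optimally embedded maximal order contains some `[n / √d : b / √d]` for which `u = b θ / θ̄`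
satisfies `λ_⊤ u ≡ n` modulo `√d` at the primes dividing `d` other than `ℓ`. Conjugation by `θ`
replaces `b` by `u`. -/
theorem exists_rotated_mem (hR : IsMaximalOrder R) (hO : IsOptimal (quadOrder d δ) R) :
    ∃ (θ b : L) (n : ℤ), θ ≠ 0 ∧ quat _ (n / δ) (b / δ) ∈ R ∧
      ∀ p : ℕ, p.Prime → (p : ℤ) ∣ d → p ≠ ℓ → IsCoprime n (p : ℤ) ∧
        b * θ / star θ ∈ locAt (p : ℤ) (Subalgebra.toSubmodule (quadOrder d δ)) ∧
        ((n : L) - C.lambda 𝔮 ⊤ * (b * θ / star θ)) / δ ∈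
          locAt (p : ℤ) (Subalgebra.toSubmodule (quadOrder d δ)) := by
  have hδ := sqrt_ne_zero d δ
  have hgood := isGoodIdeal_top d δ
  have hadm := S.isAdmissible_lambda C hgood
  obtain ⟨v, d₁, hd₁, hd⟩ := exists_eq_pow_mul_coprime S.prime_ell h.neg.ne
  have hdvd : d₁ ∣ d := ⟨_, hd.trans (mul_comm _ _)⟩
  have hpℓ : ∀ {p : ℕ}, p.Prime → (p : ℤ) ∣ d₁ → p ≠ ℓ := by
    rintro p hp hpd rfl
    exact (isCoprime_prime_iff hp).1 hd₁ hpd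
  have hpd₁ : ∀ {p : ℕ}, p.Prime → (p : ℤ) ∣ d → p ≠ ℓ → (p : ℤ) ∣ d₁ := by
    intro p hp hpd hne
    rw [hd] at hpd
    refine ((Nat.prime_iff_prime_int.1 hp).dvd_or_dvd hpd).resolve_left fun h1 => hne ?_
    have h2 := (Nat.prime_iff_prime_int.1 hp).dvd_of_dvd_pow h1
    exact (Nat.prime_dvd_prime_iff_eq hp S.prime_ell).1 (by exact_mod_cast h2)
  have hw : IsCoprime ((ℓ : ℤ) ^ v) d₁ := hd₁.symm.pow_left
  have hc : IsCoprime (jSq d ℓ q) d₁ := by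
    rw [Int.isCoprime_iff_gcd_eq_one]
    by_contra hne
    obtain ⟨p, hp, hpg⟩ := Nat.exists_prime_and_dvd hne
    exact S.not_dvd_jSq hp (((Int.natCast_dvd_natCast.2 hpg).trans (Int.gcd_dvd_right ..)).trans hdvd)
      ((Int.natCast_dvd_natCast.2 hpg).trans (Int.gcd_dvd_left ..))
  -- an element `[n / √d : b / √d]` with `n` prime to `d₁`, by self-duality of `R` away from `ℓ`
  obtain ⟨e, D, hD, hDℓ⟩ := S.exists_basis_gram hgood hadm
  obtain ⟨n, b, hn, hr⟩ := exists_int_mem_projIdeal d δ hR.1 hO hdvd fun p hp hpd y hy => by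
    refine hR.mem_locAt_of_dual d δ S.jSq_neg (S.isOrder hgood hadm) e hD hp ?_ hy
    have h1 : IsCoprime (D.natAbs : ℤ) (p : ℤ) := by
      rw [hDℓ]
      push_cast
      exact (Nat.isCoprime_iff_coprime.2
        ((Nat.coprime_primes S.prime_ell hp).2 (hpℓ hp hpd).symm)).pow_left
    rw [Int.isCoprime_iff_gcd_eq_one] at h1 ⊢
    exact h1
  obtain ⟨k, hk⟩ := exists_norm_eq_of_mem d δ hR.1 hr
  have hlam : d₁ ∣ Algebra.norm ℤ (C.lambda 𝔮 ⊤) - jSq d ℓ q := by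
    refine Dvd.dvd.trans ?_ (S.norm_lambda_modEq C ⊤).symm.dvd
    unfold normModulus
    split_ifs with hℓd
    · refine hd₁.dvd_of_dvd_mul_left ?_
      rwa [Int.mul_ediv_cancel' hℓd]
    · exact hdvd
  obtain ⟨m, hm, hmb⟩ := exists_int_smul_mem d δ b
  rw [zsmul_eq_mul] at hmb
  obtain ⟨u, ⟨z, hz⟩, hu⟩ := exists_norm_approx d δ hd hw hc hn (k := k) hlam
    (2 * (4 * m ^ 2 * d).natAbs)
  obtain ⟨θ, hθ, hθu⟩ := exists_rotation d δ hdvd hc hn hk hm (b' := ⟨_, hmb⟩) rfl hu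
  refine ⟨θ, b, n, hθ, hr, fun p hp hpd hne => ?_⟩
  have hp₁ := hpd₁ hp hpd hne
  obtain ⟨r, hr', z', hz'⟩ := hθu p hp hp₁
  refine ⟨hn.of_isCoprime_of_dvd_right hp₁, ?_, ?_⟩
  · refine mem_locAt_of_eq hr' (y := r * u + d * z') (by linear_combination hz') (le_locAt _ _ ?_)
    change _ ∈ quadOrder d δ
    exact add_mem (mul_mem (intCast_mem _ r) u.2) (mul_mem (intCast_mem _ d) z'.2)
  · have h1 : IsCoprime ((ℓ : ℤ) ^ v * r) (p : ℤ) :=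
      (hw.of_isCoprime_of_dvd_right hp₁).mul_left hr'
    refine mem_locAt_of_eq h1
      (y := -(r * z) - ((ℓ : ℤ) ^ v : ℤ) * (C.lambda 𝔮 ⊤ * (δ * z'))) ?_ (le_locAt _ _ ?_)
    · have h2 := h.sq
      push_cast at hz ⊢
      rw [mul_div_assoc', div_eq_iff hδ]
      linear_combination (-(r : L)) * hz - (ℓ : L) ^ v * (C.lambda 𝔮 ⊤ : L) * hz' +
        (ℓ : L) ^ v * (C.lambda 𝔮 ⊤ : L) * z' * h2
    · change _ ∈ quadOrder d δ
      exact sub_mem (neg_mem (mul_mem (intCast_mem _ r) z.2)) (mul_mem (intCast_mem _ _)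
        (mul_mem (C.lambda 𝔮 ⊤).2 (mul_mem (sqrt_mem_quadOrder d δ) z'.2)))

/-- Conjugation by `θ` brings `R` into some `R(𝔞)`, and both are maximal. -/
theorem exists_conj_eq_order (hR : IsMaximalOrder R) (hO : IsOptimal (quadOrder d δ) R) :
    ∃ 𝔞 : Ideal (quadOrder d δ), IsGoodIdeal 𝔞 ∧ ∃ θ : L, θ ≠ 0 ∧ ∀ x : quatAlg L (jSq d ℓ q),
      x ∈ R ↔ emb (jSq d ℓ q) θ * x * emb (jSq d ℓ q) θ⁻¹ ∈ C.order 𝔩 𝔮 𝔞 := by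
  obtain ⟨θ, b, n, hθ, hr, hu⟩ := S.exists_rotated_mem C hR hO
  have hsθ : star θ ≠ 0 := star_ne_zero.2 hθ
  have h1 : emb (jSq d ℓ q) θ * emb (jSq d ℓ q) θ⁻¹ = 1 := by
    rw [← map_mul, mul_inv_cancel₀ hθ, map_one]
  have h2 : emb (jSq d ℓ q) θ⁻¹ * emb (jSq d ℓ q) θ = 1 := by
    rw [← map_mul, inv_mul_cancel₀ hθ, map_one]
  have hO' : IsOptimal (quadOrder d δ) (conjLattice (emb _ θ) (emb _ θ⁻¹) R) := by
    intro α
    rw [mem_conjLattice, ← map_mul, ← map_mul, mul_right_comm, inv_mul_cancel₀ hθ, one_mul]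
    exact hO α
  have hr' : quat _ (n / δ) (b * θ / star θ / δ) ∈
      conjLattice (emb (jSq d ℓ q) θ) (emb _ θ⁻¹) R := by
    rw [mem_conjLattice, emb_mul_quat, quat_mul_emb]
    convert hr using 2 <;> field_simp
  obtain ⟨𝔞, ha, hle⟩ := S.exists_le_order C (hR.1.conjLattice h1 h2) hO' hr' hu
  refine ⟨𝔞, ha, θ, hθ, fun x => ?_⟩
  have h3 : R ≤ conjLattice (emb _ θ⁻¹) (emb _ θ) (C.order 𝔩 𝔮 𝔞) := by
    intro z hz
    refine mem_conjLattice.2 (hle (mem_conjLattice.2 ?_))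
    rwa [show emb (jSq d ℓ q) θ⁻¹ * (emb _ θ * z * emb _ θ⁻¹) * emb _ θ =
      (emb _ θ⁻¹ * emb _ θ) * z * (emb _ θ⁻¹ * emb _ θ) by noncomm_ring, h2, one_mul, mul_one]
  have h4 := hR.2 _ ((S.isOrder ha (S.isAdmissible_lambda C ha)).conjLattice h2 h1) h3
  conv_lhs => rw [← h4]
  exact mem_conjLattice

end Setting

end

end QuatOrders

theorem mainTheorem9 {L : Type*} [Field L] [NumberField L] [StarRing L]
    (hL : Module.finrank ℚ L = 2)
    (d : ℤ) (hd : d < 0) (hd4 : d % 4 = 0 ∨ d % 4 = 1)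
    (δ : L) (hδ : δ ^ 2 = (d : L)) (hstar : star δ = -δ)
    (ℓ : ℕ) (hℓ : ℓ.Prime) (hℓf : ¬ ℓ ∣ conductor (quadOrder d δ))
    (𝔩 : Ideal (quadOrder d δ)) (h𝔩 : 𝔩.IsPrime) (hℓ𝔩 : (ℓ : quadOrder d δ) ∈ 𝔩)
    (hnonsplit : ∀ 𝔭 : Ideal (quadOrder d δ), 𝔭.IsPrime → (ℓ : quadOrder d δ) ∈ 𝔭 → 𝔭 = 𝔩)
    (q : ℕ) (hq : IsAuxiliaryPrime d ℓ q)
    (𝔮 : Ideal (quadOrder d δ)) (h𝔮 : 𝔮.IsPrime) (hq𝔮 : (q : quadOrder d δ) ∈ 𝔮) :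
    IsQuaternionRamifiedExactlyAt ℓ (quatAlg L (jSq d ℓ q)) ∧
    (∀ (𝔞 : Ideal (quadOrder d δ)) (lam : quadOrder d δ),
      IsGoodIdeal 𝔞 → IsAdmissible d δ ℓ q 𝔮 𝔞 lam →
        IsMaximalOrder (quatOrder d δ ℓ q 𝔩 𝔮 𝔞 lam) ∧
        HasDiscriminant (quatOrder d δ ℓ q 𝔩 𝔮 𝔞 lam) ((ℓ : ℚ) ^ 2) ∧
        IsOptimal (quadOrder d δ) (quatOrder d δ ℓ q 𝔩 𝔮 𝔞 lam)) ∧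
    Nonempty (LambdaChoice d δ ℓ q) ∧
    ∀ C : LambdaChoice d δ ℓ q,
      (∀ 𝔞 : Ideal (quadOrder d δ), IsGoodIdeal 𝔞 →
        IsAdmissible d δ ℓ q 𝔮 𝔞 (C.lambda 𝔮 𝔞)) ∧
      (∀ (𝔞 𝔠 : Ideal (quadOrder d δ)) (𝔟 : Submodule ℤ L),
        IsGoodIdeal 𝔞 → IsGoodFractional (quadOrder d δ) 𝔟 →
        idealLattice 𝔠 = idealLattice 𝔞 * 𝔟 →
          C.order 𝔩 𝔮 𝔞 * embLattice (jSq d ℓ q) 𝔟 =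
            embLattice (jSq d ℓ q) 𝔟 * C.order 𝔩 𝔮 𝔠) ∧
      (∀ R : Submodule ℤ (quatAlg L (jSq d ℓ q)),
        IsMaximalOrder R → IsOptimal (quadOrder d δ) R →
          ∃ 𝔞 : Ideal (quadOrder d δ), IsGoodIdeal 𝔞 ∧
            ∃ θ : L, θ ≠ 0 ∧ ∀ x : quatAlg L (jSq d ℓ q),
              x ∈ R ↔ emb (jSq d ℓ q) θ * x * emb (jSq d ℓ q) θ⁻¹ ∈ C.order 𝔩 𝔮 𝔞) := by
  have : ImagQuad L d δ := ⟨hL, hd, hd4, hδ, hstar⟩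
  have S : Setting d δ ℓ q 𝔩 𝔮 := ⟨hℓ, hℓf, h𝔩, hℓ𝔩, hnonsplit, hq, h𝔮, hq𝔮⟩
  obtain ⟨C₀⟩ := S.nonempty_lambdaChoice
  have htop := isGoodIdeal_top d δ
  exact ⟨S.isQuaternionRamifiedExactlyAt htop (S.isAdmissible_lambda C₀ htop),
    fun 𝔞 lam ha hlam =>
      ⟨S.isMaximalOrder ha hlam, S.hasDiscriminant ha hlam, S.isOptimal hlam⟩,
    ⟨C₀⟩, fun C => ⟨fun 𝔞 ha => S.isAdmissible_lambda C ha,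
      fun 𝔞 𝔠 𝔟 ha hb hc => (S.order_mul_embLattice C ha hb hc).2,
      fun R hR hO => S.exists_conj_eq_order C hR hO⟩⟩
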